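/- **Notation.** Let $n\ge 2$ and let $\mathfrak a_n$ be the unique positive solution of $(1+\mathfrak a_n)^n=1+2n\mathfrak a_n$. For $r>0$ put $B(r)=\{t\in\mathbb C:|t|<r\}$ and $U(r)=\{t:\operatorname{Re}t>0,\ |\operatorname{Im}t|<r\}\cup B(r)$. For $0\le j,\ell\le n-1$, $\ell\ne j$, let $\theta_{j,\ell}=-\arg(e^{2\pi i\ell/n}-e^{2\pi ij/n})$, with the branches chosen so that $\max_{\ell\ne j}\theta_{j,\ell}-\min_{\ell\ne j}\theta_{j,\ell}=\frac{n-2}{n}\pi$ (explicitly, one may take $\theta_{j,\ell}=\frac{(2-\operatorname{sgn}(j-\ell))n-2(j+\ell)}{2n}\pi$), let $\theta_j=\frac12(\min_{\ell\neq j}\theta_{j,\ell}+\max_{\ell\ne j}\theta_{j,\ell})$, and let $\mathscr P_j(\xi)$ be the path $[0,\infty)\ni t\mapsto\xi+te^{i\theta_j}$. **Equation.** Let $\Delta\subseteq\mathbb C$ be a non-empty domain and consider $$\Big(-\frac{d^n}{d\xi^n}+\sum_{k=0}^{n-2}u^{n-k}\psi_k(u,\xi)\frac{d^k}{d\xi^k}\Big)W(u,\xi)=0,\qquad(3)$$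 where $\psi_k(u,\xi)\sim\delta_{0,k}+\sum_{m\ge1}\psi_{k,m}(\xi)u^{-m}$ ($0\le k\le n-2$) as $u\to+\infty$, uniformly with respect to $\xi\in\Delta$. Assume (Condition 1.1) that there are functions $\Psi_k(t,\xi)$, $0\le k\le n-2$, and constants $d',c,\rho>0$, $\sigma'\ge0$ such that 1. $\Psi_k$ is analytic on $U(\mathfrak a_nd')\times\Delta$; 2. $|\Psi_k(t,\xi)|\le c\,e^{\sigma'\operatorname{Re}t}/(1+|\xi|^{1+\rho})$ for $(t,\xi)\in U(\mathfrak a_nd')\times\Delta$; 3. $\psi_k(u,\xi)=\delta_{0,k}+\int_0^{\infty}e^{-ut}\Psi_k(t,\xi)\,dt$ for $\operatorname{Re}u>\sigma'$, $\xi\in\Delta$. Let $0<d<d'$, and for $0\le j\le n-1$ let $\Gamma_j(d)\subseteq\Delta$ be a subdomain such that each of its points has distance at least $d$ from each boundary point of $\Delta$, and such that $\xi\in\Gamma_j(d)$ implies $\xi+te^{i\theta_{j,\ell}}\in\Gamma_j(d)$ for all $t\ge0$ and $\ell\ne j$. **Coefficients.** Put $$X_j(\xi)=-\frac1n\int_{\mathscr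 P_j(\xi)}\sum_{k=0}^{n-2}e^{2\pi ij(k+1)/n}\psi_{k,1}(t)\,dt .$$ Let $\mathtt B_p$ denote the $p$-th complete exponential Bell polynomial evaluated at $(X_j',X_j'',\dots,X_j^{(p)})$ (that is, $\mathtt B_p=e^{-X_j}\frac{d^p}{d\xi^p}e^{X_j}$), $\mathsf A_{j,0}=1$, and for $m\ge1$ $$\begin{aligned}\mathsf A_{j,m}(\xi)={}&\frac1n\sum_{p=2}^{\min(n,m+1)}\binom npe^{2\pi ij(n-p+1)/n}\sum_{r=0}^p\binom pr\int_{\mathscr P_j(\xi)}\mathtt B_{p-r}\,\mathsf A_{j,m-p+1}^{(r)}(t)\,dt\\&-\frac1n\sum_{k=0}^{n-2}\sum_{p=1}^{\min(m,k)}\binom kpe^{2\pi ij(k-p+1)/n}\sum_{r=0}^p\binom pr\int_{\mathscr P_j(\xi)}\mathtt B_{p-r}\,\psi_{k,1}(t)\,\mathsf A_{j,m-p}^{(r)}(t)\,dt\\&-\frac1n\sum_{k=0}^{n-2}\sum_{q=0}^{m-1}\sum_{p=0}^{\min(k,q)}\binom kpe^{2\pi ij(k-p+1)/n}\sum_{r=0}^p\binom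 pr\int_{\mathscr P_j(\xi)}\mathtt B_{p-r}\,\psi_{k,m-q+1}(t)\,\mathsf A_{j,q-p}^{(r)}(t)\,dt.\end{aligned}$$ **Theorem 1.1.** For each $0\le j\le n-1$, equation (3) has, for $\operatorname{Re}u>\sigma'$ and $\xi\in\Gamma_j(d)$, a unique solution of the form $$W_j(u,\xi)=\exp\big(e^{2\pi ij/n}u\xi+X_j(\xi)\big)\big(1+\eta_j(u,\xi)\big)$$ with $\eta_j$ analytic on $\{u:\operatorname{Re}u>\sigma'\}\times\Gamma_j(d)$ and satisfying the limit conditions $$\lim_{t\to+\infty}\Big[\frac{\partial^s\eta_j(u,\zeta)}{\partial\zeta^s}\Big]_{\zeta=\xi+te^{i\theta_j}}=0\qquad(0\le s\le n-2)$$ for all $\operatorname{Re}u>\sigma'$, $\xi\in\Gamma_j(d)$. Moreover, there are functions $F_j(t,\xi)$ such that, for each $j$: * $\eta_j(u,\xi)=\int_0^{\infty}e^{-ut}F_j(t,\xi)\,dt$ (absolutely convergent) for $\operatorname{Re}u>\sigma'$, $\xi\in\Gamma_j(d)$; * $F_j$ is analytic on $U(\mathfrak a_nd)\times\Gamma_j(d)$;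 * $F_j(t,\xi)=\sum_{m=0}^\infty\frac{\mathsf A_{j,m+1}(\xi)}{m!}t^m$, the series being convergent, for $(t,\xi)\in B(\mathfrak a_nd)\times\Gamma_j(d)$; * for each $\sigma>\sigma'$ and $0<r<d$ there is a constant $K=K(\sigma,r)>0$, independent of $u,t,\xi,j$, such that $$|F_j(t,\xi)|\le K e^{\sigma\operatorname{Re}t}\sum_{\ell\ne j}\frac1{(\max(1,\operatorname{Re}(\xi e^{-i\theta_{j,\ell}})))^\rho}\qquad\big((t,\xi)\in U(\mathfrak a_nr)\times\Gamma_j(d)\big);$$ * for each $\sigma>\sigma'$, $\eta_j(u,\xi)\sim\sum_{m=1}^\infty\mathsf A_{j,m}(\xi)u^{-m}$ as $u\to\infty$ in $\operatorname{Re}u\ge\sigma$, uniformly with respect to $\xi\in\Gamma_j(d)$; that is, for each $N\ge1$, $\eta_j(u,\xi)-\sum_{m=1}^{N-1}\mathsf A_{j,m}(\xi)u^{-m}=O(|u|^{-N})$ uniformly in $\xi$. -/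

import Mathlib

open MeasureTheory Filter Topology Set

noncomputable section

namespace BorelWKB

/-! ### The sequence `𝔞ₙ` -/

theorem existsUnique_aSeq (n : ℕ) (hn : 2 ≤ n) :
    ∃! x : ℝ, 0 < x ∧ (1 + x) ^ n = 1 + 2 * n * x := by
  have hn0 : (0 : ℝ) < n := by
    have : 0 < n := by omega
    exact_mod_cast this
  have hcont : Continuous fun x : ℝ => (1 + x) ^ n - 1 - 2 * n * x := by fun_prop
  have hle : (1 : ℝ) / n ≤ 2 := by
    rw [div_le_iff₀ hn0]
    have : (2 : ℝ) ≤ n := by exact_mod_cast hn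
    linarith
  have hlow : (1 + 1 / (n : ℝ)) ^ n - 1 - 2 * n * (1 / n) ≤ 0 := by
    have h1 : (1 + 1 / (n : ℝ)) ^ n ≤ Real.exp (1 / n) ^ n := by
      apply pow_le_pow_left₀ (by positivity)
      have := Real.add_one_le_exp (1 / (n : ℝ))
      linarith
    have h2 : Real.exp (1 / (n : ℝ)) ^ n = Real.exp 1 := by
      rw [← Real.exp_nat_mul]
      congr 1
      field_simp
    have h3 : 2 * (n : ℝ) * (1 / n) = 2 := by field_simp
    have h4 := Real.exp_one_lt_d9
    rw [h2] at h1
    rw [h3]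
    linarith
  have hhigh : 0 ≤ (1 + (2 : ℝ)) ^ n - 1 - 2 * n * 2 := by
    have : ∀ m : ℕ, 2 ≤ m → 1 + 4 * (m : ℝ) ≤ 3 ^ m := by
      intro m hm
      induction m, hm using Nat.le_induction with
      | base => norm_num
      | succ k hk ih =>
        have : (2 : ℝ) ≤ k := by exact_mod_cast hk
        push_cast
        rw [pow_succ]
        linarith
    have h := this n hn
    norm_num
    linarith
  obtain ⟨x, hx, hfx⟩ := intermediate_value_Icc hle hcont.continuousOn
    (show (0 : ℝ) ∈ Icc _ _ from ⟨hlow, hhigh⟩)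
  have hx0 : 0 < x := lt_of_lt_of_le (by positivity) hx.1
  have hlt : ∀ a b : ℝ, 0 < a → a < b → (1 + a) ^ n = 1 + 2 * n * a →
      (1 + b) ^ n = 1 + 2 * n * b → False := by
    intro a b ha hab hA hB
    have hb : 0 < b := ha.trans hab
    have hc := (strictConvexOn_pow hn).2 (show 1 + b ∈ Ici (0 : ℝ) by
        simp only [Set.mem_Ici]; linarith) (show (1 : ℝ) ∈ Ici (0 : ℝ) by simp) (by linarith)
      (show 0 < a / b by positivity) (show 0 < 1 - a / b by rw [sub_pos, div_lt_one hb]; exact hab)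
      (by ring)
    simp only [smul_eq_mul, one_pow, mul_one] at hc
    have e1 : a / b * (1 + b) + (1 - a / b) = 1 + a := by field_simp; ring
    have e2 : a / b * (1 + 2 * n * b) + (1 - a / b) = 1 + 2 * n * a := by field_simp; ring
    rw [e1, hA, hB, e2] at hc
    exact lt_irrefl _ hc
  refine ⟨x, ⟨hx0, ?_⟩, ?_⟩
  · simp only at hfx
    linarith
  · rintro y ⟨hy0, hy⟩
    have hxe : (1 + x) ^ n = 1 + 2 * n * x := by simp only at hfx; linarith
    rcases lt_trichotomy y x with h | h | h
    · exact (hlt y x hy0 h hy hxe).elim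
    · exact h
    · exact (hlt x y hx0 h hxe hy).elim

/-- `𝔞ₙ`, the unique positive real solution of `(1 + 𝔞ₙ) ^ n = 1 + 2 n 𝔞ₙ` (for `n ≥ 2`). -/
def aSeq (n : ℕ) : ℝ :=
  if hn : 2 ≤ n then (existsUnique_aSeq n hn).choose else 0

theorem aSeq_pos (n : ℕ) (hn : 2 ≤ n) : 0 < aSeq n := by
  rw [aSeq, dif_pos hn]
  exact (existsUnique_aSeq n hn).choose_spec.1.1

theorem aSeq_eq (n : ℕ) (hn : 2 ≤ n) : (1 + aSeq n) ^ n = 1 + 2 * n * aSeq n := by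
  rw [aSeq, dif_pos hn]
  exact (existsUnique_aSeq n hn).choose_spec.1.2

/-! ### Regions in the Borel plane, Laplace transform, asymptotic series -/

/-- `U(r)`: the points at distance less than `r` from the positive real axis. -/
def U (r : ℝ) : Set ℂ :=
  {t : ℂ | 0 < t.re ∧ |t.im| < r} ∪ Metric.ball 0 r

/-- `∫₀^∞ e^{-ut} F(t) dt`. -/
def laplace (F : ℂ → ℂ) (u : ℂ) : ℂ :=
  ∫ t in Ioi (0 : ℝ), Complex.exp (-u * t) * F t

/-- `f(u, ξ) ∼ ∑_{m ≥ 1} a_m(ξ) / u ^ m` as `u → ∞` in `S`, uniformly with respect to `ξ ∈ E`. -/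
def HasUniformAsymptoticSeries (S E : Set ℂ) (f : ℂ → ℂ → ℂ) (a : ℕ → ℂ → ℂ) : Prop :=
  ∀ N : ℕ, 1 ≤ N → ∃ C R : ℝ, ∀ u ∈ S, R ≤ ‖u‖ → ∀ ξ ∈ E,
    ‖f u ξ - ∑ m ∈ Finset.Ico 1 N, a m ξ / u ^ m‖ ≤ C / ‖u‖ ^ N

/-! ### Roots of unity and angles -/

/-- `e^{2πij/n}`. -/
def omega (n j : ℕ) : ℂ :=
  Complex.exp (2 * Real.pi * Complex.I * j / n)

/-- The angles `θ_{j,ℓ}`.  They are representatives of `-arg (e^{2πiℓ/n} - e^{2πij/n})` modulo `2π`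
(`theta_eq_neg_arg`), chosen such that `max_{ℓ ≠ j} θ_{j,ℓ} - min_{ℓ ≠ j} θ_{j,ℓ} = (n - 2) π / n`
(`theta_spread`). -/
def theta (n j l : ℕ) : ℝ :=
  ((2 - ((((j : ℤ) - l).sign : ℤ) : ℝ)) * n - 2 * (j + l)) / (2 * n) * Real.pi

/-- `min_{ℓ ≠ j} θ_{j,ℓ}` -/
def thetaMin (n : ℕ) (j : Fin n) : ℝ := ⨅ l : {l : Fin n // l ≠ j}, theta n j l

/-- `max_{ℓ ≠ j} θ_{j,ℓ}` -/
def thetaMax (n : ℕ) (j : Fin n) : ℝ := ⨆ l : {l : Fin n // l ≠ j}, theta n j l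

/-- `θ_j = (min_{ℓ ≠ j} θ_{j,ℓ} + max_{ℓ ≠ j} θ_{j,ℓ}) / 2`. -/
def thetaMid (n : ℕ) (j : Fin n) : ℝ := (1 / 2) * (thetaMin n j + thetaMax n j)

theorem theta_eq_neg_arg (n : ℕ) (j l : Fin n) (hlj : l ≠ j) :
    (theta n j l : Real.Angle) = -(Complex.arg (omega n l - omega n j) : Real.Angle) := by
  have hn : 0 < n := j.pos
  have hn0 : (0 : ℝ) < n := by exact_mod_cast hn
  have hnc : (n : ℂ) ≠ 0 := by exact_mod_cast hn.ne'
  have key : ∀ a b : ℕ, omega n a - omega n b =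
      ((2 * Real.sin (Real.pi * ((a : ℝ) - b) / n) : ℝ) : ℂ) *
        Complex.exp (((Real.pi / 2 + Real.pi * ((a : ℝ) + b) / n : ℝ) : ℂ) * Complex.I) := by
    intro a b
    have e1 : omega n a = Complex.exp ((Real.pi * ((a : ℂ) + b) / n) * Complex.I) *
        Complex.exp ((Real.pi * ((a : ℂ) - b) / n) * Complex.I) := by
      rw [omega, ← Complex.exp_add]; congr 1; field_simp; ring
    have e2 : omega n b = Complex.exp ((Real.pi * ((a : ℂ) + b) / n) * Complex.I) *
        Complex.exp (-(Real.pi * ((a : ℂ) - b) / n) * Complex.I) := by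
      rw [omega, ← Complex.exp_add]; congr 1; field_simp; ring
    have e3 : Complex.exp (((Real.pi / 2 + Real.pi * ((a : ℝ) + b) / n : ℝ) : ℂ) * Complex.I) =
        Complex.I * Complex.exp ((Real.pi * ((a : ℂ) + b) / n) * Complex.I) := by
      push_cast
      rw [add_mul, Complex.exp_add, Complex.exp_pi_div_two_mul_I]
    rw [e3, e1, e2]
    push_cast
    rw [Complex.sin]
    ring_nf
    rw [Complex.I_sq]
    ring
  have harg : ∀ x : ℝ, (Complex.arg (Complex.exp ((x : ℂ) * Complex.I)) : Real.Angle) = x := by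
    intro x
    have := Complex.arg_cos_add_sin_mul_I_coe_angle (x : Real.Angle)
    rw [Real.Angle.cos_coe, Real.Angle.sin_coe] at this
    rw [Complex.exp_mul_I, ← Complex.ofReal_cos, ← Complex.ofReal_sin]
    exact this
  rcases lt_or_gt_of_ne hlj with h | h
  · have hlt : ((l : ℕ) : ℝ) < (j : ℕ) := by exact_mod_cast h
    have hjn : ((j : ℕ) : ℝ) < n := by exact_mod_cast j.2
    have hl0 : (0 : ℝ) ≤ (l : ℕ) := by positivity
    have hs : 0 < 2 * Real.sin (Real.pi * (((j : ℕ) : ℝ) - (l : ℕ)) / n) := by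
      apply mul_pos two_pos
      apply Real.sin_pos_of_pos_of_lt_pi
      · exact div_pos (mul_pos Real.pi_pos (by linarith)) hn0
      · rw [div_lt_iff₀ hn0]
        exact mul_lt_mul_of_pos_left (by linarith) Real.pi_pos
    have hsg : ((j : ℕ) : ℤ) - (l : ℕ) > 0 := by
      have : (l : ℕ) < (j : ℕ) := h
      omega
    have hneg : omega n l - omega n j =
        ((2 * Real.sin (Real.pi * (((j : ℕ) : ℝ) - (l : ℕ)) / n) : ℝ) : ℂ) *
        Complex.exp (((-(theta n j l) : ℝ) : ℂ) * Complex.I) := by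
      have h0 := key j l
      have h1 : Complex.exp (((-(theta n j l) : ℝ) : ℂ) * Complex.I) =
          -Complex.exp (((Real.pi / 2 + Real.pi * (((j : ℕ) : ℝ) + (l : ℕ)) / n : ℝ) : ℂ)
            * Complex.I) := by
        have : (((-(theta n j l) : ℝ) : ℂ) * Complex.I) =
            ((Real.pi / 2 + Real.pi * (((j : ℕ) : ℝ) + (l : ℕ)) / n : ℝ) : ℂ)
            * Complex.I - Real.pi * Complex.I := by
          rw [theta, Int.sign_eq_one_of_pos hsg]
          push_cast
          field_simp
          ring
        rw [this, Complex.exp_sub, Complex.exp_pi_mul_I, div_neg, div_one]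
      rw [h1, mul_neg, ← h0]
      ring
    rw [hneg, Complex.arg_real_mul _ hs, harg]
    simp
  · have hlt : ((j : ℕ) : ℝ) < (l : ℕ) := by exact_mod_cast h
    have hjn : ((l : ℕ) : ℝ) < n := by exact_mod_cast l.2
    have hl0 : (0 : ℝ) ≤ (j : ℕ) := by positivity
    have hs : 0 < 2 * Real.sin (Real.pi * (((l : ℕ) : ℝ) - (j : ℕ)) / n) := by
      apply mul_pos two_pos
      apply Real.sin_pos_of_pos_of_lt_pi
      · exact div_pos (mul_pos Real.pi_pos (by linarith)) hn0
      · rw [div_lt_iff₀ hn0]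
        exact mul_lt_mul_of_pos_left (by linarith) Real.pi_pos
    have hsg : ((j : ℕ) : ℤ) - (l : ℕ) < 0 := by
      have : (j : ℕ) < (l : ℕ) := h
      omega
    have hpos : omega n l - omega n j =
        ((2 * Real.sin (Real.pi * (((l : ℕ) : ℝ) - (j : ℕ)) / n) : ℝ) : ℂ) *
        Complex.exp (((-(theta n j l) : ℝ) : ℂ) * Complex.I) := by
      have h0 := key l j
      have h1 : Complex.exp (((-(theta n j l) : ℝ) : ℂ) * Complex.I) =
          Complex.exp (((Real.pi / 2 + Real.pi * (((l : ℕ) : ℝ) + (j : ℕ)) / n : ℝ) : ℂ)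
            * Complex.I) := by
        have : (((-(theta n j l) : ℝ) : ℂ) * Complex.I) =
            ((Real.pi / 2 + Real.pi * (((l : ℕ) : ℝ) + (j : ℕ)) / n : ℝ) : ℂ)
            * Complex.I - 2 * Real.pi * Complex.I := by
          rw [theta, Int.sign_eq_neg_one_of_neg hsg]
          push_cast
          field_simp
          ring
        rw [this, Complex.exp_sub, Complex.exp_two_pi_mul_I, div_one]
      rw [h1, ← h0]
    rw [hpos, Complex.arg_real_mul _ hs, harg]
    simp

theorem theta_le_and_ge (n : ℕ) (j l : Fin n) (hlj : l ≠ j) :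
    ((n : ℝ) - 4 * (j : ℕ) + 2) / (2 * n) * Real.pi ≤ theta n j l ∧
      theta n j l ≤ (3 * (n : ℝ) - 4 * (j : ℕ) - 2) / (2 * n) * Real.pi := by
  have hn0 : (0 : ℝ) < n := by exact_mod_cast j.pos
  have hj : ((j : ℕ) : ℝ) + 1 ≤ n := by exact_mod_cast j.2
  have hl : ((l : ℕ) : ℝ) + 1 ≤ n := by exact_mod_cast l.2
  have hj0 : (0 : ℝ) ≤ (j : ℕ) := by positivity
  have hl0 : (0 : ℝ) ≤ (l : ℕ) := by positivity
  have hpi := Real.pi_pos.le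
  rcases lt_or_gt_of_ne hlj with h | h
  · have hlt : ((l : ℕ) : ℝ) + 1 ≤ (j : ℕ) := by exact_mod_cast h
    have hsg : 0 < ((j : ℕ) : ℤ) - (l : ℕ) := by
      have : (l : ℕ) < (j : ℕ) := h
      omega
    rw [theta, Int.sign_eq_one_of_pos hsg]
    push_cast
    constructor <;> refine mul_le_mul_of_nonneg_right ?_ hpi <;>
      refine div_le_div_of_nonneg_right ?_ (by positivity) <;> linarith
  · have hlt : ((j : ℕ) : ℝ) + 1 ≤ (l : ℕ) := by exact_mod_cast h
    have hsg : ((j : ℕ) : ℤ) - (l : ℕ) < 0 := by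
      have : (j : ℕ) < (l : ℕ) := h
      omega
    rw [theta, Int.sign_eq_neg_one_of_neg hsg]
    push_cast
    constructor <;> refine mul_le_mul_of_nonneg_right ?_ hpi <;>
      refine div_le_div_of_nonneg_right ?_ (by positivity) <;> linarith

theorem thetaMin_eq (n : ℕ) (hn : 2 ≤ n) (j : Fin n) :
    thetaMin n j = ((n : ℝ) - 4 * (j : ℕ) + 2) / (2 * n) * Real.pi := by
  have hlow : ∀ l : {l : Fin n // l ≠ j},
      ((n : ℝ) - 4 * (j : ℕ) + 2) / (2 * n) * Real.pi ≤ theta n j l :=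
    fun l => (theta_le_and_ge n j l l.2).1
  have hbdd : BddBelow (range fun l : {l : Fin n // l ≠ j} => theta n j l) :=
    ⟨_, by rintro _ ⟨l, rfl⟩; exact hlow l⟩
  have hex : ∃ l : {l : Fin n // l ≠ j},
      theta n j l = ((n : ℝ) - 4 * (j : ℕ) + 2) / (2 * n) * Real.pi := by
    by_cases hj : (j : ℕ) = 0
    · refine ⟨⟨⟨n - 1, by omega⟩, fun h => ?_⟩, ?_⟩
      · have := congrArg Fin.val h
        simp only at this
        omega
      · have hsg : ((j : ℕ) : ℤ) - ((n - 1 : ℕ) : ℤ) < 0 := by omega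
        simp only [theta]
        rw [Int.sign_eq_neg_one_of_neg hsg, hj, Nat.cast_sub (by omega)]
        push_cast
        ring
    · have hj2 := j.2
      refine ⟨⟨⟨(j : ℕ) - 1, by omega⟩, fun h => ?_⟩, ?_⟩
      · have := congrArg Fin.val h
        simp only at this
        omega
      · have hsg : 0 < ((j : ℕ) : ℤ) - (((j : ℕ) - 1 : ℕ) : ℤ) := by omega
        simp only [theta]
        rw [Int.sign_eq_one_of_pos hsg, Nat.cast_sub (by omega)]
        push_cast
        ring
  obtain ⟨l, hl⟩ := hex
  have : Nonempty {l : Fin n // l ≠ j} := ⟨l⟩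
  exact le_antisymm (hl ▸ ciInf_le hbdd l) (le_ciInf hlow)

theorem thetaMax_eq (n : ℕ) (hn : 2 ≤ n) (j : Fin n) :
    thetaMax n j = (3 * (n : ℝ) - 4 * (j : ℕ) - 2) / (2 * n) * Real.pi := by
  have hup : ∀ l : {l : Fin n // l ≠ j},
      theta n j l ≤ (3 * (n : ℝ) - 4 * (j : ℕ) - 2) / (2 * n) * Real.pi :=
    fun l => (theta_le_and_ge n j l l.2).2
  have hbdd : BddAbove (range fun l : {l : Fin n // l ≠ j} => theta n j l) :=
    ⟨_, by rintro _ ⟨l, rfl⟩; exact hup l⟩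
  have hex : ∃ l : {l : Fin n // l ≠ j},
      theta n j l = (3 * (n : ℝ) - 4 * (j : ℕ) - 2) / (2 * n) * Real.pi := by
    have hj2 := j.2
    by_cases hj : (j : ℕ) = n - 1
    · refine ⟨⟨⟨0, by omega⟩, fun h => ?_⟩, ?_⟩
      · have := congrArg Fin.val h
        simp only at this
        omega
      · have hsg : 0 < ((j : ℕ) : ℤ) - ((0 : ℕ) : ℤ) := by omega
        simp only [theta]
        rw [Int.sign_eq_one_of_pos hsg, hj, Nat.cast_sub (by omega)]
        push_cast
        ring
    · refine ⟨⟨⟨(j : ℕ) + 1, by omega⟩, fun h => ?_⟩, ?_⟩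
      · have := congrArg Fin.val h
        simp only at this
        omega
      · have hsg : ((j : ℕ) : ℤ) - (((j : ℕ) + 1 : ℕ) : ℤ) < 0 := by omega
        simp only [theta]
        rw [Int.sign_eq_neg_one_of_neg hsg]
        push_cast
        ring
  obtain ⟨l, hl⟩ := hex
  have : Nonempty {l : Fin n // l ≠ j} := ⟨l⟩
  exact le_antisymm (ciSup_le hup) (hl ▸ le_ciSup hbdd l)

theorem theta_spread (n : ℕ) (hn : 2 ≤ n) (j : Fin n) :
    thetaMax n j - thetaMin n j = ((n : ℝ) - 2) / n * Real.pi := by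
  have hn0 : (n : ℝ) ≠ 0 := by
    have : n ≠ 0 := by omega
    exact_mod_cast this
  rw [thetaMax_eq n hn, thetaMin_eq n hn]
  field_simp
  ring

/-! ### Rays and path integrals -/

/-- The point `ξ + t e^{iθ}` of the ray with vertex `ξ` and direction `θ`. -/
def ray (ξ : ℂ) (θ t : ℝ) : ℂ := ξ + t * Complex.exp (θ * Complex.I)

/-- The integral of `f` along the infinite path `[0, ∞) ∋ s ↦ ξ + s e^{iθ}`. -/
def rayIntegral (f : ℂ → ℂ) (ξ : ℂ) (θ : ℝ) : ℂ :=
  ∫ s in Ioi (0 : ℝ), f (ray ξ θ s) * Complex.exp (θ * Complex.I)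

/-! ### Hypotheses on the equation and on the domains -/

/-- `Δ` is a non-empty domain on which the potentials are Laplace transforms,
`ψ_k(u, ξ) = δ_{0,k} + ∫₀^∞ e^{-ut} Ψ_k(t, ξ) dt` (`0 ≤ k ≤ n - 2`), of functions `Ψ_k` that are
analytic and satisfy a growth condition on `U(𝔞ₙ d') × Δ`. -/
structure BorelCondition (n : ℕ) (Δ : Set ℂ) (ψ Ψ : ℕ → ℂ → ℂ → ℂ) (d' c ρ σ' : ℝ) : Prop where
  isOpen : IsOpen Δ
  isConnected : IsConnected Δ
  d'_pos : 0 < d'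
  c_pos : 0 < c
  ρ_pos : 0 < ρ
  σ'_nonneg : 0 ≤ σ'
  analytic : ∀ k < n - 1,
    AnalyticOnNhd ℂ (fun p : ℂ × ℂ => Ψ k p.1 p.2) (U (aSeq n * d') ×ˢ Δ)
  bound : ∀ k < n - 1, ∀ t ∈ U (aSeq n * d'), ∀ ξ ∈ Δ,
    ‖Ψ k t ξ‖ ≤ c * Real.exp (σ' * t.re) / (1 + ‖ξ‖ ^ (1 + ρ))
  laplace_eq : ∀ k < n - 1, ∀ u : ℂ, σ' < u.re → ∀ ξ ∈ Δ,
    ψ k u ξ = (if k = 0 then 1 else 0) + laplace (fun t => Ψ k t ξ) u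

/-- The potentials possess the asymptotic expansions
`ψ_k(u, ξ) ∼ δ_{0,k} + ∑_{m ≥ 1} ψ_{k,m}(ξ) / u ^ m` (`0 ≤ k ≤ n - 2`) as `u → +∞`,
uniformly with respect to `ξ ∈ Δ`. -/
def PotentialExpansion (n : ℕ) (Δ : Set ℂ) (ψ : ℕ → ℂ → ℂ → ℂ) (ψc : ℕ → ℕ → ℂ → ℂ) : Prop :=
  ∀ k < n - 1, HasUniformAsymptoticSeries {u : ℂ | 0 < u.re ∧ u.im = 0} Δ
    (fun u ξ => ψ k u ξ - if k = 0 then 1 else 0) (ψc k)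

/-- `Γ` is an admissible subdomain `Γ_j(d)` of `Δ`: its points have distance at least `d` from
the boundary points of `Δ`, and it contains, with each `ξ`, the rays with vertex `ξ` and
directions `θ_{j,ℓ}`, `ℓ ≠ j`. -/
structure IsAdmissibleSubdomain (n : ℕ) (Δ : Set ℂ) (d : ℝ) (j : Fin n) (Γ : Set ℂ) : Prop where
  isOpen : IsOpen Γ
  isPreconnected : IsPreconnected Γ
  subset : Γ ⊆ Δ
  dist_boundary : ∀ ξ ∈ Γ, ∀ ζ ∈ frontier Δ, d ≤ dist ξ ζ
  ray_mem : ∀ ξ ∈ Γ, ∀ l : Fin n, l ≠ j → ∀ t : ℝ, 0 ≤ t → ray ξ (theta n j l) t ∈ Γ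

/-! ### The formal solutions -/

/-- The complete exponential Bell polynomials `B_p(x₁, …, x_p)`. -/
def completeBell (x : ℕ → ℂ) : ℕ → ℂ
  | 0 => 1
  | p + 1 => ∑ q : Fin (p + 1), (p.choose q : ℂ) * x (q + 1) * completeBell x (p - q)
termination_by p => p
decreasing_by omega

/-- `X_j(ξ) = -(1/n) ∫_{𝒫_j(ξ)} ∑_{k=0}^{n-2} e^{2πij(k+1)/n} ψ_{k,1}(t) dt`. -/
def X (n : ℕ) (ψc : ℕ → ℕ → ℂ → ℂ) (j : Fin n) (ξ : ℂ) : ℂ :=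
  -(1 / (n : ℂ)) * rayIntegral
    (fun t => ∑ k ∈ Finset.range (n - 1), omega n j ^ (k + 1) * ψc k 1 t) ξ (thetaMid n j)

/-- `B_p(X_j'(ξ), X_j''(ξ), …, X_j^{(p)}(ξ))`. -/
def bellX (n : ℕ) (ψc : ℕ → ℕ → ℂ → ℂ) (j : Fin n) (p : ℕ) (ξ : ℂ) : ℂ :=
  completeBell (fun i => iteratedDeriv i (X n ψc j) ξ) p

/-- The right-hand side of the recurrence relation for the coefficient `A_{j,m}`, as a function of
the family `A` of the preceding coefficients. -/
def coeffStep (n : ℕ) (ψc : ℕ → ℕ → ℂ → ℂ) (j : Fin n) (A : ℕ → ℂ → ℂ) (m : ℕ) (ξ : ℂ) : ℂ :=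
  (1 / (n : ℂ)) * (∑ p ∈ Finset.Icc 2 (min n (m + 1)),
      (n.choose p : ℂ) * omega n j ^ (n - p + 1) * ∑ r ∈ Finset.range (p + 1), (p.choose r : ℂ) *
        rayIntegral (fun t => bellX n ψc j (p - r) t * iteratedDeriv r (A (m + 1 - p)) t)
          ξ (thetaMid n j))
  - (1 / (n : ℂ)) * (∑ k ∈ Finset.range (n - 1), ∑ p ∈ Finset.Icc 1 (min m k),
      (k.choose p : ℂ) * omega n j ^ (k - p + 1) * ∑ r ∈ Finset.range (p + 1), (p.choose r : ℂ) *
        rayIntegral (fun t => bellX n ψc j (p - r) t * ψc k 1 t * iteratedDeriv r (A (m - p)) t)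
          ξ (thetaMid n j))
  - (1 / (n : ℂ)) * (∑ k ∈ Finset.range (n - 1), ∑ q ∈ Finset.range m,
      ∑ p ∈ Finset.range (min k q + 1),
      (k.choose p : ℂ) * omega n j ^ (k - p + 1) * ∑ r ∈ Finset.range (p + 1), (p.choose r : ℂ) *
        rayIntegral
          (fun t => bellX n ψc j (p - r) t * ψc k (m - q + 1) t * iteratedDeriv r (A (q - p)) t)
          ξ (thetaMid n j))

/-- The coefficients `A_{j,m}`: `A_{j,0} = 1`, and `A_{j,m}`, `m ≥ 1`, is given by the recurrence
relation, which involves `A_{j,0}, …, A_{j,m-1}` only (`coeffA_eq`). -/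
def coeffA (n : ℕ) (ψc : ℕ → ℕ → ℂ → ℂ) (j : Fin n) (m : ℕ) : ℂ → ℂ :=
  if m = 0 then fun _ => 1
  else coeffStep n ψc j (fun i => if _h : i < m then coeffA n ψc j i else 0) m
termination_by m

theorem coeffA_zero (n : ℕ) (ψc : ℕ → ℕ → ℂ → ℂ) (j : Fin n) :
    coeffA n ψc j 0 = fun _ => 1 := by
  rw [coeffA, if_pos rfl]

theorem coeffStep_congr (n : ℕ) (ψc : ℕ → ℕ → ℂ → ℂ) (j : Fin n) (A A' : ℕ → ℂ → ℂ) (m : ℕ)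
    (hm : 1 ≤ m) (h : ∀ i < m, A i = A' i) : coeffStep n ψc j A m = coeffStep n ψc j A' m := by
  funext ξ
  refine congrArg₂ (· - ·) (congrArg₂ (· - ·) (congrArg _ ?_) (congrArg _ ?_)) (congrArg _ ?_)
  · refine Finset.sum_congr rfl fun p hp => ?_
    rw [Finset.mem_Icc] at hp
    rw [h (m + 1 - p) (by omega)]
  · refine Finset.sum_congr rfl fun k _ => Finset.sum_congr rfl fun p hp => ?_
    rw [Finset.mem_Icc] at hp
    rw [h (m - p) (by omega)]
  · refine Finset.sum_congr rfl fun k _ => Finset.sum_congr rfl fun q hq =>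
      Finset.sum_congr rfl fun p _ => ?_
    rw [Finset.mem_range] at hq
    rw [h (q - p) (by omega)]

theorem coeffA_eq (n : ℕ) (ψc : ℕ → ℕ → ℂ → ℂ) (j : Fin n) (m : ℕ) (hm : 1 ≤ m) :
    coeffA n ψc j m = coeffStep n ψc j (coeffA n ψc j) m := by
  rw [coeffA, if_neg (by omega)]
  refine coeffStep_congr n ψc j _ _ m hm fun i hi => ?_
  rw [dif_pos hi]

/-! ### Exact solutions -/

/-- `W_j(u, ξ) = exp(e^{2πij/n} u ξ + X_j(ξ)) (1 + η(u, ξ))`. -/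
def W (n : ℕ) (ψc : ℕ → ℕ → ℂ → ℂ) (j : Fin n) (η : ℂ → ℂ → ℂ) (u ξ : ℂ) : ℂ :=
  Complex.exp (omega n j * u * ξ + X n ψc j ξ) * (1 + η u ξ)

/-- `w` satisfies `(-dⁿ/dξⁿ + ∑_{k=0}^{n-2} u^{n-k} ψ_k(u, ξ) d^k/dξ^k) w = 0` on `Γ`. -/
def SolvesODE (n : ℕ) (ψ : ℕ → ℂ → ℂ → ℂ) (u : ℂ) (Γ : Set ℂ) (w : ℂ → ℂ) : Prop :=
  ∀ ξ ∈ Γ, -iteratedDeriv n w ξ +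
    ∑ k ∈ Finset.range (n - 1), u ^ (n - k) * ψ k u ξ * iteratedDeriv k w ξ = 0

/-- `η` is analytic on `{Re u > σ'} × Γ`, the function `W_j` formed with `η` solves the
differential equation there, and `η` satisfies the limit conditions. -/
structure IsNormalisedSolution (n : ℕ) (ψ : ℕ → ℂ → ℂ → ℂ) (ψc : ℕ → ℕ → ℂ → ℂ) (σ' : ℝ)
    (j : Fin n) (Γ : Set ℂ) (η : ℂ → ℂ → ℂ) : Prop where
  analytic : AnalyticOnNhd ℂ (fun p : ℂ × ℂ => η p.1 p.2) ({u : ℂ | σ' < u.re} ×ˢ Γ)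
  solves : ∀ u : ℂ, σ' < u.re → SolvesODE n ψ u Γ (W n ψc j η u)
  limits : ∀ u : ℂ, σ' < u.re → ∀ ξ ∈ Γ, ∀ s ≤ n - 2,
    Tendsto (fun t : ℝ => iteratedDeriv s (η u) (ray ξ (thetaMid n j) t)) atTop (𝓝 0)

end BorelWKB

end

open BorelWKB

noncomputable section
namespace BorelWKB

/-! ### Holomorphic functions of two variables -/

/-! Fix `j` and write `ω_l = e^{2πil/n}`, `a_l = ω_l - ω_j`, `φ_k = ψ_k - δ_{0,k}`. If `P_l' = ω_l u
P_l + (ω_l u / n) ∑_k φ_k ∑_m ω_m^k P_m`, then `w = ∑_l P_l` has `w^(i) = u^i ∑_l ω_l^i P_l` for `i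
< n`, because the corresponding power sums of the roots of unity vanish, and `w` solves the
differential equation (`iteratedDeriv_eq_of_system`). Substitute `P_l = exp(ω_j u ξ + X_j) (δ_{lj} +
q_l)`. An integration by parts gives `u φ_k = Ψ_k(0, ξ) + ∫ e^{-ut} ∂_t Ψ_k dt`, which removes the
large factor `u` from the coupling. Hence `q_l = ∫ e^{-ut} Q_l dt` works as soon as `∂_ξ Q_l - a_l
∂_t Q_l = k_{lj} + ∑_m (b_{lm} Q_m + k_{lm} * Q_m)` and `a_l Q_l(0, ξ) = -b_{lj}`; the exponent
`X_j` is exactly what makes `b_{jj} = 0`.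

For `l ≠ j` this is integrated along the characteristic `ξ + t / a_l = const` down to `t = 0`; for
`l = j`, where `a_j = 0`, along the ray from `ξ` to infinity in the direction `e^{iθ_j}`. Since `1 /
a_l` has argument `θ_{j,l}`, and since `|a_l| ≥ 𝔞ₙ` (`aSeq_le_norm_omega_sub`), both kinds of path
stay in the union of the sets `|t - t₀| + 𝔞ₙ |ξ - ξ₀| < 𝔞ₙ d` with `t₀ ≥ 0`, `ξ₀ ∈ Γ`
(`shift_a_mem_dom`). As `|θ_{j,l} - θ_j| < π/2`, one real coordinate `y` increases along all of them
(`le_β`, `y_shift_e`).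

The estimates use the weight `exp(Λ ∫_y^∞ (1 + |v|)^{-1-ρ} dv) - 1`: integrating its derivative
along the paths gains `1 / Λ`, while the coefficients of the right-hand side carry the integrable
factor `(1 + |v|)^{-1-ρ}`, and a convolution costs only an arbitrarily small increase of the
exponential rate (`conv_le`). For large `Λ` the iteration contracts (`exists_controlled_step`,
`exists_controlled`). Its sum is analytic in both variables by Osgood's lemma, solves the system
(`sol_pde`), and `F_j = ∑_l Q_l`.

Watson's lemma expands `η_j` with coefficients `∂_t^m F_j(0, ξ)`. Substituting the expansion into
the equation and comparing formal power series in `1 / u` gives the derivative of each coefficient;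
since the coefficients vanish at infinity, integration yields the recurrence (`deriv_coeffHat`,
`coeffHat_spec`), and the Taylor series of `F_j` follows.

For uniqueness, let `u` be real and take discrete Fourier components of the difference of two
solutions along a ray. They satisfy `z_l' = b_l z_l + f_l` with `b_j = 0`, `Re b_l > 0` for `l ≠ j`,
and an integrable coupling. The `n - 1` limit conditions force all components to zero, and then
integrating from infinity is a contraction, so they vanish near infinity
(`eventually_eq_zero_of_tendsto`). The identity theorem, first in `ξ` and then in `u`, finishes. -/

open scoped BoundedContinuousFunction in
/-- The circle map `θ ↦ circleMap c r (g θ)` as a bounded continuous function. -/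
def cauchyKer (c : ℂ) (r : ℝ) (g : C(ℝ × ℝ, ℝ)) : (ℝ × ℝ) →ᵇ ℂ :=
  BoundedContinuousFunction.ofNormedAddCommGroup (fun θ => circleMap c r (g θ))
    ((continuous_circleMap c r).comp g.continuous) (‖c‖ + |r|) fun θ => by
      rw [circleMap]
      refine (norm_add_le _ _).trans ?_
      simp [Complex.norm_exp_ofReal_mul_I]

open scoped BoundedContinuousFunction in
-- The circle stays at distance at least `r - ‖z - c‖ > 0` from `z`, so the pointwise reciprocal is
-- a bounded continuous function.
theorem isUnit_cauchyKer_sub (c : ℂ) {r : ℝ} (hr : 0 < r) (g : C(ℝ × ℝ, ℝ)) {z : ℂ}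
    (hz : z ∈ Metric.ball c r) :
    IsUnit (cauchyKer c r g - algebraMap ℂ ((ℝ × ℝ) →ᵇ ℂ) z) := by
  have hne : ∀ θ, circleMap c r (g θ) - z ≠ 0 := fun θ h => by
    have h2 : z = circleMap c r (g θ) := (sub_eq_zero.1 h).symm
    rw [h2, Metric.mem_ball, dist_eq_norm, circleMap_sub_center, norm_circleMap_zero,
      abs_of_pos hr] at hz
    exact lt_irrefl _ hz
  have hlow : ∀ θ, r - ‖z - c‖ ≤ ‖circleMap c r (g θ) - z‖ := fun θ => by
    have h1 : ‖circleMap c r (g θ) - c‖ = r := by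
      rw [circleMap_sub_center, norm_circleMap_zero, abs_of_pos hr]
    have h2 := norm_sub_norm_le (circleMap c r (g θ) - c) (z - c)
    rw [sub_sub_sub_cancel_right, h1] at h2
    exact h2
  have hpos : 0 < r - ‖z - c‖ := by
    rw [Metric.mem_ball, dist_eq_norm] at hz; linarith
  let v : (ℝ × ℝ) →ᵇ ℂ := BoundedContinuousFunction.ofNormedAddCommGroup
    (fun θ => (circleMap c r (g θ) - z)⁻¹)
    ((((continuous_circleMap c r).comp g.continuous).sub continuous_const).inv₀ hne)
    (r - ‖z - c‖)⁻¹ fun θ => by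
      rw [norm_inv]
      exact inv_anti₀ hpos (hlow θ)
  refine IsUnit.of_mul_eq_one v ?_
  ext θ
  simpa [cauchyKer, v] using mul_inv_cancel₀ (hne θ)

open scoped BoundedContinuousFunction in
theorem inverse_cauchyKer_sub_apply (c : ℂ) {r : ℝ} (hr : 0 < r) (g : C(ℝ × ℝ, ℝ)) {z : ℂ}
    (hz : z ∈ Metric.ball c r) (θ : ℝ × ℝ) :
    Ring.inverse (cauchyKer c r g - algebraMap ℂ ((ℝ × ℝ) →ᵇ ℂ) z) θ =
      (circleMap c r (g θ) - z)⁻¹ := by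
  have h := Ring.mul_inverse_cancel _ (isUnit_cauchyKer_sub c hr g hz)
  have h2 := congrArg (fun f : (ℝ × ℝ) →ᵇ ℂ => f θ) h
  simp only [BoundedContinuousFunction.mul_apply, BoundedContinuousFunction.coe_one,
    Pi.one_apply] at h2
  exact eq_inv_of_mul_eq_one_right (by simpa [cauchyKer] using h2)

open scoped BoundedContinuousFunction in
/-- Osgood's lemma: a continuous function of two complex variables that is holomorphic in each
variable is analytic. -/
theorem analyticOnNhd_of_separately {f : ℂ × ℂ → ℂ} {Ω : Set (ℂ × ℂ)} (hΩ : IsOpen Ω)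
    (hc : ContinuousOn f Ω)
    (h1 : ∀ p ∈ Ω, DifferentiableAt ℂ (fun z => f (z, p.2)) p.1)
    (h2 : ∀ p ∈ Ω, DifferentiableAt ℂ (fun w => f (p.1, w)) p.2) : AnalyticOnNhd ℂ f Ω := by
  rintro ⟨z₀, w₀⟩ hp
  obtain ⟨r, hr, hsub⟩ := Metric.nhds_basis_closedBall.mem_iff.1 (hΩ.mem_nhds hp)
  rw [← closedBall_prod_same] at hsub
  have hcirc : ∀ (c : ℂ) (θ : ℝ), circleMap c r θ ∈ Metric.closedBall c r :=
    fun c θ => circleMap_mem_closedBall c hr.le θ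
  let G : ℝ × ℝ → ℂ := fun θ => deriv (circleMap z₀ r) θ.1 * deriv (circleMap w₀ r) θ.2 *
    f (circleMap z₀ r θ.1, circleMap w₀ r θ.2)
  have hGc : Continuous G := by
    have hf : Continuous fun θ : ℝ × ℝ => f (circleMap z₀ r θ.1, circleMap w₀ r θ.2) :=
      hc.comp_continuous (((continuous_circleMap z₀ r).comp continuous_fst).prodMk
        ((continuous_circleMap w₀ r).comp continuous_snd))
        fun θ => hsub ⟨hcirc _ _, hcirc _ _⟩
    have hd : ∀ c : ℂ, Continuous fun θ : ℝ => deriv (circleMap c r) θ := fun c => by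
      simp only [deriv_circleMap]
      exact (continuous_circleMap 0 r).mul continuous_const
    exact (((hd z₀).comp continuous_fst).mul ((hd w₀).comp continuous_snd)).mul hf
  let K : Set (ℝ × ℝ) := Icc 0 (2 * Real.pi) ×ˢ Icc 0 (2 * Real.pi)
  have hK : IsCompact K := isCompact_Icc.prod isCompact_Icc
  have hint : ∀ g : (ℝ × ℝ) →ᵇ ℂ, IntegrableOn (fun θ => g θ * G θ) K := fun g =>
    (g.continuous.mul hGc).continuousOn.integrableOn_compact hK
  let L₀ : ((ℝ × ℝ) →ᵇ ℂ) →ₗ[ℂ] ℂ :=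
    { toFun := fun g => ∫ θ in K, g θ * G θ
      map_add' := fun g g' => by
        rw [← integral_add (hint g) (hint g')]
        simp [add_mul]
      map_smul' := fun a g => by
        simp only [RingHom.id_apply, smul_eq_mul, BoundedContinuousFunction.coe_smul, mul_assoc]
        exact integral_const_mul _ _ }
  -- Integration against `G` over the parameter square of the torus is bounded in the supremum norm,
  -- with the `L¹` norm of `G` as constant.
  let L : ((ℝ × ℝ) →ᵇ ℂ) →L[ℂ] ℂ := L₀.mkContinuous (∫ θ in K, ‖G θ‖) fun g => by
    refine (norm_integral_le_integral_norm _).trans ?_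
    rw [mul_comm, ← integral_const_mul]
    refine integral_mono_of_nonneg (Eventually.of_forall fun θ => norm_nonneg _)
      ((hGc.norm.continuousOn.integrableOn_compact hK).const_mul _)
      (Eventually.of_forall fun θ => ?_)
    change ‖g θ * G θ‖ ≤ ‖g‖ * ‖G θ‖
    rw [norm_mul]
    exact mul_le_mul_of_nonneg_right (g.norm_coe_le_norm θ) (norm_nonneg _)
  let g₁ : C(ℝ × ℝ, ℝ) := ⟨Prod.fst, continuous_fst⟩
  let g₂ : C(ℝ × ℝ, ℝ) := ⟨Prod.snd, continuous_snd⟩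
  -- This is the double Cauchy integral, written as `L` applied to a product of two inverses in a
  -- Banach algebra. Inversion is analytic there, so joint analyticity comes by composition, without
  -- expanding a double series.
  let Φ : ℂ × ℂ → ℂ := fun p => (2 * Real.pi * Complex.I)⁻¹ * ((2 * Real.pi * Complex.I)⁻¹ *
    L (Ring.inverse (cauchyKer z₀ r g₁ - algebraMap ℂ ((ℝ × ℝ) →ᵇ ℂ) p.1) *
      Ring.inverse (cauchyKer w₀ r g₂ - algebraMap ℂ ((ℝ × ℝ) →ᵇ ℂ) p.2)))
  have hΦ : AnalyticAt ℂ Φ (z₀, w₀) := by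
    have hinv : ∀ (c : ℂ) (g : C(ℝ × ℝ, ℝ)),
        AnalyticAt ℂ (fun z : ℂ => Ring.inverse (cauchyKer c r g -
          algebraMap ℂ ((ℝ × ℝ) →ᵇ ℂ) z)) c := fun c g => by
      have hu := isUnit_cauchyKer_sub c hr g (Metric.mem_ball_self hr)
      have ha : AnalyticAt ℂ (fun z : ℂ => cauchyKer c r g - algebraMap ℂ ((ℝ × ℝ) →ᵇ ℂ) z) c :=
        analyticAt_const.sub ((Algebra.linearMap ℂ ((ℝ × ℝ) →ᵇ ℂ)).toContinuousLinearMap.analyticAt c)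
      exact AnalyticAt.comp (g := Ring.inverse) (analyticAt_inverse (𝕜 := ℂ) hu.unit) ha
    refine analyticAt_const.mul (analyticAt_const.mul ?_)
    refine (L.analyticAt _).comp ?_
    exact ((hinv z₀ g₁).comp (x := (z₀, w₀)) analyticAt_fst).mul
      ((hinv w₀ g₂).comp (x := (z₀, w₀)) analyticAt_snd)
  refine hΦ.congr ?_
  filter_upwards [Metric.ball_mem_nhds (z₀, w₀) hr] with p hp
  rw [← ball_prod_same] at hp
  obtain ⟨hz, hw⟩ := hp
  -- `e1` and `e2` are Cauchy's formula in each variable separately; Fubini in `e3` identifies the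
  -- iterated integral with `Φ`.
  have e1 : f p = (2 * Real.pi * Complex.I : ℂ)⁻¹ •
      ∮ z in C(z₀, r), (z - p.1)⁻¹ • f (z, p.2) := by
    rw [DiffContOnCl.two_pi_i_inv_smul_circleIntegral_sub_inv_smul (f := fun z => f (z, p.2)) _ hz]
    refine DifferentiableOn.diffContOnCl (fun z hz' => (h1 (z, p.2) (hsub ⟨?_,
      Metric.ball_subset_closedBall hw⟩)).differentiableWithinAt)
    exact Metric.closure_ball_subset_closedBall hz'
  have e2 : ∀ θ : ℝ, f (circleMap z₀ r θ, p.2) = (2 * Real.pi * Complex.I : ℂ)⁻¹ •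
      ∮ w in C(w₀, r), (w - p.2)⁻¹ • f (circleMap z₀ r θ, w) := fun θ => by
    rw [DiffContOnCl.two_pi_i_inv_smul_circleIntegral_sub_inv_smul
      (f := fun w => f (circleMap z₀ r θ, w)) _ hw]
    refine DifferentiableOn.diffContOnCl (fun w hw' => (h2 (circleMap z₀ r θ, w) (hsub
      ⟨hcirc _ _, ?_⟩)).differentiableWithinAt)
    exact Metric.closure_ball_subset_closedBall hw'
  have e3 : L (Ring.inverse (cauchyKer z₀ r g₁ - algebraMap ℂ ((ℝ × ℝ) →ᵇ ℂ) p.1) *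
      Ring.inverse (cauchyKer w₀ r g₂ - algebraMap ℂ ((ℝ × ℝ) →ᵇ ℂ) p.2)) =
      ∫ s in Icc 0 (2 * Real.pi), ∫ t in Icc 0 (2 * Real.pi),
        (circleMap z₀ r s - p.1)⁻¹ * (circleMap w₀ r t - p.2)⁻¹ * G (s, t) := by
    change ∫ θ in K, _ = _
    rw [Measure.volume_eq_prod, setIntegral_prod _ (by
      rw [← Measure.volume_eq_prod]; exact hint _)]
    refine integral_congr_ae (Eventually.of_forall fun s => integral_congr_ae
      (Eventually.of_forall fun t => ?_))
    simp only [BoundedContinuousFunction.mul_apply]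
    rw [inverse_cauchyKer_sub_apply z₀ hr g₁ hz, inverse_cauchyKer_sub_apply w₀ hr g₂ hw]
    rfl
  change (2 * Real.pi * Complex.I : ℂ)⁻¹ * ((2 * Real.pi * Complex.I)⁻¹ * _) = _
  rw [e3, e1, smul_eq_mul]
  congr 1
  rw [circleIntegral, intervalIntegral.integral_of_le (by positivity), ← integral_Icc_eq_integral_Ioc,
    ← integral_const_mul]
  refine integral_congr_ae (Eventually.of_forall fun s => ?_)
  simp only
  rw [e2 s, circleIntegral, intervalIntegral.integral_of_le (by positivity),
    ← integral_Icc_eq_integral_Ioc]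
  simp only [smul_eq_mul, G]
  simp only [← integral_const_mul]
  refine integral_congr_ae (Eventually.of_forall fun t => ?_)
  simp only
  ring

/-! ### Integrals depending holomorphically on parameters -/

/-- Differentiation under the integral sign for a locally dominated holomorphic integrand. -/
theorem hasDerivAt_integral_of_differentiableOn {α : Type*} [MeasurableSpace α] {μ : Measure α}
    {F : ℂ → α → ℂ} {z₀ : ℂ} {r : ℝ} (hr : 0 < r) {bound : α → ℝ}
    (hm : ∀ z ∈ Metric.ball z₀ r, AEStronglyMeasurable (F z) μ)
    (hd : ∀ᵐ a ∂μ, DifferentiableOn ℂ (fun z => F z a) (Metric.ball z₀ r))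
    (hb : ∀ᵐ a ∂μ, ∀ z ∈ Metric.ball z₀ r, ‖F z a‖ ≤ bound a) (hi : Integrable bound μ) :
    Integrable (fun a => deriv (fun z => F z a) z₀) μ ∧
      HasDerivAt (fun z => ∫ a, F z a ∂μ) (∫ a, deriv (fun z => F z a) z₀ ∂μ) z₀ := by
  have hr2 : 0 < r / 2 := by positivity
  have hsub : Metric.ball z₀ (r / 2) ⊆ Metric.ball z₀ r := Metric.ball_subset_ball (by linarith)
  have hz₀ : z₀ ∈ Metric.ball z₀ r := Metric.mem_ball_self hr
  refine hasDerivAt_integral_of_dominated_loc_of_deriv_le (F := F)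
    (F' := fun z a => deriv (fun z => F z a) z) (bound := fun a => bound a / (r / 4))
    (Metric.ball_mem_nhds z₀ hr2) ?_ ?_ ?_ ?_ ?_ ?_
  · filter_upwards [Metric.ball_mem_nhds z₀ hr] with z hz using hm z hz
  · refine hi.mono' (hm z₀ hz₀) ?_
    filter_upwards [hb] with a ha using ha z₀ hz₀
  -- Measurability of the derivative in `a` comes from difference quotients along the sequence `z₀ +
  -- (r/2)/(k+1)`, which stays in the ball.
  · have hlim : ∀ᵐ a ∂μ, Tendsto (fun k : ℕ => ((r / 2) / (k + 1) : ℂ)⁻¹ *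
        (F (z₀ + (r / 2) / (k + 1)) a - F z₀ a)) atTop (𝓝 (deriv (fun z => F z a) z₀)) := by
      have hk : Tendsto (fun k : ℕ => ((r / 2) / (k + 1) : ℂ)) atTop (𝓝[≠] 0) := by
        refine tendsto_nhdsWithin_of_tendsto_nhds_of_eventually_within _ ?_ ?_
        · have := (tendsto_one_div_add_atTop_nhds_zero_nat (𝕜 := ℂ)).const_mul ((r / 2 : ℂ))
          simpa [div_eq_mul_inv] using this
        · refine Eventually.of_forall fun k => ?_
          have h1 : (r : ℂ) ≠ 0 := by exact_mod_cast hr.ne'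
          have h2 : ((k : ℂ) + 1) ≠ 0 := by exact_mod_cast Nat.succ_ne_zero k
          simp [h1, h2]
      filter_upwards [hd] with a ha
      have h1 := ((ha.differentiableAt (Metric.ball_mem_nhds z₀ hr)).hasDerivAt).tendsto_slope_zero
      exact h1.comp hk
    refine aestronglyMeasurable_of_tendsto_ae atTop (fun k => ?_) hlim
    refine ((hm _ ?_).sub (hm z₀ hz₀)).const_mul _
    rw [Metric.mem_ball, dist_self_add_left]
    have h1 : ((r / 2) / (k + 1) : ℂ) = (((r / 2) / (k + 1) : ℝ) : ℂ) := by push_cast; rfl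
    rw [h1, Complex.norm_of_nonneg (by positivity)]
    calc r / 2 / ((k : ℝ) + 1) ≤ r / 2 := div_le_self hr2.le (by linarith [Nat.cast_nonneg (α := ℝ) k])
      _ < r := by linarith
  -- Cauchy's estimate on circles of radius `r/4` about points of the half-size ball; these circles
  -- lie in the ball of radius `r`.
  · filter_upwards [hd, hb] with a ha hba z hz
    refine Complex.norm_deriv_le_of_forall_mem_sphere_norm_le (by positivity) ?_ ?_
    · refine DifferentiableOn.diffContOnCl (ha.mono ?_)
      refine Metric.closure_ball_subset_closedBall.trans ?_
      intro x hx
      rw [Metric.mem_closedBall] at hx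
      rw [Metric.mem_ball] at hz ⊢
      linarith [dist_triangle x z z₀]
    · intro x hx
      refine hba x ?_
      rw [mem_sphere_iff_norm, ← dist_eq_norm] at hx
      rw [Metric.mem_ball] at hz ⊢
      linarith [dist_triangle x z z₀]
  · exact hi.div_const _
  · filter_upwards [hd] with a ha z hz
    exact (ha.differentiableAt (Metric.isOpen_ball.mem_nhds (hsub hz))).hasDerivAt

/-- A locally dominated integral of analytic functions of two variables is analytic. -/
theorem analyticOnNhd_integral {α : Type*} [MeasurableSpace α] {μ : Measure α}
    {F : ℂ × ℂ → α → ℂ} {Ω : Set (ℂ × ℂ)} (hΩ : IsOpen Ω)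
    (hm : ∀ p ∈ Ω, AEStronglyMeasurable (F p) μ)
    (ha : ∀ᵐ a ∂μ, AnalyticOnNhd ℂ (fun p => F p a) Ω)
    (hb : ∀ p ∈ Ω, ∃ V ∈ 𝓝 p, ∃ bound : α → ℝ, Integrable bound μ ∧
      ∀ᵐ a ∂μ, ∀ q ∈ V, q ∈ Ω → ‖F q a‖ ≤ bound a) :
    AnalyticOnNhd ℂ (fun p => ∫ a, F p a ∂μ) Ω := by
  have key : ∀ p ∈ Ω, ∃ r > 0, Metric.ball p r ⊆ Ω ∧ ∃ bound : α → ℝ, Integrable bound μ ∧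
      ∀ᵐ a ∂μ, ∀ q ∈ Metric.ball p r, ‖F q a‖ ≤ bound a := by
    intro p hp
    obtain ⟨V, hV, bound, hi, hbd⟩ := hb p hp
    obtain ⟨r, hr, hsub⟩ := Metric.mem_nhds_iff.1 (inter_mem hV (hΩ.mem_nhds hp))
    refine ⟨r, hr, fun q hq => (hsub hq).2, bound, hi, ?_⟩
    filter_upwards [hbd] with a ha q hq using ha q (hsub hq).1 (hsub hq).2
  -- Continuity comes from dominated convergence, and holomorphy in each variable from
  -- differentiation under the integral.
  refine analyticOnNhd_of_separately hΩ ?_ ?_ ?_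
  · intro p hp
    obtain ⟨r, hr, hsub, bound, hi, hbd⟩ := key p hp
    refine ContinuousAt.continuousWithinAt ?_
    refine continuousAt_of_dominated (bound := bound) ?_ ?_ hi ?_
    · filter_upwards [Metric.ball_mem_nhds p hr] with q hq using hm q (hsub hq)
    · filter_upwards [Metric.ball_mem_nhds p hr] with q hq
      filter_upwards [hbd] with a ha using ha q hq
    · filter_upwards [ha] with a ha using (ha p hp).continuousAt
  · intro p hp
    obtain ⟨r, hr, hsub, bound, hi, hbd⟩ := key p hp
    have hin : ∀ z ∈ Metric.ball p.1 r, (z, p.2) ∈ Metric.ball p r := fun z hz => by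
      rw [show p = (p.1, p.2) from rfl, ← ball_prod_same]
      exact ⟨hz, Metric.mem_ball_self hr⟩
    refine (hasDerivAt_integral_of_differentiableOn (F := fun z a => F (z, p.2) a) hr
      (fun z hz => hm _ (hsub (hin z hz))) ?_ ?_ hi).2.differentiableAt
    · filter_upwards [ha] with a ha z hz
      have := (ha _ (hsub (hin z hz))).differentiableAt
      exact (this.comp z (by fun_prop : DifferentiableAt ℂ (fun z => (z, p.2)) z)).differentiableWithinAt
    · filter_upwards [hbd] with a ha z hz using ha _ (hin z hz)
  · intro p hp
    obtain ⟨r, hr, hsub, bound, hi, hbd⟩ := key p hp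
    have hin : ∀ w ∈ Metric.ball p.2 r, (p.1, w) ∈ Metric.ball p r := fun z hz => by
      rw [show p = (p.1, p.2) from rfl, ← ball_prod_same]
      exact ⟨Metric.mem_ball_self hr, hz⟩
    refine (hasDerivAt_integral_of_differentiableOn (F := fun w a => F (p.1, w) a) hr
      (fun z hz => hm _ (hsub (hin z hz))) ?_ ?_ hi).2.differentiableAt
    · filter_upwards [ha] with a ha z hz
      have := (ha _ (hsub (hin z hz))).differentiableAt
      exact (this.comp z (by fun_prop : DifferentiableAt ℂ (fun z => (p.1, z)) z)).differentiableWithinAt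
    · filter_upwards [hbd] with a ha z hz using ha _ (hin z hz)

/-- The sum of a locally uniformly dominated series of analytic functions is analytic. -/
theorem analyticOnNhd_tsum {F : ℕ → ℂ × ℂ → ℂ} {Ω : Set (ℂ × ℂ)} (hΩ : IsOpen Ω)
    (ha : ∀ k, AnalyticOnNhd ℂ (F k) Ω)
    (hb : ∀ p ∈ Ω, ∃ V ∈ 𝓝 p, ∃ bound : ℕ → ℝ, Summable bound ∧
      ∀ k, ∀ q ∈ V, q ∈ Ω → ‖F k q‖ ≤ bound k) :
    AnalyticOnNhd ℂ (fun p => ∑' k, F k p) Ω := by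
  -- A series is an integral with respect to the counting measure.
  have h := analyticOnNhd_integral (μ := Measure.count) (F := fun p k => F k p) hΩ
    (fun p _ => (measurable_from_nat).aestronglyMeasurable) (Eventually.of_forall ha) ?_
  · intro p hp
    refine (h p hp).congr ?_
    filter_upwards [hΩ.mem_nhds hp] with q hq
    obtain ⟨V, hV, bound, hs, hbd⟩ := hb q hq
    have hi : Integrable (fun k => F k q) (Measure.count : Measure ℕ) :=
      integrable_count_iff.2 (Summable.of_nonneg_of_le (fun _ => norm_nonneg _)
        (fun k => hbd k q (mem_of_mem_nhds hV) hq) hs)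
    simpa using integral_countable hi
  · intro p hp
    obtain ⟨V, hV, bound, hs, hbd⟩ := hb p hp
    refine ⟨V, hV, bound, ?_, Eventually.of_forall fun k q hq hq' => hbd k q hq hq'⟩
    exact integrable_count_iff.2 hs.norm

/-! ### Weights -/

/-- The decay rate `(1 + |v|) ^ (-(1 + ρ))`. -/
def decay (ρ v : ℝ) : ℝ := (1 + |v|) ^ (-(1 + ρ))

/-- `∫_y^∞ (1 + |v|) ^ (-(1 + ρ)) dv` -/
def tail (ρ y : ℝ) : ℝ := ∫ v in Ioi y, decay ρ v

theorem decay_pos (ρ v : ℝ) : 0 < decay ρ v := Real.rpow_pos_of_pos (by positivity) _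

theorem decay_le_one {ρ : ℝ} (hρ : 0 < ρ) (v : ℝ) : decay ρ v ≤ 1 :=
  Real.rpow_le_one_of_one_le_of_nonpos (by linarith [abs_nonneg v]) (by linarith)

theorem continuous_decay (ρ : ℝ) : Continuous (decay ρ) := by
  unfold decay
  exact (continuous_const.add continuous_abs).rpow_const fun v =>
    Or.inl (show (1 : ℝ) + |v| ≠ 0 by positivity)

theorem integrable_decay {ρ : ℝ} (hρ : 0 < ρ) : Integrable (decay ρ) := by
  have := integrable_one_add_norm (E := ℝ) (μ := volume) (r := 1 + ρ) (by simp [hρ])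
  exact this

/-- `1 + |y| ≤ (1 + L) (1 + |x|)`. Bounded shifts of the argument therefore cost only a constant,
which allows the passage between the coordinates `x` and `y` below. -/
theorem decay_le_of_abs_sub_le {ρ : ℝ} (hρ : 0 < ρ) {x y L : ℝ} (h : |x - y| ≤ L) :
    decay ρ x ≤ (1 + L) ^ (1 + ρ) * decay ρ y := by
  have hL : 0 ≤ L := (abs_nonneg _).trans h
  have hx := abs_nonneg x
  have hy := abs_nonneg y
  have h1 : 1 + |y| ≤ (1 + L) * (1 + |x|) := by
    have : |y| ≤ |x| + |x - y| := by
      have := abs_sub_abs_le_abs_sub y x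
      rw [abs_sub_comm] at this; linarith
    nlinarith
  rw [decay, decay, Real.rpow_neg (by positivity), Real.rpow_neg (by positivity), ← div_eq_mul_inv,
    ← one_div, div_le_div_iff₀ (by positivity) (by positivity), one_mul,
    ← Real.mul_rpow (by positivity) (by positivity)]
  exact Real.rpow_le_rpow (by positivity) h1 (by linarith)

theorem tail_nonneg (ρ y : ℝ) : 0 ≤ tail ρ y :=
  integral_nonneg fun v => (decay_pos ρ v).le

theorem tail_le_total {ρ : ℝ} (hρ : 0 < ρ) (y : ℝ) : tail ρ y ≤ ∫ v, decay ρ v :=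
  setIntegral_le_integral (integrable_decay hρ) (Eventually.of_forall fun v => (decay_pos ρ v).le)

theorem tail_antitone {ρ : ℝ} (hρ : 0 < ρ) : Antitone (tail ρ) := fun _ _ h =>
  setIntegral_mono_set (integrable_decay hρ).integrableOn
    (Eventually.of_forall fun v => (decay_pos ρ v).le) (Ioi_subset_Ioi h).eventuallyLE

theorem tail_eq {ρ : ℝ} (hρ : 0 < ρ) (y : ℝ) : tail ρ y = tail ρ 0 - ∫ v in (0 : ℝ)..y, decay ρ v := by
  have := intervalIntegral.integral_Ioi_sub_Ioi' (μ := volume) (a := (0 : ℝ)) (b := y)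
    (integrable_decay hρ).integrableOn (integrable_decay hρ).integrableOn
  rw [← this, tail, tail]; ring

theorem hasDerivAt_tail {ρ : ℝ} (hρ : 0 < ρ) (y : ℝ) : HasDerivAt (tail ρ) (-decay ρ y) y := by
  have h := intervalIntegral.integral_hasDerivAt_right
    ((continuous_decay ρ).intervalIntegrable 0 y)
    ((continuous_decay ρ).stronglyMeasurableAtFilter _ _) (continuous_decay ρ).continuousAt
  have h2 := h.const_sub (tail ρ 0)
  refine h2.congr_of_eventuallyEq (Eventually.of_forall fun z => tail_eq hρ z)

theorem tendsto_tail {ρ : ℝ} (hρ : 0 < ρ) : Tendsto (tail ρ) atTop (𝓝 0) := by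
  have h := intervalIntegral_tendsto_integral_Ioi (μ := volume) (0 : ℝ)
    (integrable_decay hρ).integrableOn tendsto_id
  have h2 := h.const_sub (tail ρ 0)
  rw [show ∫ v in Ioi 0, decay ρ v = tail ρ 0 from rfl, sub_self] at h2
  exact h2.congr fun y => (tail_eq hρ y).symm

/-- Average over `[y, y + 1]`, where the decay varies by at most the factor `2 ^ (1 + ρ)`. With
`tail_le_weight` this lets the boundary term at `t = 0` gain a factor `1 / Λ` as well. -/
theorem decay_le_tail {ρ : ℝ} (hρ : 0 < ρ) (y : ℝ) :
    decay ρ y ≤ 2 ^ (1 + ρ) * tail ρ y := by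
  have h1 : ∫ v in Ioc y (y + 1), decay ρ y ≤ ∫ v in Ioc y (y + 1), 2 ^ (1 + ρ) * decay ρ v := by
    refine setIntegral_mono_on (by simp) ((integrable_decay hρ).const_mul _).integrableOn
      measurableSet_Ioc fun v hv => ?_
    have := decay_le_of_abs_sub_le hρ (x := y) (y := v) (L := 1) (by
      rw [abs_le]; constructor <;> linarith [hv.1, hv.2])
    norm_num at this ⊢
    exact this
  have h2 : ∫ v in Ioc y (y + 1), decay ρ y = decay ρ y := by simp
  rw [h2, integral_const_mul] at h1
  refine h1.trans (mul_le_mul_of_nonneg_left ?_ (by positivity))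
  exact setIntegral_mono_set (integrable_decay hρ).integrableOn
    (Eventually.of_forall fun v => (decay_pos ρ v).le) Ioc_subset_Ioi_self.eventuallyLE

/-- For `y ≥ 1` the tail is at most `∫_y^∞ v^{-1-ρ} dv = y^{-ρ} / ρ`; for `y ≤ 1` the total mass is
enough. -/
theorem tail_le_rpow {ρ : ℝ} (hρ : 0 < ρ) :
    ∃ C > 0, ∀ y, tail ρ y ≤ C * (1 / (max 1 y) ^ ρ) := by
  have htot : 0 ≤ ∫ v, decay ρ v := integral_nonneg fun v => (decay_pos ρ v).le
  refine ⟨(∫ v, decay ρ v) + 1 / ρ, by positivity, fun y => ?_⟩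
  rcases le_total y 1 with h | h
  · rw [max_eq_left h, Real.one_rpow]
    have := tail_le_total hρ y
    have : 0 ≤ 1 / ρ := by positivity
    linarith
  · have hy : 0 < y := by linarith
    rw [max_eq_right h]
    have h1 : tail ρ y ≤ ∫ v in Ioi y, v ^ (-(1 + ρ)) := by
      refine setIntegral_mono_on (integrable_decay hρ).integrableOn
        (integrableOn_Ioi_rpow_of_lt (by linarith) hy) measurableSet_Ioi fun v hv => ?_
      have hv0 : 0 < v := hy.trans hv
      rw [decay, abs_of_pos hv0]
      exact Real.rpow_le_rpow_of_nonpos hv0 (by linarith) (by linarith)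
    rw [integral_Ioi_rpow_of_lt (by linarith) hy] at h1
    have h2 : -y ^ (-(1 + ρ) + 1) / (-(1 + ρ) + 1) = 1 / ρ * (1 / y ^ ρ) := by
      rw [show -(1 + ρ) + 1 = -ρ by ring, Real.rpow_neg hy.le]
      field_simp
    rw [h2] at h1
    refine h1.trans (mul_le_mul_of_nonneg_right (by linarith) (by positivity))

/-- The weight `exp (Λ ∫_y^∞ (1 + |v|) ^ (-(1 + ρ)) dv) - 1`. -/
def weight (ρ Λ y : ℝ) : ℝ := Real.exp (Λ * tail ρ y) - 1

theorem weight_nonneg {ρ Λ : ℝ} (hΛ : 0 ≤ Λ) (y : ℝ) : 0 ≤ weight ρ Λ y :=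
  sub_nonneg.2 (Real.one_le_exp (mul_nonneg hΛ (tail_nonneg ρ y)))

theorem weight_antitone {ρ Λ : ℝ} (hρ : 0 < ρ) (hΛ : 0 ≤ Λ) : Antitone (weight ρ Λ) := fun _ _ h =>
  sub_le_sub_right (Real.exp_le_exp.2 (mul_le_mul_of_nonneg_left (tail_antitone hρ h) hΛ)) _

theorem tail_le_weight {ρ Λ : ℝ} (hΛ : 0 < Λ) (y : ℝ) : tail ρ y ≤ weight ρ Λ y / Λ := by
  rw [le_div_iff₀ hΛ, weight]
  have := Real.add_one_le_exp (Λ * tail ρ y)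
  linarith

theorem hasDerivAt_weight {ρ : ℝ} (hρ : 0 < ρ) (Λ y : ℝ) :
    HasDerivAt (weight ρ Λ) (-(Λ * (decay ρ y * Real.exp (Λ * tail ρ y)))) y := by
  have := (((hasDerivAt_tail hρ y).const_mul Λ).exp).sub_const 1
  refine this.congr_deriv ?_
  ring

theorem continuous_weight {ρ : ℝ} (hρ : 0 < ρ) (Λ : ℝ) : Continuous (weight ρ Λ) :=
  continuous_iff_continuousAt.2 fun y => (hasDerivAt_weight hρ Λ y).continuousAt

theorem continuous_tail {ρ : ℝ} (hρ : 0 < ρ) : Continuous (tail ρ) :=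
  continuous_iff_continuousAt.2 fun y => (hasDerivAt_tail hρ y).continuousAt

theorem continuous_decay_mul_exp {ρ : ℝ} (hρ : 0 < ρ) (Λ : ℝ) :
    Continuous fun y => decay ρ y * Real.exp (Λ * tail ρ y) :=
  (continuous_decay ρ).mul (Real.continuous_exp.comp (continuous_const.mul (continuous_tail hρ)))

/-- The integrand is the derivative of `-weight / Λ` along the segment. This is the purpose of the
exponential in the weight: integration reproduces the weight with a factor `1 / Λ`, however long the
segment is. -/
theorem integral_decay_mul_exp_segment {ρ Λ : ℝ} (hρ : 0 < ρ) (hΛ : 0 < Λ) (y β : ℝ) :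
    ∫ τ in (0 : ℝ)..1, β * (decay ρ (y + τ * β) * Real.exp (Λ * tail ρ (y + τ * β))) ≤
      weight ρ Λ y / Λ := by
  have hd : ∀ τ ∈ uIcc (0 : ℝ) 1, HasDerivAt (fun τ => -(weight ρ Λ (y + τ * β) / Λ))
      (β * (decay ρ (y + τ * β) * Real.exp (Λ * tail ρ (y + τ * β)))) τ := fun τ _ => by
    have h1 : HasDerivAt (fun τ : ℝ => y + τ * β) β τ := by
      simpa using ((hasDerivAt_id τ).mul_const β).const_add y
    have h2 := (((hasDerivAt_weight hρ Λ (y + τ * β)).comp τ h1).div_const Λ).neg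
    refine h2.congr_deriv ?_
    field_simp
  rw [intervalIntegral.integral_eq_sub_of_hasDerivAt hd (Continuous.intervalIntegrable
    (continuous_const.mul ((continuous_decay_mul_exp hρ Λ).comp (by fun_prop))) _ _)]
  have := weight_nonneg (ρ := ρ) hΛ.le (y + 1 * β)
  have h3 : 0 ≤ weight ρ Λ (y + 1 * β) / Λ := by positivity
  simp only [zero_mul, add_zero]
  linarith

theorem integrableOn_decay_mul_exp {ρ Λ : ℝ} (hρ : 0 < ρ) (hΛ : 0 < Λ) (y : ℝ) :
    IntegrableOn (fun s => decay ρ (y + s) * Real.exp (Λ * tail ρ (y + s))) (Ioi 0) := by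
  refine Integrable.integrableOn ?_
  refine (((integrable_decay hρ).comp_add_left y).mul_const
    (Real.exp (Λ * ∫ v, decay ρ v))).mono' ?_ (Eventually.of_forall fun s => ?_)
  · exact ((continuous_decay_mul_exp hρ Λ).comp (by fun_prop)).aestronglyMeasurable
  · have := decay_pos ρ (y + s)
    rw [Real.norm_of_nonneg (by positivity)]
    exact mul_le_mul_of_nonneg_left (Real.exp_le_exp.2 (mul_le_mul_of_nonneg_left
      (tail_le_total hρ _) hΛ.le)) this.le

/-- The primitive is again `-weight / Λ`; equality holds because the weight vanishes at infinity,
which is what subtracting `1` achieves. -/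
theorem integral_decay_mul_exp_ray {ρ Λ : ℝ} (hρ : 0 < ρ) (hΛ : 0 < Λ) (y : ℝ) :
    ∫ s in Ioi (0 : ℝ), decay ρ (y + s) * Real.exp (Λ * tail ρ (y + s)) = weight ρ Λ y / Λ := by
  have hd : ∀ s ∈ Ici (0 : ℝ), HasDerivAt (fun s => -(weight ρ Λ (y + s) / Λ))
      (decay ρ (y + s) * Real.exp (Λ * tail ρ (y + s))) s := fun s _ => by
    have h1 : HasDerivAt (fun s : ℝ => y + s) 1 s := by
      simpa using (hasDerivAt_id s).const_add y
    have h2 := (((hasDerivAt_weight hρ Λ (y + s)).comp s h1).div_const Λ).neg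
    refine h2.congr_deriv ?_
    field_simp
  have hlim : Tendsto (fun s => -(weight ρ Λ (y + s) / Λ)) atTop (𝓝 0) := by
    have h1 : Tendsto (weight ρ Λ) atTop (𝓝 0) := by
      have := ((Real.continuous_exp.tendsto _).comp ((tendsto_tail hρ).const_mul Λ)).sub_const 1
      simp only [mul_zero, Real.exp_zero, sub_self] at this
      exact this
    have h2 := ((h1.comp (tendsto_atTop_add_const_left atTop y tendsto_id)).div_const Λ).neg
    simpa [Function.comp_def] using h2
  rw [integral_Ioi_of_hasDerivAt_of_tendsto' hd (integrableOn_decay_mul_exp hρ hΛ y) hlim]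
  simp

/-- The bound does not depend on `r`, so the factor `|t|` produced by rescaling a convolution to
`[0, 1]` is harmless. -/
theorem mul_integral_exp_neg_le {ε r : ℝ} (hε : 0 < ε) :
    ∫ τ in (0 : ℝ)..1, r * Real.exp (-(ε * τ * r)) ≤ 1 / ε := by
  have hd : ∀ τ ∈ uIcc (0 : ℝ) 1, HasDerivAt (fun τ => -(Real.exp (-(ε * τ * r)) / ε))
      (r * Real.exp (-(ε * τ * r))) τ := fun τ _ => by
    have h1 : HasDerivAt (fun τ : ℝ => -(ε * τ * r)) (-(ε * r)) τ := by
      simpa using (((hasDerivAt_id τ).const_mul ε).mul_const r).fun_neg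
    have h2 := (h1.exp.div_const ε).neg
    refine h2.congr_deriv ?_
    field_simp
  rw [intervalIntegral.integral_eq_sub_of_hasDerivAt hd
    (Continuous.intervalIntegrable (by fun_prop) _ _)]
  have : 0 < Real.exp (-(ε * 1 * r)) / ε := by positivity
  simp only [mul_zero, zero_mul, neg_zero, Real.exp_zero]
  linarith

/-! ### The integral equations in the Borel plane -/

/-- The data of the first-order system
`∂_ξ Q_l - a_l ∂_t Q_l = k_{l,j} + ∑_m (b_{l,m} Q_m + k_{l,m} * Q_m)`
in the Borel plane. -/
structure BorelSystem (ι : Type) [Fintype ι] where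
  j : ι
  a : ι → ℂ
  e : ℂ
  Γ : Set ℂ
  α : ℝ
  d : ℝ
  ρ : ℝ
  σ : ℝ
  c₀ : ℝ
  C : ℝ
  b : ι → ι → ℂ → ℂ
  k : ι → ι → ℂ → ℂ → ℂ
  isOpen : IsOpen Γ
  α_pos : 0 < α
  d_pos : 0 < d
  ρ_pos : 0 < ρ
  σ_nonneg : 0 ≤ σ
  c₀_pos : 0 < c₀
  C_pos : 0 < C
  norm_e : ‖e‖ = 1
  a_j : a j = 0
  norm_a : ∀ l, l ≠ j → α ≤ ‖a l‖
  re_a : ∀ l, l ≠ j → c₀ ≤ ((starRingEnd ℂ) e / a l).re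
  mem_e : ∀ ξ ∈ Γ, ∀ s : ℝ, 0 ≤ s → ξ + s * e ∈ Γ
  mem_a : ∀ l, l ≠ j → ∀ ξ ∈ Γ, ∀ s : ℝ, 0 ≤ s → ξ + s / a l ∈ Γ
  b_jj : ∀ ξ, b j j ξ = 0
  analytic_b : ∀ l m, AnalyticOnNhd ℂ (b l m) (Metric.thickening d Γ)
  analytic_k : ∀ l m, AnalyticOnNhd ℂ (fun p : ℂ × ℂ => k l m p.1 p.2)
    (U (α * d) ×ˢ Metric.thickening d Γ)
  norm_b_le : ∀ l m, ∀ ξ ∈ Metric.thickening d Γ,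
    ‖b l m ξ‖ ≤ C * decay ρ (ξ * (starRingEnd ℂ) e).re
  norm_k_le : ∀ l m, ∀ t ∈ U (α * d), ∀ ξ ∈ Metric.thickening d Γ,
    ‖k l m t ξ‖ ≤ C * Real.exp (σ * t.re) * decay ρ (ξ * (starRingEnd ℂ) e).re

/-- `U r` is the union of the discs of radius `r` centred on the half-line `[0, ∞)`; the point of
the half-line nearest to `t` is `Re t` or `0` according to the sign of `Re t`. -/
theorem mem_U_iff {r : ℝ} {t : ℂ} :
    t ∈ U r ↔ ∃ s : ℝ, 0 ≤ s ∧ ‖t - s‖ < r := by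
  constructor
  · rintro (⟨h1, h2⟩ | h)
    · refine ⟨t.re, h1.le, ?_⟩
      have : t - (t.re : ℂ) = t.im * Complex.I := by
        rw [sub_eq_iff_eq_add']
        exact (Complex.re_add_im t).symm
      rw [this, norm_mul, Complex.norm_I, mul_one, Complex.norm_real]
      exact h2
    · exact ⟨0, le_rfl, by simpa using h⟩
  · rintro ⟨s, hs, h⟩
    by_cases ht : 0 < t.re
    · left
      refine ⟨ht, lt_of_le_of_lt ?_ h⟩
      have := Complex.abs_im_le_norm (t - s)
      simpa using this
    · right
      rw [mem_ball_zero_iff]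
      refine lt_of_le_of_lt ?_ h
      push Not at ht
      rw [Complex.norm_eq_sqrt_sq_add_sq, Complex.norm_eq_sqrt_sq_add_sq]
      refine Real.sqrt_le_sqrt ?_
      simp only [Complex.sub_re, Complex.ofReal_re, Complex.sub_im, Complex.ofReal_im, sub_zero]
      nlinarith

theorem isOpen_U (r : ℝ) : IsOpen (U r) := by
  refine IsOpen.union ?_ Metric.isOpen_ball
  exact (isOpen_lt continuous_const Complex.continuous_re).inter
    (isOpen_lt (continuous_abs.comp Complex.continuous_im) continuous_const)

/-- A homogeneous measure of the distance from the positive real axis. -/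
def axisDist (t : ℂ) : ℝ := |t.im| + max 0 (-t.re)

theorem axisDist_nonneg (t : ℂ) : 0 ≤ axisDist t := by
  have := abs_nonneg t.im
  have := le_max_left 0 (-t.re)
  unfold axisDist; linarith

theorem axisDist_mul {τ : ℝ} (hτ : 0 ≤ τ) (t : ℂ) : axisDist (τ * t) = τ * axisDist t := by
  simp only [axisDist, Complex.re_ofReal_mul, Complex.im_ofReal_mul, abs_mul, abs_of_nonneg hτ,
    mul_add, mul_max_of_nonneg _ _ hτ, mul_zero, mul_neg]

theorem norm_le_re_add_axisDist (t : ℂ) : ‖t‖ ≤ t.re + 2 * axisDist t := by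
  have h := Complex.norm_le_abs_re_add_abs_im t
  have h2 : |t.re| ≤ t.re + 2 * max 0 (-t.re) := by
    rcases le_total 0 t.re with h | h
    · rw [abs_of_nonneg h, max_eq_left (by linarith)]; linarith
    · rw [abs_of_nonpos h, max_eq_right (by linarith)]; linarith
  have := abs_nonneg t.im
  unfold axisDist; linarith

theorem continuous_axisDist : Continuous axisDist := by
  unfold axisDist; fun_prop

theorem axisDist_lt_of_mem_U {r : ℝ} (hr : 0 < r) {t : ℂ} (ht : t ∈ U r) : axisDist t < 2 * r := by
  obtain ⟨s, hs, h⟩ := mem_U_iff.1 ht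
  have h1 := Complex.abs_im_le_norm (t - s)
  have h2 := Complex.abs_re_le_norm (t - s)
  simp only [Complex.sub_re, Complex.ofReal_re, Complex.sub_im, Complex.ofReal_im, sub_zero] at h1 h2
  have h3 : max 0 (-t.re) < r := by
    rw [max_lt_iff]
    exact ⟨hr, by linarith [neg_abs_le (t.re - s)]⟩
  unfold axisDist; linarith

theorem neg_lt_re_of_mem_U {r : ℝ} {t : ℂ} (ht : t ∈ U r) : -r < t.re := by
  obtain ⟨s, hs, h⟩ := mem_U_iff.1 ht
  have h2 := Complex.abs_re_le_norm (t - s)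
  simp only [Complex.sub_re, Complex.ofReal_re] at h2
  linarith [neg_abs_le (t.re - s)]

/-- Split `t` into its projection `s` onto the positive axis, for which `Re (s w) ≥ c s`, and a
remainder of size at most `axisDist t`. -/
theorem re_mul_ge {t w : ℂ} {c B : ℝ} (hc : 0 ≤ c) (hw : c ≤ w.re) (hB : ‖w‖ ≤ B) :
    c * ‖t‖ - (c + B) * axisDist t ≤ (t * w).re := by
  set s : ℝ := max 0 t.re with hs
  have hs0 : 0 ≤ s := le_max_left _ _
  have hdist : ‖t - s‖ ≤ axisDist t := by
    have h := Complex.norm_le_abs_re_add_abs_im (t - s)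
    simp only [Complex.sub_re, Complex.ofReal_re, Complex.sub_im, Complex.ofReal_im, sub_zero] at h
    have h2 : |t.re - s| = max 0 (-t.re) := by
      rcases le_total 0 t.re with h | h
      · rw [hs, max_eq_right h, max_eq_left (by linarith)]; simp
      · rw [hs, max_eq_left h, max_eq_right (by linarith), sub_zero, abs_of_nonpos h]
    unfold axisDist; linarith
  have h1 : (t * w).re = s * w.re + ((t - s) * w).re := by
    have : t * w = s * w + (t - s) * w := by ring
    rw [this, Complex.add_re, Complex.re_ofReal_mul]
  have h2 : -(B * axisDist t) ≤ ((t - s) * w).re := by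
    have h3 := Complex.abs_re_le_norm ((t - s) * w)
    rw [norm_mul] at h3
    have h4 : ‖t - s‖ * ‖w‖ ≤ axisDist t * B :=
      mul_le_mul hdist hB (norm_nonneg _) (axisDist_nonneg t)
    linarith [neg_abs_le ((t - s) * w).re]
  have h3 : ‖t‖ ≤ s + axisDist t := by
    have h := norm_add_le (s : ℂ) (t - s)
    rw [add_sub_cancel, Complex.norm_of_nonneg hs0] at h
    linarith
  nlinarith

/-! ### Invariance of the domain and monotonicity of the weight coordinate -/

namespace BorelSystem

variable {ι : Type} [Fintype ι] (S : BorelSystem ι)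

/-- The radius `α d` of the strip in the Borel plane. -/
def R : ℝ := S.α * S.d

theorem R_pos : 0 < S.R := mul_pos S.α_pos S.d_pos

/-- The region of the `(t, ξ)` space in which the integral equations are solved. -/
def dom : Set (ℂ × ℂ) :=
  {p | ∃ t₀ : ℝ, 0 ≤ t₀ ∧ ∃ ξ₀ ∈ S.Γ, ‖p.1 - t₀‖ + S.α * ‖p.2 - ξ₀‖ < S.R}

theorem isOpen_dom : IsOpen S.dom := by
  have : S.dom = ⋃ (t₀ : ℝ) (_ : 0 ≤ t₀) (ξ₀ ∈ S.Γ),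
      {p : ℂ × ℂ | ‖p.1 - t₀‖ + S.α * ‖p.2 - ξ₀‖ < S.R} := by
    ext p; simp [dom]
  rw [this]
  exact isOpen_iUnion fun t₀ => isOpen_iUnion fun _ => isOpen_iUnion fun ξ₀ => isOpen_iUnion fun _ =>
    isOpen_lt (by fun_prop) continuous_const

variable {S}

theorem mem_dom_of_mem {t ξ : ℂ} (ht : t ∈ U S.R) (hξ : ξ ∈ S.Γ) : (t, ξ) ∈ S.dom := by
  obtain ⟨s, hs, h⟩ := mem_U_iff.1 ht
  exact ⟨s, hs, ξ, hξ, by simpa using h⟩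

theorem ofReal_mem_U {r : ℝ} (hr : 0 < r) {t : ℝ} (ht : 0 ≤ t) : (t : ℂ) ∈ U r :=
  mem_U_iff.2 ⟨t, ht, by simpa using hr⟩

theorem ofReal_mem_dom {t : ℝ} (ht : 0 ≤ t) {ξ : ℂ} (hξ : ξ ∈ S.Γ) : ((t : ℂ), ξ) ∈ S.dom :=
  mem_dom_of_mem (ofReal_mem_U S.R_pos ht) hξ

theorem fst_mem {t ξ : ℂ} (hp : (t, ξ) ∈ S.dom) : t ∈ U S.R := by
  obtain ⟨t₀, ht₀, ξ₀, hξ₀, h⟩ := hp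
  refine mem_U_iff.2 ⟨t₀, ht₀, ?_⟩
  have := mul_nonneg S.α_pos.le (norm_nonneg (ξ - ξ₀))
  simp only at h
  linarith

theorem snd_mem {t ξ : ℂ} (hp : (t, ξ) ∈ S.dom) : ξ ∈ Metric.thickening S.d S.Γ := by
  obtain ⟨t₀, ht₀, ξ₀, hξ₀, h⟩ := hp
  refine Metric.mem_thickening_iff.2 ⟨ξ₀, hξ₀, ?_⟩
  rw [dist_eq_norm]
  have h1 := norm_nonneg (t - t₀)
  simp only at h
  have h2 : S.α * ‖ξ - ξ₀‖ < S.α * S.d := by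
    have : S.R = S.α * S.d := rfl
    linarith
  exact lt_of_mul_lt_mul_left h2 S.α_pos.le

theorem smul_mem_dom {t ξ : ℂ} (hp : (t, ξ) ∈ S.dom) {τ : ℝ} (h0 : 0 ≤ τ) (h1 : τ ≤ 1) :
    (τ * t, ξ) ∈ S.dom := by
  obtain ⟨t₀, ht₀, ξ₀, hξ₀, h⟩ := hp
  refine ⟨τ * t₀, by positivity, ξ₀, hξ₀, lt_of_le_of_lt ?_ h⟩
  simp only
  rw [Complex.ofReal_mul, ← mul_sub, norm_mul, Complex.norm_of_nonneg h0]
  have := mul_le_mul_of_nonneg_right h1 (norm_nonneg (t - t₀))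
  linarith

theorem shift_e_mem_dom {t ξ : ℂ} (hp : (t, ξ) ∈ S.dom) {s : ℝ} (hs : 0 ≤ s) :
    (t, ξ + s * S.e) ∈ S.dom := by
  obtain ⟨t₀, ht₀, ξ₀, hξ₀, h⟩ := hp
  refine ⟨t₀, ht₀, ξ₀ + s * S.e, S.mem_e ξ₀ hξ₀ s hs, ?_⟩
  simpa using h

/-- The comparison point `(t₀, ξ₀)` is moved along the same characteristic and keeps its second
entry in `Γ`. The difference in `t` shrinks by the fraction `τ` while that in `ξ` grows by at most
`τ ‖t - t₀‖ / α`, since `α ≤ ‖a l‖`; hence `‖t - t₀‖ + α ‖ξ - ξ₀‖` does not increase. This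
determines the width `α d` of the strip. -/
theorem shift_a_mem_dom {t ξ : ℂ} (hp : (t, ξ) ∈ S.dom) {l : ι} (hl : l ≠ S.j) {τ : ℝ} (h0 : 0 ≤ τ)
    (h1 : τ ≤ 1) : ((1 - τ : ℝ) * t, ξ + τ * t / S.a l) ∈ S.dom := by
  obtain ⟨t₀, ht₀, ξ₀, hξ₀, h⟩ := hp
  have h1' : 0 ≤ 1 - τ := by linarith
  refine ⟨(1 - τ) * t₀, by positivity, ξ₀ + (τ * t₀ : ℝ) / S.a l,
    S.mem_a l hl ξ₀ hξ₀ _ (by positivity), lt_of_le_of_lt ?_ h⟩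
  have ha := S.norm_a l hl
  have hapos : 0 < ‖S.a l‖ := S.α_pos.trans_le ha
  have e1 : ((1 - τ : ℝ) : ℂ) * t - (((1 - τ) * t₀ : ℝ) : ℂ) = ((1 - τ : ℝ) : ℂ) * (t - t₀) := by
    push_cast; ring
  have e2 : ξ + τ * t / S.a l - (ξ₀ + ((τ * t₀ : ℝ) : ℂ) / S.a l) =
      (ξ - ξ₀) + (τ : ℂ) * (t - t₀) / S.a l := by push_cast; ring
  simp only [e1, e2]
  have h2 : S.α * ‖(τ : ℂ) * (t - t₀) / S.a l‖ ≤ τ * ‖t - t₀‖ := by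
    rw [norm_div, norm_mul, Complex.norm_of_nonneg h0, mul_div_assoc', div_le_iff₀ hapos, mul_comm]
    exact mul_le_mul_of_nonneg_left ha (by positivity)
  have h3 := norm_add_le (ξ - ξ₀) ((τ : ℂ) * (t - t₀) / S.a l)
  have h4 := mul_le_mul_of_nonneg_left h3 S.α_pos.le
  rw [norm_mul, Complex.norm_of_nonneg h1']
  linarith

theorem zero_shift_mem_dom {t ξ : ℂ} (hp : (t, ξ) ∈ S.dom) {l : ι} (hl : l ≠ S.j) :
    (0, ξ + t / S.a l) ∈ S.dom := by
  simpa using shift_a_mem_dom hp hl (τ := 1) zero_le_one le_rfl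

variable (S) in
/-- The coordinate of `ξ` in the direction `e`. -/
def x (ξ : ℂ) : ℝ := (ξ * (starRingEnd ℂ) S.e).re

variable (S) in
/-- The coordinate in terms of which the weights are expressed. -/
def y (t ξ : ℂ) : ℝ := S.x ξ - (S.c₀ + 1 / S.α) * axisDist t

variable (S) in
/-- The increment of the weight coordinate along the characteristic of index `l`. -/
def β (l : ι) (t : ℂ) : ℝ :=
  (t * ((starRingEnd ℂ) S.e / S.a l)).re + (S.c₀ + 1 / S.α) * axisDist t

theorem norm_conj_e : ‖(starRingEnd ℂ) S.e‖ = 1 := by rw [RCLike.norm_conj, S.norm_e]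

theorem e_mul_conj : S.e * (starRingEnd ℂ) S.e = 1 := by
  rw [Complex.mul_conj, Complex.normSq_eq_norm_sq, S.norm_e]; simp

theorem continuous_x : Continuous S.x := by unfold x; fun_prop

theorem continuous_y : Continuous fun p : ℂ × ℂ => S.y p.1 p.2 := by
  unfold y
  exact (continuous_x.comp continuous_snd).sub
    (continuous_const.mul (continuous_axisDist.comp continuous_fst))

/-- The coefficient `c₀ + 1 / α` of `axisDist` in `y` is exactly the loss in `re_mul_ge`, as `‖conj
e / a l‖ ≤ 1 / α`. So `y` increases along the characteristics for complex `t` too. -/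
theorem le_β {l : ι} (hl : l ≠ S.j) (t : ℂ) : S.c₀ * ‖t‖ ≤ S.β l t := by
  have h := re_mul_ge (t := t) (B := 1 / S.α) S.c₀_pos.le (S.re_a l hl) (by
    rw [norm_div, norm_conj_e]
    exact one_div_le_one_div_of_le S.α_pos (S.norm_a l hl))
  unfold β; linarith

/-- `axisDist` is homogeneous under nonnegative scaling, so `y` is an affine function of `τ`. -/
theorem y_shift_a (l : ι) (t ξ : ℂ) {τ : ℝ} (h1 : τ ≤ 1) :
    S.y ((1 - τ : ℝ) * t) (ξ + τ * t / S.a l) = S.y t ξ + τ * S.β l t := by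
  rw [y, axisDist_mul (by linarith), x, add_mul, Complex.add_re,
    show (τ : ℂ) * t / S.a l * (starRingEnd ℂ) S.e = τ * (t * ((starRingEnd ℂ) S.e / S.a l)) by ring,
    Complex.re_ofReal_mul, y, β, x]
  ring

theorem y_shift_e (t ξ : ℂ) (s : ℝ) : S.y t (ξ + s * S.e) = S.y t ξ + s := by
  rw [y, x, add_mul, mul_assoc, e_mul_conj, mul_one, Complex.add_re, Complex.ofReal_re, y, x]
  ring

theorem y_le_y_smul (t ξ : ℂ) {τ : ℝ} (h0 : 0 ≤ τ) (h1 : τ ≤ 1) : S.y t ξ ≤ S.y (τ * t) ξ := by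
  rw [y, y, axisDist_mul h0]
  have := axisDist_nonneg t
  have h2 : τ * axisDist t ≤ axisDist t := mul_le_of_le_one_left this h1
  have h3 : 0 ≤ S.c₀ + 1 / S.α := by have := S.c₀_pos; have := S.α_pos; positivity
  have := mul_le_mul_of_nonneg_left h2 h3
  linarith

/-- `axisDist` is bounded on the strip, so decay in `x` and decay in `y` are comparable. -/
theorem abs_x_sub_y_le {t ξ : ℂ} (ht : t ∈ U S.R) :
    |S.x ξ - S.y t ξ| ≤ (S.c₀ + 1 / S.α) * (2 * S.R) := by
  have h3 : 0 ≤ S.c₀ + 1 / S.α := by have := S.c₀_pos; have := S.α_pos; positivity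
  rw [y, sub_sub_cancel, abs_of_nonneg (mul_nonneg h3 (axisDist_nonneg t))]
  exact mul_le_mul_of_nonneg_left (axisDist_lt_of_mem_U S.R_pos ht).le h3

theorem norm_le_re_add {t : ℂ} (ht : t ∈ U S.R) : ‖t‖ ≤ t.re + 4 * S.R := by
  have := norm_le_re_add_axisDist t
  have := axisDist_lt_of_mem_U S.R_pos ht
  linarith

end BorelSystem

/-- A continuous bound is locally below a constant, and constants are integrable on `(0, 1]`. -/
theorem analyticOnNhd_integral_Ioc {F : ℂ × ℂ → ℝ → ℂ} {Ω : Set (ℂ × ℂ)} (hΩ : IsOpen Ω)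
    (hm : ∀ p ∈ Ω, ContinuousOn (F p) (Ioc 0 1))
    (ha : ∀ τ ∈ Ioc (0 : ℝ) 1, AnalyticOnNhd ℂ (fun p => F p τ) Ω) {B : ℂ × ℂ → ℝ}
    (hB : Continuous B) (hb : ∀ p ∈ Ω, ∀ τ ∈ Ioc (0 : ℝ) 1, ‖F p τ‖ ≤ B p) :
    AnalyticOnNhd ℂ (fun p => ∫ τ in Ioc (0 : ℝ) 1, F p τ) Ω := by
  refine analyticOnNhd_integral hΩ (fun p hp => (hm p hp).aestronglyMeasurable measurableSet_Ioc)
    ((ae_restrict_iff' measurableSet_Ioc).2 (Eventually.of_forall ha)) fun p _ => ?_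
  refine ⟨{q | B q < B p + 1}, (isOpen_lt hB continuous_const).mem_nhds (by simp),
    fun _ => B p + 1, integrable_const _, ?_⟩
  refine (ae_restrict_iff' measurableSet_Ioc).2 (Eventually.of_forall fun τ hτ q hq hq' => ?_)
  exact (hb q hq' τ hτ).trans hq.le

/-! ### Estimates of the convolutions and of the right-hand side -/

namespace BorelSystem

variable {ι : Type} [Fintype ι] {S : BorelSystem ι}

/-- The convolution of two functions in the Borel plane. -/
def conv (k Q : ℂ → ℂ → ℂ) (t ξ : ℂ) : ℂ :=
  ∫ τ in Ioc (0 : ℝ) 1, t * k (τ * t) ξ * Q ((1 - τ : ℝ) * t) ξ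

variable (S) in
/-- `Q` is analytic on the domain and bounded by `M e^{s Re t}` times the weight. -/
structure Controlled (Λ s M : ℝ) (Q : ℂ → ℂ → ℂ) : Prop where
  analytic : AnalyticOnNhd ℂ (fun p : ℂ × ℂ => Q p.1 p.2) S.dom
  le : ∀ t ξ, (t, ξ) ∈ S.dom →
    ‖Q t ξ‖ ≤ M * (Real.exp (s * t.re) * weight S.ρ Λ (S.y t ξ))

variable (S) in
/-- `f` is analytic on the domain and bounded by a multiple of the derivative of the weight. -/
structure SourceBound (Λ s A : ℝ) (f : ℂ → ℂ → ℂ) : Prop where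
  analytic : AnalyticOnNhd ℂ (fun p : ℂ × ℂ => f p.1 p.2) S.dom
  le : ∀ t ξ, (t, ξ) ∈ S.dom →
    ‖f t ξ‖ ≤ A * (Real.exp (s * t.re) * (decay S.ρ (S.y t ξ) * Real.exp (Λ * tail S.ρ (S.y t ξ))))

theorem one_sub_smul_mem_dom {t ξ : ℂ} (hp : (t, ξ) ∈ S.dom) {τ : ℝ} (h0 : 0 ≤ τ) (h1 : τ ≤ 1) :
    (((1 - τ : ℝ) : ℂ) * t, ξ) ∈ S.dom :=
  smul_mem_dom hp (by linarith) (by linarith)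

variable (S) in
/-- The constant by which the decay in `ξ` is comparable with the decay in the weight coordinate. -/
def L : ℝ := (1 + (S.c₀ + 1 / S.α) * (2 * S.R)) ^ (1 + S.ρ)

theorem L_pos : 0 < S.L := by
  have := S.c₀_pos; have := S.α_pos; have := S.R_pos
  unfold L; positivity

theorem decay_x_le {t ξ : ℂ} (hp : (t, ξ) ∈ S.dom) :
    decay S.ρ (S.x ξ) ≤ S.L * decay S.ρ (S.y t ξ) :=
  decay_le_of_abs_sub_le S.ρ_pos (abs_x_sub_y_le (fst_mem hp))

theorem k_le {l m : ι} {t ξ : ℂ} (hp : (t, ξ) ∈ S.dom) :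
    ‖S.k l m t ξ‖ ≤ S.C * Real.exp (S.σ * t.re) * decay S.ρ (S.x ξ) := by
  have h1 : t ∈ U (S.α * S.d) := fst_mem hp
  have h2 : ξ ∈ Metric.thickening S.d S.Γ := snd_mem hp
  unfold x
  exact S.norm_k_le l m t h1 ξ h2

theorem b_le {l m : ι} {t ξ : ℂ} (hp : (t, ξ) ∈ S.dom) :
    ‖S.b l m ξ‖ ≤ S.C * decay S.ρ (S.x ξ) := by
  have h2 : ξ ∈ Metric.thickening S.d S.Γ := snd_mem hp
  unfold x
  exact S.norm_b_le l m ξ h2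

theorem k_analytic (l m : ι) : AnalyticOnNhd ℂ (fun p : ℂ × ℂ => S.k l m p.1 p.2) S.dom :=
  (S.analytic_k l m).mono fun _ hp => ⟨fst_mem hp, snd_mem hp⟩

theorem b_analytic (l m : ι) : AnalyticOnNhd ℂ (fun p : ℂ × ℂ => S.b l m p.2) S.dom :=
  fun p hp => (S.analytic_b l m p.2 (snd_mem hp)).comp analyticAt_snd

/-- The exponents add up to `s Re t - (s - σ) τ Re t`, and `Re t ≥ ‖t‖ - 4R` on the strip, so the
gap `s - σ` yields decay in `τ ‖t‖`. Scaling `t` towards `0` increases `y`, so the weight at `(1 -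
τ) t` is at most the one at `t`. -/
theorem conv_integrand_le {Λ s M : ℝ} (hΛ : 0 < Λ) (hs : S.σ < s) {Q : ℂ → ℂ → ℂ} (hM : 0 ≤ M)
    (hQ : S.Controlled Λ s M Q) (l m : ι) {t ξ : ℂ} (hp : (t, ξ) ∈ S.dom) {τ : ℝ}
    (hτ : τ ∈ Ioc (0 : ℝ) 1) :
    ‖t * S.k l m (τ * t) ξ * Q ((1 - τ : ℝ) * t) ξ‖ ≤
      S.C * decay S.ρ (S.x ξ) * M * (Real.exp (s * t.re) * weight S.ρ Λ (S.y t ξ)) *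
        Real.exp ((s - S.σ) * (4 * S.R)) * (‖t‖ * Real.exp (-((s - S.σ) * τ * ‖t‖))) := by
  have h0 := hτ.1.le
  have h1 := hτ.2
  have hk := k_le (l := l) (m := m) (smul_mem_dom hp h0 h1)
  have hq := hQ.le _ _ (one_sub_smul_mem_dom hp h0 h1)
  have hw : weight S.ρ Λ (S.y ((1 - τ : ℝ) * t) ξ) ≤ weight S.ρ Λ (S.y t ξ) :=
    weight_antitone S.ρ_pos hΛ.le (y_le_y_smul t ξ (by linarith) (by linarith))
  have hdec := (decay_pos S.ρ (S.x ξ)).le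
  have hw0 := weight_nonneg (ρ := S.ρ) hΛ.le (S.y t ξ)
  have hC := S.C_pos
  rw [Complex.re_ofReal_mul] at hk hq
  have hq2 : ‖Q ((1 - τ : ℝ) * t) ξ‖ ≤
      M * (Real.exp (s * ((1 - τ) * t.re)) * weight S.ρ Λ (S.y t ξ)) :=
    hq.trans (mul_le_mul_of_nonneg_left (mul_le_mul_of_nonneg_left hw (Real.exp_pos _).le) hM)
  have hexp : Real.exp (S.σ * (τ * t.re)) * Real.exp (s * ((1 - τ) * t.re)) ≤
      Real.exp (s * t.re) * (Real.exp ((s - S.σ) * (4 * S.R)) *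
        Real.exp (-((s - S.σ) * τ * ‖t‖))) := by
    rw [← Real.exp_add, ← Real.exp_add, ← Real.exp_add]
    refine Real.exp_le_exp.2 ?_
    have ht := norm_le_re_add (fst_mem hp)
    have hε : 0 < s - S.σ := by linarith
    have e1 : (s - S.σ) * τ * (‖t‖ - t.re) ≤ (s - S.σ) * τ * (4 * S.R) :=
      mul_le_mul_of_nonneg_left (by linarith) (by positivity)
    have e2 : (s - S.σ) * τ * (4 * S.R) ≤ (s - S.σ) * (4 * S.R) := by
      have : (s - S.σ) * τ ≤ s - S.σ := mul_le_of_le_one_right hε.le h1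
      exact mul_le_mul_of_nonneg_right this (by have := S.R_pos; positivity)
    linarith
  rw [norm_mul, norm_mul]
  calc ‖t‖ * ‖S.k l m (τ * t) ξ‖ * ‖Q ((1 - τ : ℝ) * t) ξ‖
      ≤ ‖t‖ * (S.C * Real.exp (S.σ * (τ * t.re)) * decay S.ρ (S.x ξ)) *
        (M * (Real.exp (s * ((1 - τ) * t.re)) * weight S.ρ Λ (S.y t ξ))) := by gcongr
    _ = ‖t‖ * S.C * decay S.ρ (S.x ξ) * M * weight S.ρ Λ (S.y t ξ) *
        (Real.exp (S.σ * (τ * t.re)) * Real.exp (s * ((1 - τ) * t.re))) := by ring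
    _ ≤ ‖t‖ * S.C * decay S.ρ (S.x ξ) * M * weight S.ρ Λ (S.y t ξ) *
        (Real.exp (s * t.re) * (Real.exp ((s - S.σ) * (4 * S.R)) *
        Real.exp (-((s - S.σ) * τ * ‖t‖)))) := by gcongr
    _ = _ := by ring

theorem conv_integrand_continuousOn {Q : ℂ → ℂ → ℂ}
    (hQ : AnalyticOnNhd ℂ (fun p : ℂ × ℂ => Q p.1 p.2) S.dom) (l m : ι) {t ξ : ℂ}
    (hp : (t, ξ) ∈ S.dom) :
    ContinuousOn (fun τ : ℝ => t * S.k l m (τ * t) ξ * Q ((1 - τ : ℝ) * t) ξ) (Icc 0 1) := by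
  refine (continuousOn_const.mul ?_).mul ?_
  · refine (k_analytic l m).continuousOn.comp (f := fun τ : ℝ => ((τ : ℂ) * t, ξ))
      (by fun_prop) fun τ hτ => smul_mem_dom hp hτ.1 hτ.2
  · refine hQ.continuousOn.comp (f := fun τ : ℝ => (((1 - τ : ℝ) : ℂ) * t, ξ))
      (by fun_prop) fun τ hτ => one_sub_smul_mem_dom hp hτ.1 hτ.2

theorem conv_integrableOn {Q : ℂ → ℂ → ℂ}
    (hQ : AnalyticOnNhd ℂ (fun p : ℂ × ℂ => Q p.1 p.2) S.dom) (l m : ι) {t ξ : ℂ}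
    (hp : (t, ξ) ∈ S.dom) :
    IntegrableOn (fun τ : ℝ => t * S.k l m (τ * t) ξ * Q ((1 - τ : ℝ) * t) ξ) (Ioc 0 1) :=
  ((conv_integrand_continuousOn hQ l m hp).integrableOn_Icc).mono_set Ioc_subset_Icc_self

theorem conv_le {Λ s M : ℝ} (hΛ : 0 < Λ) (hs : S.σ < s) {Q : ℂ → ℂ → ℂ} (hM : 0 ≤ M)
    (hQ : S.Controlled Λ s M Q) (l m : ι) {t ξ : ℂ} (hp : (t, ξ) ∈ S.dom) :
    ‖conv (S.k l m) Q t ξ‖ ≤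
      S.C * decay S.ρ (S.x ξ) * M * (Real.exp (s * t.re) * weight S.ρ Λ (S.y t ξ)) *
        Real.exp ((s - S.σ) * (4 * S.R)) * (1 / (s - S.σ)) := by
  have hdec := (decay_pos S.ρ (S.x ξ)).le
  have hw0 := weight_nonneg (ρ := S.ρ) hΛ.le (S.y t ξ)
  have hC := S.C_pos
  set A := S.C * decay S.ρ (S.x ξ) * M * (Real.exp (s * t.re) * weight S.ρ Λ (S.y t ξ)) *
        Real.exp ((s - S.σ) * (4 * S.R)) with hA
  have hA0 : 0 ≤ A := by positivity
  have h := norm_integral_le_of_norm_le (μ := volume.restrict (Ioc (0 : ℝ) 1))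
    (f := fun τ : ℝ => t * S.k l m (τ * t) ξ * Q ((1 - τ : ℝ) * t) ξ)
    (g := fun τ => A * (‖t‖ * Real.exp (-((s - S.σ) * τ * ‖t‖))))
    ((Continuous.continuousOn (by fun_prop)).integrableOn_Icc.mono_set Ioc_subset_Icc_self)
    ((ae_restrict_iff' measurableSet_Ioc).2 (Eventually.of_forall fun τ hτ =>
      conv_integrand_le hΛ hs hM hQ l m hp hτ))
  refine h.trans ?_
  rw [integral_const_mul]
  refine mul_le_mul_of_nonneg_left ?_ hA0
  rw [← intervalIntegral.integral_of_le zero_le_one]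
  exact mul_integral_exp_neg_le (by linarith)

theorem analyticAt_comp_mul_const {f : ℂ → ℂ → ℂ} {c : ℂ} {p : ℂ × ℂ}
    (h : AnalyticAt ℂ (fun p : ℂ × ℂ => f p.1 p.2) (c * p.1, p.2)) :
    AnalyticAt ℂ (fun p : ℂ × ℂ => f (c * p.1) p.2) p :=
  AnalyticAt.comp (g := fun p : ℂ × ℂ => f p.1 p.2) (f := fun p : ℂ × ℂ => (c * p.1, p.2)) h
    ((analyticAt_const.mul analyticAt_fst).prod analyticAt_snd)

theorem conv_analytic {Λ s M : ℝ} (hΛ : 0 < Λ) (hs : S.σ < s) {Q : ℂ → ℂ → ℂ} (hM : 0 ≤ M)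
    (hQ : S.Controlled Λ s M Q) (l m : ι) :
    AnalyticOnNhd ℂ (fun p : ℂ × ℂ => conv (S.k l m) Q p.1 p.2) S.dom := by
  refine analyticOnNhd_integral_Ioc S.isOpen_dom
    (F := fun p τ => p.1 * S.k l m (τ * p.1) p.2 * Q ((1 - τ : ℝ) * p.1) p.2)
    (fun p hp => (conv_integrand_continuousOn hQ.analytic l m hp).mono Ioc_subset_Icc_self)
    (fun τ hτ p hp => ?_) (B := fun p => S.C * decay S.ρ (S.x p.2) * M *
      (Real.exp (s * p.1.re) * weight S.ρ Λ (S.y p.1 p.2)) *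
        Real.exp ((s - S.σ) * (4 * S.R)) * ‖p.1‖) ?_ fun p hp τ hτ => ?_
  · refine (analyticAt_fst.mul ?_).mul ?_
    · exact analyticAt_comp_mul_const (k_analytic l m _ (smul_mem_dom hp hτ.1.le hτ.2))
    · exact analyticAt_comp_mul_const (hQ.analytic _ (one_sub_smul_mem_dom hp hτ.1.le hτ.2))
  · have h1 := (continuous_decay S.ρ).comp (S.continuous_x.comp (continuous_snd (X := ℂ) (Y := ℂ)))
    have h2 := (continuous_weight S.ρ_pos Λ).comp S.continuous_y
    simp only [Function.comp_def] at h1 h2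
    fun_prop
  · refine (conv_integrand_le hΛ hs hM hQ l m hp hτ).trans ?_
    have hdec := (decay_pos S.ρ (S.x p.2)).le
    have hw0 := weight_nonneg (ρ := S.ρ) hΛ.le (S.y p.1 p.2)
    have hC := S.C_pos
    refine mul_le_mul_of_nonneg_left ?_ (by positivity)
    refine mul_le_of_le_one_right (norm_nonneg _) (Real.exp_le_one_iff.2 ?_)
    have := hτ.1
    have : 0 ≤ (s - S.σ) * τ * ‖p.1‖ :=
      mul_nonneg (mul_nonneg (by linarith) this.le) (norm_nonneg _)
    linarith

variable (S) in
/-- The right-hand side of the system, the inhomogeneous terms being multiplied by `ε`. -/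
def src (ε : ℂ) (Q : ι → ℂ → ℂ → ℂ) (l : ι) (t ξ : ℂ) : ℂ :=
  ε * S.k l S.j t ξ + ∑ m, (S.b l m ξ * Q m t ξ + conv (S.k l m) (Q m) t ξ)

/-- Every term has a coefficient or kernel with the factor `decay (x ξ)`, comparable with `decay y`,
and `weight ≤ exp (Λ tail)`. The constant `A` must not depend on `Λ`, since `Λ` is chosen
afterwards. -/
theorem exists_sourceBound_src {s : ℝ} (hs : S.σ < s) : ∃ A > 0, ∀ Λ > 0, ∀ M ≥ 0, ∀ ε : ℂ,
    ∀ Q : ι → ℂ → ℂ → ℂ, (∀ m, S.Controlled Λ s M (Q m)) → ∀ l,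
      S.SourceBound Λ s (A * (‖ε‖ + M)) (S.src ε Q l) := by
  have hC := S.C_pos
  have hL := S.L_pos
  have hε0 : 0 < s - S.σ := by linarith
  set A₁ := Real.exp ((s - S.σ) * S.R) with hA₁
  set A₂ := Real.exp ((s - S.σ) * (4 * S.R)) * (1 / (s - S.σ)) with hA₂
  refine ⟨S.C * S.L * (A₁ + Fintype.card ι * (1 + A₂)), by positivity, ?_⟩
  intro Λ hΛ M hM ε Q hQ l
  refine ⟨?_, fun t ξ hp => ?_⟩
  · intro p hp
    refine (analyticAt_const.mul (k_analytic l S.j p hp)).add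
      (Finset.analyticAt_fun_sum _ fun m _ => ?_)
    exact ((b_analytic l m p hp).mul ((hQ m).analytic p hp)).add
      (conv_analytic hΛ hs hM (hQ m) l m p hp)
  · have hdec := (decay_pos S.ρ (S.x ξ)).le
    have hdecy := decay_pos S.ρ (S.y t ξ)
    have hdxy := decay_x_le hp
    have hw0 := weight_nonneg (ρ := S.ρ) hΛ.le (S.y t ξ)
    set w := weight S.ρ Λ (S.y t ξ) with hw
    set D := decay S.ρ (S.y t ξ) with hD
    set H := Real.exp (Λ * tail S.ρ (S.y t ξ)) with hH
    set E := Real.exp (s * t.re) with hE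
    have hE0 : 0 < E := Real.exp_pos _
    have hwH : w ≤ H := by rw [hw, weight]; linarith
    have h1H : 1 ≤ H := Real.one_le_exp (mul_nonneg hΛ.le (tail_nonneg _ _))
    have hH0 : 0 < H := by linarith
    have hσE : Real.exp (S.σ * t.re) ≤ A₁ * E := by
      rw [hA₁, hE, ← Real.exp_add]
      refine Real.exp_le_exp.2 ?_
      have := neg_lt_re_of_mem_U (fst_mem hp)
      nlinarith
    have t1 : ‖ε * S.k l S.j t ξ‖ ≤ ‖ε‖ * (S.C * S.L * A₁ * (E * (D * H))) := by
      rw [norm_mul]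
      refine mul_le_mul_of_nonneg_left ((k_le hp).trans ?_) (norm_nonneg _)
      calc S.C * Real.exp (S.σ * t.re) * decay S.ρ (S.x ξ) ≤ S.C * (A₁ * E) * (S.L * D) := by gcongr
        _ = S.C * S.L * A₁ * (E * (D * 1)) := by ring
        _ ≤ _ := by gcongr
    have t2 : ∀ m, ‖S.b l m ξ * Q m t ξ‖ ≤ S.C * S.L * M * (E * (D * H)) := fun m => by
      rw [norm_mul]
      calc ‖S.b l m ξ‖ * ‖Q m t ξ‖ ≤ (S.C * (S.L * D)) * (M * (E * H)) := by
            refine mul_le_mul ((b_le hp).trans (mul_le_mul_of_nonneg_left hdxy hC.le)) ?_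
              (norm_nonneg _) (by positivity)
            refine ((hQ m).le t ξ hp).trans ?_
            gcongr
        _ = _ := by ring
    have t3 : ∀ m, ‖conv (S.k l m) (Q m) t ξ‖ ≤ S.C * S.L * M * A₂ * (E * (D * H)) := fun m => by
      refine (conv_le hΛ hs hM (hQ m) l m hp).trans ?_
      calc S.C * decay S.ρ (S.x ξ) * M * (E * w) *
            Real.exp ((s - S.σ) * (4 * S.R)) * (1 / (s - S.σ))
          ≤ S.C * (S.L * D) * M * (E * H) *
            Real.exp ((s - S.σ) * (4 * S.R)) * (1 / (s - S.σ)) := by gcongr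
        _ = _ := by rw [hA₂]; ring
    have t4 : ‖∑ m, (S.b l m ξ * Q m t ξ + conv (S.k l m) (Q m) t ξ)‖ ≤
        Fintype.card ι * (S.C * S.L * M * (1 + A₂) * (E * (D * H))) := by
      refine (norm_sum_le_of_le _ fun m _ => ((norm_add_le _ _).trans
        (add_le_add (t2 m) (t3 m)))).trans ?_
      rw [Finset.sum_const, Finset.card_univ, nsmul_eq_mul]
      refine le_of_eq ?_
      ring
    refine (norm_add_le _ _).trans ((add_le_add t1 t4).trans ?_)
    have hA₂0 : 0 < A₂ := by positivity
    have e1 : 0 ≤ ‖ε‖ * (S.C * S.L * (Fintype.card ι * (1 + A₂)) * (E * (D * H))) := by positivity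
    have e2 : 0 ≤ M * (S.C * S.L * A₁ * (E * (D * H))) := by positivity
    nlinarith

end BorelSystem
-- Integration along characteristics and rays
namespace BorelSystem

variable {ι : Type} [Fintype ι] {S : BorelSystem ι}

theorem exp_mul_tail_nonneg (Λ v : ℝ) : 0 ≤ decay S.ρ v * Real.exp (Λ * tail S.ρ v) :=
  mul_nonneg (decay_pos _ _).le (Real.exp_pos _).le

variable (S) in
/-- Integration along the characteristic of index `l`. -/
def charInt (l : ι) (f : ℂ → ℂ → ℂ) (t ξ : ℂ) : ℂ :=
  ∫ τ in Ioc (0 : ℝ) 1, t * f ((1 - τ : ℝ) * t) (ξ + τ * t / S.a l)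

variable (S) in
/-- Integration along the ray of direction `e`. -/
def rayInt (f : ℂ → ℂ → ℂ) (t ξ : ℂ) : ℂ := ∫ s in Ioi (0 : ℝ), f t (ξ + s * S.e)

theorem charInt_continuousOn {f : ℂ → ℂ → ℂ}
    (hf : AnalyticOnNhd ℂ (fun p : ℂ × ℂ => f p.1 p.2) S.dom) {l : ι} (hl : l ≠ S.j) {t ξ : ℂ}
    (hp : (t, ξ) ∈ S.dom) :
    ContinuousOn (fun τ : ℝ => t * f ((1 - τ : ℝ) * t) (ξ + τ * t / S.a l)) (Icc 0 1) := by
  refine continuousOn_const.mul ?_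
  exact hf.continuousOn.comp (f := fun τ : ℝ => (((1 - τ : ℝ) : ℂ) * t, ξ + τ * t / S.a l))
    (by fun_prop) fun τ hτ => shift_a_mem_dom hp hl hτ.1 hτ.2

theorem charInt_integrableOn {f : ℂ → ℂ → ℂ}
    (hf : AnalyticOnNhd ℂ (fun p : ℂ × ℂ => f p.1 p.2) S.dom) {l : ι} (hl : l ≠ S.j) {t ξ : ℂ}
    (hp : (t, ξ) ∈ S.dom) :
    IntegrableOn (fun τ : ℝ => t * f ((1 - τ : ℝ) * t) (ξ + τ * t / S.a l)) (Ioc 0 1) :=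
  ((charInt_continuousOn hf hl hp).integrableOn_Icc).mono_set Ioc_subset_Icc_self

/-- By `le_β`, the length element `‖t‖ dτ` is at most `dy / c₀`. The exponential increases by at
most `exp (s R)` along the path, because `Re t > -R`. -/
theorem charInt_integrand_le {Λ s A : ℝ} (hA : 0 ≤ A) (hs : 0 ≤ s) {f : ℂ → ℂ → ℂ}
    (hf : S.SourceBound Λ s A f) {l : ι} (hl : l ≠ S.j) {t ξ : ℂ} (hp : (t, ξ) ∈ S.dom) {τ : ℝ}
    (hτ : τ ∈ Ioc (0 : ℝ) 1) :
    ‖t * f ((1 - τ : ℝ) * t) (ξ + τ * t / S.a l)‖ ≤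
      A * Real.exp (s * S.R) / S.c₀ * Real.exp (s * t.re) *
        (S.β l t * (decay S.ρ (S.y t ξ + τ * S.β l t) *
          Real.exp (Λ * tail S.ρ (S.y t ξ + τ * S.β l t)))) := by
  have h := hf.le _ _ (shift_a_mem_dom hp hl hτ.1.le hτ.2)
  rw [y_shift_a l t ξ hτ.2, Complex.re_ofReal_mul] at h
  have hE : Real.exp (s * ((1 - τ) * t.re)) ≤ Real.exp (s * S.R) * Real.exp (s * t.re) := by
    rw [← Real.exp_add]
    refine Real.exp_le_exp.2 ?_
    have h1 := neg_lt_re_of_mem_U (fst_mem hp)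
    have h2 : τ * (-t.re) ≤ τ * S.R := mul_le_mul_of_nonneg_left (by linarith) hτ.1.le
    have h3 : τ * S.R ≤ 1 * S.R := mul_le_mul_of_nonneg_right hτ.2 S.R_pos.le
    nlinarith
  have hβ : ‖t‖ ≤ S.β l t / S.c₀ := by
    rw [le_div_iff₀ S.c₀_pos, mul_comm]; exact le_β hl t
  have hw := exp_mul_tail_nonneg (S := S) Λ (S.y t ξ + τ * S.β l t)
  have hc := S.c₀_pos
  rw [norm_mul]
  calc ‖t‖ * ‖f ((1 - τ : ℝ) * t) (ξ + τ * t / S.a l)‖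
      ≤ (S.β l t / S.c₀) * (A * (Real.exp (s * S.R) * Real.exp (s * t.re) *
          (decay S.ρ (S.y t ξ + τ * S.β l t) *
          Real.exp (Λ * tail S.ρ (S.y t ξ + τ * S.β l t))))) := by
        refine mul_le_mul hβ (h.trans ?_) (norm_nonneg _) ((norm_nonneg _).trans hβ)
        gcongr
    _ = _ := by ring

theorem charInt_le {Λ s A : ℝ} (hA : 0 ≤ A) (hs : 0 ≤ s) (hΛ : 0 < Λ) {f : ℂ → ℂ → ℂ}
    (hf : S.SourceBound Λ s A f) {l : ι} (hl : l ≠ S.j) {t ξ : ℂ} (hp : (t, ξ) ∈ S.dom) :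
    ‖S.charInt l f t ξ‖ ≤ A * Real.exp (s * S.R) / S.c₀ / Λ *
      (Real.exp (s * t.re) * weight S.ρ Λ (S.y t ξ)) := by
  have hc := S.c₀_pos
  have hcont : Continuous fun τ : ℝ => (S.β l t * (decay S.ρ (S.y t ξ + τ * S.β l t) *
          Real.exp (Λ * tail S.ρ (S.y t ξ + τ * S.β l t)))) :=
    continuous_const.mul ((continuous_decay_mul_exp S.ρ_pos Λ).comp (by fun_prop))
  refine (norm_integral_le_of_norm_le
    (g := fun τ : ℝ => A * Real.exp (s * S.R) / S.c₀ * Real.exp (s * t.re) *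
        (S.β l t * (decay S.ρ (S.y t ξ + τ * S.β l t) *
          Real.exp (Λ * tail S.ρ (S.y t ξ + τ * S.β l t)))))
    ((continuous_const.mul hcont).integrableOn_Icc.mono_set Ioc_subset_Icc_self)
    ((ae_restrict_iff' measurableSet_Ioc).2 (Eventually.of_forall fun τ hτ =>
      charInt_integrand_le hA hs hf hl hp hτ))).trans ?_
  rw [integral_const_mul, ← intervalIntegral.integral_of_le zero_le_one]
  refine (mul_le_mul_of_nonneg_left (integral_decay_mul_exp_segment S.ρ_pos hΛ (S.y t ξ) (S.β l t))
    (by positivity)).trans (le_of_eq ?_)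
  ring

theorem charInt_analytic {Λ s A : ℝ} (hA : 0 ≤ A) (hs : 0 ≤ s) (hΛ : 0 < Λ) {f : ℂ → ℂ → ℂ}
    (hf : S.SourceBound Λ s A f) {l : ι} (hl : l ≠ S.j) :
    AnalyticOnNhd ℂ (fun p : ℂ × ℂ => S.charInt l f p.1 p.2) S.dom := by
  have hc := S.c₀_pos
  refine analyticOnNhd_integral_Ioc S.isOpen_dom
    (F := fun p τ => p.1 * f ((1 - τ : ℝ) * p.1) (p.2 + τ * p.1 / S.a l))
    (fun p hp => (charInt_continuousOn hf.analytic hl hp).mono Ioc_subset_Icc_self)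
    (fun τ hτ p hp => ?_) (B := fun p => A * Real.exp (s * S.R) / S.c₀ * Real.exp (s * p.1.re) *
        (S.β l p.1 * Real.exp (Λ * ∫ v, decay S.ρ v))) ?_ fun p hp τ hτ => ?_
  · refine analyticAt_fst.mul ?_
    refine AnalyticAt.comp (g := fun p : ℂ × ℂ => f p.1 p.2)
      (f := fun p : ℂ × ℂ => (((1 - τ : ℝ) : ℂ) * p.1, p.2 + τ * p.1 / S.a l))
      (hf.analytic _ (shift_a_mem_dom hp hl hτ.1.le hτ.2)) ?_
    refine (analyticAt_const.mul analyticAt_fst).prod (analyticAt_snd.add ?_)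
    simp only [div_eq_mul_inv]
    exact (analyticAt_const.mul analyticAt_fst).mul analyticAt_const
  · unfold β
    have := continuous_axisDist
    fun_prop
  · refine (charInt_integrand_le hA hs hf hl hp hτ).trans ?_
    have hβ : 0 ≤ S.β l p.1 := (mul_nonneg hc.le (norm_nonneg _)).trans (le_β hl p.1)
    have h2 : Real.exp (Λ * tail S.ρ (S.y p.1 p.2 + τ * S.β l p.1)) ≤
        Real.exp (Λ * ∫ v, decay S.ρ v) := Real.exp_le_exp.2
      (mul_le_mul_of_nonneg_left (tail_le_total S.ρ_pos _) hΛ.le)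
    have h3 := mul_le_mul (decay_le_one S.ρ_pos (S.y p.1 p.2 + τ * S.β l p.1)) h2
      (Real.exp_pos _).le zero_le_one
    rw [one_mul] at h3
    gcongr

theorem rayInt_integrand_le {Λ s A : ℝ} {f : ℂ → ℂ → ℂ}
    (hf : S.SourceBound Λ s A f) {t ξ : ℂ} (hp : (t, ξ) ∈ S.dom) {v : ℝ} (hv : 0 ≤ v) :
    ‖f t (ξ + v * S.e)‖ ≤ A * Real.exp (s * t.re) * (decay S.ρ (S.y t ξ + v) *
          Real.exp (Λ * tail S.ρ (S.y t ξ + v))) := by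
  have h := hf.le _ _ (shift_e_mem_dom hp hv)
  rw [y_shift_e] at h
  exact h.trans (le_of_eq (by ring))

theorem rayInt_continuousOn {f : ℂ → ℂ → ℂ}
    (hf : AnalyticOnNhd ℂ (fun p : ℂ × ℂ => f p.1 p.2) S.dom) {t ξ : ℂ}
    (hp : (t, ξ) ∈ S.dom) :
    ContinuousOn (fun v : ℝ => f t (ξ + v * S.e)) (Ici 0) :=
  hf.continuousOn.comp (f := fun v : ℝ => (t, ξ + v * S.e))
    (by fun_prop) fun _ hv => shift_e_mem_dom hp hv

theorem rayInt_integrableOn {Λ s A : ℝ} (hΛ : 0 < Λ) {f : ℂ → ℂ → ℂ}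
    (hf : S.SourceBound Λ s A f) {t ξ : ℂ} (hp : (t, ξ) ∈ S.dom) :
    IntegrableOn (fun v : ℝ => f t (ξ + v * S.e)) (Ioi 0) := by
  refine ((integrableOn_decay_mul_exp S.ρ_pos hΛ (S.y t ξ)).const_mul
    (A * Real.exp (s * t.re))).mono' (((rayInt_continuousOn hf.analytic hp).mono
      Ioi_subset_Ici_self).aestronglyMeasurable measurableSet_Ioi) ?_
  exact (ae_restrict_iff' measurableSet_Ioi).2 (Eventually.of_forall fun v hv =>
    rayInt_integrand_le hf hp (le_of_lt hv))

theorem rayInt_le {Λ s A : ℝ} (hΛ : 0 < Λ) {f : ℂ → ℂ → ℂ}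
    (hf : S.SourceBound Λ s A f) {t ξ : ℂ} (hp : (t, ξ) ∈ S.dom) :
    ‖S.rayInt f t ξ‖ ≤ A / Λ * (Real.exp (s * t.re) * weight S.ρ Λ (S.y t ξ)) := by
  refine (norm_integral_le_of_norm_le
    ((integrableOn_decay_mul_exp S.ρ_pos hΛ (S.y t ξ)).const_mul (A * Real.exp (s * t.re)))
    ((ae_restrict_iff' measurableSet_Ioi).2 (Eventually.of_forall fun v hv =>
    rayInt_integrand_le hf hp (le_of_lt hv)))).trans (le_of_eq ?_)
  rw [integral_const_mul, integral_decay_mul_exp_ray S.ρ_pos hΛ]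
  ring

theorem rayInt_analytic {Λ s A : ℝ} (hA : 0 ≤ A) (hΛ : 0 < Λ) {f : ℂ → ℂ → ℂ}
    (hf : S.SourceBound Λ s A f) :
    AnalyticOnNhd ℂ (fun p : ℂ × ℂ => S.rayInt f p.1 p.2) S.dom := by
  refine analyticOnNhd_integral S.isOpen_dom (F := fun p (v : ℝ) => f p.1 (p.2 + v * S.e))
    (fun p hp => (((rayInt_continuousOn hf.analytic hp).mono
      Ioi_subset_Ici_self).aestronglyMeasurable measurableSet_Ioi))
    ((ae_restrict_iff' measurableSet_Ioi).2 (Eventually.of_forall fun v hv p hp => ?_))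
    fun p hp => ?_
  · refine AnalyticAt.comp (g := fun p : ℂ × ℂ => f p.1 p.2)
      (f := fun p : ℂ × ℂ => (p.1, p.2 + v * S.e))
      (hf.analytic _ (shift_e_mem_dom hp (le_of_lt hv))) ?_
    exact analyticAt_fst.prod (analyticAt_snd.add analyticAt_const)
  · have hcy : Continuous fun q : ℂ × ℂ => |S.y q.1 q.2 - S.y p.1 p.2| :=
      (S.continuous_y.sub continuous_const).abs
    have hce : Continuous fun q : ℂ × ℂ => Real.exp (s * q.1.re) := by fun_prop
    -- On this neighbourhood `y` changes by less than `1`, so a multiple of the decay along the ray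
    -- through `p` dominates all the integrands.
    refine ⟨{q | |S.y q.1 q.2 - S.y p.1 p.2| < 1} ∩
      {q | Real.exp (s * q.1.re) < Real.exp (s * p.1.re) + 1}, inter_mem
        ((isOpen_lt hcy continuous_const).mem_nhds (by simp))
        ((isOpen_lt hce continuous_const).mem_nhds (by simp)),
      fun v => A * (Real.exp (s * p.1.re) + 1) * ((1 + 1) ^ (1 + S.ρ) *
        Real.exp (Λ * ∫ v, decay S.ρ v)) * decay S.ρ (S.y p.1 p.2 + v),
      (((integrable_decay S.ρ_pos).comp_add_left _).const_mul _).integrableOn, ?_⟩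
    refine (ae_restrict_iff' measurableSet_Ioi).2 (Eventually.of_forall fun v hv q hq hq' => ?_)
    refine (rayInt_integrand_le hf hq' (le_of_lt hv)).trans ?_
    have h1 : decay S.ρ (S.y q.1 q.2 + v) ≤
        (1 + 1) ^ (1 + S.ρ) * decay S.ρ (S.y p.1 p.2 + v) := by
      refine decay_le_of_abs_sub_le S.ρ_pos ?_
      rw [add_sub_add_right_eq_sub]
      exact hq.1.le
    have h2 : Real.exp (Λ * tail S.ρ (S.y q.1 q.2 + v)) ≤
        Real.exp (Λ * ∫ v, decay S.ρ v) := Real.exp_le_exp.2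
      (mul_le_mul_of_nonneg_left (tail_le_total S.ρ_pos _) hΛ.le)
    have h0 := decay_pos S.ρ (S.y q.1 q.2 + v)
    have h0' := decay_pos S.ρ (S.y p.1 p.2 + v)
    calc A * Real.exp (s * q.1.re) * (decay S.ρ (S.y q.1 q.2 + v) *
          Real.exp (Λ * tail S.ρ (S.y q.1 q.2 + v)))
        ≤ A * (Real.exp (s * p.1.re) + 1) * (((1 + 1) ^ (1 + S.ρ) * decay S.ρ (S.y p.1 p.2 + v)) *
          Real.exp (Λ * ∫ v, decay S.ρ v)) := by
          have : Real.exp (s * q.1.re) ≤ Real.exp (s * p.1.re) + 1 := le_of_lt hq.2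
          gcongr
      _ = _ := by ring

variable (S) in
open Classical in
/-- One step of the iteration solving the integral equations. -/
def step (ε : ℂ) (Q : ι → ℂ → ℂ → ℂ) (l : ι) (t ξ : ℂ) : ℂ :=
  if l = S.j then -S.e * S.rayInt (S.src ε Q l) t ξ
  else -(1 / S.a l) * (ε * S.b l S.j (ξ + t / S.a l) + S.charInt l (S.src ε Q l) t ξ)

theorem a_ne_zero {l : ι} (hl : l ≠ S.j) : S.a l ≠ 0 :=
  norm_pos_iff.1 (S.α_pos.trans_le (S.norm_a l hl))

/-- `B` is independent of `Λ`, so enlarging `Λ` makes one step of the iteration as small as desired.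
-/
theorem exists_controlled_step {s : ℝ} (hs : S.σ < s) : ∃ B > 0, ∀ Λ > 0, ∀ M ≥ 0, ∀ ε : ℂ,
    ∀ Q : ι → ℂ → ℂ → ℂ, (∀ m, S.Controlled Λ s M (Q m)) → ∀ l,
      S.Controlled Λ s (B * (‖ε‖ + M) / Λ) (S.step ε Q l) := by
  obtain ⟨A, hA, hsrc⟩ := exists_sourceBound_src (S := S) hs
  have hs0 : 0 < s := S.σ_nonneg.trans_lt hs
  have hc := S.c₀_pos
  have hα := S.α_pos
  have hC := S.C_pos
  set B₁ := 1 / S.α * (S.C * (2 ^ (1 + S.ρ) * Real.exp (s * S.R)) +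
    A * Real.exp (s * S.R) / S.c₀) with hB₁
  refine ⟨A + B₁, by positivity, fun Λ hΛ M hM ε Q hQ l => ?_⟩
  have hS := hsrc Λ hΛ M hM ε Q hQ l
  have hA' : 0 ≤ A * (‖ε‖ + M) := by positivity
  by_cases hl : l = S.j
  · refine ⟨?_, fun t ξ hp => ?_⟩
    · intro p hp
      have := (analyticAt_const (v := -S.e)).mul (rayInt_analytic hA' hΛ hS p hp)
      exact this.congr (Eventually.of_forall fun q => by simp [step, hl])
    · rw [step, if_pos hl, norm_mul, norm_neg, S.norm_e, one_mul]
      refine (rayInt_le hΛ hS hp).trans ?_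
      have hw0 := weight_nonneg (ρ := S.ρ) hΛ.le (S.y t ξ)
      refine mul_le_mul_of_nonneg_right ?_ (by positivity)
      refine div_le_div_of_nonneg_right ?_ hΛ.le
      refine mul_le_mul_of_nonneg_right ?_ (by positivity)
      have : 0 < B₁ := by positivity
      linarith
  · refine ⟨?_, fun t ξ hp => ?_⟩
    · intro p hp
      have h1 : AnalyticAt ℂ (fun p : ℂ × ℂ => S.b l S.j (p.2 + p.1 / S.a l)) p := by
        refine AnalyticAt.comp (g := fun ζ : ℂ => S.b l S.j ζ)
          (f := fun p : ℂ × ℂ => p.2 + p.1 / S.a l)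
          (S.analytic_b l S.j _ (snd_mem (zero_shift_mem_dom hp hl))) ?_
        simp only [div_eq_mul_inv]
        exact analyticAt_snd.add (analyticAt_fst.mul analyticAt_const)
      have := (analyticAt_const (v := -(1 / S.a l))).mul (((analyticAt_const (v := ε)).mul h1).add
        (charInt_analytic hA' hs0.le hΛ hS hl p hp))
      exact this.congr (Eventually.of_forall fun q => by simp [step, hl])
    · have hw0 := weight_nonneg (ρ := S.ρ) hΛ.le (S.y t ξ)
      set w := weight S.ρ Λ (S.y t ξ) with hw
      have hE : 1 ≤ Real.exp (s * S.R) * Real.exp (s * t.re) := by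
        rw [← Real.exp_add]
        refine Real.one_le_exp ?_
        have := neg_lt_re_of_mem_U (fst_mem hp)
        nlinarith
      have hb : ‖S.b l S.j (ξ + t / S.a l)‖ ≤
          S.C * (2 ^ (1 + S.ρ) * Real.exp (s * S.R)) / Λ * (Real.exp (s * t.re) * w) := by
        have hz := zero_shift_mem_dom hp hl
        have h1 := b_le (l := l) (m := S.j) hz
        -- The characteristic ends at `t = 0`, where `axisDist` vanishes and the two coordinates
        -- agree.
        have h2 : S.x (ξ + t / S.a l) = S.y t ξ + S.β l t := by
          have h3 := y_shift_a (S := S) l t ξ (τ := 1) le_rfl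
          have h4 : axisDist 0 = 0 := by simp [axisDist]
          simpa [y, h4] using h3
        have hβ : 0 ≤ S.β l t := (mul_nonneg hc.le (norm_nonneg _)).trans (le_β hl t)
        rw [h2] at h1
        refine h1.trans ?_
        have h5 := decay_le_tail S.ρ_pos (S.y t ξ + S.β l t)
        have h6 : tail S.ρ (S.y t ξ + S.β l t) ≤ w / Λ :=
          (tail_antitone S.ρ_pos (by linarith)).trans (tail_le_weight hΛ (S.y t ξ))
        calc S.C * decay S.ρ (S.y t ξ + S.β l t) ≤ S.C * (2 ^ (1 + S.ρ) * (w / Λ)) := by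
              refine mul_le_mul_of_nonneg_left (h5.trans ?_) hC.le
              gcongr
          _ = S.C * (2 ^ (1 + S.ρ) * (w / Λ)) * 1 := by ring
          _ ≤ S.C * (2 ^ (1 + S.ρ) * (w / Λ)) * (Real.exp (s * S.R) * Real.exp (s * t.re)) := by
              gcongr
          _ = _ := by ring
      have hchar := charInt_le hA' hs0.le hΛ hS hl hp
      rw [step, if_neg hl, norm_mul, norm_neg, norm_div, norm_one]
      calc 1 / ‖S.a l‖ * ‖ε * S.b l S.j (ξ + t / S.a l) + S.charInt l (S.src ε Q l) t ξ‖
          ≤ 1 / S.α * (‖ε‖ * (S.C * (2 ^ (1 + S.ρ) * Real.exp (s * S.R)) / Λ *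
            (Real.exp (s * t.re) * w)) + A * (‖ε‖ + M) * Real.exp (s * S.R) / S.c₀ / Λ *
              (Real.exp (s * t.re) * w)) := by
            refine mul_le_mul (one_div_le_one_div_of_le hα (S.norm_a l hl))
              ((norm_add_le _ _).trans (add_le_add ?_ hchar)) (norm_nonneg _) (by positivity)
            rw [norm_mul]
            exact mul_le_mul_of_nonneg_left hb (norm_nonneg _)
        _ ≤ 1 / S.α * ((‖ε‖ + M) * (S.C * (2 ^ (1 + S.ρ) * Real.exp (s * S.R)) / Λ *
            (Real.exp (s * t.re) * w)) + A * (‖ε‖ + M) * Real.exp (s * S.R) / S.c₀ / Λ *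
              (Real.exp (s * t.re) * w)) := by
            gcongr
            linarith
        _ = B₁ * (‖ε‖ + M) / Λ * (Real.exp (s * t.re) * w) := by rw [hB₁]; ring
        _ ≤ _ := by
            gcongr
            linarith

end BorelSystem
-- Solution of the integral equations by iteration
namespace BorelSystem

variable {ι : Type} [Fintype ι] {S : BorelSystem ι}

theorem Controlled.add {Λ s M M' : ℝ} {Q Q' : ℂ → ℂ → ℂ} (h : S.Controlled Λ s M Q)
    (h' : S.Controlled Λ s M' Q') : S.Controlled Λ s (M + M') (Q + Q') where
  analytic p hp := (h.analytic p hp).add (h'.analytic p hp)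
  le t ξ hp := (norm_add_le _ _).trans ((add_le_add (h.le t ξ hp) (h'.le t ξ hp)).trans
    (le_of_eq (by ring)))

theorem controlled_zero (Λ s : ℝ) : S.Controlled Λ s 0 0 where
  analytic _ _ := analyticAt_const
  le t ξ _ := by simp

theorem conv_add {Q Q' : ℂ → ℂ → ℂ} (hQ : AnalyticOnNhd ℂ (fun p : ℂ × ℂ => Q p.1 p.2) S.dom)
    (hQ' : AnalyticOnNhd ℂ (fun p : ℂ × ℂ => Q' p.1 p.2) S.dom) (l m : ι) {t ξ : ℂ}
    (hp : (t, ξ) ∈ S.dom) :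
    conv (S.k l m) (Q + Q') t ξ = conv (S.k l m) Q t ξ + conv (S.k l m) Q' t ξ := by
  unfold conv
  rw [← integral_add (conv_integrableOn hQ l m hp) (conv_integrableOn hQ' l m hp)]
  simp [mul_add]

theorem src_add {ε ε' : ℂ} {Q Q' : ι → ℂ → ℂ → ℂ}
    (hQ : ∀ m, AnalyticOnNhd ℂ (fun p : ℂ × ℂ => Q m p.1 p.2) S.dom)
    (hQ' : ∀ m, AnalyticOnNhd ℂ (fun p : ℂ × ℂ => Q' m p.1 p.2) S.dom) (l : ι) {t ξ : ℂ}
    (hp : (t, ξ) ∈ S.dom) :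
    S.src (ε + ε') (Q + Q') l t ξ = S.src ε Q l t ξ + S.src ε' Q' l t ξ := by
  have h : ∑ m, (S.b l m ξ * (Q + Q') m t ξ + conv (S.k l m) ((Q + Q') m) t ξ) =
      ∑ m, (S.b l m ξ * Q m t ξ + conv (S.k l m) (Q m) t ξ) +
      ∑ m, (S.b l m ξ * Q' m t ξ + conv (S.k l m) (Q' m) t ξ) := by
    rw [← Finset.sum_add_distrib]
    refine Finset.sum_congr rfl fun m _ => ?_
    rw [Pi.add_apply, conv_add (hQ m) (hQ' m) l m hp]
    simp only [Pi.add_apply]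
    ring
  rw [src, src, src, h]
  ring

/-- The bounds are needed only to guarantee that the integrals being added converge. -/
theorem step_add {Λ s M M' : ℝ} (hΛ : 0 < Λ) (hs : S.σ < s) (hM : 0 ≤ M) (hM' : 0 ≤ M') {ε ε' : ℂ}
    {Q Q' : ι → ℂ → ℂ → ℂ} (hQ : ∀ m, S.Controlled Λ s M (Q m))
    (hQ' : ∀ m, S.Controlled Λ s M' (Q' m)) (l : ι) {t ξ : ℂ} (hp : (t, ξ) ∈ S.dom) :
    S.step (ε + ε') (Q + Q') l t ξ = S.step ε Q l t ξ + S.step ε' Q' l t ξ := by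
  obtain ⟨A, hA, hsrc⟩ := exists_sourceBound_src (S := S) hs
  have h1 := hsrc Λ hΛ M hM ε Q hQ l
  have h2 := hsrc Λ hΛ M' hM' ε' Q' hQ' l
  have hadd := fun {t ξ : ℂ} (hp : (t, ξ) ∈ S.dom) => src_add (ε := ε) (ε' := ε')
    (fun m => (hQ m).analytic) (fun m => (hQ' m).analytic) l hp
  unfold step
  split_ifs with hl
  · have : S.rayInt (S.src (ε + ε') (Q + Q') l) t ξ =
        S.rayInt (S.src ε Q l) t ξ + S.rayInt (S.src ε' Q' l) t ξ := by
      unfold rayInt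
      rw [← integral_add (rayInt_integrableOn hΛ h1 hp) (rayInt_integrableOn hΛ h2 hp)]
      exact setIntegral_congr_fun measurableSet_Ioi fun v hv =>
        hadd (shift_e_mem_dom hp (le_of_lt hv))
    rw [this]; ring
  · have : S.charInt l (S.src (ε + ε') (Q + Q') l) t ξ =
        S.charInt l (S.src ε Q l) t ξ + S.charInt l (S.src ε' Q' l) t ξ := by
      unfold charInt
      rw [← integral_add (charInt_integrableOn h1.analytic hl hp)
        (charInt_integrableOn h2.analytic hl hp)]
      refine setIntegral_congr_fun measurableSet_Ioc fun v hv => ?_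
      rw [hadd (shift_a_mem_dom hp hl hv.1.le hv.2), mul_add]
    rw [this]; ring

variable (S) in
/-- The successive corrections in the iteration. -/
def iter : ℕ → ι → ℂ → ℂ → ℂ
  | 0 => S.step 1 0
  | N + 1 => S.step 0 (iter N)

variable (S) in
/-- The solution of the integral equations. -/
def sol (l : ι) (t ξ : ℂ) : ℂ := ∑' N, S.iter N l t ξ

variable (S) in
/-- The partial sums of the iteration. -/
def partialSol (K : ℕ) : ι → ℂ → ℂ → ℂ := ∑ N ∈ Finset.range K, S.iter N

/-- The iterates themselves depend on neither `s` nor `Λ`. Hence one and the same sum obeys the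
bounds for every rate `s > σ`, each with its own `Λ`. -/
theorem exists_controlled {s : ℝ} (hs : S.σ < s) : ∃ Λ > 0,
    (∀ N l, S.Controlled Λ s ((1 / 2) ^ (N + 1)) (S.iter N l)) ∧
    (∀ M ≥ 0, ∀ Q : ι → ℂ → ℂ → ℂ, (∀ m, S.Controlled Λ s M (Q m)) → ∀ l,
      S.Controlled Λ s (M / 2) (S.step 0 Q l)) := by
  obtain ⟨B, hB, hstep⟩ := exists_controlled_step (S := S) hs
  -- With `Λ = 2 B` the first iterate has constant `1/2`, and every homogeneous step halves the
  -- constant.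
  refine ⟨2 * B, by positivity, fun N => ?_, fun M hM Q hQ l => ?_⟩
  · induction N with
    | zero =>
      intro l
      have := hstep (2 * B) (by positivity) 0 le_rfl 1 0 (fun m => controlled_zero _ _) l
      have e : B * (‖(1 : ℂ)‖ + 0) / (2 * B) = (1 / 2) ^ (0 + 1) := by
        rw [norm_one]; field_simp; norm_num
      rw [e] at this
      exact this
    | succ N ih =>
      intro l
      have := hstep (2 * B) (by positivity) _ (by positivity) 0 (S.iter N) ih l
      have e : B * (‖(0 : ℂ)‖ + (1 / 2) ^ (N + 1)) / (2 * B) = (1 / 2) ^ (N + 1 + 1) := by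
        rw [norm_zero]; field_simp; ring
      rw [e] at this
      exact this
  · have := hstep (2 * B) (by positivity) M hM 0 Q hQ l
    have e : B * (‖(0 : ℂ)‖ + M) / (2 * B) = M / 2 := by
      rw [norm_zero]; field_simp; ring
    rwa [e] at this

theorem hasSum_half (K : ℕ) : HasSum (fun N : ℕ => (1 / 2 : ℝ) ^ (N + K + 1)) ((1 / 2) ^ K) := by
  have h := hasSum_geometric_two.mul_left ((1 / 2 : ℝ) ^ (K + 1))
  have e : (1 / 2 : ℝ) ^ (K + 1) * 2 = (1 / 2) ^ K := by rw [pow_succ]; ring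
  rw [e] at h
  refine (funext fun N => ?_ : (fun N : ℕ => (1 / 2 : ℝ) ^ (N + K + 1)) =
    fun N => (1 / 2) ^ (K + 1) * (1 / 2) ^ N) ▸ h
  rw [← pow_add]
  congr 1
  omega

theorem summable_iter {t ξ : ℂ} (hp : (t, ξ) ∈ S.dom) (l : ι) :
    Summable fun N => S.iter N l t ξ := by
  obtain ⟨Λ, hΛ, hG, -⟩ := exists_controlled (S := S) (lt_add_one S.σ)
  refine Summable.of_norm_bounded ((hasSum_half 0).summable.mul_right
    (Real.exp ((S.σ + 1) * t.re) * weight S.ρ Λ (S.y t ξ))) fun N => (hG N l).le t ξ hp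

theorem sol_analytic (l : ι) :
    AnalyticOnNhd ℂ (fun p : ℂ × ℂ => S.sol l p.1 p.2) S.dom := by
  obtain ⟨Λ, hΛ, hG, -⟩ := exists_controlled (S := S) (lt_add_one S.σ)
  refine analyticOnNhd_tsum S.isOpen_dom (F := fun N p => S.iter N l p.1 p.2)
    (fun N => (hG N l).analytic) fun p hp => ?_
  have hc : Continuous fun q : ℂ × ℂ =>
      Real.exp ((S.σ + 1) * q.1.re) * weight S.ρ Λ (S.y q.1 q.2) := by
    have := (continuous_weight S.ρ_pos Λ).comp S.continuous_y
    simp only [Function.comp_def] at this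
    fun_prop
  refine ⟨_, (isOpen_lt hc (continuous_const (y := Real.exp ((S.σ + 1) * p.1.re) *
    weight S.ρ Λ (S.y p.1 p.2) + 1))).mem_nhds (by simp), _,
    (hasSum_half 0).summable.mul_right _, fun N q hq hq' => ((hG N l).le q.1 q.2 hq').trans
      (mul_le_mul_of_nonneg_left (le_of_lt hq) (by positivity))⟩

theorem controlled_sol_sub {s Λ : ℝ}
    (hG : ∀ N l, S.Controlled Λ s ((1 / 2) ^ (N + 1)) (S.iter N l)) (K : ℕ) (l : ι) :
    S.Controlled Λ s ((1 / 2) ^ K) (S.sol l - S.partialSol K l) where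
  analytic p hp := by
    refine (sol_analytic l p hp).sub ?_
    simp only [partialSol, Finset.sum_apply]
    exact Finset.analyticAt_fun_sum _ fun N _ => (hG N l).analytic p hp
  le t ξ hp := by
    have h : (S.sol l - S.partialSol K l) t ξ = ∑' N, S.iter (N + K) l t ξ := by
      simp only [Pi.sub_apply, partialSol, Finset.sum_apply, sol]
      rw [← (summable_iter hp l).sum_add_tsum_nat_add K]
      ring
    rw [h]
    exact tsum_of_norm_bounded ((hasSum_half K).mul_right _) fun N => (hG (N + K) l).le t ξ hp

theorem controlled_partialSol {s Λ : ℝ}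
    (hG : ∀ N l, S.Controlled Λ s ((1 / 2) ^ (N + 1)) (S.iter N l)) (K : ℕ) (l : ι) :
    S.Controlled Λ s (∑ N ∈ Finset.range K, (1 / 2) ^ (N + 1)) (S.partialSol K l) := by
  induction K with
  | zero => simpa [partialSol] using controlled_zero (S := S) Λ s
  | succ K ih =>
    rw [Finset.sum_range_succ, partialSol, Finset.sum_range_succ]
    exact ih.add (hG K l)

theorem exists_controlled_sol {s : ℝ} (hs : S.σ < s) :
    ∃ Λ > 0, ∀ l, S.Controlled Λ s 1 (S.sol l) := by
  obtain ⟨Λ, hΛ, hG, -⟩ := exists_controlled (S := S) hs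
  refine ⟨Λ, hΛ, fun l => ?_⟩
  simpa [partialSol] using controlled_sol_sub hG 0 l

theorem sol_eq_step {t ξ : ℂ} (hp : (t, ξ) ∈ S.dom) (l : ι) :
    S.sol l t ξ = S.step 1 S.sol l t ξ := by
  have hs := lt_add_one S.σ
  obtain ⟨Λ, hΛ, hG, hst⟩ := exists_controlled (S := S) hs
  have hpart : ∀ K, ∀ l, ∀ t ξ, (t, ξ) ∈ S.dom →
      S.step 1 (S.partialSol K) l t ξ = S.partialSol (K + 1) l t ξ := by
    intro K
    induction K with
    | zero => intro l t ξ hp; simp [partialSol, iter]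
    | succ K ih =>
      intro l t ξ hp
      have h := step_add (ε := 1) (ε' := 0) hΛ hs (Finset.sum_nonneg fun N _ => by positivity)
        (by positivity) (controlled_partialSol hG K) (hG K) l hp
      rw [add_zero, ih l t ξ hp] at h
      have e : S.partialSol (K + 1) = S.partialSol K + S.iter K := Finset.sum_range_succ _ _
      have e' : S.partialSol (K + 1 + 1) = S.partialSol (K + 1) + S.iter (K + 1) :=
        Finset.sum_range_succ _ _
      rw [e, h, e']
      rfl
  -- Split `sol` into a partial sum, on which the step gives the next partial sum, and a remainder
  -- bounded by `2^{-K}`, which the homogeneous step halves.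
  have key : ∀ K, ‖S.step 1 S.sol l t ξ - S.partialSol (K + 1) l t ξ‖ ≤
      (1 / 2) ^ K / 2 * (Real.exp ((S.σ + 1) * t.re) * weight S.ρ Λ (S.y t ξ)) := fun K => by
    have hc := fun m => controlled_sol_sub hG K m
    have h := step_add (ε := 1) (ε' := 0) (Q := S.partialSol K) (Q' := S.sol - S.partialSol K)
      hΛ hs (Finset.sum_nonneg fun N _ => by positivity)
      (by positivity) (controlled_partialSol hG K) hc l hp
    rw [add_zero, add_sub_cancel, hpart K l t ξ hp] at h
    rw [h, add_sub_cancel_left]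
    exact (hst _ (by positivity) _ hc l).le t ξ hp
  have hlim : Tendsto (fun K => S.partialSol (K + 1) l t ξ) atTop (𝓝 (S.step 1 S.sol l t ξ)) := by
    rw [tendsto_iff_norm_sub_tendsto_zero]
    have h0 : Tendsto (fun K : ℕ => (1 / 2 : ℝ) ^ K) atTop (𝓝 0) :=
      tendsto_pow_atTop_nhds_zero_of_lt_one (by norm_num) (by norm_num)
    have h1 := (h0.div_const 2).mul_const
      (Real.exp ((S.σ + 1) * t.re) * weight S.ρ Λ (S.y t ξ))
    rw [zero_div, zero_mul] at h1
    exact squeeze_zero (fun _ => norm_nonneg _)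
      (fun K => (norm_sub_rev _ _).trans_le (key K)) h1
  refine tendsto_nhds_unique ?_ hlim
  have h := ((summable_iter hp l).hasSum.tendsto_sum_nat).comp (tendsto_add_atTop_nat 1)
  simpa [partialSol, Function.comp_def, sol] using h

end BorelSystem

theorem tendsto_decay {ρ : ℝ} (hρ : 0 < ρ) (y : ℝ) :
    Tendsto (fun s : ℝ => decay ρ (y + s)) atTop (𝓝 0) := by
  have h1 : Tendsto (fun s : ℝ => 1 + |y + s|) atTop atTop :=
    tendsto_atTop_add_const_left _ _
      (tendsto_abs_atTop_atTop.comp (tendsto_atTop_add_const_left _ _ tendsto_id))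
  exact (tendsto_rpow_neg_atTop (by linarith : 0 < 1 + ρ)).comp h1

/-- Differentiation of an integral along an infinite ray with respect to the vertex. -/
theorem hasDerivAt_ray_integral {G : Set ℂ} (hG : IsOpen G) {f : ℂ → ℂ} (hf : DifferentiableOn ℂ f G)
    {e ξ₀ : ℂ} {r : ℝ} (hr : 0 < r)
    (hmem : ∀ ξ ∈ Metric.ball ξ₀ r, ∀ s : ℝ, 0 ≤ s → ξ + s * e ∈ G) {bound : ℝ → ℝ}
    (hi : IntegrableOn bound (Ioi 0))
    (hb : ∀ ξ ∈ Metric.ball ξ₀ r, ∀ s : ℝ, 0 < s → ‖f (ξ + s * e)‖ ≤ bound s)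
    (hlim : Tendsto (fun s : ℝ => f (ξ₀ + s * e)) atTop (𝓝 0)) :
    HasDerivAt (fun ξ => ∫ s in Ioi (0 : ℝ), f (ξ + s * e) * e) (-f ξ₀) ξ₀ := by
  have hξ₀ := Metric.mem_ball_self (x := ξ₀) hr
  have hderiv : ∀ ξ ∈ Metric.ball ξ₀ r, ∀ s : ℝ, 0 ≤ s →
      HasDerivAt f (deriv f (ξ + s * e)) (ξ + s * e) := fun ξ hξ s hs =>
    (hf.differentiableAt (hG.mem_nhds (hmem ξ hξ s hs))).hasDerivAt
  have hd : ∀ ξ ∈ Metric.ball ξ₀ r, ∀ s : ℝ, 0 ≤ s →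
      HasDerivAt (fun ξ => f (ξ + s * e) * e) (deriv f (ξ + s * e) * e) ξ := fun ξ hξ s hs => by
    have h1 : HasDerivAt (fun ξ : ℂ => ξ + s * e) 1 ξ := (hasDerivAt_id ξ).add_const _
    simpa using ((hderiv ξ hξ s hs).comp ξ h1).mul_const e
  have hcont : ∀ ξ ∈ Metric.ball ξ₀ r, ContinuousOn (fun s : ℝ => f (ξ + s * e) * e) (Ici 0) :=
    fun ξ hξ => (hf.continuousOn.comp (f := fun s : ℝ => ξ + s * e) (by fun_prop)
      fun s hs => hmem ξ hξ s hs).mul continuousOn_const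
  obtain ⟨hint, hder⟩ := hasDerivAt_integral_of_differentiableOn
    (μ := volume.restrict (Ioi (0 : ℝ))) (F := fun ξ (s : ℝ) => f (ξ + s * e) * e) hr
    (fun ξ hξ => ((hcont ξ hξ).mono Ioi_subset_Ici_self).aestronglyMeasurable measurableSet_Ioi)
    ((ae_restrict_iff' measurableSet_Ioi).2 (Eventually.of_forall fun s hs ξ hξ =>
      (hd ξ hξ s (le_of_lt hs)).differentiableAt.differentiableWithinAt))
    (bound := fun s => bound s * ‖e‖)
    ((ae_restrict_iff' measurableSet_Ioi).2 (Eventually.of_forall fun s hs ξ hξ => by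
      rw [norm_mul]; exact mul_le_mul_of_nonneg_right (hb ξ hξ s hs) (norm_nonneg _)))
    (hi.mul_const _)
  have heq : EqOn (fun s : ℝ => deriv (fun ξ => f (ξ + s * e) * e) ξ₀)
      (fun s : ℝ => deriv f (ξ₀ + s * e) * e) (Ioi 0) := fun s hs =>
    (hd ξ₀ hξ₀ s (le_of_lt hs)).deriv
  have hray : ∀ s ∈ Ici (0 : ℝ), HasDerivAt (fun s : ℝ => f (ξ₀ + s * e))
      (deriv f (ξ₀ + s * e) * e) s := fun s hs => by
    have h1 : HasDerivAt (fun s : ℝ => ξ₀ + s * e) e s := by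
      simpa using ((Complex.ofRealCLM.hasDerivAt (x := s)).mul_const e).const_add ξ₀
    exact (hderiv ξ₀ hξ₀ s hs).comp s h1
  -- The derivative with respect to the vertex is also the derivative along the ray, so its integral
  -- is evaluated by the fundamental theorem.
  have hFTC := integral_Ioi_of_hasDerivAt_of_tendsto' hray
    (IntegrableOn.congr_fun hint heq measurableSet_Ioi) hlim
  rw [setIntegral_congr_fun measurableSet_Ioi heq, hFTC] at hder
  simpa using hder

/-- The partial derivatives of an analytic function of two variables. -/
theorem hasDerivAt_fst_snd {f : ℂ → ℂ → ℂ} {t ξ : ℂ}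
    (hf : AnalyticAt ℂ (fun p : ℂ × ℂ => f p.1 p.2) (t, ξ)) :
    HasFDerivAt (fun p : ℂ × ℂ => f p.1 p.2)
      ((ContinuousLinearMap.fst ℂ ℂ ℂ).smulRight (deriv (fun z => f z ξ) t) +
        (ContinuousLinearMap.snd ℂ ℂ ℂ).smulRight (deriv (f t) ξ)) (t, ξ) := by
  have h := hf.differentiableAt.hasFDerivAt
  set L := fderiv ℂ (fun p : ℂ × ℂ => f p.1 p.2) (t, ξ) with hL
  have h1 : HasDerivAt (fun z => f z ξ) (L (1, 0)) t := by
    have h2 : HasDerivAt (fun z : ℂ => (z, ξ)) ((1 : ℂ), (0 : ℂ)) t :=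
      (hasDerivAt_id t).prodMk (hasDerivAt_const t ξ)
    exact h.comp_hasDerivAt (f := fun z : ℂ => (z, ξ)) t h2
  have h3 : HasDerivAt (f t) (L (0, 1)) ξ := by
    have h2 : HasDerivAt (fun z : ℂ => (t, z)) ((0 : ℂ), (1 : ℂ)) ξ :=
      (hasDerivAt_const ξ t).prodMk (hasDerivAt_id ξ)
    exact h.comp_hasDerivAt (f := fun z : ℂ => (t, z)) ξ h2
  rw [h1.deriv, h3.deriv]
  refine h.congr_fderiv ?_
  ext <;> simp

theorem hasDerivAt_curve {f : ℂ → ℂ → ℂ} {t ξ : ℂ}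
    (hf : AnalyticAt ℂ (fun p : ℂ × ℂ => f p.1 p.2) (t, ξ)) (v w : ℂ) :
    HasDerivAt (fun h : ℝ => f (t + h * v) (ξ + h * w))
      (deriv (fun z => f z ξ) t * v + deriv (f t) ξ * w) 0 := by
  have h := hasDerivAt_fst_snd hf
  have hc : ∀ z w : ℂ, HasDerivAt (fun h : ℝ => z + h * w) w 0 := fun z w => by
    simpa using ((Complex.ofRealCLM.hasDerivAt (x := (0 : ℝ))).mul_const w).const_add z
  have h2 : HasDerivAt (fun h : ℝ => (t + h * v, ξ + h * w)) (v, w) 0 :=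
    (hc t v).prodMk (hc ξ w)
  have h0 : (t, ξ) = (fun h : ℝ => (t + h * v, ξ + h * w)) 0 := by simp
  rw [h0] at h
  have h3 := (h.restrictScalars ℝ).comp_hasDerivAt (0 : ℝ) h2
  refine h3.congr_deriv ?_
  simp [mul_comm]

/-! ### The partial differential equations and the bound in `x` -/

namespace BorelSystem

variable {ι : Type} [Fintype ι] {S : BorelSystem ι}

variable (S) in
/-- The right-hand side of the system for the solution. -/
def source (l : ι) : ℂ → ℂ → ℂ := S.src 1 S.sol l

theorem exists_sourceBound_source {s : ℝ} (hs : S.σ < s) :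
    ∃ Λ > 0, ∃ A > 0, ∀ l, S.SourceBound Λ s A (S.source l) := by
  obtain ⟨Λ, hΛ, hc⟩ := exists_controlled_sol (S := S) hs
  obtain ⟨A, hA, h⟩ := exists_sourceBound_src (S := S) hs
  exact ⟨Λ, hΛ, A * (‖(1 : ℂ)‖ + 1), by positivity,
    fun l => h Λ hΛ 1 zero_le_one 1 S.sol hc l⟩

theorem source_analytic (l : ι) :
    AnalyticOnNhd ℂ (fun p : ℂ × ℂ => S.source l p.1 p.2) S.dom := by
  obtain ⟨Λ, -, A, -, h⟩ := exists_sourceBound_source (S := S) (lt_add_one S.σ)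
  exact (h l).analytic

/-- At `t = 0` the characteristic integral is empty and only the boundary term remains. For `l = j`
both sides vanish because `a j = 0` and `b j j = 0`; this is where the normalisation by the exponent
is needed. -/
theorem sol_zero {ξ : ℂ} (hξ : ξ ∈ S.Γ) (l : ι) : S.a l * S.sol l 0 ξ = -S.b l S.j ξ := by
  by_cases hl : l = S.j
  · rw [hl, S.a_j, S.b_jj]; simp
  · have hp : ((0 : ℂ), ξ) ∈ S.dom := by simpa using ofReal_mem_dom (S := S) le_rfl hξ
    have ha := a_ne_zero hl
    rw [sol_eq_step hp, step, if_neg hl]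
    have : S.charInt l (S.src 1 S.sol l) 0 ξ = 0 := by simp [charInt]
    rw [this]
    simp
    field_simp

/-- After the substitution `s = (1 - τ) t` the integrand depends on `(t, ξ)` only through `ξ + t / a
l`, which is constant on the characteristic. -/
theorem charInt_ofReal (l : ι) (f : ℂ → ℂ → ℂ) {t : ℝ} (ht : 0 < t) (ξ : ℂ) :
    S.charInt l f t ξ = ∫ s in (0 : ℝ)..t, f s (ξ + t / S.a l - s / S.a l) := by
  have h := intervalIntegral.integral_comp_sub_mul (a := (0 : ℝ)) (b := 1)
    (fun s : ℝ => f s (ξ + t / S.a l - s / S.a l)) ht.ne' t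
  simp only [mul_one, sub_self, mul_zero, sub_zero] at h
  have h2 : ∫ s in (0 : ℝ)..t, f s (ξ + t / S.a l - s / S.a l) = (t : ℂ) *
      ∫ τ in (0 : ℝ)..1, f ((t - t * τ : ℝ) : ℂ) (ξ + t / S.a l - ((t - t * τ : ℝ) : ℂ) / S.a l) := by
    rw [h, Complex.real_smul, ← mul_assoc, ← Complex.ofReal_mul, mul_inv_cancel₀ ht.ne']
    simp
  rw [h2, ← intervalIntegral.integral_const_mul, intervalIntegral.integral_of_le zero_le_one, charInt]
  refine integral_congr_ae (Eventually.of_forall fun τ => ?_)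
  simp only
  congr 2
  · push_cast; ring
  · push_cast; ring

/-- On the curve `h ↦ (t + h, ξ - h / a l)` the point `ζ` is fixed, so the boundary term is constant
and only the upper limit of the integral varies. -/
theorem hasDerivAt_sol_pde_of_ne {l : ι} (hl : l ≠ S.j) {t : ℝ} (ht : 0 < t) {ξ : ℂ}
    (hξ : ξ ∈ S.Γ) :
    HasDerivAt (fun h : ℝ => S.sol l (t + h * 1) (ξ + h * (-(1 / S.a l))))
      (-(1 / S.a l) * S.source l t ξ) 0 := by
  set ζ := ξ + t / S.a l with hζ
  have hp : ((t : ℂ), ξ) ∈ S.dom := ofReal_mem_dom ht.le hξ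
  have hcurve : Continuous fun h : ℝ => ((t : ℂ) + h * 1, ξ + h * (-(1 / S.a l))) := by fun_prop
  have hev : ∀ᶠ h : ℝ in 𝓝 0, ((t : ℂ) + h * 1, ξ + h * (-(1 / S.a l))) ∈ S.dom :=
    hcurve.continuousAt.eventually_mem (S.isOpen_dom.mem_nhds (by simpa using hp))
  have hev2 : ∀ᶠ h : ℝ in 𝓝 0, 0 < t + h := by
    have : Continuous fun h : ℝ => t + h := by fun_prop
    exact this.continuousAt.eventually_mem ((isOpen_Ioi (a := (0 : ℝ))).mem_nhds (by simpa using ht))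
  let g : ℝ → ℂ := fun s => S.source l s (ζ - s / S.a l)
  have hgdom : ∀ h : ℝ, ((t : ℂ) + h * 1, ξ + h * (-(1 / S.a l))) ∈ S.dom → 0 < t + h →
      ∀ s ∈ Icc 0 (t + h), ((s : ℂ), ζ - s / S.a l) ∈ S.dom := by
    intro h hh hpos s hs
    have h1 : 0 ≤ s / (t + h) := div_nonneg hs.1 hpos.le
    have h2 : s / (t + h) ≤ 1 := (div_le_one hpos).2 hs.2
    have := shift_a_mem_dom hh hl (τ := 1 - s / (t + h)) (by linarith) (by linarith)
    have hne : (t + h : ℂ) ≠ 0 := by exact_mod_cast hpos.ne'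
    have e1 : ((1 - (1 - s / (t + h)) : ℝ) : ℂ) * (t + h * 1) = s := by
      push_cast; field_simp; ring
    have e2 : ξ + h * (-(1 / S.a l)) + ((1 - s / (t + h) : ℝ) : ℂ) * (t + h * 1) / S.a l =
        ζ - s / S.a l := by
      rw [hζ]; push_cast; field_simp; ring
    rwa [e1, e2] at this
  -- A little room beyond `t` makes `g` continuous on `[0, t + δ]`, so that `t` is an interior point
  -- for the fundamental theorem.
  obtain ⟨δ, hδ, hsub⟩ := Metric.nhds_basis_closedBall.mem_iff.1 (hev.and hev2)
  have hδmem := hsub (show δ ∈ Metric.closedBall (0 : ℝ) δ by simp [abs_of_pos hδ])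
  have hgc : ContinuousOn g (Icc 0 (t + δ)) :=
    (source_analytic l).continuousOn.comp (f := fun s : ℝ => ((s : ℂ), ζ - s / S.a l))
      (by fun_prop) (hgdom δ hδmem.1 hδmem.2)
  have hFTC : HasDerivAt (fun T : ℝ => ∫ s in (0 : ℝ)..T, g s) (g t) t := by
    refine intervalIntegral.integral_hasDerivAt_right ?_ ?_ ?_
    · refine (hgc.mono ?_).intervalIntegrable
      rw [uIcc_of_le ht.le]
      exact Icc_subset_Icc_right (by linarith)
    · exact (hgc.mono Ioo_subset_Icc_self).stronglyMeasurableAtFilter isOpen_Ioo t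
        ⟨ht, by linarith⟩
    · exact hgc.continuousAt (Icc_mem_nhds ht (by linarith))
  have hgt : g t = S.source l t ξ := by simp [g, hζ]
  have h0 : HasDerivAt (fun h : ℝ => t + h) 1 0 := by simpa using (hasDerivAt_id (0 : ℝ)).const_add t
  have hFTC' : HasDerivAt (fun T : ℝ => ∫ s in (0 : ℝ)..T, g s) (g t) (t + 0) := by simpa using hFTC
  have h1 := ((hFTC'.scomp (0 : ℝ) h0).const_add (1 * S.b l S.j ζ)).const_mul (-(1 / S.a l))
  rw [one_smul, hgt] at h1
  refine h1.congr_of_eventuallyEq ?_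
  filter_upwards [hev, hev2] with h hh hpos
  rw [sol_eq_step hh, step, if_neg hl]
  have e : ((t : ℂ) + h * 1) = ((t + h : ℝ) : ℂ) := by push_cast; ring
  have e2 : ξ + h * (-(1 / S.a l)) + ((t + h : ℝ) : ℂ) / S.a l = ζ := by
    rw [hζ]; push_cast; field_simp; ring
  rw [e, charInt_ofReal l _ hpos, e2]
  rfl

/-- The system of partial differential equations in the Borel plane. -/
theorem sol_pde (l : ι) {t : ℝ} (ht : 0 < t) {ξ : ℂ} (hξ : ξ ∈ S.Γ) :
    deriv (S.sol l t) ξ - S.a l * deriv (fun z => S.sol l z ξ) t = S.source l t ξ := by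
  have hp : ((t : ℂ), ξ) ∈ S.dom := ofReal_mem_dom ht.le hξ
  by_cases hl : l = S.j
  · obtain ⟨Λ, hΛ, A, hA, hsb⟩ := exists_sourceBound_source (S := S) (lt_add_one S.σ)
    obtain ⟨r, hr, hsub⟩ := Metric.isOpen_iff.1 S.isOpen ξ hξ
    have hG : IsOpen {ζ : ℂ | ((t : ℂ), ζ) ∈ S.dom} :=
      S.isOpen_dom.preimage (f := fun ζ : ℂ => ((t : ℂ), ζ)) (by fun_prop)
    have hsub' : ∀ ζ ∈ Metric.ball ξ (min r 1), ((t : ℂ), ζ) ∈ S.dom := fun ζ hζ =>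
      ofReal_mem_dom ht.le (hsub (Metric.ball_subset_ball (min_le_left _ _) hζ))
    have hxy : ∀ ζ ∈ Metric.ball ξ (min r 1), |S.y t ζ - S.y t ξ| ≤ 1 := fun ζ hζ => by
      have h1 : S.y t ζ - S.y t ξ = ((ζ - ξ) * (starRingEnd ℂ) S.e).re := by
        rw [y, y, x, x, sub_mul, Complex.sub_re]; ring
      rw [h1]
      refine (Complex.abs_re_le_norm _).trans ?_
      rw [norm_mul, norm_conj_e, mul_one, ← dist_eq_norm]
      exact (Metric.mem_ball.1 hζ).le.trans (min_le_right _ _)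
    have hder := hasDerivAt_ray_integral hG (f := S.source l t) (e := S.e) (ξ₀ := ξ)
      (r := min r 1) (bound := fun v => A * Real.exp ((S.σ + 1) * (t : ℂ).re) *
        ((1 + 1) ^ (1 + S.ρ) * Real.exp (Λ * ∫ v, decay S.ρ v)) * decay S.ρ (S.y t ξ + v)) (by
      intro ζ hζ
      refine DifferentiableAt.differentiableWithinAt ?_
      exact ((source_analytic l _ hζ).differentiableAt).comp (f := fun ζ : ℂ => ((t : ℂ), ζ))
        ζ (by fun_prop)) (by positivity)
      (fun ζ hζ s hs => shift_e_mem_dom (hsub' ζ hζ) hs)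
      (((integrable_decay S.ρ_pos).comp_add_left _).const_mul _).integrableOn ?_ ?_
    · have hE : (fun ζ => S.sol l t ζ) =ᶠ[𝓝 ξ] fun ζ =>
          -∫ s in Ioi (0 : ℝ), S.source l t (ζ + s * S.e) * S.e := by
        filter_upwards [hG.mem_nhds hp] with ζ hζ
        rw [sol_eq_step hζ, step, if_pos hl, rayInt, integral_mul_const, source]
        ring
      rw [(hder.fun_neg.congr_of_eventuallyEq hE).deriv, hl, S.a_j]
      ring
    · intro ζ hζ v hv
      refine (rayInt_integrand_le (hsb l) (hsub' ζ hζ) hv.le).trans ?_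
      have h1 : decay S.ρ (S.y t ζ + v) ≤ (1 + 1) ^ (1 + S.ρ) * decay S.ρ (S.y t ξ + v) := by
        refine decay_le_of_abs_sub_le S.ρ_pos ?_
        rw [add_sub_add_right_eq_sub]
        exact hxy ζ hζ
      have h2 : Real.exp (Λ * tail S.ρ (S.y t ζ + v)) ≤
          Real.exp (Λ * ∫ v, decay S.ρ v) := Real.exp_le_exp.2
        (mul_le_mul_of_nonneg_left (tail_le_total S.ρ_pos _) hΛ.le)
      have h0 := decay_pos S.ρ (S.y t ζ + v)
      have h0' := decay_pos S.ρ (S.y t ξ + v)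
      calc A * Real.exp ((S.σ + 1) * (t : ℂ).re) * (decay S.ρ (S.y t ζ + v) *
            Real.exp (Λ * tail S.ρ (S.y t ζ + v)))
          ≤ A * Real.exp ((S.σ + 1) * (t : ℂ).re) *
            (((1 + 1) ^ (1 + S.ρ) * decay S.ρ (S.y t ξ + v)) *
            Real.exp (Λ * ∫ v, decay S.ρ v)) := by gcongr
        _ = _ := by ring
    · refine squeeze_zero_norm' (a := fun v => A * Real.exp ((S.σ + 1) * (t : ℂ).re) *
        Real.exp (Λ * ∫ v, decay S.ρ v) * decay S.ρ (S.y t ξ + v)) ?_ ?_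
      · filter_upwards [eventually_ge_atTop 0] with v hv
        refine (rayInt_integrand_le (hsb l) hp hv).trans ?_
        have h2 : Real.exp (Λ * tail S.ρ (S.y t ξ + v)) ≤
            Real.exp (Λ * ∫ v, decay S.ρ v) := Real.exp_le_exp.2
          (mul_le_mul_of_nonneg_left (tail_le_total S.ρ_pos _) hΛ.le)
        have h0 := decay_pos S.ρ (S.y t ξ + v)
        rw [mul_assoc (A * _), mul_comm (Real.exp (Λ * ∫ v, decay S.ρ v))]
        gcongr
      · simpa using (tendsto_decay S.ρ_pos (S.y t ξ)).const_mul
          (A * Real.exp ((S.σ + 1) * (t : ℂ).re) * Real.exp (Λ * ∫ v, decay S.ρ v))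
  · have h1 := hasDerivAt_sol_pde_of_ne hl ht hξ
    have h2 := hasDerivAt_curve (sol_analytic l _ hp) 1 (-(1 / S.a l))
    have h3 := h1.unique h2
    have ha := a_ne_zero hl
    field_simp at h3
    linear_combination h3

/-- The bound on the solution in terms of the coordinate in the direction `e`. -/
theorem exists_norm_sol_le {s : ℝ} (hs : S.σ < s) : ∃ K > 0, ∀ l, ∀ t ∈ U S.R, ∀ ξ ∈ S.Γ,
    ‖S.sol l t ξ‖ ≤ K * Real.exp (s * t.re) * (1 / (max 1 (S.x ξ)) ^ S.ρ) := by
  obtain ⟨Λ, hΛ, hc⟩ := exists_controlled_sol (S := S) hs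
  obtain ⟨C, hC, htail⟩ := tail_le_rpow S.ρ_pos
  set T := ∫ v, decay S.ρ v with hT
  set B := (S.c₀ + 1 / S.α) * (2 * S.R) with hB
  have hB0 : 0 ≤ B := by
    have := S.c₀_pos; have := S.α_pos; have := S.R_pos; positivity
  refine ⟨Λ * Real.exp (Λ * T) * (C * (1 + B) ^ S.ρ), by positivity, fun l t ht ξ hξ => ?_⟩
  have hp := mem_dom_of_mem ht hξ
  have h1 := (hc l).le t ξ hp
  have hxy := abs_x_sub_y_le (ξ := ξ) ht
  set v := S.y t ξ with hv
  -- `e^x - 1 ≤ x e^x`, with the exponential bounded by its value at the total mass.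
  have hw : weight S.ρ Λ v ≤ Λ * Real.exp (Λ * T) * tail S.ρ v := by
    have h2 : weight S.ρ Λ v ≤ Λ * tail S.ρ v * Real.exp (Λ * tail S.ρ v) := by
      have h3 := Real.add_one_le_exp (-(Λ * tail S.ρ v))
      have h4 := Real.exp_pos (Λ * tail S.ρ v)
      have h5 : Real.exp (-(Λ * tail S.ρ v)) * Real.exp (Λ * tail S.ρ v) = 1 := by
        rw [← Real.exp_add]; simp
      rw [weight]
      nlinarith
    refine h2.trans ?_
    have h6 : Real.exp (Λ * tail S.ρ v) ≤ Real.exp (Λ * T) :=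
      Real.exp_le_exp.2 (mul_le_mul_of_nonneg_left (tail_le_total S.ρ_pos v) hΛ.le)
    have h7 := tail_nonneg S.ρ v
    calc Λ * tail S.ρ v * Real.exp (Λ * tail S.ρ v) ≤ Λ * tail S.ρ v * Real.exp (Λ * T) := by gcongr
      _ = _ := by ring
  have hmax : max 1 (S.x ξ) ≤ (1 + B) * max 1 v := by
    have h2 : S.x ξ ≤ v + B := by linarith [(abs_le.1 hxy).2]
    have h3 := le_max_left 1 v
    have h4 := le_max_right 1 v
    refine max_le (by nlinarith) (by nlinarith)
  have hmax0 : 0 < max 1 (S.x ξ) := lt_of_lt_of_le one_pos (le_max_left _ _)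
  have hmax1 : 0 < max 1 v := lt_of_lt_of_le one_pos (le_max_left _ _)
  have hinv : 1 / (max 1 v) ^ S.ρ ≤ (1 + B) ^ S.ρ * (1 / (max 1 (S.x ξ)) ^ S.ρ) := by
    rw [mul_one_div, div_le_div_iff₀ (by positivity) (by positivity), one_mul,
      ← Real.mul_rpow (by positivity) (by positivity)]
    exact Real.rpow_le_rpow hmax0.le hmax S.ρ_pos.le
  calc ‖S.sol l t ξ‖ ≤ 1 * (Real.exp (s * t.re) * weight S.ρ Λ v) := h1
    _ ≤ 1 * (Real.exp (s * t.re) * (Λ * Real.exp (Λ * T) * (C * ((1 + B) ^ S.ρ *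
        (1 / (max 1 (S.x ξ)) ^ S.ρ))))) := by
        have := htail v
        gcongr
        refine hw.trans ?_
        gcongr
        exact this.trans (by gcongr)
    _ = _ := by ring

end BorelSystem

/-! ### Laplace transforms and Watson's lemma -/

theorem norm_exp_neg_mul_ofReal (u : ℂ) (t : ℝ) :
    ‖Complex.exp (-u * t)‖ = Real.exp (-u.re * t) := by
  rw [Complex.norm_exp]; simp

theorem laplace_integrand_le {g : ℂ → ℂ} {K s t : ℝ} {u : ℂ}
    (hg : ‖g t‖ ≤ K * Real.exp (s * t)) :
    ‖Complex.exp (-u * t) * g t‖ ≤ K * Real.exp (-(u.re - s) * t) := by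
  rw [norm_mul, norm_exp_neg_mul_ofReal]
  refine (mul_le_mul_of_nonneg_left hg (Real.exp_pos _).le).trans (le_of_eq ?_)
  rw [mul_left_comm, ← Real.exp_add]
  ring_nf

theorem integrableOn_exp_neg {c : ℝ} (hc : 0 < c) (K : ℝ) :
    IntegrableOn (fun t : ℝ => K * Real.exp (-c * t)) (Ioi 0) :=
  (integrableOn_exp_mul_Ioi (by linarith) 0).const_mul K

theorem laplace_integrableOn {g : ℂ → ℂ} {K s : ℝ} {u : ℂ} (hu : s < u.re)
    (hc : ContinuousOn (fun t : ℝ => g t) (Ioi 0))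
    (hg : ∀ t : ℝ, 0 < t → ‖g t‖ ≤ K * Real.exp (s * t)) :
    IntegrableOn (fun t : ℝ => Complex.exp (-u * t) * g t) (Ioi 0) := by
  refine (integrableOn_exp_neg (sub_pos.2 hu) K).mono' ?_ ?_
  · refine ContinuousOn.aestronglyMeasurable ?_ measurableSet_Ioi
    exact (Continuous.continuousOn (by fun_prop)).mul hc
  · exact (ae_restrict_iff' measurableSet_Ioi).2 (Eventually.of_forall fun t ht =>
      laplace_integrand_le (hg t ht))

theorem norm_laplace_le {g : ℂ → ℂ} {K s : ℝ} {u : ℂ} (hu : s < u.re)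
    (hg : ∀ t : ℝ, 0 < t → ‖g t‖ ≤ K * Real.exp (s * t)) :
    ‖laplace g u‖ ≤ K / (u.re - s) := by
  refine (norm_integral_le_of_norm_le (integrableOn_exp_neg (sub_pos.2 hu) K)
    ((ae_restrict_iff' measurableSet_Ioi).2 (Eventually.of_forall fun t ht =>
      laplace_integrand_le (hg t ht)))).trans (le_of_eq ?_)
  rw [integral_const_mul, integral_exp_mul_Ioi (by linarith)]
  have : u.re - s ≠ 0 := (sub_pos.2 hu).ne'
  have h2 : -(u.re - s) ≠ 0 := neg_ne_zero.2 this
  simp only [mul_zero, Real.exp_zero]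
  field_simp

theorem ofReal_continuousOn {R : ℝ} (hR : 0 < R) {g : ℂ → ℂ} (hd : DifferentiableOn ℂ g (U R)) :
    ContinuousOn (fun t : ℝ => g t) (Ici 0) :=
  hd.continuousOn.comp (by fun_prop) fun _ ht => BorelSystem.ofReal_mem_U hR ht

/-- Integration by parts; the boundary term at infinity vanishes because `Re u > s`. -/
theorem laplace_deriv {R : ℝ} (hR : 0 < R) {g : ℂ → ℂ} (hd : DifferentiableOn ℂ g (U R))
    {K K' s : ℝ} {u : ℂ} (hu : s < u.re)
    (hg : ∀ t : ℝ, 0 ≤ t → ‖g t‖ ≤ K * Real.exp (s * t))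
    (hg' : ∀ t : ℝ, 0 ≤ t → ‖deriv g t‖ ≤ K' * Real.exp (s * t)) :
    laplace (deriv g) u = u * laplace g u - g 0 := by
  have hd' : DifferentiableOn ℂ (deriv g) (U R) := hd.deriv (isOpen_U R)
  have hi := laplace_integrableOn hu ((ofReal_continuousOn hR hd).mono Ioi_subset_Ici_self)
    fun t ht => hg t ht.le
  have hi' := laplace_integrableOn hu ((ofReal_continuousOn hR hd').mono Ioi_subset_Ici_self)
    fun t ht => hg' t ht.le
  have hder : ∀ t ∈ Ici (0 : ℝ), HasDerivAt (fun t : ℝ => Complex.exp (-u * t) * g t)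
      (Complex.exp (-u * t) * deriv g t - u * (Complex.exp (-u * t) * g t)) t := fun t ht => by
    have h1 : HasDerivAt g (deriv g t) (t : ℂ) :=
      (hd.differentiableAt ((isOpen_U R).mem_nhds (BorelSystem.ofReal_mem_U hR ht))).hasDerivAt
    have h2 : HasDerivAt (fun z : ℂ => Complex.exp (-u * z)) (Complex.exp (-u * t) * -u) (t : ℂ) := by
      simpa using ((hasDerivAt_id (t : ℂ)).const_mul (-u)).cexp
    have h3 := (h2.mul h1).comp_ofReal
    refine h3.congr_deriv ?_
    ring
  have hlim : Tendsto (fun t : ℝ => Complex.exp (-u * t) * g t) atTop (𝓝 0) := by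
    have h0 : Tendsto (fun t : ℝ => K * Real.exp (-(u.re - s) * t)) atTop (𝓝 0) := by
      have h1 : Tendsto (fun t : ℝ => -(u.re - s) * t) atTop atBot :=
        tendsto_id.const_mul_atTop_of_neg (by linarith)
      simpa using (Real.tendsto_exp_atBot.comp h1).const_mul K
    refine squeeze_zero_norm' ?_ h0
    filter_upwards [eventually_ge_atTop 0] with t ht using laplace_integrand_le (hg t ht)
  have h := integral_Ioi_of_hasDerivAt_of_tendsto' hder (hi'.sub (hi.const_mul u)) hlim
  rw [integral_sub hi' (hi.const_mul u), integral_const_mul] at h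
  simp only [Complex.ofReal_zero, mul_zero, Complex.exp_zero, one_mul, zero_sub] at h
  unfold laplace
  linear_combination h

theorem closedBall_subset_U {R t : ℝ} (hR : 0 < R) (ht : 0 ≤ t) :
    Metric.closedBall (t : ℂ) (R / 2) ⊆ U R := fun z hz => by
  refine mem_U_iff.2 ⟨t, ht, ?_⟩
  rw [Metric.mem_closedBall, dist_eq_norm] at hz
  linarith

/-- Cauchy's estimate on discs of radius `R / 2` centred on the axis. The exponential rate is
unchanged, and the constant is independent of `t` and linear in `K`, so decay of `K` in `ξ` passes
to the derivatives. -/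
theorem norm_iteratedDeriv_le_axis {R : ℝ} (hR : 0 < R) {f : ℂ → ℂ}
    (hd : DifferentiableOn ℂ f (U R)) {K s : ℝ} (hK : 0 ≤ K) (hs : 0 ≤ s)
    (hf : ∀ t ∈ U R, ‖f t‖ ≤ K * Real.exp (s * t.re)) (N : ℕ) (t : ℝ) (ht : 0 ≤ t) :
    ‖iteratedDeriv N f t‖ ≤ N.factorial * (K * Real.exp (s * (R / 2))) / (R / 2) ^ N *
      Real.exp (s * t) := by
  have h := Complex.norm_iteratedDeriv_le_of_forall_mem_sphere_norm_le (c := (t : ℂ))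
    (C := K * Real.exp (s * (R / 2)) * Real.exp (s * t)) N (half_pos hR)
    (f := f) ?_ ?_
  · refine h.trans (le_of_eq ?_)
    ring
  · exact DifferentiableOn.diffContOnCl (hd.mono
      (Metric.closure_ball_subset_closedBall.trans (closedBall_subset_U hR ht)))
  · intro z hz
    have hz' := Metric.sphere_subset_closedBall hz
    refine (hf z (closedBall_subset_U hR ht hz')).trans ?_
    rw [mul_assoc, ← Real.exp_add]
    refine mul_le_mul_of_nonneg_left (Real.exp_le_exp.2 ?_) hK
    rw [Metric.mem_closedBall, dist_eq_norm] at hz'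
    have h1 := Complex.re_le_norm (z - t)
    simp only [Complex.sub_re, Complex.ofReal_re] at h1
    nlinarith

theorem differentiableOn_iteratedDeriv {V : Set ℂ} (hV : IsOpen V) {f : ℂ → ℂ}
    (hd : DifferentiableOn ℂ f V) (N : ℕ) : DifferentiableOn ℂ (iteratedDeriv N f) V := by
  induction N with
  | zero => simpa using hd
  | succ N ih => rw [iteratedDeriv_succ]; exact ih.deriv hV

/-- Watson's lemma with an exact remainder. -/
theorem laplace_eq_sum_add {R : ℝ} (hR : 0 < R) {f : ℂ → ℂ}
    (hd : DifferentiableOn ℂ f (U R)) {K s : ℝ} (hK : 0 ≤ K) (hs : 0 ≤ s)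
    (hf : ∀ t ∈ U R, ‖f t‖ ≤ K * Real.exp (s * t.re)) {u : ℂ} (hu : s < u.re) (N : ℕ) :
    laplace f u = ∑ m ∈ Finset.range N, iteratedDeriv m f 0 / u ^ (m + 1) +
      laplace (iteratedDeriv N f) u / u ^ N := by
  have hu0 : u ≠ 0 := by rintro rfl; simp at hu; linarith
  induction N with
  | zero => simp
  | succ N ih =>
    have h := laplace_deriv hR (differentiableOn_iteratedDeriv (isOpen_U R) hd N) hu
      (norm_iteratedDeriv_le_axis hR hd hK hs hf N)
      (fun t ht => by
        have := norm_iteratedDeriv_le_axis hR hd hK hs hf (N + 1) t ht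
        rwa [iteratedDeriv_succ] at this)
    rw [ih, Finset.sum_range_succ, iteratedDeriv_succ, h]
    field_simp
    ring

theorem watson {R : ℝ} (hR : 0 < R) {E : Set ℂ} {F : ℂ → ℂ → ℂ}
    (hd : ∀ ξ ∈ E, DifferentiableOn ℂ (fun t => F t ξ) (U R)) {K s s' : ℝ} (hK : 0 ≤ K) (hs : 0 ≤ s)
    (hss' : s < s')
    (hf : ∀ ξ ∈ E, ∀ t ∈ U R, ‖F t ξ‖ ≤ K * Real.exp (s * t.re)) (N : ℕ) (hN : 1 ≤ N) :
    ∃ C : ℝ, ∀ u : ℂ, s' ≤ u.re → ∀ ξ ∈ E,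
      ‖laplace (fun t => F t ξ) u -
        ∑ m ∈ Finset.Ico 1 N, iteratedDeriv (m - 1) (fun t => F t ξ) 0 / u ^ m‖ ≤ C / ‖u‖ ^ N := by
  set K' : ℕ → ℝ := fun N => N.factorial * (K * Real.exp (s * (R / 2))) / (R / 2) ^ N with hK'
  -- The expansion is carried one term further than the stated sum: the first summand bounds that
  -- extra term, the second the remaining Laplace integral.
  refine ⟨K' (N - 1) + K' N / (s' - s), fun u hu ξ hξ => ?_⟩
  have hu' : s < u.re := hss'.trans_le hu
  have hu0 : u ≠ 0 := by rintro rfl; simp at hu'; linarith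
  have h := laplace_eq_sum_add hR (hd ξ hξ) hK hs (hf ξ hξ) hu' N
  obtain ⟨M, rfl⟩ : ∃ M, N = M + 1 := ⟨N - 1, by omega⟩
  have hsum : ∑ m ∈ Finset.Ico 1 (M + 1), iteratedDeriv (m - 1) (fun t => F t ξ) 0 / u ^ m =
      ∑ m ∈ Finset.range M, iteratedDeriv m (fun t => F t ξ) 0 / u ^ (m + 1) := by
    rw [Finset.sum_Ico_eq_sum_range]
    refine Finset.sum_congr (by simp) fun m _ => ?_
    rw [Nat.add_sub_cancel_left, add_comm]
  rw [hsum, h, Finset.sum_range_succ, add_assoc, add_sub_cancel_left]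
  have hax := norm_iteratedDeriv_le_axis hR (hd ξ hξ) hK hs (hf ξ hξ)
  have h1 : ‖iteratedDeriv M (fun t => F t ξ) 0 / u ^ (M + 1)‖ ≤ K' M / ‖u‖ ^ (M + 1) := by
    rw [norm_div, norm_pow]
    have := hax M 0 le_rfl
    simp only [mul_zero, Real.exp_zero, mul_one, Complex.ofReal_zero] at this
    gcongr
  have h2 : ‖laplace (iteratedDeriv (M + 1) (fun t => F t ξ)) u / u ^ (M + 1)‖ ≤
      K' (M + 1) / (s' - s) / ‖u‖ ^ (M + 1) := by
    rw [norm_div, norm_pow]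
    have h3 := norm_laplace_le hu' (fun t ht => hax (M + 1) t ht.le)
    have h4 : 0 ≤ K' (M + 1) := by positivity
    refine div_le_div_of_nonneg_right (h3.trans ?_) (by positivity)
    exact div_le_div_of_nonneg_left h4 (by linarith) (by linarith)
  refine (norm_add_le _ _).trans ((add_le_add h1 h2).trans (le_of_eq ?_))
  rw [Nat.add_sub_cancel]
  ring

/-- Laplace transforms turn convolutions into products. -/
theorem laplace_convolution {k Q : ℂ → ℂ} {u : ℂ}
    (hk : IntegrableOn (fun t : ℝ => Complex.exp (-u * t) * k t) (Ioi 0))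
    (hQ : IntegrableOn (fun t : ℝ => Complex.exp (-u * t) * Q t) (Ioi 0)) :
    IntegrableOn (fun t : ℝ => Complex.exp (-u * t) *
      ∫ τ in Ioc (0 : ℝ) 1, (t : ℂ) * k (τ * t) * Q ((1 - τ : ℝ) * t)) (Ioi 0) ∧
    laplace (fun t => ∫ τ in Ioc (0 : ℝ) 1, t * k (τ * t) * Q ((1 - τ : ℝ) * t)) u =
      laplace k u * laplace Q u := by
  -- Rescaling `[0, x]` to `[0, 1]` and splitting `exp (-u x)` into two factors identifies the
  -- integrand with an ordinary one-sided convolution.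
  have hEq : EqOn (fun x : ℝ => ∫ t in (0 : ℝ)..x,
        (ContinuousLinearMap.mul ℝ ℂ) (Complex.exp (-u * t) * k t)
          (Complex.exp (-u * (x - t : ℝ)) * Q (x - t : ℝ)))
      (fun t : ℝ => Complex.exp (-u * t) *
        ∫ τ in Ioc (0 : ℝ) 1, (t : ℂ) * k (τ * t) * Q ((1 - τ : ℝ) * t)) (Ioi 0) := by
    intro x hx
    have hx0 : (x : ℝ) ≠ 0 := ne_of_gt hx
    have h := intervalIntegral.integral_comp_mul_left (a := (0 : ℝ)) (b := 1)
      (fun t : ℝ => k t * Q (x - t : ℝ)) hx0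
    simp only [mul_zero, mul_one] at h
    simp only [ContinuousLinearMap.mul_apply']
    rw [← intervalIntegral.integral_of_le zero_le_one]
    have e1 : ∫ τ in (0 : ℝ)..1, (x : ℂ) * k (τ * x) * Q ((1 - τ : ℝ) * x) =
        x * ∫ τ in (0 : ℝ)..1, k (x * τ : ℝ) * Q ((x - x * τ : ℝ)) := by
      rw [← intervalIntegral.integral_const_mul]
      refine intervalIntegral.integral_congr fun τ _ => ?_
      rw [mul_assoc]
      congr 3
      · push_cast; ring
      · push_cast; ring
    rw [e1, h, Complex.real_smul, ← mul_assoc (x : ℂ), ← Complex.ofReal_mul, mul_inv_cancel₀ hx0,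
      Complex.ofReal_one, one_mul, ← intervalIntegral.integral_const_mul]
    refine intervalIntegral.integral_congr fun t _ => ?_
    have : Complex.exp (-u * x) = Complex.exp (-u * t) * Complex.exp (-u * (x - t : ℝ)) := by
      rw [← Complex.exp_add]; congr 1; push_cast; ring
    rw [this]; ring
  constructor
  · have h := (integrable_posConvolution hk hQ (ContinuousLinearMap.mul ℝ ℂ)).integrableOn (s := Ioi 0)
    refine IntegrableOn.congr_fun h (fun x hx => ?_) measurableSet_Ioi
    refine Eq.trans ?_ (hEq hx)
    simp only [posConvolution]
    rw [indicator_of_mem hx]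
  · have h := integral_posConvolution hk hQ (ContinuousLinearMap.mul ℝ ℂ)
    rw [setIntegral_congr_fun measurableSet_Ioi hEq] at h
    exact h

/-! ### Laplace transforms of the solution -/

namespace BorelSystem

variable {ι : Type} [Fintype ι] {S : BorelSystem ι}

variable (S) in
/-- The Laplace transforms of the solution. -/
def q (l : ι) (u ξ : ℂ) : ℂ := laplace (fun t => S.sol l t ξ) u

variable (S) in
/-- The Laplace transforms of the kernels. -/
def kHat (l m : ι) (u ξ : ℂ) : ℂ := laplace (fun t => S.k l m t ξ) u

theorem one_div_max_rpow_le_one (v : ℝ) : 1 / (max 1 v) ^ S.ρ ≤ 1 := by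
  have h : 1 ≤ (max 1 v) ^ S.ρ := Real.one_le_rpow (le_max_left _ _) S.ρ_pos.le
  rw [div_le_one (by linarith)]
  exact h

theorem exists_norm_sol_le' {s : ℝ} (hs : S.σ < s) : ∃ K > 0, ∀ l, ∀ t ∈ U S.R, ∀ ξ ∈ S.Γ,
    ‖S.sol l t ξ‖ ≤ K * Real.exp (s * t.re) := by
  obtain ⟨K, hK, h⟩ := exists_norm_sol_le (S := S) hs
  refine ⟨K, hK, fun l t ht ξ hξ => (h l t ht ξ hξ).trans ?_⟩
  exact mul_le_of_le_one_right (by positivity) (one_div_max_rpow_le_one _)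

theorem sol_differentiableOn (l : ι) {ξ : ℂ} (hξ : ξ ∈ S.Γ) :
    DifferentiableOn ℂ (fun t => S.sol l t ξ) (U S.R) := fun t ht =>
  ((sol_analytic l _ (mem_dom_of_mem ht hξ)).differentiableAt.comp (f := fun t => (t, ξ)) t
    (by fun_prop)).differentiableWithinAt

theorem k_differentiableOn (l m : ι) {ξ : ℂ} (hξ : ξ ∈ S.Γ) :
    DifferentiableOn ℂ (fun t => S.k l m t ξ) (U S.R) := fun t ht =>
  ((k_analytic l m _ (mem_dom_of_mem ht hξ)).differentiableAt.comp (f := fun t => (t, ξ)) t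
    (by fun_prop)).differentiableWithinAt

theorem sol_laplace_integrableOn (l : ι) {u : ℂ} (hu : S.σ < u.re) {ξ : ℂ} (hξ : ξ ∈ S.Γ) :
    IntegrableOn (fun t : ℝ => Complex.exp (-u * t) * S.sol l t ξ) (Ioi 0) := by
  obtain ⟨s, hs, hsu⟩ := exists_between hu
  obtain ⟨K, hK, h⟩ := exists_norm_sol_le' (S := S) hs
  exact laplace_integrableOn (g := fun t => S.sol l t ξ) hsu
    ((ofReal_continuousOn S.R_pos (sol_differentiableOn l hξ)).mono Ioi_subset_Ici_self)
    fun t ht => by simpa using h l t (ofReal_mem_U S.R_pos ht.le) ξ hξ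

theorem k_laplace_integrableOn (l m : ι) {u : ℂ} (hu : S.σ < u.re) {ξ : ℂ} (hξ : ξ ∈ S.Γ) :
    IntegrableOn (fun t : ℝ => Complex.exp (-u * t) * S.k l m t ξ) (Ioi 0) := by
  refine laplace_integrableOn (g := fun t => S.k l m t ξ) (K := S.C) hu
    ((ofReal_continuousOn S.R_pos (k_differentiableOn l m hξ)).mono Ioi_subset_Ici_self)
    fun t ht => (k_le (ofReal_mem_dom ht.le hξ)).trans ?_
  exact mul_le_of_le_one_right (mul_nonneg S.C_pos.le (Real.exp_pos _).le) (decay_le_one S.ρ_pos _)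

theorem laplace_source (l : ι) {u : ℂ} (hu : S.σ < u.re) {ξ : ℂ} (hξ : ξ ∈ S.Γ) :
    IntegrableOn (fun t : ℝ => Complex.exp (-u * t) * S.source l t ξ) (Ioi 0) ∧
    laplace (fun t => S.source l t ξ) u = S.kHat l S.j u ξ +
      ∑ m, (S.b l m ξ * S.q m u ξ + S.kHat l m u ξ * S.q m u ξ) := by
  have hq := fun m => sol_laplace_integrableOn m hu hξ
  have hk := fun m => k_laplace_integrableOn l m hu hξ
  have hc : ∀ m, IntegrableOn (fun t : ℝ => Complex.exp (-u * t) *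
      conv (S.k l m) (S.sol m) t ξ) (Ioi 0) ∧
      laplace (fun t => conv (S.k l m) (S.sol m) t ξ) u = S.kHat l m u ξ * S.q m u ξ :=
    fun m => laplace_convolution (k := fun t => S.k l m t ξ) (Q := fun t => S.sol m t ξ)
    (hk m) (hq m)
  have hm : ∀ m ∈ Finset.univ, Integrable (fun t : ℝ => S.b l m ξ * (Complex.exp (-u * t) *
      S.sol m t ξ) + Complex.exp (-u * t) * conv (S.k l m) (S.sol m) t ξ)
      (volume.restrict (Ioi 0)) := fun m _ => ((hq m).const_mul _).add (hc m).1
  have heq : (fun t : ℝ => Complex.exp (-u * t) * S.source l t ξ) = fun t : ℝ =>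
      Complex.exp (-u * t) * S.k l S.j t ξ + ∑ m, (S.b l m ξ * (Complex.exp (-u * t) *
      S.sol m t ξ) + Complex.exp (-u * t) * conv (S.k l m) (S.sol m) t ξ) := by
    funext t
    rw [source, src, one_mul, mul_add, Finset.mul_sum]
    congr 1
    refine Finset.sum_congr rfl fun m _ => ?_
    ring
  have hs := integrable_finsetSum Finset.univ hm
  constructor
  · rw [heq]
    exact (hk S.j).add hs
  · unfold laplace
    simp only
    rw [heq, integral_add (hk S.j) hs, integral_finsetSum _ hm]
    congr 1
    refine Finset.sum_congr rfl fun m _ => ?_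
    rw [integral_add ((hq m).const_mul _) (hc m).1, integral_const_mul]
    congr 1
    exact (hc m).2

/-- The Laplace transforms satisfy a first-order linear system. -/
theorem hasDerivAt_q (l : ι) {u : ℂ} (hu : S.σ < u.re) {ξ : ℂ} (hξ : ξ ∈ S.Γ) :
    HasDerivAt (S.q l u) (S.a l * u * S.q l u ξ + S.b l S.j ξ + S.kHat l S.j u ξ +
      ∑ m, (S.b l m ξ * S.q m u ξ + S.kHat l m u ξ * S.q m u ξ)) ξ := by
  obtain ⟨s, hs, hsu⟩ := exists_between hu
  have hs0 : 0 ≤ s := S.σ_nonneg.trans hs.le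
  obtain ⟨K, hK, hb⟩ := exists_norm_sol_le' (S := S) hs
  obtain ⟨r, hr, hsub⟩ := Metric.isOpen_iff.1 S.isOpen ξ hξ
  have hdξ : ∀ t : ℝ, 0 ≤ t → ∀ ζ ∈ S.Γ, DifferentiableAt ℂ (S.sol l t) ζ := fun t ht ζ hζ =>
    (sol_analytic l _ (ofReal_mem_dom ht hζ)).differentiableAt.comp (f := fun ζ => ((t : ℂ), ζ)) ζ
      (by fun_prop)
  have hder := (hasDerivAt_integral_of_differentiableOn (μ := volume.restrict (Ioi (0 : ℝ)))
    (F := fun ζ (t : ℝ) => Complex.exp (-u * t) * S.sol l t ζ) (z₀ := ξ) hr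
    (fun ζ hζ => (sol_laplace_integrableOn l hu (hsub hζ)).aestronglyMeasurable)
    ((ae_restrict_iff' measurableSet_Ioi).2 (Eventually.of_forall fun t ht ζ hζ =>
      ((hdξ t (le_of_lt ht) ζ (hsub hζ)).const_mul _).differentiableWithinAt))
    ((ae_restrict_iff' measurableSet_Ioi).2 (Eventually.of_forall fun t ht ζ hζ =>
      laplace_integrand_le (g := fun t => S.sol l t ζ) (K := K) (s := s) (by
        simpa using hb l t (ofReal_mem_U S.R_pos (le_of_lt ht)) ζ (hsub hζ))))
    (integrableOn_exp_neg (sub_pos.2 hsu) K)).2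
  have hlap := laplace_deriv S.R_pos (sol_differentiableOn l hξ) hsu (K := K)
    (fun t ht => by simpa using hb l t (ofReal_mem_U S.R_pos ht) ξ hξ)
    (fun t ht => by
      have := norm_iteratedDeriv_le_axis S.R_pos (sol_differentiableOn l hξ) hK.le hs0
        (fun t ht => hb l t ht ξ hξ) 1 t ht
      rwa [iteratedDeriv_one] at this)
  have hint : IntegrableOn (fun t : ℝ => Complex.exp (-u * t) *
      deriv (fun t => S.sol l t ξ) t) (Ioi 0) := by
    refine laplace_integrableOn (K := (1 : ℕ).factorial * (K * Real.exp (s * (S.R / 2))) /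
      (S.R / 2) ^ 1) hsu ((ofReal_continuousOn S.R_pos
      ((sol_differentiableOn l hξ).deriv (isOpen_U _))).mono Ioi_subset_Ici_self) fun t ht => ?_
    have := norm_iteratedDeriv_le_axis S.R_pos (sol_differentiableOn l hξ) hK.le hs0
        (fun t ht => hb l t ht ξ hξ) 1 t ht.le
    rwa [iteratedDeriv_one] at this
  obtain ⟨hsi, hsl⟩ := laplace_source l hu hξ
  -- The differential equation replaces `∂_ξ` by `a l ∂_t` plus the source. Integrating `∂_t` by
  -- parts produces `-a l Q_l(0, ξ)`, which equals `b_{l,j}` by `sol_zero`.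
  have hval : ∫ t in Ioi (0 : ℝ), deriv (fun ζ => Complex.exp (-u * t) * S.sol l t ζ) ξ =
      S.a l * (u * S.q l u ξ - S.sol l 0 ξ) + laplace (fun t => S.source l t ξ) u := by
    have h1 : EqOn (fun t : ℝ => deriv (fun ζ => Complex.exp (-u * t) * S.sol l t ζ) ξ)
        (fun t : ℝ => S.a l * (Complex.exp (-u * t) * deriv (fun t => S.sol l t ξ) t) +
          Complex.exp (-u * t) * S.source l t ξ) (Ioi 0) := fun t ht => by
      simp only
      rw [deriv_const_mul _ (hdξ t (le_of_lt ht) ξ hξ), ← sol_pde l ht hξ]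
      ring
    rw [setIntegral_congr_fun measurableSet_Ioi h1, integral_add (hint.const_mul _) hsi,
      integral_const_mul]
    congr 2
  rw [hval, hsl, mul_sub, sol_zero hξ] at hder
  refine HasDerivAt.congr_deriv hder ?_
  ring

/-- Joint analyticity of the Laplace transforms. -/
theorem q_analytic (l : ι) :
    AnalyticOnNhd ℂ (fun p : ℂ × ℂ => S.q l p.1 p.2) ({u : ℂ | S.σ < u.re} ×ˢ S.Γ) := by
  have hopen : IsOpen ({u : ℂ | S.σ < u.re} ×ˢ S.Γ) :=
    (isOpen_lt continuous_const Complex.continuous_re).prod S.isOpen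
  refine analyticOnNhd_integral hopen
    (F := fun p (t : ℝ) => Complex.exp (-p.1 * t) * S.sol l t p.2)
    (fun p hp => (sol_laplace_integrableOn l hp.1 hp.2).aestronglyMeasurable)
    ((ae_restrict_iff' measurableSet_Ioi).2 (Eventually.of_forall fun t ht p hp => ?_))
    fun p hp => ?_
  · refine AnalyticAt.mul ?_ ?_
    · exact ((analyticAt_fst.neg).mul analyticAt_const).cexp
    · exact (sol_analytic l _ (ofReal_mem_dom (le_of_lt ht) hp.2)).comp
        (f := fun p : ℂ × ℂ => ((t : ℂ), p.2)) (analyticAt_const.prod analyticAt_snd)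
  · obtain ⟨s', hs', hsu⟩ := exists_between (show S.σ < p.1.re from hp.1)
    obtain ⟨s, hs, hss'⟩ := exists_between hs'
    obtain ⟨K, hK, hb⟩ := exists_norm_sol_le' (S := S) hs
    refine ⟨{q | s' < q.1.re}, (isOpen_lt continuous_const
      (Complex.continuous_re.comp continuous_fst)).mem_nhds hsu, _,
      integrableOn_exp_neg (sub_pos.2 hss') K, ?_⟩
    refine (ae_restrict_iff' measurableSet_Ioi).2 (Eventually.of_forall fun t ht q hq hq' => ?_)
    refine (laplace_integrand_le (g := fun t => S.sol l t q.2) (K := K) (s := s) (by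
        simpa using hb l t (ofReal_mem_U S.R_pos (le_of_lt ht)) q.2 hq'.2)).trans ?_
    refine mul_le_mul_of_nonneg_left (Real.exp_le_exp.2 ?_) hK.le
    have h1 : s' < q.1.re := hq
    have h2 : 0 < t := ht
    nlinarith

theorem exists_norm_q_le {u : ℂ} (hu : S.σ < u.re) : ∃ K > 0, ∀ l, ∀ ξ ∈ S.Γ,
    ‖S.q l u ξ‖ ≤ K * (1 / (max 1 (S.x ξ)) ^ S.ρ) := by
  obtain ⟨s, hs, hsu⟩ := exists_between hu
  obtain ⟨K, hK, hb⟩ := exists_norm_sol_le (S := S) hs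
  have : 0 < u.re - s := sub_pos.2 hsu
  refine ⟨K / (u.re - s), by positivity, fun l ξ hξ => ?_⟩
  have h := norm_laplace_le (g := fun t => S.sol l t ξ) (K := K * (1 / (max 1 (S.x ξ)) ^ S.ρ)) hsu
    fun t ht => by
      have := hb l t (ofReal_mem_U S.R_pos ht.le) ξ hξ
      simp only [Complex.ofReal_re] at this
      linarith
  refine h.trans (le_of_eq ?_)
  ring

end BorelSystem

/-! ### Roots of unity and angles -/

theorem omega_eq_pow (n l : ℕ) : omega n l = Complex.exp (2 * Real.pi * Complex.I / n) ^ l := by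
  rw [omega, ← Complex.exp_nat_mul]
  congr 1
  ring

theorem norm_omega (n l : ℕ) : ‖omega n l‖ = 1 := by
  rw [omega, show (2 * Real.pi * Complex.I * l / n : ℂ) = ((2 * Real.pi * l / n : ℝ) : ℂ) * Complex.I by
    push_cast; ring]
  exact Complex.norm_exp_ofReal_mul_I _

theorem omega_ne_zero (n l : ℕ) : omega n l ≠ 0 := Complex.exp_ne_zero _

theorem omega_pow {n : ℕ} (hn : n ≠ 0) (l : ℕ) : omega n l ^ n = 1 := by
  rw [omega_eq_pow, ← pow_mul, mul_comm l n, pow_mul, (Complex.isPrimitiveRoot_exp n hn).pow_eq_one,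
    one_pow]

theorem omega_injective {n : ℕ} (hn : n ≠ 0) {l m : Fin n} (h : omega n l = omega n m) : l = m := by
  rw [omega_eq_pow, omega_eq_pow] at h
  exact Fin.ext ((Complex.isPrimitiveRoot_exp n hn).pow_inj l.2 m.2 h)

theorem sum_omega_pow {n : ℕ} (hn : n ≠ 0) (k : ℕ) :
    ∑ l : Fin n, omega n l ^ k = if n ∣ k then (n : ℂ) else 0 := by
  have hζ := Complex.isPrimitiveRoot_exp n hn
  set ζ := Complex.exp (2 * Real.pi * Complex.I / n) with hζd
  have h1 : ∀ l : Fin n, omega n l ^ k = (ζ ^ k) ^ (l : ℕ) := fun l => by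
    rw [omega_eq_pow, ← hζd, ← pow_mul, ← pow_mul, mul_comm]
  simp only [h1]
  rw [Fin.sum_univ_eq_sum_range (fun l => (ζ ^ k) ^ l) n]
  split_ifs with h
  · rw [(hζ.pow_eq_one_iff_dvd k).2 h]; simp
  · have hne : ζ ^ k ≠ 1 := fun h' => h ((hζ.pow_eq_one_iff_dvd k).1 h')
    rw [geom_sum_eq hne, ← pow_mul, mul_comm k n, pow_mul, hζ.pow_eq_one, one_pow, sub_self, zero_div]

/-- The left side is the part of the binomial expansion of degree at least two, whose coefficients
are nonnegative. -/
theorem norm_one_add_pow_sub_le (z : ℂ) (n : ℕ) :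
    ‖(1 + z) ^ n - 1 - n * z‖ ≤ (1 + ‖z‖) ^ n - 1 - n * ‖z‖ := by
  induction n with
  | zero => simp
  | succ n ih =>
    have e : (1 + z) ^ (n + 1) - 1 - ((n + 1 : ℕ) : ℂ) * z =
        ((1 + z) ^ n - 1 - n * z) * (1 + z) + n * z ^ 2 := by push_cast; ring
    rw [e]
    have h1 : ‖1 + z‖ ≤ 1 + ‖z‖ := (norm_add_le _ _).trans (by rw [norm_one])
    calc ‖((1 + z) ^ n - 1 - n * z) * (1 + z) + n * z ^ 2‖
        ≤ ‖((1 + z) ^ n - 1 - n * z)‖ * ‖1 + z‖ + n * ‖z‖ ^ 2 := by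
          refine (norm_add_le _ _).trans ?_
          rw [norm_mul, norm_mul, norm_pow, Complex.norm_natCast]
      _ ≤ ((1 + ‖z‖) ^ n - 1 - n * ‖z‖) * (1 + ‖z‖) + n * ‖z‖ ^ 2 := by
          gcongr
          exact (norm_nonneg _).trans ih
      _ = _ := by push_cast; ring

/-- By strict convexity the graph of `(1 + x) ^ n` lies strictly below the line `1 + 2 n x` between
its intersections at `0` and `𝔞ₙ`. -/
theorem aSeq_le_of_le {n : ℕ} (hn : 2 ≤ n) {a : ℝ} (ha : 0 < a) (h : 1 + 2 * n * a ≤ (1 + a) ^ n) :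
    aSeq n ≤ a := by
  by_contra! hab
  have hb := aSeq_pos n hn
  have hB := aSeq_eq n hn
  set b := aSeq n
  have hc := (strictConvexOn_pow hn).2 (show 1 + b ∈ Ici (0 : ℝ) by
      simp only [Set.mem_Ici]; linarith) (show (1 : ℝ) ∈ Ici (0 : ℝ) by simp) (by linarith)
    (show 0 < a / b by positivity) (show 0 < 1 - a / b by rw [sub_pos, div_lt_one hb]; exact hab)
    (by ring)
  simp only [smul_eq_mul, one_pow, mul_one] at hc
  have e1 : a / b * (1 + b) + (1 - a / b) = 1 + a := by field_simp; ring
  have e2 : a / b * (1 + 2 * n * b) + (1 - a / b) = 1 + 2 * n * a := by field_simp; ring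
  rw [e1, hB, e2] at hc
  linarith

/-- The distance between distinct roots of unity is at least `𝔞ₙ`. -/
theorem aSeq_le_norm_omega_sub {n : ℕ} (hn : 2 ≤ n) {l j : Fin n} (hlj : l ≠ j) :
    aSeq n ≤ ‖omega n l - omega n j‖ := by
  have hn0 : n ≠ 0 := by omega
  have hne : omega n l - omega n j ≠ 0 := sub_ne_zero.2 fun h => hlj (omega_injective hn0 h)
  refine aSeq_le_of_le hn (norm_pos_iff.2 hne) ?_
  have hj0 := omega_ne_zero n j
  -- Since `(1 + z) ^ n = 1`, the terms of degree at least two add up to `-n z`. Hence `n ‖z‖ ≤ (1 +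
  -- ‖z‖) ^ n - 1 - n ‖z‖`, which is the inequality defining `𝔞ₙ`.
  set z := (omega n l - omega n j) / omega n j with hz
  have hnz : ‖z‖ = ‖omega n l - omega n j‖ := by rw [hz, norm_div, norm_omega, div_one]
  have h1 : (1 + z) ^ n = 1 := by
    have : 1 + z = omega n l / omega n j := by rw [hz]; field_simp; ring
    rw [this, div_pow, omega_pow hn0, omega_pow hn0, div_one]
  have h := norm_one_add_pow_sub_le z n
  rw [h1, sub_self, zero_sub, norm_neg, norm_mul, Complex.norm_natCast, hnz] at h
  linarith

theorem omega_sub_eq {n : ℕ} {j l : Fin n} (hlj : l ≠ j) :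
    omega n l - omega n j =
      ‖omega n l - omega n j‖ * Complex.exp (-(theta n j l : ℂ) * Complex.I) := by
  have h := theta_eq_neg_arg n j l hlj
  rw [← Real.Angle.coe_neg, Real.Angle.angle_eq_iff_two_pi_dvd_sub] at h
  obtain ⟨k, hk⟩ := h
  conv_lhs => rw [← Complex.norm_mul_exp_arg_mul_I (omega n l - omega n j)]
  congr 1
  rw [Complex.exp_eq_exp_iff_exists_int]
  refine ⟨k, ?_⟩
  have : (Complex.arg (omega n l - omega n j) : ℝ) = -theta n j l + 2 * Real.pi * k := by linarith
  rw [this]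
  push_cast
  ring

/-- The characteristics for real `t` run in the directions `θ_{j,l}`, under which `Γ` is invariant.
-/
theorem ofReal_div_omega_sub {n : ℕ} {j l : Fin n} (hlj : l ≠ j) (s : ℝ) :
    (s : ℂ) / (omega n l - omega n j) =
      ((s / ‖omega n l - omega n j‖ : ℝ) : ℂ) * Complex.exp (theta n j l * Complex.I) := by
  have h := omega_sub_eq hlj
  have hexp : Complex.exp (-(theta n j l : ℂ) * Complex.I) ≠ 0 := Complex.exp_ne_zero _
  have h2 : Complex.exp (theta n j l * Complex.I) *
      Complex.exp (-(theta n j l : ℂ) * Complex.I) = 1 := by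
    rw [← Complex.exp_add]; simp
  have h3 : (Complex.exp (-(theta n j l : ℂ) * Complex.I))⁻¹ = Complex.exp (theta n j l * Complex.I) :=
    (eq_inv_of_mul_eq_one_left h2).symm
  rw [h, div_mul_eq_div_div, div_eq_mul_inv _ (Complex.exp _), h3, ← h]
  push_cast
  rfl

/-- Half of the spread of the angles. -/
def halfSpread (n : ℕ) : ℝ := ((n : ℝ) - 2) / (2 * n) * Real.pi

theorem halfSpread_nonneg {n : ℕ} (hn : 2 ≤ n) : 0 ≤ halfSpread n := by
  have : (2 : ℝ) ≤ n := by exact_mod_cast hn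
  exact mul_nonneg (div_nonneg (by linarith) (by positivity)) Real.pi_pos.le

theorem halfSpread_lt {n : ℕ} (hn : 2 ≤ n) : halfSpread n < Real.pi / 2 := by
  have : (2 : ℝ) ≤ n := by exact_mod_cast hn
  have h : ((n : ℝ) - 2) / (2 * n) < 1 / 2 := by
    rw [div_lt_div_iff₀ (by positivity) (by positivity)]; linarith
  have := mul_lt_mul_of_pos_right h Real.pi_pos
  unfold halfSpread
  linarith

theorem cos_halfSpread_pos {n : ℕ} (hn : 2 ≤ n) : 0 < Real.cos (halfSpread n) :=
  Real.cos_pos_of_mem_Ioo ⟨by linarith [halfSpread_nonneg hn, Real.pi_pos], halfSpread_lt hn⟩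

theorem thetaMin_eq_sub {n : ℕ} (hn : 2 ≤ n) (j : Fin n) :
    thetaMin n j = thetaMid n j - halfSpread n := by
  have := theta_spread n hn j
  rw [thetaMid, halfSpread]
  have e : ((n : ℝ) - 2) / (2 * n) * Real.pi = (((n : ℝ) - 2) / n * Real.pi) / 2 := by
    field_simp
  rw [e, ← this]; ring

theorem thetaMax_eq_add {n : ℕ} (hn : 2 ≤ n) (j : Fin n) :
    thetaMax n j = thetaMid n j + halfSpread n := by
  have := theta_spread n hn j
  rw [thetaMid, halfSpread]
  have e : ((n : ℝ) - 2) / (2 * n) * Real.pi = (((n : ℝ) - 2) / n * Real.pi) / 2 := by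
    field_simp
  rw [e, ← this]; ring

theorem abs_theta_sub_le {n : ℕ} (hn : 2 ≤ n) {j l : Fin n} (hlj : l ≠ j) :
    |theta n j l - thetaMid n j| ≤ halfSpread n := by
  have h := theta_le_and_ge n j l hlj
  rw [← thetaMin_eq n hn, ← thetaMax_eq n hn, thetaMin_eq_sub hn, thetaMax_eq_add hn] at h
  rw [abs_le]
  constructor <;> linarith [h.1, h.2]

theorem cos_theta_sub_ge {n : ℕ} (hn : 2 ≤ n) {j l : Fin n} (hlj : l ≠ j) :
    Real.cos (halfSpread n) ≤ Real.cos (theta n j l - thetaMid n j) := by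
  rw [← Real.cos_abs (theta n j l - thetaMid n j)]
  exact Real.cos_le_cos_of_nonneg_of_le_pi (abs_nonneg _)
    (by linarith [halfSpread_lt hn, Real.pi_pos]) (abs_theta_sub_le hn hlj)

theorem exists_theta_eq_min_max {n : ℕ} (hn : 2 ≤ n) (j : Fin n) :
    (∃ l : Fin n, l ≠ j ∧ theta n j l = thetaMin n j) ∧
      ∃ l : Fin n, l ≠ j ∧ theta n j l = thetaMax n j := by
  have : Nonempty {l : Fin n // l ≠ j} := by
    by_cases hj : (j : ℕ) = 0
    · exact ⟨⟨⟨1, by omega⟩, fun h => by have := congrArg Fin.val h; simp at this; omega⟩⟩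
    · exact ⟨⟨⟨0, by omega⟩, fun h => by have := congrArg Fin.val h; simp at this; omega⟩⟩
  constructor
  · obtain ⟨⟨l, hl⟩, h⟩ := exists_eq_ciInf_of_finite (f := fun l : {l : Fin n // l ≠ j} => theta n j l)
    exact ⟨l, hl, h⟩
  · obtain ⟨⟨l, hl⟩, h⟩ := exists_eq_ciSup_of_finite (f := fun l : {l : Fin n // l ≠ j} => theta n j l)
    exact ⟨l, hl, h⟩

/-- The direction `e^{iθ_j}`. -/
def dir (n : ℕ) (j : Fin n) : ℂ := Complex.exp (thetaMid n j * Complex.I)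

/-- Two unit vectors at angles `θ_j ± δ` add up to `2 cos δ` times the one at angle `θ_j`. -/
theorem dir_eq {n : ℕ} (hn : 2 ≤ n) (j : Fin n) :
    dir n j = ((1 / (2 * Real.cos (halfSpread n)) : ℝ) : ℂ) *
      (Complex.exp (thetaMin n j * Complex.I) + Complex.exp (thetaMax n j * Complex.I)) := by
  rw [thetaMin_eq_sub hn, thetaMax_eq_add hn, dir]
  have hc : (Complex.cos (halfSpread n) : ℂ) ≠ 0 := by
    rw [← Complex.ofReal_cos]
    exact_mod_cast (cos_halfSpread_pos hn).ne'
  have e1 : Complex.exp (((thetaMid n j - halfSpread n : ℝ) : ℂ) * Complex.I) =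
      Complex.exp (thetaMid n j * Complex.I) * Complex.exp (-(halfSpread n) * Complex.I) := by
    rw [← Complex.exp_add]; congr 1; push_cast; ring
  have e2 : Complex.exp (((thetaMid n j + halfSpread n : ℝ) : ℂ) * Complex.I) =
      Complex.exp (thetaMid n j * Complex.I) * Complex.exp ((halfSpread n) * Complex.I) := by
    rw [← Complex.exp_add]; congr 1; push_cast; ring
  have e3 : Complex.exp (-(halfSpread n) * Complex.I) + Complex.exp ((halfSpread n) * Complex.I) =
      2 * Complex.cos (halfSpread n) := by
    rw [Complex.two_cos]; ring
  rw [e1, e2, ← mul_add, e3]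
  push_cast
  field_simp

/-- The middle direction is a positive combination of the two extreme ones, so one goes along the
first and then along the second. -/
theorem ray_mid_mem {n : ℕ} (hn : 2 ≤ n) {Δ : Set ℂ} {d : ℝ} {j : Fin n} {Γ : Set ℂ}
    (hΓ : IsAdmissibleSubdomain n Δ d j Γ) {ξ : ℂ} (hξ : ξ ∈ Γ) {s : ℝ} (hs : 0 ≤ s) :
    ξ + s * dir n j ∈ Γ := by
  obtain ⟨⟨l₁, hl₁, h₁⟩, ⟨l₂, hl₂, h₂⟩⟩ := exists_theta_eq_min_max hn j
  have hc := cos_halfSpread_pos hn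
  have hs' : 0 ≤ s * (1 / (2 * Real.cos (halfSpread n))) := by positivity
  have h := hΓ.ray_mem _ (hΓ.ray_mem ξ hξ l₁ hl₁ _ hs') l₂ hl₂ _ hs'
  rw [h₁, h₂, ray, ray] at h
  convert h using 1
  rw [dir_eq hn]
  push_cast
  ring

/-- A ball of radius `d` about a point of `Γ` is connected, meets `Δ` and avoids its frontier, so it
lies in `Δ`. -/
theorem thickening_subset {n : ℕ} {Δ : Set ℂ} (hΔ : IsOpen Δ) {d : ℝ} {j : Fin n} {Γ : Set ℂ}
    (hΓ : IsAdmissibleSubdomain n Δ d j Γ) : Metric.thickening d Γ ⊆ Δ := by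
  intro ζ hζ
  obtain ⟨ξ, hξ, hd⟩ := Metric.mem_thickening_iff.1 hζ
  have hd0 : 0 < d := dist_nonneg.trans_lt hd
  refine (convex_ball ξ d).isPreconnected.subset_left_of_subset_union hΔ
    (isClosed_closure.isOpen_compl) (disjoint_compl_right_iff_subset.2 subset_closure) ?_
    ⟨ξ, Metric.mem_ball_self hd0, hΓ.subset hξ⟩ (Metric.mem_ball.2 hd)
  intro z hz
  by_contra hne
  rw [mem_union, not_or, mem_compl_iff, not_not] at hne
  have hfr : z ∈ frontier Δ := by rw [hΔ.frontier_eq]; exact ⟨hne.2, hne.1⟩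
  have := hΓ.dist_boundary ξ hξ z hfr
  rw [Metric.mem_ball, dist_comm] at hz
  linarith

theorem norm_dir (n : ℕ) (j : Fin n) : ‖dir n j‖ = 1 := Complex.norm_exp_ofReal_mul_I _

theorem conj_dir (n : ℕ) (j : Fin n) :
    (starRingEnd ℂ) (dir n j) = Complex.exp (-(thetaMid n j : ℂ) * Complex.I) := by
  rw [dir, ← Complex.exp_conj]
  congr 1
  simp

/-- The quotient has argument `θ_{j,l} - θ_j`, at most `halfSpread n < π / 2` in absolute value, and
modulus at least `1 / 2`. -/
theorem re_conj_dir_div {n : ℕ} (hn : 2 ≤ n) {j l : Fin n} (hlj : l ≠ j) :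
    Real.cos (halfSpread n) / 2 ≤ ((starRingEnd ℂ) (dir n j) / (omega n l - omega n j)).re := by
  have hn0 : n ≠ 0 := by omega
  have hne : omega n l - omega n j ≠ 0 := sub_ne_zero.2 fun h => hlj (omega_injective hn0 h)
  have h2 : ‖omega n l - omega n j‖ ≤ 2 := by
    refine (norm_sub_le _ _).trans ?_
    rw [norm_omega, norm_omega]; norm_num
  have h0 : 0 < ‖omega n l - omega n j‖ := norm_pos_iff.2 hne
  have e : (starRingEnd ℂ) (dir n j) / (omega n l - omega n j) =
      ((1 / ‖omega n l - omega n j‖ : ℝ) : ℂ) *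
        Complex.exp (((theta n j l - thetaMid n j : ℝ) : ℂ) * Complex.I) := by
    have h1 := ofReal_div_omega_sub hlj 1
    rw [Complex.ofReal_one] at h1
    rw [div_eq_mul_one_div, h1, conj_dir, mul_left_comm, ← Complex.exp_add]
    congr 2
    push_cast
    ring
  rw [e, Complex.re_ofReal_mul, Complex.exp_ofReal_mul_I_re]
  have hc := cos_halfSpread_pos hn
  have hc2 := cos_theta_sub_ge hn hlj
  calc Real.cos (halfSpread n) / 2 = 1 / 2 * Real.cos (halfSpread n) := by ring
    _ ≤ _ := by gcongr

theorem one_div_one_add_rpow_le {ρ : ℝ} (hρ : 0 < ρ) (ξ : ℂ) {e : ℂ} (he : ‖e‖ = 1) :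
    1 / (1 + ‖ξ‖ ^ (1 + ρ)) ≤ 2 ^ (1 + ρ) * decay ρ (ξ * (starRingEnd ℂ) e).re := by
  have hx : |(ξ * (starRingEnd ℂ) e).re| ≤ ‖ξ‖ := by
    refine (Complex.abs_re_le_norm _).trans ?_
    rw [norm_mul, RCLike.norm_conj, he, mul_one]
  set x := (ξ * (starRingEnd ℂ) e).re
  have h0 := norm_nonneg ξ
  have hx0 := abs_nonneg x
  have hp : 0 ≤ 1 + ρ := by linarith
  have h1 : (1 + |x|) ^ (1 + ρ) ≤ 2 ^ (1 + ρ) * (1 + ‖ξ‖ ^ (1 + ρ)) := by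
    have h2 : (1 + |x|) ^ (1 + ρ) ≤ (2 * max 1 ‖ξ‖) ^ (1 + ρ) := by
      refine Real.rpow_le_rpow (by positivity) ?_ hp
      linarith [le_max_left 1 ‖ξ‖, le_max_right 1 ‖ξ‖]
    have hm : 0 ≤ max 1 ‖ξ‖ := h0.trans (le_max_right _ _)
    rw [Real.mul_rpow (by norm_num) hm] at h2
    refine h2.trans (mul_le_mul_of_nonneg_left ?_ (by positivity))
    rcases le_total 1 ‖ξ‖ with h | h
    · rw [max_eq_right h]; linarith
    · rw [max_eq_left h, Real.one_rpow]
      have := Real.rpow_nonneg h0 (1 + ρ)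
      linarith
  rw [decay, Real.rpow_neg (by positivity), ← div_eq_mul_inv,
    div_le_div_iff₀ (by positivity) (by positivity), one_mul]
  exact h1

/-! ### The system attached to the differential equation -/

/-- `(ω_l / n) ∑_k ω_m ^ k Ψ_k(0, ξ)` -/
def kernelZero (n : ℕ) (Ψ : ℕ → ℂ → ℂ → ℂ) (l m : Fin n) (ξ : ℂ) : ℂ :=
  omega n l / n * ∑ k ∈ Finset.range (n - 1), omega n m ^ k * Ψ k 0 ξ

/-- `(ω_l / n) ∑_k ω_m ^ k ∂_t Ψ_k(t, ξ)` -/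
def kernelDeriv (n : ℕ) (Ψ : ℕ → ℂ → ℂ → ℂ) (l m : Fin n) (t ξ : ℂ) : ℂ :=
  omega n l / n * ∑ k ∈ Finset.range (n - 1), omega n m ^ k * deriv (fun z => Ψ k z ξ) t

theorem norm_omega_sum_le {n : ℕ} (l m : Fin n) {f : ℕ → ℂ} {B : ℝ} (hB : 0 ≤ B)
    (hf : ∀ k < n - 1, ‖f k‖ ≤ B) :
    ‖omega n l / n * ∑ k ∈ Finset.range (n - 1), omega n m ^ k * f k‖ ≤ B := by
  have hn : (0 : ℝ) < n := by exact_mod_cast l.pos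
  have h1 : ‖∑ k ∈ Finset.range (n - 1), omega n m ^ k * f k‖ ≤ (n - 1 : ℕ) * B := by
    refine (norm_sum_le_of_le _ (fun k hk => ?_ : ∀ k ∈ Finset.range (n - 1), _ ≤ B)).trans ?_
    · rw [norm_mul, norm_pow, norm_omega, one_pow, one_mul]
      exact hf k (Finset.mem_range.1 hk)
    · simp
  have h2 : ((n - 1 : ℕ) : ℝ) * B ≤ n * B :=
    mul_le_mul_of_nonneg_right (by exact_mod_cast Nat.sub_le n 1) hB
  rw [norm_mul, norm_div, norm_omega, Complex.norm_natCast, one_div, inv_mul_le_iff₀ hn]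
  linarith

theorem analyticAt_deriv_fst {f : ℂ → ℂ → ℂ} {p : ℂ × ℂ}
    (hf : AnalyticAt ℂ (fun p : ℂ × ℂ => f p.1 p.2) p) :
    AnalyticAt ℂ (fun p : ℂ × ℂ => deriv (fun z => f z p.2) p.1) p := by
  have h1 : AnalyticAt ℂ (fun p => fderiv ℂ (fun p : ℂ × ℂ => f p.1 p.2) p ((1 : ℂ), (0 : ℂ))) p :=
    ((ContinuousLinearMap.apply ℂ ℂ ((1 : ℂ), (0 : ℂ))).analyticAt _).comp hf.fderiv
  refine h1.congr ?_
  filter_upwards [hf.eventually_analyticAt] with q hq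
  rw [(hasDerivAt_fst_snd (t := q.1) (ξ := q.2) hq).fderiv]
  simp

section Potentials

variable {n : ℕ} {Δ : Set ℂ} {ψ Ψ : ℕ → ℂ → ℂ → ℂ} {d d' c ρ σ' : ℝ}

theorem U_mono {r s : ℝ} (h : r ≤ s) : U r ⊆ U s := fun _ ht => by
  obtain ⟨t₀, ht₀, h'⟩ := mem_U_iff.1 ht
  exact mem_U_iff.2 ⟨t₀, ht₀, h'.trans_le h⟩

theorem zero_mem_U {r : ℝ} (hr : 0 < r) : (0 : ℂ) ∈ U r := Or.inr (Metric.mem_ball_self hr)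

variable (hcond : BorelCondition n Δ ψ Ψ d' c ρ σ')
include hcond

theorem BorelCondition.norm_zero_le (hn : 2 ≤ n) {k : ℕ} (hk : k < n - 1) {ξ : ℂ} (hξ : ξ ∈ Δ) :
    ‖Ψ k 0 ξ‖ ≤ c / (1 + ‖ξ‖ ^ (1 + ρ)) := by
  have h := hcond.bound k hk 0 (zero_mem_U (mul_pos (aSeq_pos n hn) hcond.d'_pos)) ξ hξ
  simpa using h

/-- Cauchy's estimate on circles of radius `𝔞ₙ (d' - d) / 2`, which fit into the wider strip. The
room between `d` and `d'` pays for the derivative in the kernels. -/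
theorem BorelCondition.norm_deriv_le (hn : 2 ≤ n) (hdd' : d < d') {k : ℕ} (hk : k < n - 1) {t : ℂ}
    (ht : t ∈ U (aSeq n * d)) {ξ : ℂ} (hξ : ξ ∈ Δ) :
    ‖deriv (fun z => Ψ k z ξ) t‖ ≤ c * (Real.exp (σ' * (aSeq n * (d' - d) / 2)) /
      (aSeq n * (d' - d) / 2)) * Real.exp (σ' * t.re) / (1 + ‖ξ‖ ^ (1 + ρ)) := by
  have hα := aSeq_pos n hn
  set r := aSeq n * (d' - d) / 2 with hr
  have hr0 : 0 < r := by have := sub_pos.2 hdd'; positivity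
  have hsub : Metric.closedBall t r ⊆ U (aSeq n * d') := fun z hz => by
    obtain ⟨s, hs, h⟩ := mem_U_iff.1 ht
    refine mem_U_iff.2 ⟨s, hs, ?_⟩
    rw [Metric.mem_closedBall, dist_eq_norm] at hz
    have e : z - s = (z - t) + (t - s) := by ring
    rw [e]
    refine (norm_add_le _ _).trans_lt ?_
    have : r + aSeq n * d = aSeq n * d' - r := by rw [hr]; ring
    linarith
  have h := Complex.norm_deriv_le_of_forall_mem_sphere_norm_le (c := t) (R := r)
    (f := fun z => Ψ k z ξ) (C := c * Real.exp (σ' * (t.re + r)) / (1 + ‖ξ‖ ^ (1 + ρ))) hr0 ?_ ?_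
  · refine h.trans (le_of_eq ?_)
    rw [mul_add, Real.exp_add]
    have : 0 < 1 + ‖ξ‖ ^ (1 + ρ) := by positivity
    field_simp
  · refine DifferentiableOn.diffContOnCl fun z hz => ?_
    have hz' := hsub (Metric.closure_ball_subset_closedBall hz)
    exact ((hcond.analytic k hk (z, ξ) ⟨hz', hξ⟩).differentiableAt.comp (f := fun z => (z, ξ)) z
      (by fun_prop)).differentiableWithinAt
  · intro z hz
    refine (hcond.bound k hk z (hsub (Metric.sphere_subset_closedBall hz)) ξ hξ).trans ?_
    have h1 : z.re ≤ t.re + r := by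
      have h2 := (Complex.re_le_norm (z - t))
      rw [← dist_eq_norm, Metric.mem_sphere.1 hz, Complex.sub_re] at h2
      linarith
    have h3 := mul_le_mul_of_nonneg_left h1 hcond.σ'_nonneg
    have := hcond.c_pos
    gcongr

theorem BorelCondition.analyticAt {k : ℕ} (hk : k < n - 1) {t ξ : ℂ}
    (ht : t ∈ U (aSeq n * d')) (hξ : ξ ∈ Δ) :
    AnalyticAt ℂ (fun p : ℂ × ℂ => Ψ k p.1 p.2) (t, ξ) := hcond.analytic k hk (t, ξ) ⟨ht, hξ⟩

theorem BorelCondition.analyticOnNhd_kernelZero (hn : 2 ≤ n) (l m : Fin n) :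
    AnalyticOnNhd ℂ (kernelZero n Ψ l m) Δ := fun ξ hξ => by
  unfold kernelZero
  refine analyticAt_const.mul (Finset.analyticAt_fun_sum _ fun k hk => analyticAt_const.mul ?_)
  exact (hcond.analyticAt (Finset.mem_range.1 hk)
    (zero_mem_U (mul_pos (aSeq_pos n hn) hcond.d'_pos)) hξ).comp
      (f := fun ξ => ((0 : ℂ), ξ)) (analyticAt_const.prod analyticAt_id)

theorem BorelCondition.norm_kernelZero_le (hn : 2 ≤ n) (l m : Fin n) {ξ : ℂ} (hξ : ξ ∈ Δ) {e : ℂ}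
    (he : ‖e‖ = 1) :
    ‖kernelZero n Ψ l m ξ‖ ≤ c * 2 ^ (1 + ρ) * decay ρ (ξ * (starRingEnd ℂ) e).re := by
  have h1 := one_div_one_add_rpow_le hcond.ρ_pos ξ he
  have hc := hcond.c_pos
  refine (norm_omega_sum_le l m (B := c / (1 + ‖ξ‖ ^ (1 + ρ))) (by positivity)
    fun k hk => hcond.norm_zero_le hn hk hξ).trans ?_
  rw [div_eq_mul_one_div, mul_assoc]
  gcongr

theorem BorelCondition.norm_kernelDeriv_le (hn : 2 ≤ n) (hdd' : d < d') (l m : Fin n) {t : ℂ}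
    (ht : t ∈ U (aSeq n * d)) {ξ : ℂ} (hξ : ξ ∈ Δ) {e : ℂ} (he : ‖e‖ = 1) :
    ‖kernelDeriv n Ψ l m t ξ‖ ≤ c * (Real.exp (σ' * (aSeq n * (d' - d) / 2)) /
      (aSeq n * (d' - d) / 2)) * 2 ^ (1 + ρ) * Real.exp (σ' * t.re) *
        decay ρ (ξ * (starRingEnd ℂ) e).re := by
  have h1 := one_div_one_add_rpow_le hcond.ρ_pos ξ he
  have hc := hcond.c_pos
  have hα := aSeq_pos n hn
  have := sub_pos.2 hdd'
  refine (norm_omega_sum_le l m (by positivity)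
    fun k hk => hcond.norm_deriv_le hn hdd' hk ht hξ).trans ?_
  rw [div_eq_mul_one_div, mul_right_comm _ ((2 : ℝ) ^ (1 + ρ)), mul_assoc _ ((2 : ℝ) ^ (1 + ρ))]
  gcongr

/-- The transform of `∂_t Ψ_k` is `u` times that of `Ψ_k` minus `Ψ_k(0, ξ)`. Thus the factor `u` in
the coupling is absorbed into a term free of `u` and a Laplace transform. -/
theorem BorelCondition.laplace_kernelDeriv (hn : 2 ≤ n) (l m : Fin n) {u : ℂ}
    (hu : σ' < u.re) {ξ : ℂ} (hξ : ξ ∈ Δ) :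
    kernelZero n Ψ l m ξ + laplace (fun t => kernelDeriv n Ψ l m t ξ) u =
      omega n l / n * u * ∑ k ∈ Finset.range (n - 1),
        omega n m ^ k * (ψ k u ξ - if k = 0 then 1 else 0) := by
  have hα := aSeq_pos n hn
  have hR : 0 < aSeq n * d' := mul_pos hα hcond.d'_pos
  have hc := hcond.c_pos
  -- Only real `t` matter here, so any narrower strip serves for the bound on the derivative.
  obtain ⟨δ, hδ0, hδ⟩ := exists_between hcond.d'_pos
  have hdiff : ∀ k < n - 1, DifferentiableOn ℂ (fun t => Ψ k t ξ) (U (aSeq n * d')) := fun k hk t ht =>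
    ((hcond.analyticAt hk ht hξ).differentiableAt.comp (f := fun z => (z, ξ)) t
      (by fun_prop)).differentiableWithinAt
  have hb : ∀ k < n - 1, ∀ t : ℝ, 0 ≤ t → ‖Ψ k t ξ‖ ≤ c / (1 + ‖ξ‖ ^ (1 + ρ)) * Real.exp (σ' * t) :=
    fun k hk t ht => by
      refine (hcond.bound k hk t (BorelSystem.ofReal_mem_U hR ht) ξ hξ).trans (le_of_eq ?_)
      simp; ring
  have hb' : ∀ k < n - 1, ∀ t : ℝ, 0 ≤ t → ‖deriv (fun z => Ψ k z ξ) t‖ ≤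
      c * (Real.exp (σ' * (aSeq n * (d' - δ) / 2)) / (aSeq n * (d' - δ) / 2)) /
        (1 + ‖ξ‖ ^ (1 + ρ)) * Real.exp (σ' * t) :=
    fun k hk t ht => by
      refine (hcond.norm_deriv_le hn hδ hk (BorelSystem.ofReal_mem_U (mul_pos hα hδ0) ht) hξ).trans (le_of_eq ?_)
      simp; ring
  have hint : ∀ k ∈ Finset.range (n - 1), Integrable (fun t : ℝ => omega n l / n * omega n m ^ k *
      (Complex.exp (-u * t) * deriv (fun z => Ψ k z ξ) t)) (volume.restrict (Ioi 0)) := fun k hk => by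
    have hk := Finset.mem_range.1 hk
    refine (laplace_integrableOn hu ((ofReal_continuousOn hR ((hdiff k hk).deriv
      (isOpen_U _))).mono Ioi_subset_Ici_self) fun t ht => hb' k hk t ht.le).const_mul _
  have hlap : laplace (fun t => kernelDeriv n Ψ l m t ξ) u = ∑ k ∈ Finset.range (n - 1),
      omega n l / n * omega n m ^ k * laplace (deriv fun z => Ψ k z ξ) u := by
    unfold laplace kernelDeriv
    simp_rw [← integral_const_mul]
    rw [← integral_finsetSum _ hint]
    refine integral_congr_ae (Eventually.of_forall fun t => ?_)
    simp only [Finset.mul_sum]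
    refine Finset.sum_congr rfl fun k _ => ?_
    ring
  rw [hlap, kernelZero, Finset.mul_sum, ← Finset.sum_add_distrib, Finset.mul_sum]
  refine Finset.sum_congr rfl fun k hk => ?_
  have hk := Finset.mem_range.1 hk
  rw [laplace_deriv hR (hdiff k hk) hu (hb k hk) (hb' k hk), hcond.laplace_eq k hk u hu ξ hξ]
  ring

/-- The first-order system attached to the differential equation and the `j`-th root of unity. -/
def BorelCondition.system (hn : 2 ≤ n) (hd : 0 < d) (hdd' : d < d') {j : Fin n} {Γ : Set ℂ}
    (hΓ : IsAdmissibleSubdomain n Δ d j Γ) : BorelSystem (Fin n) where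
  j := j
  a l := omega n l - omega n j
  e := dir n j
  Γ := Γ
  α := aSeq n
  d := d
  ρ := ρ
  σ := σ'
  c₀ := Real.cos (halfSpread n) / 2
  -- The factor `2` allows for the subtraction on the diagonal of `b`.
  C := max (c * 2 ^ (1 + ρ) * 2) (c * (Real.exp (σ' * (aSeq n * (d' - d) / 2)) /
      (aSeq n * (d' - d) / 2)) * 2 ^ (1 + ρ))
  -- All components share the factor `exp (X_j)`, so `X_j' = kernelZero n Ψ j j` is subtracted from
  -- every diagonal entry; the entry `(j, j)` becomes zero.
  b l m ξ := kernelZero n Ψ l m ξ - if l = m then kernelZero n Ψ j j ξ else 0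
  k := kernelDeriv n Ψ
  isOpen := hΓ.isOpen
  α_pos := aSeq_pos n hn
  d_pos := hd
  ρ_pos := hcond.ρ_pos
  σ_nonneg := hcond.σ'_nonneg
  c₀_pos := half_pos (cos_halfSpread_pos hn)
  C_pos := lt_max_of_lt_left (by have := hcond.c_pos; positivity)
  norm_e := norm_dir n j
  a_j := sub_self _
  norm_a _ hl := aSeq_le_norm_omega_sub hn hl
  re_a _ hl := re_conj_dir_div hn hl
  mem_e ξ hξ s hs := ray_mid_mem hn hΓ hξ hs
  mem_a l hl ξ hξ s hs := by
    rw [ofReal_div_omega_sub hl]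
    exact hΓ.ray_mem ξ hξ l hl _ (by positivity)
  b_jj ξ := by simp
  analytic_b l m := fun ξ hξ => by
    have hξ' := thickening_subset hcond.isOpen hΓ hξ
    have h1 := hcond.analyticOnNhd_kernelZero hn l m ξ hξ'
    have h2 := hcond.analyticOnNhd_kernelZero hn j j ξ hξ'
    by_cases h : l = m
    · simp only [h, if_true] at h1 ⊢
      exact h1.fun_sub h2
    · simp only [h, if_false, sub_zero]
      exact h1
  analytic_k l m := fun p hp => by
    have hξ := thickening_subset hcond.isOpen hΓ hp.2
    have ht := U_mono (mul_le_mul_of_nonneg_left hdd'.le (aSeq_pos n hn).le) hp.1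
    unfold kernelDeriv
    refine analyticAt_const.mul (Finset.analyticAt_fun_sum _ fun k hk => analyticAt_const.mul ?_)
    exact analyticAt_deriv_fst (hcond.analyticAt (Finset.mem_range.1 hk) ht hξ)
  norm_b_le l m ξ hξ := by
    have hξ' := thickening_subset hcond.isOpen hΓ hξ
    have h1 := hcond.norm_kernelZero_le hn l m hξ' (norm_dir n j)
    have h2 := hcond.norm_kernelZero_le hn j j hξ' (norm_dir n j)
    have h3 : ‖if l = m then kernelZero n Ψ j j ξ else 0‖ ≤
        c * 2 ^ (1 + ρ) * decay ρ (ξ * (starRingEnd ℂ) (dir n j)).re := by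
      split_ifs
      · exact h2
      · rw [norm_zero]; exact (norm_nonneg _).trans h2
    refine (norm_sub_le _ _).trans ((add_le_add h1 h3).trans ?_)
    have : c * 2 ^ (1 + ρ) * decay ρ (ξ * (starRingEnd ℂ) (dir n j)).re +
      c * 2 ^ (1 + ρ) * decay ρ (ξ * (starRingEnd ℂ) (dir n j)).re =
      c * 2 ^ (1 + ρ) * 2 * decay ρ (ξ * (starRingEnd ℂ) (dir n j)).re := by ring
    rw [this]
    exact mul_le_mul_of_nonneg_right (le_max_left _ _) (decay_pos _ _).le
  norm_k_le l m t ht ξ hξ := by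
    refine (hcond.norm_kernelDeriv_le hn hdd' l m ht (thickening_subset hcond.isOpen hΓ hξ)
      (norm_dir n j)).trans ?_
    exact mul_le_mul_of_nonneg_right (mul_le_mul_of_nonneg_right (le_max_right _ _)
      (Real.exp_pos _).le) (decay_pos _ _).le

end Potentials

/-! ### Functions with a bound along the rays in a given direction -/

/-- `f` is analytic on `Γ`, and `f (ξ + s e) = O(g s)`, locally uniformly in `ξ ∈ Γ`. -/
structure RayBound (Γ : Set ℂ) (e : ℂ) (g : ℝ → ℝ) (f : ℂ → ℂ) : Prop where
  analytic : AnalyticOnNhd ℂ f Γ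
  bound : ∀ ξ ∈ Γ, ∃ r > 0, ∃ C, 0 ≤ C ∧ ∀ ζ ∈ Metric.ball ξ r, ∀ s : ℝ, 0 ≤ s →
    ‖f (ζ + s * e)‖ ≤ C * g s

namespace RayBound

variable {Γ : Set ℂ} {e : ℂ} {g h : ℝ → ℝ} {f f₁ f₂ : ℂ → ℂ}

theorem congr (hΓ : IsOpen Γ) (hmem : ∀ ξ ∈ Γ, ∀ s : ℝ, 0 ≤ s → ξ + s * e ∈ Γ)
    (hf : RayBound Γ e g f₁) (h : EqOn f₁ f₂ Γ) : RayBound Γ e g f₂ := by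
  refine ⟨fun ξ hξ => (hf.analytic ξ hξ).congr (h.eventuallyEq_of_mem (hΓ.mem_nhds hξ)),
    fun ξ hξ => ?_⟩
  obtain ⟨r, hr, C, hC, hb⟩ := hf.bound ξ hξ
  obtain ⟨r', hr', hsub⟩ := Metric.isOpen_iff.1 hΓ ξ hξ
  refine ⟨min r r', lt_min hr hr', C, hC, fun ζ hζ s hs => ?_⟩
  rw [← h (hmem ζ (hsub (Metric.ball_subset_ball (min_le_right _ _) hζ)) s hs)]
  exact hb ζ (Metric.ball_subset_ball (min_le_left _ _) hζ) s hs

theorem mono (hf : RayBound Γ e g f) (hgh : ∀ s, 0 ≤ s → g s ≤ h s) : RayBound Γ e h f := by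
  refine ⟨hf.analytic, fun ξ hξ => ?_⟩
  obtain ⟨r, hr, C, hC, hb⟩ := hf.bound ξ hξ
  exact ⟨r, hr, C, hC, fun ζ hζ s hs => (hb ζ hζ s hs).trans
    (mul_le_mul_of_nonneg_left (hgh s hs) hC)⟩

/-- Cauchy's estimate on discs translated along the ray: their radius does not depend on `s`. -/
theorem deriv (hΓ : IsOpen Γ) (hmem : ∀ ξ ∈ Γ, ∀ s : ℝ, 0 ≤ s → ξ + s * e ∈ Γ)
    (hf : RayBound Γ e g f) : RayBound Γ e g (deriv f) := by
  refine ⟨hf.analytic.deriv, fun ξ hξ => ?_⟩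
  obtain ⟨r, hr, C, hC, hb⟩ := hf.bound ξ hξ
  obtain ⟨r', hr', hsub⟩ := Metric.isOpen_iff.1 hΓ ξ hξ
  set δ := min r r' with hδ
  have hδ0 : 0 < δ := lt_min hr hr'
  have key : ∀ ζ ∈ Metric.ball ξ (δ / 2), ∀ s : ℝ, 0 ≤ s → ∀ z ∈ Metric.closedBall (ζ + s * e) (δ / 2),
      z ∈ Γ ∧ ‖f z‖ ≤ C * g s := by
    intro ζ hζ s hs z hz
    have hz' : z - s * e ∈ Metric.ball ξ δ := by
      rw [Metric.mem_ball, dist_eq_norm] at hζ ⊢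
      rw [Metric.mem_closedBall, dist_eq_norm] at hz
      have : z - s * e - ξ = (z - (ζ + s * e)) + (ζ - ξ) := by ring
      rw [this]
      exact (norm_add_le _ _).trans_lt (by linarith)
    have e1 : z = (z - s * e) + s * e := by ring
    rw [e1]
    exact ⟨hmem _ (hsub (Metric.ball_subset_ball (min_le_right _ _) hz')) s hs,
      hb _ (Metric.ball_subset_ball (min_le_left _ _) hz') s hs⟩
  refine ⟨δ / 2, half_pos hδ0, C / (δ / 2), by positivity, fun ζ hζ s hs => ?_⟩
  have h := Complex.norm_deriv_le_of_forall_mem_sphere_norm_le (c := ζ + s * e) (R := δ / 2) (f := f)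
    (C := C * g s) (half_pos hδ0) ?_ fun z hz => (key ζ hζ s hs z (Metric.sphere_subset_closedBall hz)).2
  · exact h.trans (le_of_eq (by ring))
  · exact DifferentiableOn.diffContOnCl fun z hz => (hf.analytic z (key ζ hζ s hs z
      (Metric.closure_ball_subset_closedBall hz)).1).differentiableAt.differentiableWithinAt

theorem iteratedDeriv (hΓ : IsOpen Γ) (hmem : ∀ ξ ∈ Γ, ∀ s : ℝ, 0 ≤ s → ξ + s * e ∈ Γ)
    (hf : RayBound Γ e g f) (k : ℕ) : RayBound Γ e g (iteratedDeriv k f) := by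
  induction k with
  | zero => simpa using hf
  | succ k ih => rw [iteratedDeriv_succ]; exact ih.deriv hΓ hmem

theorem add (hf₁ : RayBound Γ e g f₁) (hf₂ : RayBound Γ e g f₂) :
    RayBound Γ e g fun ξ => f₁ ξ + f₂ ξ := by
  refine ⟨fun ξ hξ => (hf₁.analytic ξ hξ).fun_add (hf₂.analytic ξ hξ), fun ξ hξ => ?_⟩
  obtain ⟨r, hr, C, hC, hb⟩ := hf₁.bound ξ hξ
  obtain ⟨r', hr', C', hC', hb'⟩ := hf₂.bound ξ hξ
  refine ⟨min r r', lt_min hr hr', C + C', by positivity, fun ζ hζ s hs => ?_⟩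
  refine (norm_add_le _ _).trans ?_
  rw [add_mul]
  exact add_le_add (hb ζ (Metric.ball_subset_ball (min_le_left _ _) hζ) s hs)
    (hb' ζ (Metric.ball_subset_ball (min_le_right _ _) hζ) s hs)

theorem mul (hf₁ : RayBound Γ e g f₁) (hf₂ : RayBound Γ e h f₂) :
    RayBound Γ e (fun s => g s * h s) fun ξ => f₁ ξ * f₂ ξ := by
  refine ⟨fun ξ hξ => (hf₁.analytic ξ hξ).fun_mul (hf₂.analytic ξ hξ), fun ξ hξ => ?_⟩
  obtain ⟨r, hr, C, hC, hb⟩ := hf₁.bound ξ hξ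
  obtain ⟨r', hr', C', hC', hb'⟩ := hf₂.bound ξ hξ
  refine ⟨min r r', lt_min hr hr', C * C', by positivity, fun ζ hζ s hs => ?_⟩
  have h1 := hb ζ (Metric.ball_subset_ball (min_le_left _ _) hζ) s hs
  have h2 := hb' ζ (Metric.ball_subset_ball (min_le_right _ _) hζ) s hs
  rw [norm_mul]
  calc _ ≤ (C * g s) * (C' * h s) := mul_le_mul h1 h2 (norm_nonneg _) ((norm_nonneg _).trans h1)
    _ = _ := by ring

theorem const (c : ℂ) : RayBound Γ e (fun _ => 1) fun _ => c :=
  ⟨analyticOnNhd_const, fun _ _ => ⟨1, one_pos, ‖c‖, norm_nonneg _, fun _ _ _ _ => by simp⟩⟩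

theorem mul_left (hf₁ : RayBound Γ e (fun _ => 1) f₁) (hf₂ : RayBound Γ e g f₂) :
    RayBound Γ e g fun ξ => f₁ ξ * f₂ ξ :=
  (hf₁.mul hf₂).mono fun _ _ => (one_mul _).le

theorem mul_right (hf₁ : RayBound Γ e g f₁) (hf₂ : RayBound Γ e (fun _ => 1) f₂) :
    RayBound Γ e g fun ξ => f₁ ξ * f₂ ξ :=
  (hf₁.mul hf₂).mono fun _ _ => (mul_one _).le

theorem const_mul (hf : RayBound Γ e g f) (c : ℂ) : RayBound Γ e g fun ξ => c * f ξ :=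
  (const c).mul_left hf

theorem zero (hg : ∀ s, 0 ≤ s → 0 ≤ g s) : RayBound Γ e g fun _ => 0 :=
  ⟨analyticOnNhd_const, fun _ _ => ⟨1, one_pos, 1, zero_le_one, fun _ _ s hs => by
    simpa using hg s hs⟩⟩

theorem sum (hg : ∀ s, 0 ≤ s → 0 ≤ g s) {ι : Type*} (I : Finset ι) {F : ι → ℂ → ℂ}
    (hF : ∀ i ∈ I, RayBound Γ e g (F i)) : RayBound Γ e g fun ξ => ∑ i ∈ I, F i ξ := by
  classical
  induction I using Finset.induction_on with
  | empty => simpa using zero hg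
  | insert i I hi ih =>
    simp only [Finset.sum_insert hi]
    exact (hF i (Finset.mem_insert_self _ _)).add
      (ih fun i' hi' => hF i' (Finset.mem_insert_of_mem hi'))

theorem tendsto (hf : RayBound Γ e g f) (hg : Tendsto g atTop (𝓝 0)) {ξ : ℂ} (hξ : ξ ∈ Γ) :
    Tendsto (fun s : ℝ => f (ξ + s * e)) atTop (𝓝 0) := by
  obtain ⟨r, hr, C, -, hb⟩ := hf.bound ξ hξ
  refine squeeze_zero_norm' ((eventually_ge_atTop 0).mono fun s hs =>
    hb ξ (Metric.mem_ball_self hr) s hs) ?_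
  simpa using hg.const_mul C

theorem continuousOn (hmem : ∀ ξ ∈ Γ, ∀ s : ℝ, 0 ≤ s → ξ + s * e ∈ Γ) (hf : RayBound Γ e g f)
    {ξ : ℂ} (hξ : ξ ∈ Γ) : ContinuousOn (fun s : ℝ => f (ξ + s * e)) (Ici 0) := fun s hs =>
  (((hf.analytic _ (hmem ξ hξ s hs)).continuousAt.comp (f := fun s : ℝ => ξ + s * e)
    (by fun_prop))).continuousWithinAt

theorem integrableOn (hmem : ∀ ξ ∈ Γ, ∀ s : ℝ, 0 ≤ s → ξ + s * e ∈ Γ)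
    (hf : RayBound Γ e g f) (hg : IntegrableOn g (Ioi 0)) {ξ : ℂ} (hξ : ξ ∈ Γ) :
    IntegrableOn (fun s : ℝ => f (ξ + s * e) * e) (Ioi 0) := by
  obtain ⟨r, hr, C, -, hb⟩ := hf.bound ξ hξ
  refine Integrable.mul_const ((hg.const_mul C).mono'
    (((hf.continuousOn hmem hξ).mono Ioi_subset_Ici_self).aestronglyMeasurable measurableSet_Ioi)
    ((ae_restrict_iff' measurableSet_Ioi).2 (Eventually.of_forall fun s hs => ?_))) e
  exact hb ξ (Metric.mem_ball_self hr) s (le_of_lt hs)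

theorem hasDerivAt_integral (hΓ : IsOpen Γ) (hmem : ∀ ξ ∈ Γ, ∀ s : ℝ, 0 ≤ s → ξ + s * e ∈ Γ)
    (hf : RayBound Γ e g f) (hg : IntegrableOn g (Ioi 0)) (hg' : Tendsto g atTop (𝓝 0))
    {ξ : ℂ} (hξ : ξ ∈ Γ) :
    HasDerivAt (fun ξ => ∫ s in Ioi (0 : ℝ), f (ξ + s * e) * e) (-f ξ) ξ := by
  obtain ⟨r, hr, C, -, hb⟩ := hf.bound ξ hξ
  obtain ⟨r', hr', hsub⟩ := Metric.isOpen_iff.1 hΓ ξ hξ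
  exact hasDerivAt_ray_integral hΓ hf.analytic.differentiableOn (lt_min hr hr')
    (fun ζ hζ s hs => hmem ζ (hsub (Metric.ball_subset_ball (min_le_right _ _) hζ)) s hs)
    (hg.const_mul C)
    (fun ζ hζ s hs => hb ζ (Metric.ball_subset_ball (min_le_left _ _) hζ) s hs.le)
    (hf.tendsto hg' hξ)

/-- The ray integral of an integrable function is bounded along rays. -/
theorem integral (hΓ : IsOpen Γ) (hmem : ∀ ξ ∈ Γ, ∀ s : ℝ, 0 ≤ s → ξ + s * e ∈ Γ)
    (hf : RayBound Γ e g f) (hg : IntegrableOn g (Ioi 0)) (hg' : Tendsto g atTop (𝓝 0))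
    (hg0 : ∀ s, 0 ≤ s → 0 ≤ g s) (hga : ∀ s t, 0 ≤ s → s ≤ t → g t ≤ g s) (he : ‖e‖ = 1) :
    RayBound Γ e (fun _ => 1) fun ξ => ∫ s in Ioi (0 : ℝ), f (ξ + s * e) * e := by
  refine ⟨DifferentiableOn.analyticOnNhd (fun ξ hξ => (hf.hasDerivAt_integral hΓ hmem hg hg'
    hξ).differentiableAt.differentiableWithinAt) hΓ, fun ξ hξ => ?_⟩
  obtain ⟨r, hr, C, hC, hb⟩ := hf.bound ξ hξ
  refine ⟨r, hr, C * ∫ s in Ioi (0 : ℝ), g s, mul_nonneg hC (setIntegral_nonneg measurableSet_Ioi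
    fun s hs => hg0 s (le_of_lt hs)), fun ζ hζ s hs => ?_⟩
  rw [mul_one, ← integral_const_mul]
  refine norm_integral_le_of_norm_le (hg.const_mul C) ((ae_restrict_iff' measurableSet_Ioi).2
    (Eventually.of_forall fun t ht => ?_))
  have ht' : (0 : ℝ) ≤ t := le_of_lt ht
  have h1 := hb ζ hζ (s + t) (by positivity)
  have e1 : ζ + s * e + t * e = ζ + ((s + t : ℝ) : ℂ) * e := by push_cast; ring
  rw [norm_mul, he, mul_one, e1]
  exact h1.trans (mul_le_mul_of_nonneg_left (hga t (s + t) ht' (by linarith)) hC)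

/-- A function that tends to zero along rays is the integral of its derivative. -/
theorem eq_neg_integral (hmem : ∀ ξ ∈ Γ, ∀ s : ℝ, 0 ≤ s → ξ + s * e ∈ Γ)
    (hf : RayBound Γ e g f) (hg : IntegrableOn g (Ioi 0)) {F : ℂ → ℂ}
    (hF : ∀ ξ ∈ Γ, HasDerivAt F (f ξ) ξ) {ξ : ℂ} (hξ : ξ ∈ Γ)
    (hlim : Tendsto (fun s : ℝ => F (ξ + s * e)) atTop (𝓝 0)) :
    F ξ = -∫ s in Ioi (0 : ℝ), f (ξ + s * e) * e := by
  have hd : ∀ s ∈ Ici (0 : ℝ), HasDerivAt (fun s : ℝ => F (ξ + s * e)) (f (ξ + s * e) * e) s := by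
    intro s hs
    have h1 : HasDerivAt (fun s : ℝ => ξ + s * e) e s := by
      simpa using ((Complex.ofRealCLM.hasDerivAt (x := s)).mul_const e).const_add ξ
    exact HasDerivAt.comp_of_eq s (hF _ (hmem ξ hξ s hs)) h1 rfl
  have h := integral_Ioi_of_hasDerivAt_of_tendsto' hd (hf.integrableOn hmem hg hξ) hlim
  rw [h]
  simp

end RayBound

theorem integrableOn_decay {ρ : ℝ} (hρ : 0 < ρ) : IntegrableOn (decay ρ) (Ioi 0) :=
  (integrable_decay hρ).integrableOn

theorem tendsto_decay_atTop {ρ : ℝ} (hρ : 0 < ρ) : Tendsto (decay ρ) atTop (𝓝 0) := by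
  simpa using tendsto_decay hρ 0

theorem decay_antitone {ρ : ℝ} (hρ : 0 < ρ) (s t : ℝ) (hs : 0 ≤ s) (hst : s ≤ t) :
    decay ρ t ≤ decay ρ s := by
  unfold decay
  rw [abs_of_nonneg hs, abs_of_nonneg (hs.trans hst)]
  exact Real.rpow_le_rpow_of_nonpos (by linarith) (by linarith) (by linarith)

/-- A bound in terms of the projection to the direction of the ray gives a bound along rays. -/
theorem RayBound.of_decay {Γ : Set ℂ} {e : ℂ} {ρ C : ℝ} (hρ : 0 < ρ) (he : ‖e‖ = 1) {f : ℂ → ℂ}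
    (hΓ : IsOpen Γ) (hmem : ∀ ξ ∈ Γ, ∀ s : ℝ, 0 ≤ s → ξ + s * e ∈ Γ)
    (hf : AnalyticOnNhd ℂ f Γ) (hC : 0 ≤ C)
    (hb : ∀ ξ ∈ Γ, ‖f ξ‖ ≤ C * decay ρ (ξ * (starRingEnd ℂ) e).re) :
    RayBound Γ e (decay ρ) f := by
  refine ⟨hf, fun ξ hξ => ?_⟩
  obtain ⟨r, hr, hsub⟩ := Metric.isOpen_iff.1 hΓ ξ hξ
  refine ⟨r, hr, C * (1 + (‖ξ‖ + r)) ^ (1 + ρ), by positivity, fun ζ hζ s hs => ?_⟩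
  refine (hb _ (hmem ζ (hsub hζ) s hs)).trans ?_
  rw [mul_assoc]
  refine mul_le_mul_of_nonneg_left (decay_le_of_abs_sub_le hρ ?_) hC
  have hee : e * (starRingEnd ℂ) e = 1 := by rw [Complex.mul_conj']; simp [he]
  have e1 : (ζ + s * e) * (starRingEnd ℂ) e = ζ * (starRingEnd ℂ) e + s := by
    rw [add_mul, mul_assoc, hee, mul_one]
  rw [e1, Complex.add_re, Complex.ofReal_re, add_sub_cancel_right]
  refine (Complex.abs_re_le_norm _).trans ?_
  rw [norm_mul, RCLike.norm_conj, he, mul_one]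
  have : ζ = (ζ - ξ) + ξ := by ring
  rw [this]
  refine (norm_add_le _ _).trans ?_
  rw [Metric.mem_ball, dist_eq_norm] at hζ
  linarith

/-! ### Asymptotic expansions in inverse powers of a positive real variable -/

open scoped PowerSeries Polynomial

/-- `f u ∼ ∑ a_m u⁻ᵐ` as `u → +∞`. -/
def Asymp (f : ℝ → ℂ) (a : ℂ⟦X⟧) : Prop :=
  ∀ N : ℕ, ∃ p : ℂ[X], PowerSeries.X ^ N ∣ (p : ℂ⟦X⟧) - a ∧
    (fun u : ℝ => f u - p.eval ((u : ℂ)⁻¹)) =O[atTop] fun u : ℝ => (u⁻¹) ^ N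

theorem tendsto_eval_inv (p : ℂ[X]) :
    Tendsto (fun u : ℝ => p.eval ((u : ℂ)⁻¹)) atTop (𝓝 (p.eval 0)) := by
  have h : Tendsto (fun u : ℝ => ((u : ℂ)⁻¹)) atTop (𝓝 0) := by
    have := (Complex.continuous_ofReal.tendsto 0).comp tendsto_inv_atTop_zero
    refine (this.congr fun u => ?_).trans_eq (by simp)
    simp
  exact (p.continuous.tendsto 0).comp h

theorem isBigO_eval_inv (p : ℂ[X]) :
    (fun u : ℝ => p.eval ((u : ℂ)⁻¹)) =O[atTop] fun _ : ℝ => (1 : ℝ) :=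
  (tendsto_eval_inv p).isBigO_one ℝ

namespace Asymp

variable {f g : ℝ → ℂ} {a b : ℂ⟦X⟧}

theorem isBigO_one (hf : Asymp f a) : f =O[atTop] fun _ : ℝ => (1 : ℝ) := by
  obtain ⟨p, -, h⟩ := hf 0
  simp only [pow_zero] at h
  exact (h.add (isBigO_eval_inv p)).congr_left fun u => by ring

theorem add (hf : Asymp f a) (hg : Asymp g b) : Asymp (fun u => f u + g u) (a + b) := fun N => by
  obtain ⟨p, hp, hp'⟩ := hf N
  obtain ⟨q, hq, hq'⟩ := hg N
  refine ⟨p + q, ?_, (hp'.add hq').congr_left fun u => ?_⟩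
  · rw [Polynomial.coe_add, add_sub_add_comm]
    exact dvd_add hp hq
  · rw [Polynomial.eval_add]; ring

/-- The definition asks for some polynomial congruent to the series modulo `X ^ N`, not for the
truncation, so the product of the two polynomials can be used as it is. -/
theorem mul (hf : Asymp f a) (hg : Asymp g b) : Asymp (fun u => f u * g u) (a * b) := fun N => by
  obtain ⟨p, hp, hp'⟩ := hf N
  obtain ⟨q, hq, hq'⟩ := hg N
  refine ⟨p * q, ?_, ?_⟩
  · have : ((p * q : ℂ[X]) : ℂ⟦X⟧) - a * b = p * (q - b) + (p - a) * b := by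
      rw [Polynomial.coe_mul]; ring
    rw [this]
    exact dvd_add (dvd_mul_of_dvd_right hq _) (dvd_mul_of_dvd_left hp _)
  · have h1 := hp'.mul hg.isBigO_one
    have h2 := (isBigO_eval_inv p).mul hq'
    simp only [one_mul, mul_one] at h1 h2
    exact (h1.add h2).congr_left fun u => by rw [Polynomial.eval_mul]; ring

theorem const (c : ℂ) : Asymp (fun _ => c) (PowerSeries.C c) := fun N =>
  ⟨Polynomial.C c, by simp, by simpa using Asymptotics.isBigO_zero _ _⟩

theorem inv : Asymp (fun u => (u : ℂ)⁻¹) PowerSeries.X := fun N =>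
  ⟨Polynomial.X, by simp, by simpa using Asymptotics.isBigO_zero _ _⟩

theorem pow (hf : Asymp f a) (k : ℕ) : Asymp (fun u => f u ^ k) (a ^ k) := by
  induction k with
  | zero => simpa using const 1
  | succ k ih => simpa only [pow_succ] using ih.mul hf

theorem const_mul (hf : Asymp f a) (c : ℂ) : Asymp (fun u => c * f u) (PowerSeries.C c * a) :=
  (const c).mul hf

theorem sum {ι : Type*} (I : Finset ι) {F : ι → ℝ → ℂ} {A : ι → ℂ⟦X⟧}
    (h : ∀ i ∈ I, Asymp (F i) (A i)) : Asymp (fun u => ∑ i ∈ I, F i u) (∑ i ∈ I, A i) := by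
  classical
  induction I using Finset.induction_on with
  | empty => simpa using const 0
  | insert i I hi ih =>
    simp only [Finset.sum_insert hi]
    exact (h i (Finset.mem_insert_self _ _)).add
      (ih fun i' hi' => h i' (Finset.mem_insert_of_mem hi'))

theorem congr (hf : Asymp f a) (h : f =ᶠ[atTop] g) : Asymp g a := fun N => by
  obtain ⟨p, hp, hp'⟩ := hf N
  exact ⟨p, hp, hp'.congr' (h.sub EventuallyEq.rfl) EventuallyEq.rfl⟩

end Asymp

/-- Remove one factor `X` at a time: the constant term of the quotient is its limit as `u → ∞`,
which is zero. -/
theorem X_pow_dvd_of_isBigO (p : ℂ[X]) (N : ℕ)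
    (h : (fun u : ℝ => p.eval ((u : ℂ)⁻¹)) =O[atTop] fun u : ℝ => (u⁻¹) ^ N) :
    Polynomial.X ^ N ∣ p := by
  induction N with
  | zero => simp
  | succ N ih =>
    have hle : (fun u : ℝ => (u⁻¹) ^ (N + 1)) =O[atTop] fun u : ℝ => (u⁻¹) ^ N := by
      have h1 : (fun u : ℝ => u⁻¹) =O[atTop] fun _ => (1 : ℝ) :=
        tendsto_inv_atTop_zero.isBigO_one ℝ
      simpa [pow_succ] using (Asymptotics.isBigO_refl (fun u : ℝ => (u⁻¹) ^ N) atTop).mul h1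
    obtain ⟨q, rfl⟩ := ih (h.trans hle)
    have h2 : (fun u : ℝ => q.eval ((u : ℂ)⁻¹)) =O[atTop] fun u : ℝ => u⁻¹ := by
      have h3' : (fun u : ℝ => ((u : ℂ)) ^ N * (Polynomial.X ^ N * q).eval ((u : ℂ)⁻¹)) =O[atTop]
          fun u : ℝ => u ^ N * (u⁻¹) ^ (N + 1) := by
        refine (Asymptotics.IsBigO.of_norm_left (f' := fun u : ℝ => ((u : ℂ)) ^ N) ?_).mul h
        simpa using (Asymptotics.isBigO_refl (fun u : ℝ => u ^ N) atTop).norm_left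
      refine h3'.congr' ?_ ?_
      · filter_upwards [eventually_ne_atTop 0] with u hu
        have : (u : ℂ) ≠ 0 := by exact_mod_cast hu
        simp [this]
      · filter_upwards [eventually_ne_atTop 0] with u hu
        rw [pow_succ, ← mul_assoc, ← mul_pow, mul_inv_cancel₀ hu, one_pow, one_mul]
    have h4 := tendsto_nhds_unique (h2.trans_tendsto tendsto_inv_atTop_zero) (tendsto_eval_inv q)
    have h5 : Polynomial.X ∣ q := by
      rw [Polynomial.X_dvd_iff, Polynomial.coeff_zero_eq_eval_zero, ← h4]
    rw [pow_succ]
    exact mul_dvd_mul_left _ h5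

theorem Asymp.unique {f : ℝ → ℂ} {a b : ℂ⟦X⟧} (ha : Asymp f a) (hb : Asymp f b) : a = b := by
  ext m
  obtain ⟨p, hp, hp'⟩ := ha (m + 1)
  obtain ⟨q, hq, hq'⟩ := hb (m + 1)
  have h1 : Polynomial.X ^ (m + 1) ∣ q - p := by
    refine X_pow_dvd_of_isBigO _ _ ((hp'.sub hq').congr_left fun u => ?_)
    rw [Polynomial.eval_sub]; ring
  have h2 := PowerSeries.X_pow_dvd_iff.1 hp m (Nat.lt_succ_self m)
  have h3 := PowerSeries.X_pow_dvd_iff.1 hq m (Nat.lt_succ_self m)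
  have h4 := Polynomial.X_pow_dvd_iff.1 h1 m (Nat.lt_succ_self m)
  simp only [map_sub, Polynomial.coeff_coe, Polynomial.coeff_sub] at h2 h3 h4
  rw [sub_eq_zero] at h2 h3 h4
  rw [← h2, ← h3, h4]

theorem Asymp.of_bound {f : ℝ → ℂ} (a : ℕ → ℂ)
    (h : ∀ N : ℕ, 1 ≤ N → ∃ C R : ℝ, ∀ u : ℝ, R ≤ u →
      ‖f u - ∑ m ∈ Finset.range N, a m / (u : ℂ) ^ m‖ ≤ C / u ^ N) : Asymp f (PowerSeries.mk a) := by
  have key : ∀ N : ℕ, 1 ≤ N → ∃ p : ℂ[X], PowerSeries.X ^ N ∣ (p : ℂ⟦X⟧) - PowerSeries.mk a ∧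
    (fun u : ℝ => f u - p.eval ((u : ℂ)⁻¹)) =O[atTop] fun u : ℝ => (u⁻¹) ^ N := by
    intro N hN
    obtain ⟨C, R, hC⟩ := h N hN
    refine ⟨∑ m ∈ Finset.range N, Polynomial.monomial m (a m), ?_, ?_⟩
    · rw [PowerSeries.X_pow_dvd_iff]
      intro m hm
      rw [map_sub, Polynomial.coeff_coe, PowerSeries.coeff_mk, Polynomial.finsetSum_coeff]
      simp [Polynomial.coeff_monomial, hm]
    · refine Asymptotics.IsBigO.of_bound C ?_
      filter_upwards [eventually_ge_atTop R, eventually_gt_atTop 0] with u hu hu0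
      rw [norm_pow, norm_inv, Real.norm_of_nonneg hu0.le, inv_pow, ← div_eq_mul_inv,
        Polynomial.eval_finsetSum]
      simp only [Polynomial.eval_monomial, inv_pow, ← div_eq_mul_inv]
      exact hC u hu
  intro N
  rcases Nat.eq_zero_or_pos N with rfl | hN
  · obtain ⟨p, -, hp'⟩ := key 1 le_rfl
    refine ⟨p, by simp, hp'.trans ?_⟩
    simpa using (tendsto_inv_atTop_zero (𝕜 := ℝ)).isBigO_one ℝ
  · exact key N hN

/-- An expansion that starts with `1 / u`. -/
theorem Asymp.of_bound_Ico {f : ℝ → ℂ} (c : ℂ) (a : ℕ → ℂ)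
    (h : ∀ N : ℕ, 1 ≤ N → ∃ C R : ℝ, ∀ u : ℝ, R ≤ u →
      ‖f u - ∑ m ∈ Finset.Ico 1 N, a m / (u : ℂ) ^ m‖ ≤ C / u ^ N) :
    Asymp (fun u => c + f u) (PowerSeries.mk fun m => if m = 0 then c else a m) := by
  refine Asymp.of_bound _ fun N hN => ?_
  obtain ⟨C, R, hC⟩ := h N hN
  refine ⟨C, R, fun u hu => ?_⟩
  have : ∑ m ∈ Finset.range N, (if m = 0 then c else a m) / (u : ℂ) ^ m =
      c + ∑ m ∈ Finset.Ico 1 N, a m / (u : ℂ) ^ m := by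
    rw [Finset.range_eq_Ico, Finset.sum_eq_sum_Ico_succ_bot (by omega)]
    simp only [if_true, pow_zero, div_one, zero_add]
    congr 1
    refine Finset.sum_congr rfl fun m hm => ?_
    rw [if_neg (by have := (Finset.mem_Ico.1 hm).1; omega)]
  rw [this, add_sub_add_left_eq_sub]
  exact hC u hu

/-! ### The coefficients of the potentials and the exponent -/

theorem analyticAt_iteratedDeriv_fst {f : ℂ → ℂ → ℂ} (m : ℕ) {p : ℂ × ℂ}
    (hf : AnalyticAt ℂ (fun p : ℂ × ℂ => f p.1 p.2) p) :
    AnalyticAt ℂ (fun p : ℂ × ℂ => iteratedDeriv m (fun z => f z p.2) p.1) p := by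
  induction m with
  | zero => simpa using hf
  | succ m ih =>
    simp only [iteratedDeriv_succ]
    exact analyticAt_deriv_fst (f := fun t ξ => iteratedDeriv m (fun z => f z ξ) t) ih

section Potentials

variable {n : ℕ} {Δ : Set ℂ} {ψ Ψ : ℕ → ℂ → ℂ → ℂ} {ψc : ℕ → ℕ → ℂ → ℂ} {d c ρ σ' : ℝ}

theorem BorelCondition.differentiableOn (hcond : BorelCondition n Δ ψ Ψ d c ρ σ') {k : ℕ}
    (hk : k < n - 1) {ξ : ℂ} (hξ : ξ ∈ Δ) :
    DifferentiableOn ℂ (fun t => Ψ k t ξ) (U (aSeq n * d)) := fun _ ht =>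
  ((hcond.analyticAt hk ht hξ).differentiableAt.comp (f := fun z => (z, ξ)) _
    (by fun_prop)).differentiableWithinAt

/-- The coefficients of the potentials are the derivatives of the Borel transforms. -/
theorem PotentialExpansion.eq_iteratedDeriv (hn : 2 ≤ n)
    (hcond : BorelCondition n Δ ψ Ψ d c ρ σ') (hexp : PotentialExpansion n Δ ψ ψc) {k : ℕ}
    (hk : k < n - 1) (m : ℕ) {ξ : ℂ} (hξ : ξ ∈ Δ) :
    ψc k (m + 1) ξ = iteratedDeriv m (fun t => Ψ k t ξ) 0 := by
  have hR : 0 < aSeq n * d := mul_pos (aSeq_pos n hn) hcond.d'_pos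
  have hc := hcond.c_pos
  have h1 : Asymp (fun u : ℝ => 0 + (ψ k u ξ - if k = 0 then 1 else 0))
      (PowerSeries.mk fun m => if m = 0 then 0 else ψc k m ξ) := by
    refine Asymp.of_bound_Ico 0 (fun m => ψc k m ξ) fun N hN => ?_
    obtain ⟨C, R, h⟩ := hexp k hk N hN
    refine ⟨C, max R 1, fun u hu => ?_⟩
    have hu0 : 0 < u := lt_of_lt_of_le one_pos ((le_max_right _ _).trans hu)
    have := h u ⟨by simpa using hu0, by simp⟩ (by
      rw [Complex.norm_of_nonneg hu0.le]; exact (le_max_left _ _).trans hu) ξ hξ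
    rwa [Complex.norm_of_nonneg hu0.le] at this
  -- Watson's lemma gives a second expansion of the same function, and asymptotic expansions are
  -- unique.
  have h2 : Asymp (fun u : ℝ => 0 + (ψ k u ξ - if k = 0 then 1 else 0))
      (PowerSeries.mk fun m => if m = 0 then 0 else iteratedDeriv (m - 1) (fun t => Ψ k t ξ) 0) := by
    refine Asymp.of_bound_Ico 0 (fun m => iteratedDeriv (m - 1) (fun t => Ψ k t ξ) 0) fun N hN => ?_
    obtain ⟨C, h⟩ := watson hR (E := {ξ}) (F := Ψ k) (K := c / (1 + ‖ξ‖ ^ (1 + ρ))) (s := σ')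
      (s' := σ' + 1) (fun ζ hζ => by rw [mem_singleton_iff.1 hζ]; exact hcond.differentiableOn hk hξ)
      (by positivity) hcond.σ'_nonneg (lt_add_one _) (fun ζ hζ t ht => by
        rw [mem_singleton_iff.1 hζ]
        exact (hcond.bound k hk t ht ξ hξ).trans (le_of_eq (by ring))) N hN
    refine ⟨C, max 0 (σ' + 1), fun u hu => ?_⟩
    have hu0 : 0 ≤ u := (le_max_left _ _).trans hu
    have hu1 : σ' + 1 ≤ u := (le_max_right _ _).trans hu
    have := h u (by simpa using hu1) ξ rfl
    rw [Complex.norm_of_nonneg hu0] at this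
    rw [hcond.laplace_eq k hk u (by simpa using (lt_add_one σ').trans_le hu1) ξ hξ, add_sub_cancel_left]
    exact this
  have h := congrArg (PowerSeries.coeff (m + 1)) (h1.unique h2)
  simpa using h

theorem BorelCondition.analyticOnNhd_iteratedDeriv (hcond : BorelCondition n Δ ψ Ψ d c ρ σ')
    (hn : 2 ≤ n) {k : ℕ} (hk : k < n - 1) (m : ℕ) :
    AnalyticOnNhd ℂ (fun ξ => iteratedDeriv m (fun t => Ψ k t ξ) 0) Δ := fun _ hξ =>
  (analyticAt_iteratedDeriv_fst m (hcond.analyticAt hk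
    (zero_mem_U (mul_pos (aSeq_pos n hn) hcond.d'_pos)) hξ)).comp
      (f := fun ξ => ((0 : ℂ), ξ)) (analyticAt_const.prod analyticAt_id)

theorem BorelCondition.norm_iteratedDeriv_le (hcond : BorelCondition n Δ ψ Ψ d c ρ σ')
    (hn : 2 ≤ n) {k : ℕ} (hk : k < n - 1) (m : ℕ) : ∃ C, 0 ≤ C ∧ ∀ ξ ∈ Δ,
    ‖iteratedDeriv m (fun t => Ψ k t ξ) 0‖ ≤ C * (1 / (1 + ‖ξ‖ ^ (1 + ρ))) := by
  have hR : 0 < aSeq n * d := mul_pos (aSeq_pos n hn) hcond.d'_pos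
  have hc := hcond.c_pos
  refine ⟨m.factorial * (c * Real.exp (σ' * (aSeq n * d / 2))) / (aSeq n * d / 2) ^ m,
    by positivity, fun ξ hξ => ?_⟩
  have h := norm_iteratedDeriv_le_axis hR (hcond.differentiableOn hk hξ)
    (K := c / (1 + ‖ξ‖ ^ (1 + ρ))) (s := σ') (by positivity) hcond.σ'_nonneg
    (fun t ht => (hcond.bound k hk t ht ξ hξ).trans (le_of_eq (by ring))) m 0 le_rfl
  rw [mul_zero, Real.exp_zero, mul_one, Complex.ofReal_zero] at h
  exact h.trans (le_of_eq (by ring))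

end Potentials

/-- The standing data for a fixed root of unity. -/
structure Setting (n : ℕ) (Δ : Set ℂ) (ψ Ψ : ℕ → ℂ → ℂ → ℂ) (ψc : ℕ → ℕ → ℂ → ℂ)
    (d d' c ρ σ' : ℝ) (j : Fin n) (Γ : Set ℂ) : Prop where
  two_le : 2 ≤ n
  cond : BorelCondition n Δ ψ Ψ d' c ρ σ'
  expansion : PotentialExpansion n Δ ψ ψc
  d_pos : 0 < d
  d_lt : d < d'
  admissible : IsAdmissibleSubdomain n Δ d j Γ

/-! ### The exponent and its bounds along rays -/

namespace Setting

variable {n : ℕ} {Δ : Set ℂ} {ψ Ψ : ℕ → ℂ → ℂ → ℂ} {ψc : ℕ → ℕ → ℂ → ℂ}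
    {d d' c ρ σ' : ℝ} {j : Fin n} {Γ : Set ℂ}

theorem n_ne_zero (H : Setting n Δ ψ Ψ ψc d d' c ρ σ' j Γ) : (n : ℂ) ≠ 0 := by
  have := H.two_le
  exact_mod_cast (by omega : n ≠ 0)

theorem isOpen (H : Setting n Δ ψ Ψ ψc d d' c ρ σ' j Γ) : IsOpen Γ := H.admissible.isOpen

theorem ray_mem (H : Setting n Δ ψ Ψ ψc d d' c ρ σ' j Γ) :
    ∀ ξ ∈ Γ, ∀ s : ℝ, 0 ≤ s → ξ + s * dir n j ∈ Γ := fun _ hξ _ hs =>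
  ray_mid_mem H.two_le H.admissible hξ hs

theorem rayIntegral_eq (f : ℂ → ℂ) (ξ : ℂ) : rayIntegral f ξ (thetaMid n j) =
    ∫ s in Ioi (0 : ℝ), f (ξ + s * dir n j) * dir n j := rfl

theorem rayBound_ψc (H : Setting n Δ ψ Ψ ψc d d' c ρ σ' j Γ) {k : ℕ} (hk : k < n - 1) {m : ℕ}
    (hm : 1 ≤ m) : RayBound Γ (dir n j) (decay ρ) (ψc k m) := by
  obtain ⟨m, rfl⟩ : ∃ m', m = m' + 1 := ⟨m - 1, by omega⟩
  obtain ⟨C, hC, hb⟩ := H.cond.norm_iteratedDeriv_le H.two_le hk m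
  have h : RayBound Γ (dir n j) (decay ρ) (fun ξ => iteratedDeriv m (fun t => Ψ k t ξ) 0) := by
    refine RayBound.of_decay (C := C * 2 ^ (1 + ρ)) H.cond.ρ_pos (norm_dir n j) H.isOpen H.ray_mem
      ((H.cond.analyticOnNhd_iteratedDeriv H.two_le hk m).mono H.admissible.subset) (by positivity)
      fun ξ hξ => (hb ξ (H.admissible.subset hξ)).trans ?_
    rw [mul_assoc]
    exact mul_le_mul_of_nonneg_left (one_div_one_add_rpow_le H.cond.ρ_pos ξ (norm_dir n j)) hC
  exact h.congr H.isOpen H.ray_mem fun ξ hξ =>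
    (H.expansion.eq_iteratedDeriv H.two_le H.cond hk m (H.admissible.subset hξ)).symm

theorem rayBound_sum (H : Setting n Δ ψ Ψ ψc d d' c ρ σ' j Γ) : RayBound Γ (dir n j) (decay ρ)
    fun ξ => ∑ k ∈ Finset.range (n - 1), omega n j ^ (k + 1) * ψc k 1 ξ :=
  RayBound.sum (fun s _ => (decay_pos ρ s).le) _ fun _ hk =>
    (H.rayBound_ψc (Finset.mem_range.1 hk) le_rfl).const_mul _

theorem hasDerivAt_X (H : Setting n Δ ψ Ψ ψc d d' c ρ σ' j Γ) {ξ : ℂ} (hξ : ξ ∈ Γ) :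
    HasDerivAt (X n ψc j)
      (1 / n * ∑ k ∈ Finset.range (n - 1), omega n j ^ (k + 1) * ψc k 1 ξ) ξ := by
  have h := (H.rayBound_sum.hasDerivAt_integral H.isOpen H.ray_mem
    (integrableOn_decay H.cond.ρ_pos) (tendsto_decay_atTop H.cond.ρ_pos) hξ).const_mul (-(1 / (n : ℂ)))
  rw [neg_mul_neg] at h
  exact h

theorem rayBound_X (H : Setting n Δ ψ Ψ ψc d d' c ρ σ' j Γ) :
    RayBound Γ (dir n j) (fun _ => 1) (X n ψc j) :=
  (H.rayBound_sum.integral H.isOpen H.ray_mem (integrableOn_decay H.cond.ρ_pos)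
    (tendsto_decay_atTop H.cond.ρ_pos) (fun s _ => (decay_pos ρ s).le)
    (decay_antitone H.cond.ρ_pos) (norm_dir n j)).const_mul _

theorem rayBound_deriv_X (H : Setting n Δ ψ Ψ ψc d d' c ρ σ' j Γ) :
    RayBound Γ (dir n j) (decay ρ) (deriv (X n ψc j)) :=
  (H.rayBound_sum.const_mul (1 / (n : ℂ))).congr H.isOpen H.ray_mem fun _ hξ =>
    (H.hasDerivAt_X hξ).deriv.symm

/-- This links the prescribed exponent with the diagonal shift in the first-order system. -/
theorem deriv_X_eq (H : Setting n Δ ψ Ψ ψc d d' c ρ σ' j Γ) {ξ : ℂ} (hξ : ξ ∈ Γ) :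
    deriv (X n ψc j) ξ = kernelZero n Ψ j j ξ := by
  rw [(H.hasDerivAt_X hξ).deriv, kernelZero, Finset.mul_sum, Finset.mul_sum]
  refine Finset.sum_congr rfl fun k hk => ?_
  rw [H.expansion.eq_iteratedDeriv H.two_le H.cond (Finset.mem_range.1 hk) 0
    (H.admissible.subset hξ), iteratedDeriv_zero, pow_succ]
  ring

/-- The exponential of the exponent is bounded along rays. -/
theorem rayBound_exp_X (H : Setting n Δ ψ Ψ ψc d d' c ρ σ' j Γ) :
    RayBound Γ (dir n j) (fun _ => 1) (fun ξ => Complex.exp (X n ψc j ξ)) := by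
  refine ⟨fun ξ hξ => (H.rayBound_X.analytic ξ hξ).cexp, fun ξ hξ => ?_⟩
  obtain ⟨r, hr, C, hC, hb⟩ := H.rayBound_X.bound ξ hξ
  refine ⟨r, hr, Real.exp C, (Real.exp_pos _).le, fun ζ hζ s hs => ?_⟩
  rw [mul_one, Complex.norm_exp]
  have := hb ζ hζ s hs
  rw [mul_one] at this
  exact Real.exp_le_exp.2 ((Complex.re_le_norm _).trans this)

end Setting

/-! ### From the first-order system to the differential equation -/

section Companion

variable {n : ℕ} {Γ : Set ℂ} {u : ℂ} {φ : ℕ → ℂ → ℂ} {P : Fin n → ℂ → ℂ} {w : ℂ → ℂ}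

/-- The coupling term depends on `l` only through the factor `ω_l`, so in the weighted sum it is
multiplied by the power sum of exponent `i + 1`. -/
theorem hasDerivAt_sum_omega
    (hP : ∀ l, ∀ ξ ∈ Γ, HasDerivAt (P l) (omega n l * u * P l ξ + omega n l / n * u *
      ∑ k ∈ Finset.range (n - 1), φ k ξ * ∑ m : Fin n, omega n m ^ k * P m ξ) ξ) (i : ℕ) {ξ : ℂ} (hξ : ξ ∈ Γ) :
    HasDerivAt (fun ξ => u ^ i * ∑ l : Fin n, omega n l ^ i * P l ξ)
      (u ^ (i + 1) * ∑ l : Fin n, omega n l ^ (i + 1) * P l ξ + u ^ (i + 1) / n * (∑ l : Fin n, omega n l ^ (i + 1)) *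
        ∑ k ∈ Finset.range (n - 1), φ k ξ * ∑ m : Fin n, omega n m ^ k * P m ξ) ξ := by
  have h := (HasDerivAt.fun_sum fun l (_ : l ∈ Finset.univ) =>
    (hP l ξ hξ).const_mul (omega n l ^ i)).const_mul (u ^ i)
  refine h.congr_deriv ?_
  generalize ∑ k ∈ Finset.range (n - 1), φ k ξ * ∑ m : Fin n, omega n m ^ k * P m ξ = G
  rw [Finset.mul_sum, Finset.mul_sum, Finset.mul_sum, Finset.sum_mul, ← Finset.sum_add_distrib]
  refine Finset.sum_congr rfl fun l _ => ?_
  ring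

/-- For `0 < i + 1 < n` the power sum is zero and the coupling drops out. It survives only at `i + 1
= n`, where it supplies the lower-order terms of the equation. -/
theorem iteratedDeriv_eq_sum_omega (hn : 2 ≤ n) (hΓ : IsOpen Γ)
    (hP : ∀ l, ∀ ξ ∈ Γ, HasDerivAt (P l) (omega n l * u * P l ξ + omega n l / n * u *
      ∑ k ∈ Finset.range (n - 1), φ k ξ * ∑ m : Fin n, omega n m ^ k * P m ξ) ξ)
    (hw : ∀ ξ ∈ Γ, w ξ = ∑ l : Fin n, P l ξ) (i : ℕ) (hi : i < n) : ∀ ξ ∈ Γ,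
    iteratedDeriv i w ξ = u ^ i * ∑ l : Fin n, omega n l ^ i * P l ξ := by
  induction i with
  | zero => intro ξ hξ; simp [hw ξ hξ]
  | succ i ih =>
    intro ξ hξ
    have h := hasDerivAt_sum_omega hP i hξ
    have hE : iteratedDeriv i w =ᶠ[𝓝 ξ] fun ξ => u ^ i * ∑ l : Fin n, omega n l ^ i * P l ξ :=
      EqOn.eventuallyEq_of_mem (ih (by omega)) (hΓ.mem_nhds hξ)
    rw [iteratedDeriv_succ, hE.deriv_eq, h.deriv, sum_omega_pow (by omega),
      if_neg (Nat.not_dvd_of_pos_of_lt (by omega) hi)]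
    ring

theorem iteratedDeriv_eq_of_system (hn : 2 ≤ n) (hΓ : IsOpen Γ)
    (hP : ∀ l, ∀ ξ ∈ Γ, HasDerivAt (P l) (omega n l * u * P l ξ + omega n l / n * u *
      ∑ k ∈ Finset.range (n - 1), φ k ξ * ∑ m : Fin n, omega n m ^ k * P m ξ) ξ)
    (hw : ∀ ξ ∈ Γ, w ξ = ∑ l : Fin n, P l ξ) {ξ : ℂ} (hξ : ξ ∈ Γ) :
    iteratedDeriv n w ξ = u ^ n * w ξ +
      ∑ k ∈ Finset.range (n - 1), u ^ (n - k) * φ k ξ * iteratedDeriv k w ξ := by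
  obtain ⟨i, rfl⟩ : ∃ i, n = i + 1 := ⟨n - 1, by omega⟩
  have hE : iteratedDeriv i w =ᶠ[𝓝 ξ] fun ξ => u ^ i * ∑ l : Fin (i + 1), omega (i + 1) l ^ i * P l ξ :=
    EqOn.eventuallyEq_of_mem (iteratedDeriv_eq_sum_omega hn hΓ hP hw i (by omega)) (hΓ.mem_nhds hξ)
  have h := hasDerivAt_sum_omega hP i hξ
  have hn0 : ((i + 1 : ℕ) : ℂ) ≠ 0 := by exact_mod_cast i.succ_ne_zero
  rw [iteratedDeriv_succ, hE.deriv_eq, h.deriv, sum_omega_pow (by omega), if_pos dvd_rfl, hw ξ hξ,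
    div_mul_cancel₀ _ hn0]
  congr 1
  · congr 1
    refine Finset.sum_congr rfl fun l _ => ?_
    rw [omega_pow (by omega), one_mul]
  · rw [Finset.mul_sum]
    refine Finset.sum_congr rfl fun k hk => ?_
    have hk := Finset.mem_range.1 hk
    rw [iteratedDeriv_eq_sum_omega hn hΓ hP hw k (by omega) ξ hξ]
    have : u ^ (i + 1) = u ^ (i + 1 - k) * u ^ k := by rw [← pow_add]; congr 1; omega
    rw [this]
    ring

end Companion

theorem RayBound.of_max_rpow {Γ : Set ℂ} {e : ℂ} {ρ C : ℝ} (hρ : 0 < ρ) (he : ‖e‖ = 1) {f : ℂ → ℂ}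
    (hΓ : IsOpen Γ) (hmem : ∀ ξ ∈ Γ, ∀ s : ℝ, 0 ≤ s → ξ + s * e ∈ Γ)
    (hf : AnalyticOnNhd ℂ f Γ) (hC : 0 ≤ C)
    (hb : ∀ ξ ∈ Γ, ‖f ξ‖ ≤ C * (1 / (max 1 (ξ * (starRingEnd ℂ) e).re) ^ ρ)) :
    RayBound Γ e (fun s => 1 / (1 + s) ^ ρ) f := by
  refine ⟨hf, fun ξ hξ => ?_⟩
  obtain ⟨r, hr, hsub⟩ := Metric.isOpen_iff.1 hΓ ξ hξ
  set L := 2 + (‖ξ‖ + r)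
  have hL : 0 < L := by have := norm_nonneg ξ; positivity
  refine ⟨r, hr, C * L ^ ρ, by positivity, fun ζ hζ s hs => ?_⟩
  refine (hb _ (hmem ζ (hsub hζ) s hs)).trans ?_
  rw [mul_assoc]
  refine mul_le_mul_of_nonneg_left ?_ hC
  have hee : e * (starRingEnd ℂ) e = 1 := by rw [Complex.mul_conj']; simp [he]
  have e1 : (ζ + s * e) * (starRingEnd ℂ) e = ζ * (starRingEnd ℂ) e + s := by
    rw [add_mul, mul_assoc, hee, mul_one]
  rw [e1, Complex.add_re, Complex.ofReal_re]
  have hx : |(ζ * (starRingEnd ℂ) e).re| ≤ ‖ξ‖ + r := by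
    refine (Complex.abs_re_le_norm _).trans ?_
    rw [norm_mul, RCLike.norm_conj, he, mul_one]
    have : ζ = (ζ - ξ) + ξ := by ring
    rw [this]
    refine (norm_add_le _ _).trans ?_
    rw [Metric.mem_ball, dist_eq_norm] at hζ
    linarith
  set x := (ζ * (starRingEnd ℂ) e).re
  have h1 : 1 + s ≤ L * max 1 (x + s) := by
    have h2 := (abs_le.1 hx).1
    have h3 := le_max_left 1 (x + s)
    have h4 := le_max_right 1 (x + s)
    have h5 : 0 ≤ ‖ξ‖ + r := by positivity
    nlinarith
  have hm : 0 < max 1 (x + s) := lt_max_of_lt_left one_pos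
  have h6 := Real.rpow_le_rpow (by positivity) h1 hρ.le
  rw [Real.mul_rpow hL.le hm.le] at h6
  rw [mul_one_div, div_le_div_iff₀ (by positivity) (by positivity), one_mul]
  exact h6

theorem tendsto_one_div_rpow {ρ : ℝ} (hρ : 0 < ρ) :
    Tendsto (fun s : ℝ => 1 / (1 + s) ^ ρ) atTop (𝓝 0) := by
  have h1 : Tendsto (fun s : ℝ => 1 + s) atTop atTop := tendsto_atTop_add_const_left _ _ tendsto_id
  simp_rw [one_div]
  exact ((tendsto_rpow_atTop hρ).comp h1).inv_tendsto_atTop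

/-! ### The error term and the solution built from it -/

namespace Setting

variable {n : ℕ} {Δ : Set ℂ} {ψ Ψ : ℕ → ℂ → ℂ → ℂ} {ψc : ℕ → ℕ → ℂ → ℂ}
    {d d' c ρ σ' : ℝ} {j : Fin n} {Γ : Set ℂ}

/-- The first-order system. -/
def system (H : Setting n Δ ψ Ψ ψc d d' c ρ σ' j Γ) : BorelSystem (Fin n) :=
  H.cond.system H.two_le H.d_pos H.d_lt H.admissible

/-- The Borel transform of the solution. -/
def borel (H : Setting n Δ ψ Ψ ψc d d' c ρ σ' j Γ) (t ξ : ℂ) : ℂ := ∑ l : Fin n, H.system.sol l t ξ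

/-- The error term of the solution. -/
def eta (H : Setting n Δ ψ Ψ ψc d d' c ρ σ' j Γ) (u ξ : ℂ) : ℂ := ∑ l : Fin n, H.system.q l u ξ

/-- The Laplace transforms of the kernels in terms of the potentials. -/
theorem b_add_kHat (H : Setting n Δ ψ Ψ ψc d d' c ρ σ' j Γ) (l m : Fin n) {u : ℂ} (hu : σ' < u.re)
    {ξ : ℂ} (hξ : ξ ∈ Γ) : H.system.b l m ξ + H.system.kHat l m u ξ =
      omega n l / n * u * (∑ k ∈ Finset.range (n - 1),
        omega n m ^ k * (ψ k u ξ - if k = 0 then 1 else 0)) -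
      if l = m then deriv (X n ψc j) ξ else 0 := by
  rw [← H.cond.laplace_kernelDeriv H.two_le l m hu (H.admissible.subset hξ), H.deriv_X_eq hξ]
  change kernelZero n Ψ l m ξ - (if l = m then kernelZero n Ψ j j ξ else 0) +
    laplace (fun t => kernelDeriv n Ψ l m t ξ) u = _
  ring

/-- The components of the solution. -/
def component (H : Setting n Δ ψ Ψ ψc d d' c ρ σ' j Γ) (u : ℂ) (l : Fin n) (ξ : ℂ) : ℂ :=
  Complex.exp (omega n j * u * ξ + X n ψc j ξ) * ((if l = j then 1 else 0) + H.system.q l u ξ)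

/-- The exponential factor contributes `ω_j u + X_j'` to the logarithmic derivative. This restores
the `ω_j` subtracted in `a l` and the `X_j'` subtracted on the diagonal of `b`. -/
theorem hasDerivAt_component (H : Setting n Δ ψ Ψ ψc d d' c ρ σ' j Γ) {u : ℂ} (hu : σ' < u.re)
    (l : Fin n) {ξ : ℂ} (hξ : ξ ∈ Γ) :
    HasDerivAt (H.component u l) (omega n l * u * H.component u l ξ + omega n l / n * u *
      ∑ k ∈ Finset.range (n - 1), (ψ k u ξ - if k = 0 then 1 else 0) *
        ∑ m : Fin n, omega n m ^ k * H.component u m ξ) ξ := by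
  have hX := (H.rayBound_X.analytic ξ hξ).differentiableAt.hasDerivAt
  have h1 := ((((hasDerivAt_id ξ).const_mul (omega n j * u)).fun_add hX).cexp).mul
    ((BorelSystem.hasDerivAt_q (S := H.system) l hu hξ).const_add (if l = j then (1 : ℂ) else 0))
  refine h1.congr_deriv ?_
  set E := Complex.exp (omega n j * u * id ξ + X n ψc j ξ) with hE
  set φ : ℕ → ℂ := fun k => ψ k u ξ - if k = 0 then 1 else 0 with hφ
  set q := fun l => H.system.q l u ξ with hq
  have hb := fun m => H.b_add_kHat l m hu hξ
  have hj : H.system.j = j := rfl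
  have ha : H.system.a l = omega n l - omega n j := rfl
  -- The inhomogeneous terms are the contribution of the Kronecker delta in `δ_{mj} + q_m`.
  have hsum : H.system.b l H.system.j ξ + H.system.kHat l H.system.j u ξ +
      ∑ m : Fin n, (H.system.b l m ξ * q m + H.system.kHat l m u ξ * q m) =
      ∑ m : Fin n, (omega n l / n * u * (∑ k ∈ Finset.range (n - 1), omega n m ^ k * φ k) -
        if l = m then deriv (X n ψc j) ξ else 0) * ((if m = j then 1 else 0) + q m) := by
    rw [hj, hb j]
    simp_rw [mul_add, Finset.sum_add_distrib, mul_ite, mul_one, mul_zero,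
      Finset.sum_ite_eq', Finset.mem_univ, if_true]
    rw [add_right_inj, ← Finset.sum_add_distrib]
    refine Finset.sum_congr rfl fun m _ => ?_
    rw [← add_mul, hb m]
  have hsum2 : ∑ m : Fin n, (omega n l / n * u * (∑ k ∈ Finset.range (n - 1), omega n m ^ k * φ k) -
        if l = m then deriv (X n ψc j) ξ else 0) * ((if m = j then 1 else 0) + q m) =
      omega n l / n * u * (∑ k ∈ Finset.range (n - 1), φ k *
        ∑ m : Fin n, omega n m ^ k * ((if m = j then 1 else 0) + q m)) -
        deriv (X n ψc j) ξ * ((if l = j then 1 else 0) + q l) := by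
    simp_rw [sub_mul, Finset.sum_sub_distrib, ite_mul, zero_mul, Finset.sum_ite_eq, Finset.mem_univ,
      if_true, Finset.mul_sum, Finset.sum_mul]
    congr 1
    rw [Finset.sum_comm]
    refine Finset.sum_congr rfl fun k _ => Finset.sum_congr rfl fun m _ => ?_
    ring
  have hcomp : ∀ m, H.component u m ξ = E * ((if m = j then 1 else 0) + q m) := fun m => rfl
  simp_rw [hcomp]
  have e1 : H.system.a l * u * H.system.q l u ξ + H.system.b l H.system.j ξ +
      H.system.kHat l H.system.j u ξ + ∑ m : Fin n, (H.system.b l m ξ * H.system.q m u ξ +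
        H.system.kHat l m u ξ * H.system.q m u ξ) = (omega n l - omega n j) * u * q l +
      (omega n l / n * u * (∑ k ∈ Finset.range (n - 1), φ k *
        ∑ m : Fin n, omega n m ^ k * ((if m = j then 1 else 0) + q m)) -
        deriv (X n ψc j) ξ * ((if l = j then 1 else 0) + q l)) := by
    rw [← hsum2, ← hsum, ha]; ring
  rw [e1]
  have e2 : ∑ k ∈ Finset.range (n - 1), φ k * ∑ m : Fin n, omega n m ^ k *
      (E * ((if m = j then 1 else 0) + q m)) = E * ∑ k ∈ Finset.range (n - 1), φ k *
        ∑ m : Fin n, omega n m ^ k * ((if m = j then 1 else 0) + q m) := by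
    simp_rw [Finset.mul_sum]
    refine Finset.sum_congr rfl fun k _ => Finset.sum_congr rfl fun m _ => ?_
    ring
  change _ = omega n l * u * _ + omega n l / n * u * (∑ k ∈ Finset.range (n - 1), φ k * _)
  rw [e2]
  by_cases hl : l = j
  · subst hl; simp only [if_true]; ring
  · simp only [hl, if_false]; ring

theorem solvesODE (H : Setting n Δ ψ Ψ ψc d d' c ρ σ' j Γ) {u : ℂ} (hu : σ' < u.re) :
    SolvesODE n ψ u Γ (W n ψc j H.eta u) := by
  intro ξ hξ
  have hn := H.two_le
  have hw : ∀ ξ ∈ Γ, W n ψc j H.eta u ξ = ∑ l : Fin n, H.component u l ξ := fun ξ _ => by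
    simp only [W, eta, component, ← Finset.mul_sum, Finset.sum_add_distrib]
    simp
  have h := iteratedDeriv_eq_of_system (φ := fun k ξ => ψ k u ξ - if k = 0 then 1 else 0) hn H.isOpen
    (fun l ξ hξ => H.hasDerivAt_component hu l hξ) hw hξ
  have hsplit : ∀ f : ℕ → ℂ, ∑ k ∈ Finset.range (n - 1), f k = f 0 + ∑ k ∈ Finset.Ico 1 (n - 1), f k :=
    fun f => by rw [Finset.range_eq_Ico, Finset.sum_eq_sum_Ico_succ_bot (by omega)]
  have hIco : ∑ k ∈ Finset.Ico 1 (n - 1), u ^ (n - k) * (ψ k u ξ - if k = 0 then 1 else 0) *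
      iteratedDeriv k (W n ψc j H.eta u) ξ = ∑ k ∈ Finset.Ico 1 (n - 1), u ^ (n - k) *
      ψ k u ξ * iteratedDeriv k (W n ψc j H.eta u) ξ := by
    refine Finset.sum_congr rfl fun k hk => ?_
    rw [if_neg (by have := (Finset.mem_Ico.1 hk).1; omega), sub_zero]
  rw [h, hsplit, hsplit, hIco, iteratedDeriv_zero, if_pos rfl, Nat.sub_zero]
  ring

theorem eta_analytic (H : Setting n Δ ψ Ψ ψc d d' c ρ σ' j Γ) :
    AnalyticOnNhd ℂ (fun p : ℂ × ℂ => H.eta p.1 p.2) ({u : ℂ | σ' < u.re} ×ˢ Γ) := fun p hp => by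
  unfold eta
  exact Finset.analyticAt_fun_sum _ fun l _ => BorelSystem.q_analytic (S := H.system) l p hp

theorem analyticOnNhd_snd {f : ℂ → ℂ → ℂ} {A B : Set ℂ}
    (hf : AnalyticOnNhd ℂ (fun p : ℂ × ℂ => f p.1 p.2) (A ×ˢ B)) {u : ℂ} (hu : u ∈ A) :
    AnalyticOnNhd ℂ (f u) B := fun ξ hξ =>
  (hf (u, ξ) ⟨hu, hξ⟩).comp (f := fun ξ => (u, ξ)) (analyticAt_const.prod analyticAt_id)

theorem analyticOnNhd_fst {f : ℂ → ℂ → ℂ} {A B : Set ℂ}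
    (hf : AnalyticOnNhd ℂ (fun p : ℂ × ℂ => f p.1 p.2) (A ×ˢ B)) {ξ : ℂ} (hξ : ξ ∈ B) :
    AnalyticOnNhd ℂ (fun u => f u ξ) A := fun u hu =>
  (hf (u, ξ) ⟨hu, hξ⟩).comp (f := fun u => (u, ξ)) (analyticAt_id.prod analyticAt_const)

theorem rayBound_eta (H : Setting n Δ ψ Ψ ψc d d' c ρ σ' j Γ) {u : ℂ} (hu : σ' < u.re) :
    RayBound Γ (dir n j) (fun s => 1 / (1 + s) ^ ρ) (H.eta u) := by
  obtain ⟨K, hK, hb⟩ := BorelSystem.exists_norm_q_le (S := H.system) hu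
  refine RayBound.of_max_rpow (C := n * K) H.cond.ρ_pos (norm_dir n j) H.isOpen H.ray_mem
    (analyticOnNhd_snd H.eta_analytic hu) (by positivity) fun ξ hξ => ?_
  refine (norm_sum_le_of_le _ fun l _ => hb l ξ hξ).trans (le_of_eq ?_)
  simp only [Finset.sum_const, Finset.card_univ, Fintype.card_fin, nsmul_eq_mul, mul_assoc]
  rfl

theorem isNormalisedSolution (H : Setting n Δ ψ Ψ ψc d d' c ρ σ' j Γ) :
    IsNormalisedSolution n ψ ψc σ' j Γ H.eta where
  analytic := H.eta_analytic
  solves _ hu := H.solvesODE hu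
  limits _ hu _ hξ s _ := ((H.rayBound_eta hu).iteratedDeriv H.isOpen H.ray_mem s).tendsto
    (tendsto_one_div_rpow H.cond.ρ_pos) hξ

end Setting

/-! ### Solutions that tend to zero vanish -/

/-- A solution of `z' = b z + f` that is negligible with respect to `e^{bs}` is controlled by `f`. -/
theorem norm_le_integral_of_hasDerivAt {z f : ℝ → ℂ} {b : ℂ} {g : ℝ → ℝ} {s₀ : ℝ} (hb : 0 ≤ b.re)
    (hz : ∀ s, s₀ ≤ s → HasDerivAt z (b * z s + f s) s)
    (hf : ContinuousOn f (Ici s₀)) (hfg : ∀ s, s₀ ≤ s → ‖f s‖ ≤ g s) (hg : IntegrableOn g (Ioi s₀))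
    (hlim : Tendsto (fun s : ℝ => Complex.exp (-b * s) * z s) atTop (𝓝 0)) :
    ‖z s₀‖ ≤ ∫ s in Ioi s₀, g s := by
  have hexp : ∀ s : ℝ, HasDerivAt (fun s : ℝ => Complex.exp (-b * s)) (Complex.exp (-b * s) * -b) s :=
    fun s => by
      have h1 : HasDerivAt (fun s : ℝ => -b * (s : ℂ)) (-b) s := by
        simpa using (Complex.ofRealCLM.hasDerivAt (x := s)).const_mul (-b)
      exact h1.cexp
  have hd : ∀ s ∈ Ici s₀, HasDerivAt (fun s : ℝ => Complex.exp (-b * s) * z s)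
      (Complex.exp (-b * s) * f s) s := fun s hs => by
    refine ((hexp s).mul (hz s hs)).congr_deriv ?_
    ring
  have hle : ∀ s ∈ Ioi s₀, ‖Complex.exp (-b * s) * f s‖ ≤ Real.exp (-b.re * s₀) * g s := by
    intro s hs
    have hs' : s₀ ≤ s := le_of_lt hs
    rw [norm_mul, Complex.norm_exp]
    refine mul_le_mul (Real.exp_le_exp.2 ?_) (hfg s hs') (norm_nonneg _) (Real.exp_pos _).le
    rw [Complex.re_mul_ofReal, Complex.neg_re]
    nlinarith
  have hi : IntegrableOn (fun s : ℝ => Complex.exp (-b * s) * f s) (Ioi s₀) := by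
    refine (hg.const_mul (Real.exp (-b.re * s₀))).mono' ?_
      ((ae_restrict_iff' measurableSet_Ioi).2 (Eventually.of_forall hle))
    exact (ContinuousOn.mul (by fun_prop) (hf.mono Ioi_subset_Ici_self)).aestronglyMeasurable
      measurableSet_Ioi
  -- Variation of constants from infinity: `-e^{-b s₀} z(s₀)` is the integral of `e^{-b s} f(s)`.
  -- The factor `e^{-s₀ Re b}` cancels because `Re b ≥ 0`.
  have h := integral_Ioi_of_hasDerivAt_of_tendsto' hd hi hlim
  have h2 : ‖∫ s in Ioi s₀, Complex.exp (-b * s) * f s‖ ≤ ∫ s in Ioi s₀, Real.exp (-b.re * s₀) * g s :=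
    norm_integral_le_of_norm_le (hg.const_mul _)
      ((ae_restrict_iff' measurableSet_Ioi).2 (Eventually.of_forall hle))
  rw [h, zero_sub, norm_neg, norm_mul, Complex.norm_exp, integral_const_mul, Complex.re_mul_ofReal,
    Complex.neg_re] at h2
  exact le_of_mul_le_mul_left h2 (Real.exp_pos _)

theorem tendsto_exp_mul_of_bounded {z : ℝ → ℂ} {b : ℂ} {B s₀ : ℝ} (hb : 0 < b.re)
    (hz : ∀ s, s₀ ≤ s → ‖z s‖ ≤ B) :
    Tendsto (fun s : ℝ => Complex.exp (-b * s) * z s) atTop (𝓝 0) := by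
  have h1 : Tendsto (fun s : ℝ => Real.exp (-(b.re * s)) * B) atTop (𝓝 0) := by
    have h2 : Tendsto (fun s : ℝ => b.re * s) atTop atTop := tendsto_id.const_mul_atTop hb
    simpa using (Real.tendsto_exp_neg_atTop_nhds_zero.comp h2).mul_const B
  refine squeeze_zero_norm' ((eventually_ge_atTop s₀).mono fun s hs => ?_) h1
  rw [norm_mul, Complex.norm_exp, Complex.re_mul_ofReal, Complex.neg_re, neg_mul]
  exact mul_le_mul_of_nonneg_left (hz s hs) (Real.exp_pos _).le

theorem tendsto_exp_mul_of_tendsto {z : ℝ → ℂ} {b : ℂ} (hb : 0 ≤ b.re)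
    (hz : Tendsto z atTop (𝓝 0)) :
    Tendsto (fun s : ℝ => Complex.exp (-b * s) * z s) atTop (𝓝 0) := by
  refine squeeze_zero_norm' ((eventually_ge_atTop 0).mono fun s hs => ?_)
    (by simpa using hz.norm)
  rw [norm_mul, Complex.norm_exp, Complex.re_mul_ofReal, Complex.neg_re]
  refine mul_le_of_le_one_left (norm_nonneg _) (Real.exp_le_one_iff.2 ?_)
  nlinarith

theorem tendsto_integral_Ioi_zero {g : ℝ → ℝ} {s₀ : ℝ} (hg : IntegrableOn g (Ioi s₀)) :
    Tendsto (fun s => ∫ t in Ioi s, g t) atTop (𝓝 0) := by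
  have h1 := intervalIntegral_tendsto_integral_Ioi s₀ hg tendsto_id
  have h2 : Tendsto (fun s => (∫ t in Ioi s₀, g t) - ∫ t in s₀..s, g t) atTop (𝓝 0) := by
    simpa using h1.const_sub (∫ t in Ioi s₀, g t)
  refine h2.congr' ((eventually_ge_atTop s₀).mono fun s hs => ?_)
  rw [intervalIntegral.integral_of_le hs, ← Ioc_union_Ioi_eq_Ioi hs,
    setIntegral_union (Ioc_disjoint_Ioi le_rfl) measurableSet_Ioi
      (hg.mono_set Ioc_subset_Ioi_self) (hg.mono_set (Ioi_subset_Ioi hs))]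
  ring

/-- A solution of the first-order system whose first `n - 1` discrete Fourier coefficients tend to
zero vanishes near infinity. -/
theorem eventually_eq_zero_of_tendsto {n : ℕ} (hn : 2 ≤ n) {j : Fin n} {z f : Fin n → ℝ → ℂ} {Y : ℕ → ℝ → ℂ}
    {b : Fin n → ℂ} {D : ℝ → ℝ}
    (hbj : b j = 0) (hb : ∀ l, l ≠ j → 0 < (b l).re)
    (hz : ∀ l : Fin n, ∀ s, 0 ≤ s → HasDerivAt (z l) (b l * z l s + f l s) s)
    (hf : ∀ l : Fin n, ContinuousOn (f l) (Ici 0))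
    (hD : IntegrableOn D (Ioi 0)) (hD0 : ∀ s, 0 ≤ D s)
    (hfD : ∀ l : Fin n, ∀ s, 0 ≤ s → ‖f l s‖ ≤ D s * ∑ k ∈ Finset.range (n - 1), ‖Y k s‖)
    (hzY : ∀ l : Fin n, ∀ s, 0 ≤ s → n * z l s = ∑ k ∈ Finset.range n, (omega n l)⁻¹ ^ k * Y k s)
    (hYz : ∀ k < n, ∀ s, 0 ≤ s → ‖Y k s‖ ≤ ∑ l : Fin n, ‖z l s‖)
    (hY : ∀ k < n - 1, Tendsto (Y k) atTop (𝓝 0)) :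
    ∃ s₀, 0 ≤ s₀ ∧ ∀ s, s₀ ≤ s → ∀ l : Fin n, z l s = 0 := by
  have hn0 : n ≠ 0 := by omega
  have hbre : ∀ l, 0 ≤ (b l).re := fun l => by
    by_cases hl : l = j
    · rw [hl, hbj]; simp
    · exact (hb l hl).le
  set T : ℝ → ℝ := fun s => ∑ k ∈ Finset.range (n - 1), ‖Y k s‖ with hT
  have hTlim : Tendsto T atTop (𝓝 0) := by
    have := tendsto_finsetSum (Finset.range (n - 1)) fun k hk => (hY k (Finset.mem_range.1 hk)).norm
    simpa using this
  have hT0 : ∀ s, 0 ≤ T s := fun s => Finset.sum_nonneg fun _ _ => norm_nonneg _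
  -- The coefficient `Y (n - 1)` is the only one not known to tend to zero. It enters `z l` with the
  -- factor `ω_l^{-(n-1)} = ω_l`, so this combination eliminates it.
  have hrel : ∀ l : Fin n, ∀ s, 0 ≤ s → ‖z l s - omega n l / omega n j * z j s‖ ≤ 2 * T s := by
    intro l s hs
    have hl0 := omega_ne_zero n l
    have hj0 := omega_ne_zero n j
    have e1 : (n : ℂ) * (z l s - omega n l / omega n j * z j s) = ∑ k ∈ Finset.range (n - 1),
        ((omega n l)⁻¹ ^ k - omega n l / omega n j * (omega n j)⁻¹ ^ k) * Y k s := by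
      rw [mul_sub, mul_left_comm, hzY l s hs, hzY j s hs, Finset.mul_sum, ← Finset.sum_sub_distrib]
      obtain ⟨i, rfl⟩ : ∃ i, n = i + 1 := ⟨n - 1, by omega⟩
      rw [Finset.sum_range_succ, Nat.add_sub_cancel]
      have hp : ∀ l : Fin (i + 1), (omega (i + 1) l)⁻¹ ^ i = omega (i + 1) l := fun l => by
        have := omega_pow hn0 l
        rw [pow_succ] at this
        rw [inv_pow]
        exact (eq_inv_of_mul_eq_one_right this).symm
      have hc : omega (i + 1) l / omega (i + 1) j * (omega (i + 1) j * Y i s) =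
        omega (i + 1) l * Y i s := by field_simp
      rw [hp l, hp j, hc, sub_self, add_zero]
      refine Finset.sum_congr rfl fun k _ => ?_
      ring
    have e2 : ‖(n : ℂ) * (z l s - omega n l / omega n j * z j s)‖ ≤ 2 * T s := by
      rw [e1, hT, Finset.mul_sum]
      refine norm_sum_le_of_le _ fun k _ => ?_
      rw [norm_mul]
      refine mul_le_mul_of_nonneg_right ((norm_sub_le _ _).trans ?_) (norm_nonneg _)
      simp only [norm_mul, norm_pow, norm_inv, norm_div, norm_omega]
      norm_num
    rw [norm_mul, Complex.norm_natCast] at e2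
    have h1 : (1 : ℝ) ≤ n := by exact_mod_cast (by omega : 1 ≤ n)
    nlinarith [norm_nonneg (z l s - omega n l / omega n j * z j s)]
  -- Beyond `s₁` one has `T < 1`, so the forcing terms are dominated by the integrable function `D`.
  obtain ⟨s₁, hs₁⟩ := eventually_atTop.1 ((hTlim.eventually (gt_mem_nhds one_pos)).and
    (eventually_ge_atTop 0))
  have hs₁0 : 0 ≤ s₁ := (hs₁ s₁ le_rfl).2
  have hDi : ∀ s, 0 ≤ s → IntegrableOn D (Ioi s) := fun s hs => hD.mono_set (Ioi_subset_Ioi hs)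
  have hfD' : ∀ l : Fin n, ∀ s, s₁ ≤ s → ‖f l s‖ ≤ D s := fun l s hs =>
    (hfD l s (hs₁0.trans hs)).trans (mul_le_of_le_one_right (hD0 s) (hs₁ s hs).1.le)
  -- the component `z j` is bounded
  have hzj : ∀ s, s₁ ≤ s → ‖z j s‖ ≤ ‖z j s₁‖ + ∫ t in Ioi s₁, D t := by
    intro s hs
    have hint : IntervalIntegrable (f j) volume s₁ s :=
      ((hf j).mono fun t ht => by
        rw [uIcc_of_le hs] at ht; exact hs₁0.trans ht.1).intervalIntegrable
    have h1 := intervalIntegral.integral_eq_sub_of_hasDerivAt (f := z j) (f' := f j) (a := s₁) (b := s)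
      (fun t ht => by
        rw [uIcc_of_le hs] at ht
        simpa [hbj] using hz j t (hs₁0.trans ht.1)) hint
    have h2 : ‖∫ t in s₁..s, f j t‖ ≤ ∫ t in Ioi s₁, D t := by
      rw [intervalIntegral.integral_of_le hs]
      refine (norm_integral_le_of_norm_le ((hDi s₁ hs₁0).mono_set Ioc_subset_Ioi_self)
        ((ae_restrict_iff' measurableSet_Ioc).2 (Eventually.of_forall fun t ht =>
          hfD' j t ht.1.le))).trans ?_
      exact setIntegral_mono_set (hDi s₁ hs₁0) (Eventually.of_forall hD0)
        (Eventually.of_forall Ioc_subset_Ioi_self)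
    rw [h1] at h2
    have h3 : z j s = z j s₁ + (z j s - z j s₁) := by ring
    rw [h3]
    exact (norm_add_le _ _).trans (by linarith)
  set B := 2 + (‖z j s₁‖ + ∫ t in Ioi s₁, D t) with hB
  have hzB : ∀ l : Fin n, ∀ s, s₁ ≤ s → ‖z l s‖ ≤ B := by
    intro l s hs
    have h1 := hrel l s (hs₁0.trans hs)
    have h2 : z l s = (z l s - omega n l / omega n j * z j s) + omega n l / omega n j * z j s := by ring
    rw [h2]
    refine (norm_add_le _ _).trans ?_
    rw [norm_mul, norm_div, norm_omega, norm_omega, div_one, one_mul]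
    have h3 := (hs₁ s hs).1
    have h4 := hzj s hs
    linarith
  -- Boundedness and `Re b_l > 0` exclude the growing solution, so the tail of the integral of `D`
  -- bounds `z l`.
  have hstep : ∀ l : Fin n, l ≠ j → Tendsto (z l) atTop (𝓝 0) := fun l hl => by
    refine squeeze_zero_norm' ((eventually_ge_atTop s₁).mono fun s hs => ?_)
      (tendsto_integral_Ioi_zero hD)
    have hs0 := hs₁0.trans hs
    exact norm_le_integral_of_hasDerivAt (hbre l) (fun t ht => hz l t (hs0.trans ht))
      ((hf l).mono (Ici_subset_Ici.2 hs0)) (fun t ht => hfD' l t (hs.trans ht)) (hDi s hs0)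
      (tendsto_exp_mul_of_bounded (hb l hl) (hzB l))
  -- For `l = j` use `hrel` with another index `m`, whose component already tends to zero.
  have hzlim : ∀ l : Fin n, Tendsto (z l) atTop (𝓝 0) := fun l => by
    by_cases hl : l = j
    · obtain ⟨m, hm, -⟩ := (exists_theta_eq_min_max hn j).1
      have h1 : Tendsto (fun s => 2 * T s + ‖z m s‖) atTop (𝓝 0) := by
        simpa using (hTlim.const_mul 2).add (hstep m hm).norm
      refine squeeze_zero_norm' ((eventually_ge_atTop 0).mono fun s hs => ?_) h1
      rw [hl]
      have h2 := hrel m s hs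
      have h3 : ‖omega n m / omega n j * z j s‖ = ‖z j s‖ := by
        rw [norm_mul, norm_div, norm_omega, norm_omega, div_one, one_mul]
      have h4 : omega n m / omega n j * z j s =
        z m s - (z m s - omega n m / omega n j * z j s) := by ring
      rw [← h3, h4]
      exact (norm_sub_le _ _).trans (by linarith)
    · exact hstep l hl
  -- contraction
  have htail := (tendsto_integral_Ioi_zero hD).const_mul (n * n : ℝ)
  rw [mul_zero] at htail
  obtain ⟨s₂, hs₂⟩ := eventually_atTop.1 ((htail.eventually (gt_mem_nhds (half_pos one_pos))).and
    (eventually_ge_atTop s₁))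
  have hs₂1 : s₁ ≤ s₂ := (hs₂ s₂ le_rfl).2
  have hs₂0 := hs₁0.trans hs₂1
  have hB0 : 0 ≤ B := (norm_nonneg _).trans (hzB j s₁ le_rfl)
  -- Each use of the integral inequality halves the bound. The `n * n` in the choice of `s₂` allows
  -- for summing over at most `n` coefficients and over `n` components.
  have hind : ∀ N : ℕ, ∀ s, s₂ ≤ s → ∑ l : Fin n, ‖z l s‖ ≤ n * B / 2 ^ N := by
    intro N
    induction N with
    | zero =>
      intro s hs
      refine (Finset.sum_le_sum fun l _ => hzB l s (hs₂1.trans hs)).trans ?_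
      simp
    | succ N ih =>
      intro s hs
      have hs0 := hs₂0.trans hs
      have h1 : ∀ l : Fin n, ‖z l s‖ ≤ ∫ t in Ioi s, n * (n * B / 2 ^ N) * D t := fun l => by
        refine norm_le_integral_of_hasDerivAt (hbre l) (fun t ht => hz l t (hs0.trans ht))
          ((hf l).mono (Ici_subset_Ici.2 hs0)) (fun t ht => (hfD l t (hs0.trans ht)).trans ?_)
          ((hDi s hs0).const_mul _) (tendsto_exp_mul_of_tendsto (hbre l) (hzlim l))
        rw [mul_comm]
        refine mul_le_mul_of_nonneg_right ?_ (hD0 t)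
        refine (Finset.sum_le_sum fun k hk => (hYz k (by
          have := Finset.mem_range.1 hk; omega) t (hs0.trans ht)).trans (ih t (hs.trans ht))).trans ?_
        rw [Finset.sum_const, Finset.card_range, nsmul_eq_mul]
        exact mul_le_mul_of_nonneg_right (by exact_mod_cast Nat.sub_le n 1) (by positivity)
      refine (Finset.sum_le_sum fun l _ => h1 l).trans ?_
      rw [Finset.sum_const, Finset.card_univ, Fintype.card_fin, nsmul_eq_mul, integral_const_mul]
      have h2 := (hs₂ s hs).1
      have h3 : (n : ℝ) * (n * (n * B / 2 ^ N) * ∫ t in Ioi s, D t) =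
        (n * n * ∫ t in Ioi s, D t) * (n * B / 2 ^ N) := by ring
      rw [h3, pow_succ, ← div_div, div_eq_mul_one_div _ (2 : ℝ), mul_comm]
      exact mul_le_mul_of_nonneg_left h2.le (by positivity)
  refine ⟨s₂, hs₂0, fun s hs l => ?_⟩
  have h1 : Tendsto (fun N : ℕ => n * B / 2 ^ N) atTop (𝓝 0) := by
    have := (tendsto_pow_atTop_nhds_zero_of_lt_one (r := (1 / 2 : ℝ)) (by norm_num)
      (by norm_num)).const_mul (n * B)
    rw [mul_zero] at this
    refine this.congr fun N => ?_
    rw [one_div, inv_pow, div_eq_mul_inv]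
  have h2 := ge_of_tendsto' h1 fun N => hind N s hs
  have h3 := Finset.single_le_sum (f := fun l : Fin n => ‖z l s‖) (fun l _ => norm_nonneg _)
    (Finset.mem_univ l)
  exact norm_le_zero_iff.1 (h3.trans h2)

theorem analyticOnNhd_iteratedDeriv {f : ℂ → ℂ} {s : Set ℂ} (hf : AnalyticOnNhd ℂ f s) (k : ℕ) :
    AnalyticOnNhd ℂ (iteratedDeriv k f) s := by
  induction k with
  | zero => simpa using hf
  | succ k ih => rw [iteratedDeriv_succ]; exact ih.deriv

theorem iteratedDeriv_mul_of_analyticAt {f g : ℂ → ℂ} {ξ : ℂ} (hf : AnalyticAt ℂ f ξ)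
    (hg : AnalyticAt ℂ g ξ) (k : ℕ) : iteratedDeriv k (fun ξ => f ξ * g ξ) ξ =
      ∑ i ∈ Finset.range (k + 1), (k.choose i : ℂ) * iteratedDeriv i f ξ * iteratedDeriv (k - i) g ξ :=
  iteratedDeriv_fun_mul hf.contDiffAt hg.contDiffAt

theorem iteratedDeriv_exp_mul {y : ℂ → ℂ} {ξ : ℂ} (hy : AnalyticAt ℂ y ξ) (c : ℂ) (k : ℕ) :
    iteratedDeriv k (fun ξ => Complex.exp (c * ξ) * y ξ) ξ = Complex.exp (c * ξ) *
      ∑ i ∈ Finset.range (k + 1), (k.choose i : ℂ) * c ^ (k - i) * iteratedDeriv i y ξ := by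
  have he : AnalyticAt ℂ (fun ξ => Complex.exp (c * ξ)) ξ := by fun_prop
  have h := iteratedDeriv_mul_of_analyticAt hy he k
  simp only [mul_comm (y _)] at h
  rw [h, Finset.mul_sum]
  refine Finset.sum_congr rfl fun i _ => ?_
  rw [iteratedDeriv_cexp_const_mul]
  ring

theorem sum_omega_pow_mul_inv_pow {n k i : ℕ} (hk : k < n) (hi : i < n) :
    ∑ m : Fin n, omega n m ^ k * (omega n m)⁻¹ ^ i = if i = k then (n : ℂ) else 0 := by
  have hn : n ≠ 0 := by omega
  have h1 : ∀ m : Fin n, omega n m ^ k * (omega n m)⁻¹ ^ i = omega n m ^ (k + (n - i)) := fun m => by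
    rw [pow_add, inv_pow]
    congr 1
    refine inv_eq_of_mul_eq_one_right ?_
    rw [← pow_add, Nat.add_sub_cancel' hi.le, omega_pow hn]
  rw [Finset.sum_congr rfl fun m _ => h1 m, sum_omega_pow hn]
  have h2 : n ∣ k + (n - i) ↔ i = k := by
    constructor
    · rintro ⟨q, hq⟩
      have : q = 1 := by
        rcases q with _ | _ | q
        · omega
        · rfl
        · exfalso
          have : n * (q + 1 + 1) = n * q + n + n := by ring
          have : 0 ≤ n * q := Nat.zero_le _
          omega
      rw [this] at hq
      omega
    · rintro rfl
      exact ⟨1, by omega⟩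
  simp only [h2]

/-! ### Uniqueness of normalised solutions -/

namespace Setting

variable {n : ℕ} {Δ : Set ℂ} {ψ Ψ : ℕ → ℂ → ℂ → ℂ} {ψc : ℕ → ℕ → ℂ → ℂ}
    {d d' c ρ σ' : ℝ} {j : Fin n} {Γ : Set ℂ}

theorem norm_potential_le (H : Setting n Δ ψ Ψ ψc d d' c ρ σ' j Γ) {k : ℕ} (hk : k < n - 1) {u : ℂ}
    (hu : σ' < u.re) {ξ : ℂ} (hξ : ξ ∈ Γ) : ‖ψ k u ξ - if k = 0 then 1 else 0‖ ≤
      c * 2 ^ (1 + ρ) / (u.re - σ') * decay ρ (ξ * (starRingEnd ℂ) (dir n j)).re := by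
  have hΔ := H.admissible.subset hξ
  have hR : 0 < aSeq n * d' := mul_pos (aSeq_pos n H.two_le) H.cond.d'_pos
  rw [H.cond.laplace_eq k hk u hu ξ hΔ, add_sub_cancel_left]
  refine (norm_laplace_le (g := fun t => Ψ k t ξ) (K := c * (1 / (1 + ‖ξ‖ ^ (1 + ρ)))) hu fun t ht =>
    (H.cond.bound k hk t (BorelSystem.ofReal_mem_U hR ht.le) ξ hΔ).trans (le_of_eq (by
      simp; ring))).trans ?_
  have h1 := one_div_one_add_rpow_le H.cond.ρ_pos ξ (norm_dir n j)
  have h2 := sub_pos.2 hu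
  have hc := H.cond.c_pos
  rw [div_mul_eq_mul_div, mul_assoc]
  gcongr

/-- A solution that tends to zero along rays together with its first `n - 2` derivatives, apart
from an exponential factor, vanishes. -/
theorem eq_zero_of_solvesODE (H : Setting n Δ ψ Ψ ψc d d' c ρ σ' j Γ) {u : ℝ} (hu : σ' < u)
    (hu0 : 0 < u) {y : ℂ → ℂ} (hy : AnalyticOnNhd ℂ y Γ)
    (hode : SolvesODE n ψ u Γ fun ξ => Complex.exp (omega n j * u * ξ) * y ξ)
    (hlim : ∀ ξ ∈ Γ, ∀ k ≤ n - 2,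
      Tendsto (fun s : ℝ => iteratedDeriv k y (ξ + s * dir n j)) atTop (𝓝 0)) :
    ∀ ξ ∈ Γ, y ξ = 0 := by
  intro ξ hξ
  have hn := H.two_le
  have hnc := H.n_ne_zero
  have huc : (u : ℂ) ≠ 0 := by exact_mod_cast hu0.ne'
  set cc := omega n j * (u : ℂ) with hcc
  set w : ℂ → ℂ := fun ξ => Complex.exp (cc * ξ) * y ξ with hw
  have hwa : AnalyticOnNhd ℂ w Γ := fun ζ hζ =>
    AnalyticAt.fun_mul (by fun_prop) (hy ζ hζ)
  -- the derivatives without the exponential factor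
  set Y : ℕ → ℂ → ℂ := fun k ζ => Complex.exp (-(cc * ζ)) * iteratedDeriv k w ζ with hYdef
  have hYa : ∀ k, AnalyticOnNhd ℂ (Y k) Γ := fun k ζ hζ =>
    AnalyticAt.fun_mul (by fun_prop) (analyticOnNhd_iteratedDeriv hwa k ζ hζ)
  have hY0 : ∀ ζ, Y 0 ζ = y ζ := fun ζ => by
    simp only [hYdef, hw, iteratedDeriv_zero]
    rw [← mul_assoc, ← Complex.exp_add, neg_add_cancel, Complex.exp_zero, one_mul]
  have hYd : ∀ k, ∀ ζ ∈ Γ, HasDerivAt (Y k) (Y (k + 1) ζ - cc * Y k ζ) ζ := fun k ζ hζ => by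
    have h1 : HasDerivAt (fun ζ => Complex.exp (-(cc * ζ))) (Complex.exp (-(cc * ζ)) * -cc) ζ := by
      have h2 : HasDerivAt (fun ζ => -(cc * ζ)) (-cc) ζ := by
        simpa using ((hasDerivAt_id ζ).const_mul cc).fun_neg
      exact h2.cexp
    have h3 := (analyticOnNhd_iteratedDeriv hwa k ζ hζ).differentiableAt.hasDerivAt
    refine (h1.mul h3).congr_deriv ?_
    simp only [hYdef, iteratedDeriv_succ]
    ring
  have hYexp : ∀ k, ∀ ζ ∈ Γ, Y k ζ =
      ∑ i ∈ Finset.range (k + 1), (k.choose i : ℂ) * cc ^ (k - i) * iteratedDeriv i y ζ :=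
    fun k ζ hζ => by
      simp only [hYdef, hw]
      rw [iteratedDeriv_exp_mul (hy ζ hζ), ← mul_assoc, ← Complex.exp_add, neg_add_cancel,
        Complex.exp_zero, one_mul]
  have hYlim : ∀ k < n - 1, Tendsto (fun s : ℝ => Y k (ξ + s * dir n j)) atTop (𝓝 0) := fun k hk => by
    have h1 := tendsto_finsetSum (Finset.range (k + 1)) fun i hi =>
      (hlim ξ hξ i (by have := Finset.mem_range.1 hi; omega)).const_mul ((k.choose i : ℂ) * cc ^ (k - i))
    simp only [mul_zero, Finset.sum_const_zero] at h1
    refine h1.congr' ((eventually_ge_atTop 0).mono fun s hs => ?_)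
    exact (hYexp k _ (H.ray_mem ξ hξ s hs)).symm
  have hYode : ∀ ζ ∈ Γ, Y n ζ = ∑ k ∈ Finset.range (n - 1), (u : ℂ) ^ (n - k) * ψ k u ζ * Y k ζ :=
    fun ζ hζ => by
      have h := hode ζ hζ
      rw [neg_add_eq_zero] at h
      simp only [hYdef]
      rw [h, Finset.mul_sum]
      refine Finset.sum_congr rfl fun k _ => ?_
      ring
  set φ : ℕ → ℂ → ℂ := fun k ζ => ψ k u ζ - if k = 0 then 1 else 0 with hφ
  have hYode' : ∀ ζ ∈ Γ, Y n ζ = (u : ℂ) ^ n * Y 0 ζ +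
      ∑ k ∈ Finset.range (n - 1), (u : ℂ) ^ (n - k) * φ k ζ * Y k ζ := fun ζ hζ => by
    rw [hYode ζ hζ]
    have h1 : ∀ k ∈ Finset.range (n - 1), (u : ℂ) ^ (n - k) * ψ k u ζ * Y k ζ =
        (if k = 0 then (u : ℂ) ^ n * Y 0 ζ else 0) + (u : ℂ) ^ (n - k) * φ k ζ * Y k ζ := fun k _ => by
      by_cases hk : k = 0
      · subst hk; simp only [hφ, if_true, Nat.sub_zero]; ring
      · simp only [hφ, hk, if_false, sub_zero, zero_add]
    rw [Finset.sum_congr rfl h1, Finset.sum_add_distrib, Finset.sum_ite_eq',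
      if_pos (Finset.mem_range.2 (by omega))]
  -- discrete Fourier transform
  set p : Fin n → ℂ → ℂ := fun l ζ => 1 / n * ∑ k ∈ Finset.range n, (omega n l * u)⁻¹ ^ k * Y k ζ with hp
  have hpa : ∀ l, AnalyticOnNhd ℂ (p l) Γ := fun l ζ hζ =>
    analyticAt_const.fun_mul (Finset.analyticAt_fun_sum _ fun k _ =>
      analyticAt_const.fun_mul (hYa k ζ hζ))
  have hpd : ∀ l, ∀ ζ ∈ Γ, HasDerivAt (p l) ((omega n l - omega n j) * u * p l ζ + omega n l * u / n *
      ∑ k ∈ Finset.range (n - 1), (u : ℂ)⁻¹ ^ k * φ k ζ * Y k ζ) ζ := fun l ζ hζ => by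
    have h0 := omega_ne_zero n l
    have h := (HasDerivAt.fun_sum fun k (_ : k ∈ Finset.range n) =>
      (hYd k ζ hζ).const_mul ((omega n l * (u : ℂ))⁻¹ ^ k)).const_mul (1 / (n : ℂ))
    refine h.congr_deriv ?_
    have hv : (omega n l * (u : ℂ)) ≠ 0 := mul_ne_zero h0 huc
    set v := omega n l * (u : ℂ) with hvdef
    -- The shift `k ↦ k + 1` acts on the discrete Fourier transform as multiplication by `v = ω_l
    -- u`, up to the two end terms.
    have h1 : ∑ k ∈ Finset.range n, v⁻¹ ^ k * (Y (k + 1) ζ - cc * Y k ζ) =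
        v * (∑ k ∈ Finset.range n, v⁻¹ ^ k * Y k ζ + (v⁻¹ ^ n * Y n ζ - Y 0 ζ)) -
          cc * ∑ k ∈ Finset.range n, v⁻¹ ^ k * Y k ζ := by
      have h2 : ∑ k ∈ Finset.range n, v⁻¹ ^ k * Y k ζ + (v⁻¹ ^ n * Y n ζ - Y 0 ζ) =
          ∑ k ∈ Finset.range n, v⁻¹ ^ (k + 1) * Y (k + 1) ζ := by
        have h3 := Finset.sum_range_succ (fun k => v⁻¹ ^ k * Y k ζ) n
        rw [Finset.sum_range_succ'] at h3
        simp only [pow_zero, one_mul] at h3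
        linear_combination -h3
      rw [h2, Finset.mul_sum, Finset.mul_sum, ← Finset.sum_sub_distrib]
      refine Finset.sum_congr rfl fun k _ => ?_
      rw [pow_succ]
      field_simp
    -- Here the differential equation is used. As `ω_l ^ n = 1`, its leading term cancels `Y 0` and
    -- only the small potentials are left.
    have h4 : v⁻¹ ^ n * Y n ζ - Y 0 ζ = ∑ k ∈ Finset.range (n - 1), (u : ℂ)⁻¹ ^ k * φ k ζ * Y k ζ := by
      have h5 : v⁻¹ ^ n = (u : ℂ)⁻¹ ^ n := by
        rw [hvdef, mul_inv, mul_pow, inv_pow, omega_pow (by omega), inv_one, one_mul]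
      rw [h5, hYode' ζ hζ, mul_add, ← mul_assoc, ← mul_pow, inv_mul_cancel₀ huc, one_pow, one_mul,
        add_sub_cancel_left, Finset.mul_sum]
      refine Finset.sum_congr rfl fun k hk => ?_
      have hk := Finset.mem_range.1 hk
      have h6 : (u : ℂ)⁻¹ ^ n = (u : ℂ)⁻¹ ^ k * (u : ℂ)⁻¹ ^ (n - k) := by
        rw [← pow_add]; congr 1; omega
      have h7 : (u : ℂ)⁻¹ ^ (n - k) * (u : ℂ) ^ (n - k) = 1 := by
        rw [← mul_pow, inv_mul_cancel₀ huc, one_pow]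
      rw [h6]
      linear_combination (u : ℂ)⁻¹ ^ k * φ k ζ * Y k ζ * h7
    rw [h1, h4]
    simp only [hp]
    rw [hcc, hvdef]
    field_simp
    ring
  have hinv : ∀ k < n, ∀ ζ, (u : ℂ)⁻¹ ^ k * Y k ζ = ∑ m : Fin n, omega n m ^ k * p m ζ := by
    intro k hk ζ
    have h1 : ∀ m : Fin n, omega n m ^ k * p m ζ = ∑ i ∈ Finset.range n,
        1 / n * ((omega n m ^ k * (omega n m)⁻¹ ^ i) * ((u : ℂ)⁻¹ ^ i * Y i ζ)) := fun m => by
      simp only [hp, Finset.mul_sum]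
      refine Finset.sum_congr rfl fun i _ => ?_
      rw [mul_inv, mul_pow]
      ring
    rw [Finset.sum_congr rfl fun m _ => h1 m, Finset.sum_comm]
    have h2 : ∀ i ∈ Finset.range n, ∑ m : Fin n, 1 / (n : ℂ) * ((omega n m ^ k * (omega n m)⁻¹ ^ i) *
        ((u : ℂ)⁻¹ ^ i * Y i ζ)) = if i = k then (u : ℂ)⁻¹ ^ i * Y i ζ else 0 := fun i hi => by
      rw [← Finset.mul_sum, ← Finset.sum_mul, sum_omega_pow_mul_inv_pow hk (Finset.mem_range.1 hi)]
      split_ifs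
      · field_simp
      · simp
    rw [Finset.sum_congr rfl h2, Finset.sum_ite_eq', if_pos (Finset.mem_range.2 hk)]
  -- restriction to the ray
  set e := dir n j with he
  have hline : ∀ s : ℝ, HasDerivAt (fun s : ℝ => ξ + s * e) e s := fun s => by
    simpa using ((Complex.ofRealCLM.hasDerivAt (x := s)).mul_const e).const_add ξ
  have hray : ∀ s : ℝ, 0 ≤ s → ξ + s * e ∈ Γ := fun s hs => H.ray_mem ξ hξ s hs
  have hx : ∀ s : ℝ, ((ξ + s * e) * (starRingEnd ℂ) e).re = (ξ * (starRingEnd ℂ) e).re + s := fun s => by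
    have hee : e * (starRingEnd ℂ) e = 1 := by rw [Complex.mul_conj', he, norm_dir]; simp
    rw [add_mul, mul_assoc, hee, mul_one, Complex.add_re, Complex.ofReal_re]
  set x := (ξ * (starRingEnd ℂ) e).re with hxdef
  set K := c * 2 ^ (1 + ρ) / (u - σ') with hK
  have hK0 : 0 ≤ K := by
    have := sub_pos.2 hu
    have := H.cond.c_pos
    positivity
  have hkey : ∃ s₀ : ℝ, 0 ≤ s₀ ∧ ∀ s, s₀ ≤ s → ∀ l : Fin n, p l (ξ + s * e) = 0 := by
    refine eventually_eq_zero_of_tendsto hn (j := j)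
      (z := fun l s => p l (ξ + s * e))
      (f := fun l s => e * (deriv (p l) (ξ + s * e) - (omega n l - omega n j) * u * p l (ξ + s * e)))
      (Y := fun k s => (u : ℂ)⁻¹ ^ k * Y k (ξ + s * e))
      (b := fun l => e * ((omega n l - omega n j) * u))
      (D := fun s => u * K * decay ρ (x + s)) (by simp) ?_ ?_ ?_ ?_ ?_ ?_ ?_ ?_ ?_
    -- `conj e / a = conj (e a) / |a|²`, so `e a` has positive real part by `re_conj_dir_div`, and
    -- multiplication by the positive real number `u` preserves this.
    · intro l hl
      have h1 := re_conj_dir_div hn hl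
      have hc0 := cos_halfSpread_pos hn
      set a := omega n l - omega n j
      have ha0 : a ≠ 0 := sub_ne_zero.2 fun h => hl (omega_injective (by omega) h)
      have h2 : (starRingEnd ℂ) e / a = ((1 / ‖a‖ ^ 2 : ℝ) : ℂ) * (starRingEnd ℂ) (e * a) := by
        have h3 : a * (starRingEnd ℂ) a = ((‖a‖ ^ 2 : ℝ) : ℂ) := by
          rw [Complex.mul_conj']; push_cast; ring
        have h4 : ((‖a‖ ^ 2 : ℝ) : ℂ) ≠ 0 := by
          have : 0 < ‖a‖ := norm_pos_iff.2 ha0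
          exact_mod_cast (by positivity : ‖a‖ ^ 2 ≠ 0)
        rw [map_mul, div_eq_iff ha0, Complex.ofReal_div, Complex.ofReal_one]
        field_simp
        rw [← h3]; ring
      rw [h2, Complex.re_ofReal_mul, Complex.conj_re] at h1
      have h5 : 0 < (1 / ‖a‖ ^ 2) * (e * a).re := lt_of_lt_of_le (half_pos hc0) h1
      have h6 : 0 < (e * a).re := pos_of_mul_pos_right h5 (by positivity)
      rw [← mul_assoc, Complex.re_mul_ofReal]
      positivity
    · intro l s hs
      have h1 := (hpa l _ (hray s hs)).differentiableAt.hasDerivAt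
      refine (HasDerivAt.comp_of_eq s h1 (hline s) rfl).congr_deriv ?_
      ring
    · intro l s hs
      have h1 : ContinuousAt (fun s : ℝ => ξ + s * e) s := (hline s).continuousAt
      have h2 := (hpa l _ (hray s hs)).continuousAt.comp (f := fun s : ℝ => ξ + s * e) h1
      have h3 := ((hpa l).deriv _ (hray s hs)).continuousAt.comp (f := fun s : ℝ => ξ + s * e) h1
      exact (continuousAt_const.mul (h3.sub (continuousAt_const.mul h2))).continuousWithinAt
    · exact ((integrable_decay H.cond.ρ_pos).comp_add_left x).integrableOn.const_mul _
    · exact fun s => mul_nonneg (mul_nonneg hu0.le hK0) (decay_pos _ _).le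
    · intro l s hs
      have hmem := hray s hs
      simp only [(hpd l _ hmem).deriv, add_sub_cancel_left]
      rw [norm_mul, he, norm_dir, one_mul, norm_mul, norm_div, norm_mul, norm_omega, one_mul,
        Complex.norm_of_nonneg hu0.le, Complex.norm_natCast]
      have h1 : ‖∑ k ∈ Finset.range (n - 1), (u : ℂ)⁻¹ ^ k * φ k (ξ + s * e) * Y k (ξ + s * e)‖ ≤
          K * decay ρ (x + s) * ∑ k ∈ Finset.range (n - 1), ‖(u : ℂ)⁻¹ ^ k * Y k (ξ + s * e)‖ := by
        rw [Finset.mul_sum]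
        refine norm_sum_le_of_le _ fun k hk => ?_
        have h2 := H.norm_potential_le (Finset.mem_range.1 hk) (u := u) (by simpa using hu) hmem
        rw [← he, hx, Complex.ofReal_re] at h2
        rw [mul_right_comm, norm_mul, mul_comm]
        exact mul_le_mul_of_nonneg_right h2 (norm_nonneg _)
      have hn1 : (1 : ℝ) ≤ n := by exact_mod_cast (by omega : 1 ≤ n)
      have h3 : u / n ≤ u := div_le_self hu0.le hn1
      calc _ ≤ u * (K * decay ρ (x + s) * ∑ k ∈ Finset.range (n - 1), ‖(u : ℂ)⁻¹ ^ k * Y k (ξ + s * e)‖) :=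
            mul_le_mul h3 h1 (norm_nonneg _) hu0.le
        _ = _ := by ring
    · intro l s hs
      simp only [hp]
      rw [← mul_assoc, mul_one_div_cancel hnc, one_mul]
      refine Finset.sum_congr rfl fun k _ => ?_
      rw [mul_inv, mul_pow]; ring
    · intro k hk s hs
      simp only [hinv k hk]
      refine norm_sum_le_of_le _ fun m _ => ?_
      rw [norm_mul, norm_pow, norm_omega, one_pow, one_mul]
    · intro k hk
      simpa using (hYlim k hk).const_mul ((u : ℂ)⁻¹ ^ k)
  obtain ⟨s₀, hs₀, hzero⟩ := hkey
  -- the identity theorem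
  have hz₁ : ξ + s₀ * e ∈ Γ := hray s₀ hs₀
  have hfreq : ∃ᶠ z in 𝓝[≠] (ξ + s₀ * e), y z = 0 := by
    have ht : Tendsto (fun s : ℝ => ξ + s * e) (𝓝[>] s₀) (𝓝[≠] (ξ + s₀ * e)) := by
      refine tendsto_nhdsWithin_iff.2 ⟨((hline s₀).continuousAt.tendsto).mono_left
        nhdsWithin_le_nhds, ?_⟩
      filter_upwards [self_mem_nhdsWithin] with s hs hne
      have hs' : s₀ < s := hs
      rw [mem_singleton_iff, add_right_inj] at hne
      have he0 : e ≠ 0 := by rw [← norm_pos_iff, he, norm_dir]; exact one_pos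
      have := mul_right_cancel₀ he0 hne
      exact hs'.ne' (by exact_mod_cast this)
    refine ht.frequently ?_
    refine Eventually.frequently ?_
    filter_upwards [self_mem_nhdsWithin] with s hs
    have hs' : s₀ < s := hs
    have h1 := hinv 0 (by omega) (ξ + s * e)
    rw [pow_zero, one_mul, hY0] at h1
    rw [h1]
    refine Finset.sum_eq_zero fun m _ => ?_
    rw [show p m (ξ + s * e) = 0 from hzero s hs'.le m, mul_zero]
  exact hy.eqOn_zero_of_preconnected_of_frequently_eq_zero H.admissible.isPreconnected hz₁ hfreq hξ

/-- Normalised solutions are unique. -/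
theorem eq_of_isNormalisedSolution (H : Setting n Δ ψ Ψ ψc d d' c ρ σ' j Γ) {η₁ η₂ : ℂ → ℂ → ℂ}
    (h₁ : IsNormalisedSolution n ψ ψc σ' j Γ η₁) (h₂ : IsNormalisedSolution n ψ ψc σ' j Γ η₂)
    {u : ℂ} (hu : σ' < u.re) {ξ : ℂ} (hξ : ξ ∈ Γ) : η₁ u ξ = η₂ u ξ := by
  have hn := H.two_le
  -- The growth argument is carried out for real parameters; analyticity in `u` extends the result
  -- to the half-plane.
  have hreal : ∀ v : ℝ, σ' < v → ∀ ζ ∈ Γ, η₁ v ζ = η₂ v ζ := by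
    intro v hv ζ hζ
    have hv' : σ' < (v : ℂ).re := by simpa using hv
    have hv0 : 0 < v := H.cond.σ'_nonneg.trans_lt hv
    have ha₁ := analyticOnNhd_snd h₁.analytic hv'
    have ha₂ := analyticOnNhd_snd h₂.analytic hv'
    have hE := H.rayBound_exp_X
    have had : AnalyticOnNhd ℂ (fun ζ => η₁ v ζ - η₂ v ζ) Γ := fun ζ hζ =>
      (ha₁ ζ hζ).fun_sub (ha₂ ζ hζ)
    have hW : ∀ η : ℂ → ℂ → ℂ, AnalyticOnNhd ℂ (η v) Γ → AnalyticOnNhd ℂ (W n ψc j η v) Γ :=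
      fun η hη ζ hζ => AnalyticAt.fun_mul
        (AnalyticAt.cexp (AnalyticAt.fun_add (by fun_prop) (H.rayBound_X.analytic ζ hζ)))
        (analyticAt_const.fun_add (hη ζ hζ))
    have hz := H.eq_zero_of_solvesODE hv hv0
      (y := fun ζ => Complex.exp (X n ψc j ζ) * (η₁ v ζ - η₂ v ζ))
      (fun ζ hζ => (hE.analytic ζ hζ).fun_mul (had ζ hζ)) ?_ ?_ ζ hζ
    · exact sub_eq_zero.1 ((mul_eq_zero.1 hz).resolve_left (Complex.exp_ne_zero _))
    · intro ζ hζ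
      have hdiff : (fun ζ => Complex.exp (omega n j * v * ζ) *
          (Complex.exp (X n ψc j ζ) * (η₁ v ζ - η₂ v ζ))) =
          fun ζ => W n ψc j η₁ v ζ - W n ψc j η₂ v ζ := by
        funext ζ
        simp only [W]
        rw [Complex.exp_add]
        ring
      have hsub : ∀ k, iteratedDeriv k (fun ζ => W n ψc j η₁ v ζ - W n ψc j η₂ v ζ) ζ =
          iteratedDeriv k (W n ψc j η₁ v) ζ - iteratedDeriv k (W n ψc j η₂ v) ζ := fun k =>
        iteratedDeriv_fun_sub (hW η₁ ha₁ ζ hζ).contDiffAt (hW η₂ ha₂ ζ hζ).contDiffAt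
      rw [hdiff]
      simp only [hsub, mul_sub, Finset.sum_sub_distrib]
      have e₁ := h₁.solves v hv' ζ hζ
      have e₂ := h₂.solves v hv' ζ hζ
      linear_combination e₁ - e₂
    · intro ζ hζ k hk
      -- By Leibniz' rule the limit conditions survive multiplication by `exp (X_j)`, whose
      -- derivatives are bounded along rays.
      have h0 : Tendsto (fun s : ℝ => ∑ i ∈ Finset.range (k + 1), (k.choose i : ℂ) *
          iteratedDeriv i (fun ζ => Complex.exp (X n ψc j ζ)) (ζ + s * dir n j) *
            iteratedDeriv (k - i) (fun ζ => η₁ v ζ - η₂ v ζ) (ζ + s * dir n j)) atTop (𝓝 0) := by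
        rw [← Finset.sum_const_zero (s := Finset.range (k + 1))]
        refine tendsto_finsetSum _ fun i _ => ?_
        have hl : Tendsto (fun s : ℝ => iteratedDeriv (k - i) (fun ζ => η₁ v ζ - η₂ v ζ)
            (ζ + s * dir n j)) atTop (𝓝 0) := by
          have h3 := (h₁.limits v hv' ζ hζ (k - i) (by omega)).sub
            (h₂.limits v hv' ζ hζ (k - i) (by omega))
          rw [sub_zero] at h3
          refine h3.congr' ((eventually_ge_atTop 0).mono fun s hs => ?_)
          have hm := H.ray_mem ζ hζ s hs
          exact (iteratedDeriv_fun_sub (ha₁ _ hm).contDiffAt (ha₂ _ hm).contDiffAt).symm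
        obtain ⟨r, hr, C, hC, hb⟩ := (hE.iteratedDeriv H.isOpen H.ray_mem i).bound ζ hζ
        have h4 : Tendsto (fun s : ℝ => (k.choose i : ℝ) * C * ‖iteratedDeriv (k - i)
            (fun ζ => η₁ v ζ - η₂ v ζ) (ζ + s * dir n j)‖) atTop (𝓝 0) := by
          simpa using hl.norm.const_mul ((k.choose i : ℝ) * C)
        refine squeeze_zero_norm' ((eventually_ge_atTop 0).mono fun s hs => ?_) h4
        have h5 := hb ζ (Metric.mem_ball_self hr) s hs
        rw [norm_mul, norm_mul, Complex.norm_natCast]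
        rw [mul_one] at h5
        gcongr
      refine h0.congr' ((eventually_ge_atTop 0).mono fun s hs => ?_)
      have hm := H.ray_mem ζ hζ s hs
      exact (iteratedDeriv_mul_of_analyticAt (hE.analytic _ hm) (had _ hm) k).symm
  -- the identity theorem with respect to the parameter
  have ha := (analyticOnNhd_fst h₁.analytic hξ)
  have hb := (analyticOnNhd_fst h₂.analytic hξ)
  have hpre : IsPreconnected {u : ℂ | σ' < u.re} := (convex_halfSpace_re_gt σ').isPreconnected
  have hz₀ : ((σ' + 1 : ℝ) : ℂ) ∈ {u : ℂ | σ' < u.re} := by simp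
  refine ha.eqOn_of_preconnected_of_frequently_eq hb hpre hz₀ ?_ hu
  have ht : Tendsto (fun s : ℝ => (s : ℂ)) (𝓝[>] (σ' + 1)) (𝓝[≠] ((σ' + 1 : ℝ) : ℂ)) := by
    refine tendsto_nhdsWithin_iff.2 ⟨(Complex.continuous_ofReal.tendsto _).mono_left
      nhdsWithin_le_nhds, ?_⟩
    filter_upwards [self_mem_nhdsWithin] with s hs hne
    have hs' : σ' + 1 < s := hs
    rw [mem_singleton_iff] at hne
    exact hs'.ne' (by exact_mod_cast hne)
  refine ht.frequently (Eventually.frequently ?_)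
  filter_upwards [self_mem_nhdsWithin] with s hs
  have hs' : σ' + 1 < s := hs
  exact hreal s (by linarith) ξ hξ

end Setting

namespace Setting

/-! ### The Borel transform and the asymptotic expansion of the error term -/

variable {n : ℕ} {Δ : Set ℂ} {ψ Ψ : ℕ → ℂ → ℂ → ℂ} {ψc : ℕ → ℕ → ℂ → ℂ}
    {d d' c ρ σ' : ℝ} {j : Fin n} {Γ : Set ℂ}

theorem radius_pos (H : Setting n Δ ψ Ψ ψc d d' c ρ σ' j Γ) : 0 < aSeq n * d :=
  mul_pos (aSeq_pos n H.two_le) H.d_pos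

theorem borel_analytic (H : Setting n Δ ψ Ψ ψc d d' c ρ σ' j Γ) :
    AnalyticOnNhd ℂ (fun p : ℂ × ℂ => H.borel p.1 p.2) (U (aSeq n * d) ×ˢ Γ) := fun p hp => by
  unfold borel
  exact Finset.analyticAt_fun_sum _ fun l _ =>
    BorelSystem.sol_analytic (S := H.system) l p (BorelSystem.mem_dom_of_mem (S := H.system) hp.1 hp.2)

theorem borel_differentiableOn (H : Setting n Δ ψ Ψ ψc d d' c ρ σ' j Γ) {ξ : ℂ} (hξ : ξ ∈ Γ) :
    DifferentiableOn ℂ (fun t => H.borel t ξ) (U (aSeq n * d)) :=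
  (analyticOnNhd_fst H.borel_analytic hξ).differentiableOn

theorem exists_norm_borel_le (H : Setting n Δ ψ Ψ ψc d d' c ρ σ' j Γ) {σ : ℝ} (hσ : σ' < σ) :
    ∃ K, 0 < K ∧ ∀ t ∈ U (aSeq n * d), ∀ ξ ∈ Γ, ‖H.borel t ξ‖ ≤
      K * Real.exp (σ * t.re) * (1 / (max 1 (ξ * (starRingEnd ℂ) (dir n j)).re) ^ ρ) := by
  obtain ⟨K, hK, hb⟩ := BorelSystem.exists_norm_sol_le (S := H.system) hσ
  have hn : (0 : ℝ) < n := by exact_mod_cast j.pos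
  refine ⟨n * K, by positivity, fun t ht ξ hξ => ?_⟩
  refine (norm_sum_le_of_le _ fun l _ => hb l t ht ξ hξ).trans (le_of_eq ?_)
  simp only [Finset.sum_const, Finset.card_univ, Fintype.card_fin, nsmul_eq_mul, mul_assoc]
  rfl

theorem one_div_max_rpow_le_one (H : Setting n Δ ψ Ψ ψc d d' c ρ σ' j Γ) (v : ℝ) :
    1 / (max 1 v) ^ ρ ≤ 1 := BorelSystem.one_div_max_rpow_le_one (S := H.system) v

theorem exists_norm_borel_le' (H : Setting n Δ ψ Ψ ψc d d' c ρ σ' j Γ) {σ : ℝ} (hσ : σ' < σ) :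
    ∃ K, 0 < K ∧ ∀ ξ ∈ Γ, ∀ t ∈ U (aSeq n * d), ‖H.borel t ξ‖ ≤ K * Real.exp (σ * t.re) := by
  obtain ⟨K, hK, hb⟩ := H.exists_norm_borel_le hσ
  exact ⟨K, hK, fun ξ hξ t ht => (hb t ht ξ hξ).trans
    (mul_le_of_le_one_right (by positivity) (H.one_div_max_rpow_le_one _))⟩

theorem borel_laplace (H : Setting n Δ ψ Ψ ψc d d' c ρ σ' j Γ) {u : ℂ} (hu : σ' < u.re) {ξ : ℂ}
    (hξ : ξ ∈ Γ) : IntegrableOn (fun t : ℝ => Complex.exp (-u * t) * H.borel t ξ) (Ioi 0) ∧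
      H.eta u ξ = laplace (fun t => H.borel t ξ) u := by
  have hi : ∀ l ∈ Finset.univ, Integrable (fun t : ℝ => Complex.exp (-u * t) * H.system.sol l t ξ)
      (volume.restrict (Ioi 0)) := fun l _ =>
    BorelSystem.sol_laplace_integrableOn (S := H.system) l hu hξ
  have he : (fun t : ℝ => Complex.exp (-u * t) * H.borel t ξ) = fun t : ℝ =>
      ∑ l, Complex.exp (-u * t) * H.system.sol l t ξ := by
    funext t; rw [borel, Finset.mul_sum]
  constructor
  · rw [he]; exact integrable_finsetSum _ hi
  · unfold laplace
    rw [he, integral_finsetSum _ hi]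
    rfl

/-- The coefficients of the asymptotic expansion of `1 + η`. -/
def coeffHat (H : Setting n Δ ψ Ψ ψc d d' c ρ σ' j Γ) : ℕ → ℂ → ℂ
  | 0 => fun _ => 1
  | m + 1 => fun ξ => iteratedDeriv m (fun t => H.borel t ξ) 0

theorem coeffHat_eq (H : Setting n Δ ψ Ψ ψc d d' c ρ σ' j Γ) {m : ℕ} (hm : 1 ≤ m) (ξ : ℂ) :
    H.coeffHat m ξ = iteratedDeriv (m - 1) (fun t => H.borel t ξ) 0 := by
  obtain ⟨m, rfl⟩ : ∃ m', m = m' + 1 := ⟨m - 1, by omega⟩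
  rfl

theorem rayBound_coeffHat_succ (H : Setting n Δ ψ Ψ ψc d d' c ρ σ' j Γ) (m : ℕ) :
    RayBound Γ (dir n j) (fun s => 1 / (1 + s) ^ ρ) (H.coeffHat (m + 1)) := by
  obtain ⟨K, hK, hb⟩ := H.exists_norm_borel_le (lt_add_one σ')
  have hR := H.radius_pos
  have hσ : 0 ≤ σ' + 1 := by linarith [H.cond.σ'_nonneg]
  refine RayBound.of_max_rpow (C := m.factorial * (K * Real.exp ((σ' + 1) * (aSeq n * d / 2))) /
    (aSeq n * d / 2) ^ m) H.cond.ρ_pos (norm_dir n j) H.isOpen H.ray_mem ?_ (by positivity)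
    fun ξ hξ => ?_
  · exact fun ξ hξ => (analyticAt_iteratedDeriv_fst m (H.borel_analytic ((0 : ℂ), ξ)
      ⟨zero_mem_U hR, hξ⟩)).comp (f := fun ξ => ((0 : ℂ), ξ)) (analyticAt_const.prod analyticAt_id)
  · set v := 1 / (max 1 (ξ * (starRingEnd ℂ) (dir n j)).re) ^ ρ
    have hv : 0 ≤ v := by
      have : (0 : ℝ) ≤ max 1 (ξ * (starRingEnd ℂ) (dir n j)).re := zero_le_one.trans (le_max_left _ _)
      positivity
    have h := norm_iteratedDeriv_le_axis hR (H.borel_differentiableOn hξ) (K := K * v)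
      (by positivity) hσ (fun t ht => (hb t ht ξ hξ).trans (le_of_eq (by ring))) m 0 le_rfl
    rw [mul_zero, Real.exp_zero, mul_one, Complex.ofReal_zero] at h
    exact h.trans (le_of_eq (by ring))

theorem rayBound_coeffHat (H : Setting n Δ ψ Ψ ψc d d' c ρ σ' j Γ) (m : ℕ) :
    RayBound Γ (dir n j) (fun _ => 1) (H.coeffHat m) := by
  rcases m with _ | m
  · exact RayBound.const 1
  · refine (H.rayBound_coeffHat_succ m).mono fun s hs => ?_
    have h1 : 1 ≤ (1 + s) ^ ρ := Real.one_le_rpow (by linarith) H.cond.ρ_pos.le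
    rw [div_le_one (by linarith)]
    exact h1

theorem eta_asymptotic (H : Setting n Δ ψ Ψ ψc d d' c ρ σ' j Γ) {σ : ℝ} (hσ : σ' < σ) (N : ℕ)
    (hN : 1 ≤ N) : ∃ C : ℝ, ∀ u : ℂ, σ ≤ u.re → ∀ ξ ∈ Γ,
      ‖H.eta u ξ - ∑ m ∈ Finset.Ico 1 N, H.coeffHat m ξ / u ^ m‖ ≤ C / ‖u‖ ^ N := by
  obtain ⟨s, hs, hsσ⟩ := exists_between hσ
  obtain ⟨K, hK, hb⟩ := H.exists_norm_borel_le' hs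
  obtain ⟨C, h⟩ := watson H.radius_pos (E := Γ) (F := H.borel) (fun ξ hξ => H.borel_differentiableOn hξ)
    hK.le (H.cond.σ'_nonneg.trans hs.le) hsσ hb N hN
  refine ⟨C, fun u hu ξ hξ => ?_⟩
  rw [(H.borel_laplace (hσ.trans_le hu) hξ).2, Finset.sum_congr rfl fun m hm => by
    rw [H.coeffHat_eq (Finset.mem_Ico.1 hm).1]]
  exact h u hu ξ hξ

/-- The expansion is uniform in `ξ`, so Cauchy's estimate on a small circle applied to the remainder
permits termwise differentiation. -/
theorem asymp_iteratedDeriv (H : Setting n Δ ψ Ψ ψc d d' c ρ σ' j Γ) {ξ : ℂ} (hξ : ξ ∈ Γ) (r : ℕ) :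
    Asymp (fun u : ℝ => iteratedDeriv r (fun ζ => 1 + H.eta u ζ) ξ)
      (PowerSeries.mk fun m => iteratedDeriv r (H.coeffHat m) ξ) := by
  obtain ⟨δ, hδ, hsub⟩ := Metric.isOpen_iff.1 H.isOpen ξ hξ
  have hδ2 : 0 < δ / 2 := half_pos hδ
  have hcl : Metric.closedBall ξ (δ / 2) ⊆ Γ :=
    (Metric.closedBall_subset_ball (by linarith)).trans hsub
  refine Asymp.of_bound _ fun N hN => ?_
  obtain ⟨C, hC⟩ := H.eta_asymptotic (lt_add_one σ') N hN
  refine ⟨r.factorial * C / (δ / 2) ^ r, σ' + 1, fun u hu => ?_⟩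
  have hu0 : 0 < u := by linarith [H.cond.σ'_nonneg]
  have hu' : σ' < (u : ℂ).re := by simpa using (lt_add_one σ').trans_le hu
  have hη : AnalyticOnNhd ℂ (fun ζ => 1 + H.eta u ζ) Γ := fun ζ hζ =>
    analyticAt_const.fun_add (analyticOnNhd_snd H.eta_analytic hu' ζ hζ)
  have hterm : ∀ m, AnalyticOnNhd ℂ (fun ζ => ((u : ℂ) ^ m)⁻¹ * H.coeffHat m ζ) Γ := fun m ζ hζ =>
    analyticAt_const.fun_mul ((H.rayBound_coeffHat m).analytic ζ hζ)
  have hsum : AnalyticOnNhd ℂ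
      (fun ζ => ∑ m ∈ Finset.range N, ((u : ℂ) ^ m)⁻¹ * H.coeffHat m ζ) Γ := fun ζ hζ =>
    Finset.analyticAt_fun_sum _ fun m _ => hterm m ζ hζ
  have hdiff : iteratedDeriv r (fun ζ => (1 + H.eta u ζ) -
      ∑ m ∈ Finset.range N, ((u : ℂ) ^ m)⁻¹ * H.coeffHat m ζ) ξ =
      iteratedDeriv r (fun ζ => 1 + H.eta u ζ) ξ -
      ∑ m ∈ Finset.range N, iteratedDeriv r (H.coeffHat m) ξ / (u : ℂ) ^ m := by
    rw [iteratedDeriv_fun_sub (hη ξ hξ).contDiffAt (hsum ξ hξ).contDiffAt,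
      iteratedDeriv_fun_sum fun m _ => (hterm m ξ hξ).contDiffAt]
    congr 1
    refine Finset.sum_congr rfl fun m _ => ?_
    rw [iteratedDeriv_const_mul_field, div_eq_inv_mul]
  rw [← hdiff]
  have h := Complex.norm_iteratedDeriv_le_of_forall_mem_sphere_norm_le (c := ξ) (R := δ / 2)
    (C := C / u ^ N) (f := fun ζ => (1 + H.eta u ζ) -
      ∑ m ∈ Finset.range N, ((u : ℂ) ^ m)⁻¹ * H.coeffHat m ζ) r hδ2 ?_ ?_
  · exact h.trans (le_of_eq (by ring))
  · exact DifferentiableOn.diffContOnCl fun ζ hζ =>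
      ((hη ζ (hcl (Metric.closure_ball_subset_closedBall hζ))).fun_sub
        (hsum ζ (hcl (Metric.closure_ball_subset_closedBall hζ)))).differentiableAt.differentiableWithinAt
  · intro ζ hζ
    have h1 := hC u (by simpa using hu) ζ (hcl (Metric.sphere_subset_closedBall hζ))
    rw [Complex.norm_of_nonneg hu0.le] at h1
    refine le_trans (le_of_eq ?_) h1
    congr 1
    rw [Finset.range_eq_Ico, Finset.sum_eq_sum_Ico_succ_bot (by omega)]
    simp only [coeffHat, pow_zero, inv_one, mul_one, zero_add]
    rw [add_sub_add_left_eq_sub]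
    congr 1
    exact Finset.sum_congr rfl fun m _ => by rw [div_eq_inv_mul]

end Setting

/-! ### The recurrence relation for the coefficients -/

/-- Substitute `q = i + b`. The left form arises from multiplying power series, the right one is the
form of the recurrence. -/
theorem sum_range_sum_range_eq (k m : ℕ) (g : ℕ → ℕ → ℂ) :
    ∑ i ∈ Finset.range (k + 1), (if i ≤ m then ∑ b ∈ Finset.range (m - i + 1), g i b else 0) =
      ∑ q ∈ Finset.range (m + 1), ∑ p ∈ Finset.range (min k q + 1), g p (q - p) := by
  have h1 : ∀ q ∈ Finset.range (m + 1), ∑ p ∈ Finset.range (min k q + 1), g p (q - p) =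
      ∑ p ∈ Finset.range (k + 1), if p ≤ q then g p (q - p) else 0 := fun q _ => by
    rw [← Finset.sum_filter]
    refine Finset.sum_congr ?_ fun _ _ => rfl
    ext p
    simp only [Finset.mem_range, Finset.mem_filter]
    omega
  rw [Finset.sum_congr rfl h1, Finset.sum_comm]
  refine Finset.sum_congr rfl fun p _ => ?_
  split_ifs with hp
  · have e : m + 1 = p + (m - p + 1) := by omega
    have e' : ∑ x ∈ Finset.range (m + 1), (if p ≤ x then g p (x - p) else 0) =
        ∑ x ∈ Finset.range (p + (m - p + 1)), (if p ≤ x then g p (x - p) else 0) := by rw [← e]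
    rw [e', Finset.sum_range_add (fun x => if p ≤ x then g p (x - p) else 0)]
    have h2 : ∑ x ∈ Finset.range p, (if p ≤ x then g p (x - p) else 0) = 0 :=
      Finset.sum_eq_zero fun x hx => if_neg (by have := Finset.mem_range.1 hx; omega)
    rw [h2, zero_add]
    refine Finset.sum_congr rfl fun x _ => ?_
    rw [if_pos (Nat.le_add_right p x), Nat.add_sub_cancel_left]
  · refine (Finset.sum_eq_zero fun x hx => if_neg ?_).symm
    have := Finset.mem_range.1 hx
    omega

theorem completeBell_zero (x : ℕ → ℂ) : completeBell x 0 = 1 := by rw [completeBell]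

theorem completeBell_succ (x : ℕ → ℂ) (p : ℕ) : completeBell x (p + 1) =
    ∑ q ∈ Finset.range (p + 1), (p.choose q : ℂ) * x (q + 1) * completeBell x (p - q) := by
  rw [completeBell, Finset.sum_range]

/-- A value of a ray integral of a function that decays along rays. -/
structure IsRayIntegral (Γ : Set ℂ) (ρ θ : ℝ) (ξ v : ℂ) (f : ℂ → ℂ) : Prop where
  rayBound : RayBound Γ (Complex.exp (θ * Complex.I)) (decay ρ) f
  eq : v = rayIntegral f ξ θ

namespace IsRayIntegral

variable {Γ : Set ℂ} {ρ θ : ℝ} {ξ v w : ℂ} {f g : ℂ → ℂ}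

theorem const_mul (h : IsRayIntegral Γ ρ θ ξ v f) (c : ℂ) :
    IsRayIntegral Γ ρ θ ξ (c * v) fun t => c * f t := by
  refine ⟨h.rayBound.const_mul c, ?_⟩
  rw [h.eq, rayIntegral, rayIntegral, ← integral_const_mul]
  simp only [mul_assoc]

variable (hρ : 0 < ρ) (hmem : ∀ ξ ∈ Γ, ∀ s : ℝ, 0 ≤ s → ξ + s * Complex.exp (θ * Complex.I) ∈ Γ)
  (hξ : ξ ∈ Γ)
include hρ hmem hξ

theorem sum {ι : Type*} (I : Finset ι) {V : ι → ℂ} {F : ι → ℂ → ℂ}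
    (h : ∀ i ∈ I, IsRayIntegral Γ ρ θ ξ (V i) (F i)) :
    IsRayIntegral Γ ρ θ ξ (∑ i ∈ I, V i) fun t => ∑ i ∈ I, F i t := by
  refine ⟨RayBound.sum (fun s _ => (decay_pos ρ s).le) I fun i hi => (h i hi).rayBound, ?_⟩
  rw [Finset.sum_congr rfl fun i hi => (h i hi).eq]
  simp only [rayIntegral, Finset.sum_mul]
  exact (integral_finsetSum I fun i hi =>
    (h i hi).rayBound.integrableOn hmem (integrableOn_decay hρ) hξ).symm

theorem sub (hf : IsRayIntegral Γ ρ θ ξ v f) (hg : IsRayIntegral Γ ρ θ ξ w g) :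
    IsRayIntegral Γ ρ θ ξ (v - w) fun t => f t - g t := by
  refine ⟨?_, ?_⟩
  · have := hf.rayBound.add (hg.rayBound.const_mul (-1))
    simpa only [neg_one_mul, ← sub_eq_add_neg] using this
  · rw [hf.eq, hg.eq]
    simp only [rayIntegral, sub_mul]
    exact (integral_sub (hf.rayBound.integrableOn hmem (integrableOn_decay hρ) hξ)
      (hg.rayBound.integrableOn hmem (integrableOn_decay hρ) hξ)).symm

end IsRayIntegral

namespace Setting

variable {n : ℕ} {Δ : Set ℂ} {ψ Ψ : ℕ → ℂ → ℂ → ℂ} {ψc : ℕ → ℕ → ℂ → ℂ}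
    {d d' c ρ σ' : ℝ} {j : Fin n} {Γ : Set ℂ}

theorem bellX_zero (ξ : ℂ) : bellX n ψc j 0 ξ = 1 := completeBell_zero _

theorem bellX_succ (p : ℕ) (ξ : ℂ) : bellX n ψc j (p + 1) ξ =
    ∑ q ∈ Finset.range (p + 1), (p.choose q : ℂ) * iteratedDeriv (q + 1) (X n ψc j) ξ *
      bellX n ψc j (p - q) ξ := completeBell_succ _ _

theorem bellX_one (ξ : ℂ) : bellX n ψc j 1 ξ = deriv (X n ψc j) ξ := by
  rw [bellX_succ]
  simp [bellX_zero, iteratedDeriv_one]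

theorem decay_mono (H : Setting n Δ ψ Ψ ψc d d' c ρ σ' j Γ) {f : ℂ → ℂ}
    (hf : RayBound Γ (dir n j) (decay ρ) f) : RayBound Γ (dir n j) (fun _ => 1) f :=
  hf.mono fun s _ => decay_le_one H.cond.ρ_pos s

theorem rayBound_iteratedDeriv_X (H : Setting n Δ ψ Ψ ψc d d' c ρ σ' j Γ) (q : ℕ) :
    RayBound Γ (dir n j) (decay ρ) (iteratedDeriv (q + 1) (X n ψc j)) := by
  rw [iteratedDeriv_succ']
  exact H.rayBound_deriv_X.iteratedDeriv H.isOpen H.ray_mem q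

/-- For `p ≥ 1` every term contains a derivative of `X` of positive order, which decays; `B_0 = 1`
does not, hence the two statements. -/
theorem rayBound_bellX (H : Setting n Δ ψ Ψ ψc d d' c ρ σ' j Γ) (p : ℕ) :
    RayBound Γ (dir n j) (fun _ => 1) (bellX n ψc j p) ∧
      (1 ≤ p → RayBound Γ (dir n j) (decay ρ) (bellX n ψc j p)) := by
  induction p using Nat.strong_induction_on with
  | _ p ih =>
    rcases p with _ | p
    · exact ⟨(RayBound.const 1).congr H.isOpen H.ray_mem fun ξ _ => (bellX_zero ξ).symm,
        fun h => absurd h (by omega)⟩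
    · have h : RayBound Γ (dir n j) (decay ρ) (bellX n ψc j (p + 1)) := by
        refine (RayBound.sum (fun s _ => (decay_pos ρ s).le) (Finset.range (p + 1)) fun q hq =>
          ((H.rayBound_iteratedDeriv_X q).const_mul (p.choose q : ℂ)).mul_right
            (ih (p - q) (by omega)).1).congr H.isOpen H.ray_mem fun ξ _ => (bellX_succ p ξ).symm
      exact ⟨H.decay_mono h, fun _ => h⟩

/-- The Bell polynomials are the logarithmic derivatives of the exponential factor. -/
theorem iteratedDeriv_exp_X (H : Setting n Δ ψ Ψ ψc d d' c ρ σ' j Γ) (p : ℕ) : ∀ ξ ∈ Γ,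
    iteratedDeriv p (fun ζ => Complex.exp (X n ψc j ζ)) ξ =
      Complex.exp (X n ψc j ξ) * bellX n ψc j p ξ := by
  induction p using Nat.strong_induction_on with
  | _ p ih =>
    intro ξ hξ
    rcases p with _ | p
    · simp [bellX_zero]
    · have hX := H.rayBound_X.analytic
      have hd : deriv (fun ζ => Complex.exp (X n ψc j ζ)) =ᶠ[𝓝 ξ]
          fun ζ => deriv (X n ψc j) ζ * Complex.exp (X n ψc j ζ) := by
        filter_upwards [H.isOpen.mem_nhds hξ] with ζ hζ
        rw [((hX ζ hζ).differentiableAt.hasDerivAt.cexp).deriv, mul_comm]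
      rw [iteratedDeriv_succ', hd.iteratedDeriv_eq, iteratedDeriv_mul_of_analyticAt
        (hX.deriv ξ hξ) (H.rayBound_exp_X.analytic ξ hξ), bellX_succ, Finset.mul_sum]
      refine Finset.sum_congr rfl fun q _ => ?_
      rw [ih (p - q) (by omega) ξ hξ, ← iteratedDeriv_succ']
      ring

/-- The operator `e^{-X} (d/dξ)^p e^X`. -/
def twist (n : ℕ) (ψc : ℕ → ℕ → ℂ → ℂ) (j : Fin n) (p : ℕ) (f : ℂ → ℂ) (ξ : ℂ) : ℂ :=
  ∑ r ∈ Finset.range (p + 1), (p.choose r : ℂ) * (bellX n ψc j (p - r) ξ * iteratedDeriv r f ξ)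

theorem twist_zero (f : ℂ → ℂ) (ξ : ℂ) : twist n ψc j 0 f ξ = f ξ := by
  simp [twist, bellX_zero]

theorem twist_one (f : ℂ → ℂ) (ξ : ℂ) :
    twist n ψc j 1 f ξ = deriv (X n ψc j) ξ * f ξ + deriv f ξ := by
  simp [twist, Finset.sum_range_succ, bellX_zero, bellX_one, iteratedDeriv_one]

theorem iteratedDeriv_exp_X_mul (H : Setting n Δ ψ Ψ ψc d d' c ρ σ' j Γ) {f : ℂ → ℂ} {ξ : ℂ}
    (hξ : ξ ∈ Γ) (hf : AnalyticAt ℂ f ξ) (p : ℕ) :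
    iteratedDeriv p (fun ζ => Complex.exp (X n ψc j ζ) * f ζ) ξ =
      Complex.exp (X n ψc j ξ) * twist n ψc j p f ξ := by
  have h := iteratedDeriv_mul_of_analyticAt hf (H.rayBound_exp_X.analytic ξ hξ) p
  simp only [mul_comm (f _)] at h
  rw [h, twist, Finset.mul_sum]
  refine Finset.sum_congr rfl fun r _ => ?_
  rw [H.iteratedDeriv_exp_X _ ξ hξ]
  ring

/-- The differential equation for the error term. -/
theorem twist_eq (H : Setting n Δ ψ Ψ ψc d d' c ρ σ' j Γ) {u : ℂ} (hu : σ' < u.re) {ξ : ℂ}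
    (hξ : ξ ∈ Γ) :
    ∑ i ∈ Finset.range n, (n.choose (i + 1) : ℂ) * omega n j ^ (n - (i + 1)) *
      (u⁻¹ ^ (i + 1) * twist n ψc j (i + 1) (fun ζ => 1 + H.eta u ζ) ξ) =
    ∑ k ∈ Finset.range (n - 1), ∑ i ∈ Finset.range (k + 1), (k.choose i : ℂ) * omega n j ^ (k - i) *
      (u⁻¹ ^ i * (twist n ψc j i (fun ζ => 1 + H.eta u ζ) ξ * (ψ k u ξ - if k = 0 then 1 else 0))) := by
  have hn := H.two_le
  have hu0 : u ≠ 0 := by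
    rintro rfl
    simp only [Complex.zero_re] at hu
    linarith [H.cond.σ'_nonneg]
  have hη : AnalyticOnNhd ℂ (fun ζ => 1 + H.eta u ζ) Γ := fun ζ hζ =>
    analyticAt_const.fun_add (analyticOnNhd_snd H.eta_analytic hu ζ hζ)
  set T : ℕ → ℂ := fun i => twist n ψc j i (fun ζ => 1 + H.eta u ζ) ξ with hT
  have hW : W n ψc j H.eta u = fun ζ => Complex.exp (omega n j * u * ζ) *
      (Complex.exp (X n ψc j ζ) * (1 + H.eta u ζ)) := by
    funext ζ
    rw [W, Complex.exp_add]
    ring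
  have hiter : ∀ k, iteratedDeriv k (W n ψc j H.eta u) ξ = Complex.exp (omega n j * u * ξ) *
      Complex.exp (X n ψc j ξ) * ∑ i ∈ Finset.range (k + 1), (k.choose i : ℂ) *
        (omega n j * u) ^ (k - i) * T i := fun k => by
    rw [hW, iteratedDeriv_exp_mul ((H.rayBound_exp_X.analytic ξ hξ).fun_mul (hη ξ hξ)),
      mul_assoc (Complex.exp (omega n j * u * ξ))]
    congr 1
    rw [Finset.mul_sum]
    refine Finset.sum_congr rfl fun i _ => ?_
    rw [H.iteratedDeriv_exp_X_mul hξ (hη ξ hξ)]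
    ring
  have hE : Complex.exp (omega n j * u * ξ) * Complex.exp (X n ψc j ξ) ≠ 0 :=
    mul_ne_zero (Complex.exp_ne_zero _) (Complex.exp_ne_zero _)
  have hode := H.solvesODE hu ξ hξ
  rw [neg_add_eq_zero] at hode
  simp only [hiter] at hode
  have hode2 : ∑ i ∈ Finset.range (n + 1), (n.choose i : ℂ) * (omega n j * u) ^ (n - i) * T i =
      ∑ k ∈ Finset.range (n - 1), u ^ (n - k) * ψ k u ξ * ∑ i ∈ Finset.range (k + 1),
        (k.choose i : ℂ) * (omega n j * u) ^ (k - i) * T i := by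
    refine mul_left_cancel₀ hE ?_
    rw [hode, Finset.mul_sum]
    refine Finset.sum_congr rfl fun k _ => ?_
    ring
  -- separate the leading terms
  have hlead : ∑ k ∈ Finset.range (n - 1), u ^ (n - k) * ψ k u ξ * ∑ i ∈ Finset.range (k + 1),
        (k.choose i : ℂ) * (omega n j * u) ^ (k - i) * T i =
      u ^ n * T 0 + ∑ k ∈ Finset.range (n - 1), u ^ (n - k) * (ψ k u ξ - if k = 0 then 1 else 0) *
        ∑ i ∈ Finset.range (k + 1), (k.choose i : ℂ) * (omega n j * u) ^ (k - i) * T i := by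
    have h1 : ∀ k ∈ Finset.range (n - 1), u ^ (n - k) * ψ k u ξ * ∑ i ∈ Finset.range (k + 1),
        (k.choose i : ℂ) * (omega n j * u) ^ (k - i) * T i = (if k = 0 then u ^ n * T 0 else 0) +
        u ^ (n - k) * (ψ k u ξ - if k = 0 then 1 else 0) *
        ∑ i ∈ Finset.range (k + 1), (k.choose i : ℂ) * (omega n j * u) ^ (k - i) * T i := fun k _ => by
      by_cases hk : k = 0
      · subst hk; simp; ring
      · simp [hk]
    rw [Finset.sum_congr rfl h1, Finset.sum_add_distrib, Finset.sum_ite_eq',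
      if_pos (Finset.mem_range.2 (by omega))]
  -- The term `i = 0` on the left is `(ω_j u) ^ n T 0 = u ^ n T 0` and cancels the leading term on
  -- the right.
  rw [hlead, Finset.sum_range_succ', Nat.choose_zero_right, Nat.cast_one, one_mul, Nat.sub_zero,
    mul_pow, omega_pow (by omega), one_mul, add_comm, add_right_inj] at hode2
  -- Dividing by `u ^ n` leaves only nonnegative powers of `u⁻¹`, to which formal power series
  -- apply.
  have hmul := congrArg (fun z => u⁻¹ ^ n * z) hode2
  simp only [Finset.mul_sum] at hmul
  have hp : ∀ a b : ℕ, a + b = n → u⁻¹ ^ n * u ^ a = u⁻¹ ^ b := fun a b hab => by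
    rw [← hab, pow_add, mul_right_comm, ← mul_pow, inv_mul_cancel₀ hu0, one_pow, one_mul]
  refine Eq.trans (Finset.sum_congr rfl fun i hi => ?_) (hmul.trans
    (Finset.sum_congr rfl fun k hk => Finset.sum_congr rfl fun i hi => ?_))
  · have hi := Finset.mem_range.1 hi
    rw [← hp (n - (i + 1)) (i + 1) (by omega), mul_pow]
    ring
  · have hk := Finset.mem_range.1 hk
    have hi := Finset.mem_range.1 hi
    have h2 := hp (n - k + (k - i)) i (by omega)
    rw [pow_add] at h2
    rw [← h2, mul_pow]
    ring

open scoped PowerSeries in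
/-- The recurrence relation in terms of formal power series. -/
theorem coeff_identity (H : Setting n Δ ψ Ψ ψc d d' c ρ σ' j Γ) {ξ : ℂ} (hξ : ξ ∈ Γ) (m : ℕ) :
    ∑ i ∈ Finset.range n, (n.choose (i + 1) : ℂ) * omega n j ^ (n - (i + 1)) *
      (if i ≤ m then twist n ψc j (i + 1) (H.coeffHat (m - i)) ξ else 0) =
    ∑ k ∈ Finset.range (n - 1), ∑ i ∈ Finset.range (k + 1), (k.choose i : ℂ) * omega n j ^ (k - i) *
      (if i ≤ m then ∑ b ∈ Finset.range (m - i + 1),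
        twist n ψc j i (H.coeffHat b) ξ * ψc k (m - i - b + 1) ξ else 0) := by
  set D : ℕ → ℂ⟦X⟧ := fun i => PowerSeries.mk fun m => twist n ψc j i (H.coeffHat m) ξ with hD
  have hDa : ∀ i, Asymp (fun u : ℝ => twist n ψc j i (fun ζ => 1 + H.eta u ζ) ξ) (D i) := fun i => by
    have h := Asymp.sum (Finset.range (i + 1)) fun r (_ : r ∈ Finset.range (i + 1)) =>
      (((H.asymp_iteratedDeriv hξ r).const_mul (bellX n ψc j (i - r) ξ)).const_mul (i.choose r : ℂ))
    have e : D i = ∑ r ∈ Finset.range (i + 1), PowerSeries.C (i.choose r : ℂ) *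
        (PowerSeries.C (bellX n ψc j (i - r) ξ) *
          PowerSeries.mk fun m => iteratedDeriv r (H.coeffHat m) ξ) := by
      ext m
      simp only [hD, PowerSeries.coeff_mk, map_sum, PowerSeries.coeff_C_mul, twist]
    rw [e]
    exact h
  set P : ℕ → ℂ⟦X⟧ := fun k => PowerSeries.mk fun m => ψc k (m + 1) ξ with hP
  have hPa : ∀ k < n - 1, Asymp (fun u : ℝ => ψ k u ξ - if k = 0 then 1 else 0)
      (PowerSeries.X * P k) := fun k hk => by
    have h := Asymp.of_bound_Ico (f := fun u : ℝ => ψ k u ξ - if k = 0 then 1 else 0) 0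
      (fun m => ψc k m ξ) fun N hN => by
        obtain ⟨C, R, h⟩ := H.expansion k hk N hN
        refine ⟨C, max R 1, fun u hu => ?_⟩
        have hu0 : 0 < u := lt_of_lt_of_le one_pos ((le_max_right _ _).trans hu)
        have := h u ⟨by simpa using hu0, by simp⟩ (by
          rw [Complex.norm_of_nonneg hu0.le]; exact (le_max_left _ _).trans hu) ξ
          (H.admissible.subset hξ)
        rwa [Complex.norm_of_nonneg hu0.le] at this
    simp only [zero_add] at h
    have e : PowerSeries.X * P k = PowerSeries.mk fun m => if m = 0 then 0 else ψc k m ξ := by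
      ext m
      rcases m with _ | m
      · simp
      · rw [PowerSeries.coeff_succ_X_mul]; simp [hP]
    rwa [e]
  have hL := Asymp.sum (Finset.range n) fun i (_ : i ∈ Finset.range n) =>
    (((Asymp.inv.pow (i + 1)).mul (hDa (i + 1))).const_mul
      ((n.choose (i + 1) : ℂ) * omega n j ^ (n - (i + 1))))
  have hR := Asymp.sum (Finset.range (n - 1)) fun k (hk : k ∈ Finset.range (n - 1)) =>
    Asymp.sum (Finset.range (k + 1)) fun i (_ : i ∈ Finset.range (k + 1)) =>
      ((Asymp.inv.pow i).mul ((hDa i).mul (hPa k (Finset.mem_range.1 hk)))).const_mul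
        ((k.choose i : ℂ) * omega n j ^ (k - i))
  have hEq := hL.unique (hR.congr ((eventually_gt_atTop σ').mono fun u hu =>
    (H.twist_eq (u := u) (by simpa using hu) hξ).symm))
  -- Both sides are divisible by `X`: on the left because the powers start at `i + 1`, on the right
  -- because the potentials are `O(1 / u)`. Hence the index `m + 1`.
  have hc := congrArg (PowerSeries.coeff (m + 1)) hEq
  simp only [map_sum, PowerSeries.coeff_C_mul] at hc
  have h1 : ∀ i, PowerSeries.coeff (m + 1) (PowerSeries.X ^ (i + 1) * D (i + 1)) =
      if i ≤ m then twist n ψc j (i + 1) (H.coeffHat (m - i)) ξ else 0 := fun i => by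
    rw [PowerSeries.coeff_X_pow_mul']
    simp [hD]
  have h2 : ∀ k i, PowerSeries.coeff (m + 1) (PowerSeries.X ^ i * (D i * (PowerSeries.X * P k))) =
      if i ≤ m then ∑ b ∈ Finset.range (m - i + 1),
        twist n ψc j i (H.coeffHat b) ξ * ψc k (m - i - b + 1) ξ else 0 := fun k i => by
    have e : PowerSeries.X ^ i * (D i * (PowerSeries.X * P k)) =
      PowerSeries.X * (PowerSeries.X ^ i * (D i * P k)) := by ring
    rw [e, PowerSeries.coeff_succ_X_mul, PowerSeries.coeff_X_pow_mul', PowerSeries.coeff_mul,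
      Finset.Nat.sum_antidiagonal_eq_sum_range_succ
        (fun a b => PowerSeries.coeff a (D i) * PowerSeries.coeff b (P k))]
    simp [hD, hP]
  simp only [h1, h2] at hc
  exact hc

/-- The right-hand side of the recurrence relation before integration. -/
def recurrence (n : ℕ) (ψc : ℕ → ℕ → ℂ → ℂ) (j : Fin n) (A : ℕ → ℂ → ℂ) (m : ℕ) (ξ : ℂ) : ℂ :=
  (1 / (n : ℂ)) * (∑ p ∈ Finset.Icc 2 (min n (m + 1)),
      (n.choose p : ℂ) * omega n j ^ (n - p + 1) * ∑ r ∈ Finset.range (p + 1), (p.choose r : ℂ) *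
        (bellX n ψc j (p - r) ξ * iteratedDeriv r (A (m + 1 - p)) ξ))
  - (1 / (n : ℂ)) * (∑ k ∈ Finset.range (n - 1), ∑ p ∈ Finset.Icc 1 (min m k),
      (k.choose p : ℂ) * omega n j ^ (k - p + 1) * ∑ r ∈ Finset.range (p + 1), (p.choose r : ℂ) *
        (bellX n ψc j (p - r) ξ * ψc k 1 ξ * iteratedDeriv r (A (m - p)) ξ))
  - (1 / (n : ℂ)) * (∑ k ∈ Finset.range (n - 1), ∑ q ∈ Finset.range m,
      ∑ p ∈ Finset.range (min k q + 1),
      (k.choose p : ℂ) * omega n j ^ (k - p + 1) * ∑ r ∈ Finset.range (p + 1), (p.choose r : ℂ) *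
        (bellX n ψc j (p - r) ξ * ψc k (m - q + 1) ξ * iteratedDeriv r (A (q - p)) ξ))

/-- `coeff_identity` is solved for its term with `p = 1`, that is `X_j' A_m + A_m'`. The part `X_j'
A_m` cancels the terms `ψ_{k,1} A_m` on the right, by the choice of `X_j`; otherwise `A_m'` depends
only on earlier coefficients. -/
theorem deriv_coeffHat (H : Setting n Δ ψ Ψ ψc d d' c ρ σ' j Γ) {ξ : ℂ} (hξ : ξ ∈ Γ) (m : ℕ) :
    deriv (H.coeffHat m) ξ = -recurrence n ψc j H.coeffHat m ξ := by
  have hn := H.two_le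
  have hnc := H.n_ne_zero
  have hω := omega_ne_zero n j
  have hωn := omega_pow (by omega : n ≠ 0) j
  set T : ℕ → ℕ → ℂ := fun i b => twist n ψc j i (H.coeffHat b) ξ with hT
  have hI := H.coeff_identity hξ m
  -- the left-hand side
  have hL : ∑ i ∈ Finset.range n, (n.choose (i + 1) : ℂ) * omega n j ^ (n - (i + 1)) *
      (if i ≤ m then T (i + 1) (m - i) else 0) = n * omega n j ^ (n - 1) * T 1 m +
      ∑ p ∈ Finset.Icc 2 (min n (m + 1)), (n.choose p : ℂ) * omega n j ^ (n - p) * T p (m + 1 - p) := by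
    obtain ⟨i₀, rfl⟩ : ∃ i₀, n = i₀ + 1 := ⟨n - 1, by omega⟩
    rw [Finset.sum_range_succ', add_comm]
    congr 1
    · simp
    · have e2 : Finset.range (min i₀ m) = (Finset.range i₀).filter fun i => i + 1 ≤ m := by
        ext i
        simp only [Finset.mem_range, Finset.mem_filter]
        omega
      have e3 : ∑ p ∈ Finset.Icc 2 (min (i₀ + 1) (m + 1)), ((i₀ + 1).choose p : ℂ) *
          omega (i₀ + 1) j ^ (i₀ + 1 - p) * T p (m + 1 - p) = ∑ i ∈ Finset.range (min i₀ m),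
          ((i₀ + 1).choose (i + 2) : ℂ) * omega (i₀ + 1) j ^ (i₀ + 1 - (i + 2)) *
            T (i + 2) (m + 1 - (i + 2)) := by
        refine (Finset.sum_nbij (fun i => i + 2) ?_ ?_ ?_ fun _ _ => rfl).symm
        · intro i hi
          have := Finset.mem_range.1 hi
          exact Finset.mem_Icc.2 (by omega)
        · intro a _ b _ h
          simpa using h
        · intro p hp
          have := Finset.mem_Icc.1 (Finset.mem_coe.1 hp)
          exact ⟨p - 2, Finset.mem_coe.2 (Finset.mem_range.2 (by omega)), by simp only; omega⟩
      rw [e3, e2, Finset.sum_filter]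
      refine Finset.sum_congr rfl fun i _ => ?_
      split_ifs with h
      · have : m + 1 - (i + 2) = m - (i + 1) := by omega
        rw [this]
      · simp
  -- the right-hand side
  have hR : ∀ k, ∑ i ∈ Finset.range (k + 1), (k.choose i : ℂ) * omega n j ^ (k - i) *
      (if i ≤ m then ∑ b ∈ Finset.range (m - i + 1), T i b * ψc k (m - i - b + 1) ξ else 0) =
      omega n j ^ k * T 0 m * ψc k 1 ξ +
      (∑ p ∈ Finset.Icc 1 (min m k), (k.choose p : ℂ) * omega n j ^ (k - p) *
        (T p (m - p) * ψc k 1 ξ) +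
      ∑ q ∈ Finset.range m, ∑ p ∈ Finset.range (min k q + 1), (k.choose p : ℂ) * omega n j ^ (k - p) *
        (T p (q - p) * ψc k (m - q + 1) ξ)) := fun k => by
    have h1 := sum_range_sum_range_eq k m fun i b => (k.choose i : ℂ) * omega n j ^ (k - i) *
      (T i b * ψc k (m - i - b + 1) ξ)
    simp only [← Finset.mul_sum, ← mul_ite_zero] at h1
    rw [h1, Finset.sum_range_succ]
    have h2 : ∀ q ∈ Finset.range (m + 1), ∀ p ∈ Finset.range (min k q + 1),
        (k.choose p : ℂ) * omega n j ^ (k - p) * (T p (q - p) * ψc k (m - p - (q - p) + 1) ξ) =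
        (k.choose p : ℂ) * omega n j ^ (k - p) * (T p (q - p) * ψc k (m - q + 1) ξ) :=
      fun q _ p hp => by
        have hp := Finset.mem_range.1 hp
        have : m - p - (q - p) = m - q := by omega
        rw [this]
    rw [Finset.sum_congr rfl fun q hq => Finset.sum_congr rfl (h2 q (by
      have := Finset.mem_range.1 hq; exact Finset.mem_range.2 (by omega))),
      Finset.sum_congr rfl (h2 m (Finset.mem_range.2 (by omega))), Nat.sub_self, zero_add,
      Finset.range_eq_Ico, Finset.range_eq_Ico, Finset.sum_eq_sum_Ico_succ_bot
        (by omega : 0 < min k m + 1), min_comm k m]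
    have e : Finset.Ico (0 + 1) (min m k + 1) = Finset.Icc 1 (min m k) := by
      ext p; simp only [Finset.mem_Ico, Finset.mem_Icc]; omega
    rw [e]
    simp only [Nat.choose_zero_right, Nat.cast_one, one_mul, Nat.sub_zero, Finset.range_eq_Ico]
    ring
  change ∑ i ∈ Finset.range n, (n.choose (i + 1) : ℂ) * omega n j ^ (n - (i + 1)) *
      (if i ≤ m then T (i + 1) (m - i) else 0) =
    ∑ k ∈ Finset.range (n - 1), ∑ i ∈ Finset.range (k + 1), (k.choose i : ℂ) * omega n j ^ (k - i) *
      (if i ≤ m then ∑ b ∈ Finset.range (m - i + 1), T i b * ψc k (m - i - b + 1) ξ else 0) at hI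
  simp only [hL, hR, Finset.sum_add_distrib] at hI
  have hT1 : T 1 m = deriv (X n ψc j) ξ * H.coeffHat m ξ + deriv (H.coeffHat m) ξ := twist_one _ _
  have hT0 : T 0 m = H.coeffHat m ξ := twist_zero _ _
  have hX : n * deriv (X n ψc j) ξ * H.coeffHat m ξ =
      omega n j * ∑ k ∈ Finset.range (n - 1), omega n j ^ k * T 0 m * ψc k 1 ξ := by
    rw [(H.hasDerivAt_X hξ).deriv, ← mul_assoc, mul_one_div_cancel hnc, one_mul, hT0,
      Finset.mul_sum, Finset.sum_mul]
    refine Finset.sum_congr rfl fun k _ => ?_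
    ring
  have e1 : ∑ p ∈ Finset.Icc 2 (min n (m + 1)), (n.choose p : ℂ) * omega n j ^ (n - p + 1) *
      ∑ r ∈ Finset.range (p + 1), (p.choose r : ℂ) *
        (bellX n ψc j (p - r) ξ * iteratedDeriv r (H.coeffHat (m + 1 - p)) ξ) = omega n j *
      ∑ p ∈ Finset.Icc 2 (min n (m + 1)), (n.choose p : ℂ) * omega n j ^ (n - p) * T p (m + 1 - p) := by
    rw [Finset.mul_sum]
    refine Finset.sum_congr rfl fun p _ => ?_
    simp only [hT, twist]
    ring
  have e0 : ∀ p b (v : ℂ), ∑ r ∈ Finset.range (p + 1), (p.choose r : ℂ) *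
        (bellX n ψc j (p - r) ξ * v * iteratedDeriv r (H.coeffHat b) ξ) = T p b * v := by
    intro p b v
    simp only [hT, twist, Finset.sum_mul]
    refine Finset.sum_congr rfl fun r _ => ?_
    ring
  have e2 : ∑ k ∈ Finset.range (n - 1), ∑ p ∈ Finset.Icc 1 (min m k),
      (k.choose p : ℂ) * omega n j ^ (k - p + 1) * (T p (m - p) * ψc k 1 ξ) = omega n j *
      ∑ k ∈ Finset.range (n - 1), ∑ p ∈ Finset.Icc 1 (min m k), (k.choose p : ℂ) * omega n j ^ (k - p) *
        (T p (m - p) * ψc k 1 ξ) := by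
    simp only [Finset.mul_sum]
    refine Finset.sum_congr rfl fun k _ => Finset.sum_congr rfl fun p _ => ?_
    ring
  have e3 : ∑ k ∈ Finset.range (n - 1), ∑ q ∈ Finset.range m, ∑ p ∈ Finset.range (min k q + 1),
      (k.choose p : ℂ) * omega n j ^ (k - p + 1) * (T p (q - p) * ψc k (m - q + 1) ξ) = omega n j *
      ∑ k ∈ Finset.range (n - 1), ∑ q ∈ Finset.range m, ∑ p ∈ Finset.range (min k q + 1),
        (k.choose p : ℂ) * omega n j ^ (k - p) * (T p (q - p) * ψc k (m - q + 1) ξ) := by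
    simp only [Finset.mul_sum]
    refine Finset.sum_congr rfl fun k _ => Finset.sum_congr rfl fun q _ =>
      Finset.sum_congr rfl fun p _ => ?_
    ring
  have hωs : omega n j * omega n j ^ (n - 1) = 1 := by
    rw [← pow_succ', Nat.sub_add_cancel (by omega), hωn]
  rw [recurrence, e1]
  simp only [e0]
  rw [e2, e3, eq_neg_iff_add_eq_zero]
  refine mul_left_cancel₀ hnc ?_
  rw [hT1] at hI
  have hinv : (n : ℂ) * (1 / n) = 1 := mul_one_div_cancel hnc
  simp only [mul_add, mul_sub, ← mul_assoc (n : ℂ) (1 / (n : ℂ)), hinv, one_mul]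
  -- Multiplication by `ω_j` turns the factor `ω_j ^ (n - 1)` of the isolated term into `1`, and
  -- raises the exponents to those of the recurrence.
  linear_combination omega n j * hI - hX -
    n * (deriv (X n ψc j) ξ * H.coeffHat m ξ + deriv (H.coeffHat m) ξ) * hωs

/-- The recurrence is a sum of separate ray integrals, so each integrand must be integrable before
they can be combined. A factor `ψ_{k,q}` ensures this in two of the sums; in the other, the Bell
polynomial or the derivative of `A` decays. -/
theorem isRayIntegral_coeffStep (H : Setting n Δ ψ Ψ ψc d d' c ρ σ' j Γ) (A : ℕ → ℂ → ℂ) {m : ℕ}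
    (hA : ∀ i < m, RayBound Γ (dir n j) (fun _ => 1) (A i) ∧
      RayBound Γ (dir n j) (decay ρ) (deriv (A i))) {ξ : ℂ} (hξ : ξ ∈ Γ) :
    IsRayIntegral Γ ρ (thetaMid n j) ξ (coeffStep n ψc j A m ξ) (recurrence n ψc j A m) := by
  have hρ := H.cond.ρ_pos
  have hmem := H.ray_mem
  have hbase : ∀ {f : ℂ → ℂ}, RayBound Γ (dir n j) (decay ρ) f →
      IsRayIntegral Γ ρ (thetaMid n j) ξ (rayIntegral f ξ (thetaMid n j)) f := fun h => ⟨h, rfl⟩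
  have hit : ∀ i < m, ∀ r, RayBound Γ (dir n j) (fun _ => 1) (iteratedDeriv r (A i)) :=
    fun i hi r => (hA i hi).1.iteratedDeriv H.isOpen H.ray_mem r
  have hψ : ∀ k ∈ Finset.range (n - 1), ∀ p r b q, b < m → RayBound Γ (dir n j) (decay ρ)
      fun t => bellX n ψc j (p - r) t * ψc k (q + 1) t * iteratedDeriv r (A b) t := fun k hk p r b q hb =>
    ((H.rayBound_bellX (p - r)).1.mul_left
      (H.rayBound_ψc (Finset.mem_range.1 hk) (by omega))).mul_right (hit b hb r)
  refine IsRayIntegral.sub hρ hmem hξ (IsRayIntegral.sub hρ hmem hξ (.const_mul ?_ _)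
    (.const_mul ?_ _)) (.const_mul ?_ _)
  · refine .sum hρ hmem hξ _ fun p hp => .const_mul (.sum hρ hmem hξ _ fun r hr =>
      .const_mul (hbase ?_) _) _
    have hp := Finset.mem_Icc.1 hp
    have hr := Finset.mem_range.1 hr
    have hi : m + 1 - p < m := by omega
    -- For `r = 0` the Bell index is `p ≥ 2`, so the polynomial decays; for positive `r` a
    -- derivative of `A` decays.
    rcases r with _ | r
    · refine (((H.rayBound_bellX (p - 0)).2 (by omega)).mul_right (hit _ hi 0))
    · refine (H.rayBound_bellX (p - (r + 1))).1.mul_left ?_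
      rw [iteratedDeriv_succ']
      exact (hA _ hi).2.iteratedDeriv H.isOpen H.ray_mem r
  · refine .sum hρ hmem hξ _ fun k hk => .sum hρ hmem hξ _ fun p hp => .const_mul
      (.sum hρ hmem hξ _ fun r hr => .const_mul (hbase (hψ k hk p r _ 0 ?_)) _) _
    have hp := Finset.mem_Icc.1 hp
    omega
  · refine .sum hρ hmem hξ _ fun k hk => .sum hρ hmem hξ _ fun q hq => .sum hρ hmem hξ _ fun p hp =>
      .const_mul (.sum hρ hmem hξ _ fun r hr => .const_mul (hbase (hψ k hk p r _ _ ?_)) _) _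
    have hq := Finset.mem_range.1 hq
    omega

/-- The two claims are proved together: decay of the derivatives of earlier coefficients makes the
next integrand integrable, and vanishing at infinity fixes the constant of integration. -/
theorem coeffHat_spec (H : Setting n Δ ψ Ψ ψc d d' c ρ σ' j Γ) (m : ℕ) :
    RayBound Γ (dir n j) (decay ρ) (deriv (H.coeffHat m)) ∧
      (1 ≤ m → ∀ ξ ∈ Γ, H.coeffHat m ξ = coeffStep n ψc j H.coeffHat m ξ) := by
  induction m using Nat.strong_induction_on with
  | _ m ih =>
    rcases m with _ | m
    · refine ⟨?_, fun h => absurd h (by omega)⟩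
      have : deriv (H.coeffHat 0) = fun _ => 0 := by
        funext ξ; exact deriv_const ξ 1
      rw [this]
      exact RayBound.zero fun s _ => (decay_pos ρ s).le
    · have hR := fun ξ (hξ : ξ ∈ Γ) => H.isRayIntegral_coeffStep H.coeffHat (m := m + 1)
        (fun i hi => ⟨H.rayBound_coeffHat i, (ih i hi).1⟩) hξ
      have hdec : Γ.Nonempty → RayBound Γ (dir n j) (decay ρ) (deriv (H.coeffHat (m + 1))) := by
        rintro ⟨ξ₀, hξ₀⟩
        refine ((hR ξ₀ hξ₀).rayBound.const_mul (-1)).congr H.isOpen H.ray_mem fun ξ hξ => ?_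
        rw [neg_one_mul, H.deriv_coeffHat hξ]
      refine ⟨?_, fun _ ξ hξ => ?_⟩
      · rcases Γ.eq_empty_or_nonempty with h | h
        · subst h; exact ⟨fun _ h => h.elim, fun _ h => h.elim⟩
        · exact hdec h
      · have hlim := (H.rayBound_coeffHat_succ m).tendsto (tendsto_one_div_rpow H.cond.ρ_pos) hξ
        have h := RayBound.eq_neg_integral H.ray_mem (hdec ⟨ξ, hξ⟩)
          (integrableOn_decay H.cond.ρ_pos) (fun ζ hζ =>
            ((H.rayBound_coeffHat (m + 1)).analytic ζ hζ).differentiableAt.hasDerivAt) hξ hlim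
        rw [h, (hR ξ hξ).eq, rayIntegral_eq, ← integral_neg]
        refine setIntegral_congr_fun measurableSet_Ioi fun s hs => ?_
        rw [H.deriv_coeffHat (H.ray_mem ξ hξ s (le_of_lt hs))]
        ring

/-- `Γ` is open and contains the rays of integration, so equality on `Γ` passes to all derivatives
occurring under the integrals. -/
theorem coeffStep_congr_of_eqOn (H : Setting n Δ ψ Ψ ψc d d' c ρ σ' j Γ) {A A' : ℕ → ℂ → ℂ} {m : ℕ}
    (h : ∀ i < m, EqOn (A i) (A' i) Γ) {ξ : ℂ} (hξ : ξ ∈ Γ) :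
    coeffStep n ψc j A m ξ = coeffStep n ψc j A' m ξ := by
  have key : ∀ i < m, ∀ r (g : ℂ → ℂ),
      rayIntegral (fun t => g t * iteratedDeriv r (A i) t) ξ (thetaMid n j) =
        rayIntegral (fun t => g t * iteratedDeriv r (A' i) t) ξ (thetaMid n j) := by
    intro i hi r g
    refine setIntegral_congr_fun measurableSet_Ioi fun s hs => ?_
    have := (h i hi).iteratedDeriv_of_isOpen H.isOpen r (H.ray_mem ξ hξ s (le_of_lt hs))
    simp only [ray]
    rw [← dir, this]
  refine congrArg₂ (· - ·) (congrArg₂ (· - ·) (congrArg _ ?_) (congrArg _ ?_)) (congrArg _ ?_)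
  · refine Finset.sum_congr rfl fun p hp => congrArg _ (Finset.sum_congr rfl fun r _ => ?_)
    rw [Finset.mem_Icc] at hp
    rw [key (m + 1 - p) (by omega)]
  · refine Finset.sum_congr rfl fun k _ => Finset.sum_congr rfl fun p hp =>
      congrArg _ (Finset.sum_congr rfl fun r _ => ?_)
    rw [Finset.mem_Icc] at hp
    rw [key (m - p) (by omega) r (fun t => bellX n ψc j (p - r) t * ψc k 1 t)]
  · refine Finset.sum_congr rfl fun k _ => Finset.sum_congr rfl fun q hq =>
      Finset.sum_congr rfl fun p _ => congrArg _ (Finset.sum_congr rfl fun r _ => ?_)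
    rw [Finset.mem_range] at hq
    rw [key (q - p) (by omega) r (fun t => bellX n ψc j (p - r) t * ψc k (m - q + 1) t)]

/-- The coefficients of the asymptotic expansion satisfy the recurrence relation. -/
theorem coeffHat_eq_coeffA (H : Setting n Δ ψ Ψ ψc d d' c ρ σ' j Γ) (m : ℕ) :
    EqOn (H.coeffHat m) (coeffA n ψc j m) Γ := by
  induction m using Nat.strong_induction_on with
  | _ m ih =>
    intro ξ hξ
    rcases m with _ | m
    · rw [coeffA_zero]; rfl
    · rw [(H.coeffHat_spec (m + 1)).2 (by omega) ξ hξ, coeffA_eq n ψc j (m + 1) (by omega)]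
      exact H.coeffStep_congr_of_eqOn ih hξ

end Setting
namespace Setting

variable {n : ℕ} {Δ : Set ℂ} {ψ Ψ : ℕ → ℂ → ℂ → ℂ} {ψc : ℕ → ℕ → ℂ → ℂ}
    {d d' c ρ σ' : ℝ} {j : Fin n} {Γ : Set ℂ}

/-- The Borel transform is the sum of its power series. -/
theorem hasSum_borel (H : Setting n Δ ψ Ψ ψc d d' c ρ σ' j Γ) {t : ℂ}
    (ht : t ∈ Metric.ball (0 : ℂ) (aSeq n * d)) {ξ : ℂ} (hξ : ξ ∈ Γ) :
    HasSum (fun m : ℕ => coeffA n ψc j (m + 1) ξ / (m.factorial : ℂ) * t ^ m) (H.borel t ξ) := by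
  have hd : DifferentiableOn ℂ (fun t => H.borel t ξ) (Metric.ball 0 (aSeq n * d)) :=
    (H.borel_differentiableOn hξ).mono subset_union_right
  refine (Complex.hasSum_taylorSeries_on_ball hd ht).congr_fun fun m => ?_
  rw [← H.coeffHat_eq_coeffA (m + 1) hξ, coeffHat]
  simp only [smul_eq_mul, sub_zero]
  ring

end Setting

/-- The decay in the middle direction is controlled by that in the two extreme directions. -/
theorem one_div_max_re_dir_le (n : ℕ) (hn : 2 ≤ n) (j : Fin n) {ρ : ℝ} (hρ : 0 ≤ ρ) (ξ : ℂ) :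
    1 / (max 1 (ξ * (starRingEnd ℂ) (dir n j)).re) ^ ρ ≤
      ∑ l ∈ Finset.univ.filter (fun l : Fin n => l ≠ j),
        1 / (max 1 (ξ * Complex.exp (-(theta n j l : ℂ) * Complex.I)).re) ^ ρ := by
  have hpos : ∀ x : ℝ, 0 < max 1 x := fun x => lt_of_lt_of_le one_pos (le_max_left _ _)
  have key : ∀ l : Fin n, l ≠ j → (ξ * Complex.exp (-(theta n j l : ℂ) * Complex.I)).re ≤
      max 1 (ξ * (starRingEnd ℂ) (dir n j)).re →
      1 / (max 1 (ξ * (starRingEnd ℂ) (dir n j)).re) ^ ρ ≤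
      ∑ l ∈ Finset.univ.filter (fun l : Fin n => l ≠ j),
        1 / (max 1 (ξ * Complex.exp (-(theta n j l : ℂ) * Complex.I)).re) ^ ρ := fun l hl h => by
    refine le_trans ?_ (Finset.single_le_sum (f := fun l : Fin n =>
      1 / (max 1 (ξ * Complex.exp (-(theta n j l : ℂ) * Complex.I)).re) ^ ρ)
      (fun i _ => one_div_nonneg.2 (Real.rpow_nonneg (hpos _).le _))
      (Finset.mem_filter.2 ⟨Finset.mem_univ l, hl⟩))
    exact one_div_le_one_div_of_le (Real.rpow_pos_of_pos (hpos _) _)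
      (Real.rpow_le_rpow (hpos _).le (max_le (le_max_left _ _) h) hρ)
  obtain ⟨⟨l₁, hl₁, h₁⟩, ⟨l₂, hl₂, h₂⟩⟩ := exists_theta_eq_min_max hn j
  have hcos := cos_halfSpread_pos hn
  have hconj : ∀ x : ℝ, (starRingEnd ℂ) (Complex.exp (x * Complex.I)) =
      Complex.exp (-(x : ℂ) * Complex.I) := fun x => by
    rw [← Complex.exp_conj, map_mul, Complex.conj_ofReal, Complex.conj_I]
    congr 1
    ring
  -- The two extreme projections have mean `cos δ` times the middle one, `δ` being the half spread.
  -- The smaller of them is therefore at most that, and its single term of the sum is already large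
  -- enough.
  have hsum : (ξ * Complex.exp (-(theta n j l₁ : ℂ) * Complex.I)).re +
      (ξ * Complex.exp (-(theta n j l₂ : ℂ) * Complex.I)).re =
      2 * Real.cos (halfSpread n) * (ξ * (starRingEnd ℂ) (dir n j)).re := by
    rw [h₁, h₂, dir_eq hn j, map_mul, map_add, Complex.conj_ofReal, hconj, hconj, mul_left_comm,
      Complex.re_ofReal_mul, ← mul_assoc, mul_one_div_cancel (by positivity), one_mul, mul_add,
      Complex.add_re]
  have hle : Real.cos (halfSpread n) * (ξ * (starRingEnd ℂ) (dir n j)).re ≤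
      max 1 (ξ * (starRingEnd ℂ) (dir n j)).re := by
    have hc1 := Real.cos_le_one (halfSpread n)
    have h1 := le_max_right 1 (ξ * (starRingEnd ℂ) (dir n j)).re
    have h2 := hpos (ξ * (starRingEnd ℂ) (dir n j)).re
    nlinarith
  rcases le_total (ξ * Complex.exp (-(theta n j l₁ : ℂ) * Complex.I)).re
    (ξ * Complex.exp (-(theta n j l₂ : ℂ) * Complex.I)).re with h | h
  · exact key l₁ hl₁ (by linarith)
  · exact key l₂ hl₂ (by linarith)

end BorelWKB
end

theorem theorem1p1 (n : ℕ) (hn : 2 ≤ n) (Δ : Set ℂ)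
    (ψ Ψ : ℕ → ℂ → ℂ → ℂ) (ψc : ℕ → ℕ → ℂ → ℂ) (d d' c ρ σ' : ℝ)
    (hcond : BorelCondition n Δ ψ Ψ d' c ρ σ')
    (hexp : PotentialExpansion n Δ ψ ψc)
    (hd : 0 < d) (hdd' : d < d')
    (Γ : Fin n → Set ℂ) (hΓ : ∀ j, IsAdmissibleSubdomain n Δ d j (Γ j)) :
    ∃ η F : Fin n → ℂ → ℂ → ℂ,
      -- the solutions exist
      (∀ j, IsNormalisedSolution n ψ ψc σ' j (Γ j) (η j)) ∧
      -- they are unique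
      (∀ j, ∀ η' : ℂ → ℂ → ℂ, IsNormalisedSolution n ψ ψc σ' j (Γ j) η' →
        ∀ u : ℂ, σ' < u.re → ∀ ξ ∈ Γ j,
          η' u ξ = η j u ξ ∧ W n ψc j η' u ξ = W n ψc j (η j) u ξ) ∧
      -- they are Laplace transforms
      (∀ j, ∀ u : ℂ, σ' < u.re → ∀ ξ ∈ Γ j,
        MeasureTheory.IntegrableOn (fun t : ℝ => Complex.exp (-u * t) * F j t ξ) (Set.Ioi 0) ∧
        η j u ξ = laplace (fun t => F j t ξ) u) ∧
      -- analyticity of the Borel transforms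
      (∀ j, AnalyticOnNhd ℂ (fun p : ℂ × ℂ => F j p.1 p.2) (U (aSeq n * d) ×ˢ Γ j)) ∧
      -- power series of the Borel transforms
      (∀ j, ∀ t ∈ Metric.ball (0 : ℂ) (aSeq n * d), ∀ ξ ∈ Γ j,
        HasSum (fun m : ℕ => coeffA n ψc j (m + 1) ξ / (m.factorial : ℂ) * t ^ m) (F j t ξ)) ∧
      -- exponential bound on the Borel transforms
      (∀ σ r : ℝ, σ' < σ → 0 < r → r < d → ∃ K : ℝ, 0 < K ∧
        ∀ j, ∀ t ∈ U (aSeq n * r), ∀ ξ ∈ Γ j,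
          ‖F j t ξ‖ ≤ K * Real.exp (σ * t.re) *
            ∑ l ∈ Finset.univ.filter (fun l : Fin n => l ≠ j),
              1 / (max 1 (ξ * Complex.exp (-(theta n j l : ℂ) * Complex.I)).re) ^ ρ) ∧
      -- asymptotic expansions in closed half-planes
      (∀ σ : ℝ, σ' < σ → ∀ j,
        HasUniformAsymptoticSeries {u : ℂ | σ ≤ u.re} (Γ j) (η j) (coeffA n ψc j)) := by
  have H : ∀ j, Setting n Δ ψ Ψ ψc d d' c ρ σ' j (Γ j) := fun j => ⟨hn, hcond, hexp, hd, hdd', hΓ j⟩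
  refine ⟨fun j => (H j).eta, fun j => (H j).borel, fun j => (H j).isNormalisedSolution, ?_,
    fun j u hu ξ hξ => (H j).borel_laplace hu hξ, fun j => (H j).borel_analytic,
    fun j t ht ξ hξ => (H j).hasSum_borel ht hξ, ?_, ?_⟩
  · intro j η' hη' u hu ξ hξ
    have h := (H j).eq_of_isNormalisedSolution hη' (H j).isNormalisedSolution hu hξ
    exact ⟨h, by rw [W, W, h]⟩
  · intro σ r hσ _ hr
    -- There are finitely many indices, so the sum of the constants is uniform in `j`.
    choose K hK hb using fun j => (H j).exists_norm_borel_le hσ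
    have hsum : ∀ j, K j ≤ ∑ i, K i := fun j =>
      Finset.single_le_sum (fun i _ => (hK i).le) (Finset.mem_univ j)
    refine ⟨∑ j, K j, lt_of_lt_of_le (hK ⟨0, by omega⟩) (hsum _), fun j t ht ξ hξ => ?_⟩
    refine (hb j t (U_mono (mul_le_mul_of_nonneg_left hr.le (aSeq_pos n hn).le) ht) ξ hξ).trans ?_
    have h0 : 0 ≤ 1 / (max 1 (ξ * (starRingEnd ℂ) (dir n j)).re) ^ ρ :=
      one_div_nonneg.2 (Real.rpow_nonneg (zero_le_one.trans (le_max_left _ _)) _)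
    exact mul_le_mul (mul_le_mul_of_nonneg_right (hsum j) (Real.exp_pos _).le)
      (one_div_max_re_dir_le n hn j hcond.ρ_pos.le ξ) h0
      (mul_nonneg ((hK j).le.trans (hsum j)) (Real.exp_pos _).le)
  · intro σ hσ j N hN
    obtain ⟨C, hC⟩ := (H j).eta_asymptotic hσ N hN
    -- The remainder bound holds throughout the half-plane, so the threshold for `‖u‖` can be `0`.
    refine ⟨C, 0, fun u hu _ ξ hξ => ?_⟩
    have h := hC u hu ξ hξ
    simp only [fun m => (H j).coeffHat_eq_coeffA m hξ] at h
    exact h
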